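/- **Setting.** Let $K:[0,\infty)\to\mathbb R$ be smooth with $K=1$ on $[0,1]$ and $K=0$ on $[4,\infty)$. For masses $0<m<M$ and $\Lambda\ge0$ put $$P_m^\Lambda(p)=\frac{[1-K((1+\Lambda/m)^2)]\,K(p^2/\Lambda^2)}{p^2+m^2},\qquad P_M^\Lambda(p)=\frac{[1-K(\Lambda^2/M^2)]\,K(p^2/\Lambda^2)}{p^2+M^2},\qquad p\in\mathbb R^4 .$$ For an ultraviolet cutoff $\Lambda_0>M$, the perturbative vertex functions of the Euclidean $\phi$-$\psi$ theory ($\phi$ light of mass $m$, $\psi$ heavy of mass $M$, symmetry $\mathbb Z_2\times\mathbb Z_2$) are functions $\mathcal L^{\Lambda,\Lambda_0}_{r,2n}(p_1,\dots,p_{2n_1};p'_1,\dots,p'_{2n_2-1})$, where $r\in\mathbb N^3$ is the order in the couplings $(g_1,g_2,g_3)$, $n=(n_1,n_2)$ with $|n|=n_1+n_2\ge1$, and the momentum of the last leg (the last heavy leg, or the last light leg if $n_2=0$) is minus the sum of all the others. They are smooth on $[0,\Lambda_0]\times(\mathbb R^4)^{2|n|-1}$, they vanish for $r=0$ and for $|n|>|r|+1$,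 and they satisfy: (a) the flow equation, for $0\le\Lambda\le\Lambda_0$, $$\begin{aligned}\partial_\Lambda\mathcal L_{r,2n}={}&-\binom{2n_1+2}{2}\int\!\frac{d^4q}{(2\pi)^4}\,\partial_\Lambda P_m^\Lambda(q)\,\mathcal L_{r,2(n_1+1,n_2)}(\dots,q,-q;\dots)\\&+2\!\!\sum_{r'+r''=r}\ \sum_{l_1+l_1'=n_1+1,\ l_2+l_2'=n_2}\!\! l_1l_1'\,\big[\partial_\Lambda P_m^\Lambda(P)\,\mathcal L_{r',2l}(\dots,P;\dots)\,\mathcal L_{r'',2l'}(\dots,-P;\dots)\big]_{symm}\\&+(\text{the same two terms with the roles of the light and the heavy field exchanged}),\end{aligned}$$ where $P$ is minus the sum of the external momenta of the first factor and $[\cdot]_{symm}$ averages over the permutations of all light and of all heavy external momenta; (b) at $\Lambda=\Lambda_0$ they are, for suitable numbers $\rho_{a,r}$ (the order-$r$ coefficients of the bare couplings), the vertex functions of the local bare action $\int d^4x\,[\frac{\rho_1}2\phi^2+\frac{\rho_2}2(\partial\phi)^2+\frac{\rho_3}{4!}\phi^4+\frac{\rho_4}2\psi^2+\frac{\rho_5}2(\partial\psi)^2+\frac{\rho_6}{4!}\psi^4+\frac{\rho_7}4\phi^2\psi^2]$;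 (c) at $\Lambda=0$, with given momenta $\bar p'_1,\dots,\bar p'_5$ of length $M$: $\mathcal L_{r,(2,0)}(0)=0$, $\partial_\mu\partial_\nu\mathcal L_{r,(2,0)}(0)=0$, $\mathcal L_{r,(4,0)}(0)=\frac1{4!}\delta_{r,(1,0,0)}$, $\mathcal L_{r,(0,2)}(\bar p'_1)=0$, $\mathcal L_{r,(0,4)}(\bar p'_2,\bar p'_3,\bar p'_4)=\frac1{4!}\delta_{r,(0,1,0)}$, $\mathcal L_{r,(2,2)}(0,0;\bar p'_5)=\frac14\delta_{r,(0,0,1)}$, and the $\delta_{\mu\nu}$-part of $\partial_\mu\partial_\nu\mathcal L_{r,(0,2)}(\bar p'_1)$ vanishes, i.e. $\partial_\mu\partial_\nu\mathcal L_{r,(0,2)}(\bar p'_1)=c_r\,\bar p'_{1\mu}\bar p'_{1\nu}$ for some number $c_r$. For $a,b,b'>0$ (or $a=0$) let $\|\partial^z f\|_{(a,b,b')}$ be the maximum of $|\partial^w f|$ over all multiindices $w$ with $|w|=z$ and all independent momenta with $|p_i|\le\max\{a,b\}$, $|p'_i|\le\max\{a,b'\}$. **Theorem 2.** (i) For all $0<m<M$,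 all $\bar p'_1,\dots,\bar p'_5$ of length $M$ and every $\Lambda_0>M$ such vertex functions exist. (ii) Let $\kappa>0$. For all $r$, $n$, $z$ there is a polynomial $\mathcal P$, depending only on $K,\kappa,r,n,z$, such that for all $0<m<M$, all $\bar p'_i$ of length $M$, all $\Lambda_0>M$ and all $0\le\Lambda\le\Lambda_0$ the following holds with $\mu=\kappa m$, $\|\cdot\|=\|\cdot\|_{(2\Lambda,\mu,M)}$ and $\mathrm{Plog}(x)=\mathcal P(\log x)$. For all momenta in the region that defines $\|\cdot\|$, the functions $\partial^w\mathcal L^{\Lambda,\Lambda_0}_{r,2n}$, $|w|=z$, are differentiable in $\Lambda_0$ (from the right if $\Lambda_0=\Lambda$). For vertices without heavy legs $$\|\partial_{\Lambda_0}\partial^z\mathcal L_{r,2(n_1,0)}\|\le\Big(\frac{\Lambda+m}{\Lambda_0}\Big)^3(\Lambda+m)^{3-2n_1-z}\,\mathrm{Plog}\Big(\frac{\Lambda_0}m\Big);$$ for irrelevant vertices ($2|n|+z>4$) with heavy legs ($n_2\ne0$) $$\|\partial_{\Lambda_0}\partial^z\mathcal L_{r,2n}\|\le\Big(\frac{\Lambda+M}{\Lambda_0}\Big)^2\Big(\frac{\Lambda+m}{\Lambda_0}\Big)(\Lambda+m)^{3-2|n|-z}\,\mathrm{Plog}\Big(\frac{\Lambda_0}m\Big);$$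 and for relevant vertices ($2|n|+z\le4$) with heavy legs $$\|\partial_{\Lambda_0}\partial^z\mathcal L_{r,2n}\|\le\Big(\frac{\Lambda+M}{\Lambda_0}\Big)^3(\Lambda+M)^{3-2|n|-z}\,\mathrm{Plog}\Big(\frac{\Lambda_0}m\Big).$$ (iii) Hence the theory is perturbatively renormalizable: for fixed $m,M,\bar p'_i$ and all $r$, $n$ and $\Lambda\ge0$ (in particular at $\Lambda=0$, where the vertex functions are the amputated connected Green functions), $\mathcal L^{\Lambda,\Lambda_0}_{r,2n}$ converges as $\Lambda_0\to\infty$ to a smooth function of the momenta, uniformly on bounded sets of momenta and together with all its momentum derivatives. -/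

import Mathlib

open Set Filter Topology MeasureTheory
open scoped ContDiff

namespace PhiPsi

noncomputable section

/-- Euclidean four-momenta. -/
abbrev Mom : Type := EuclideanSpace ℝ (Fin 4)

/-- The profile of the cutoff: a smooth function `K` on `[0, ∞)` with `K = 1` on `[0, 1]` and
`K = 0` on `[4, ∞)`.  All derivatives of `K` then vanish at `1` and at `4`, so that `K` approaches
its limiting values there faster than any power. -/
structure IsCutoffProfile (K : ℝ → ℝ) : Prop where
  smooth : ContDiffOn ℝ ∞ K (Ici 0)
  eq_one : ∀ a ∈ Icc (0 : ℝ) 1, K a = 1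
  eq_zero : ∀ a, 4 ≤ a → K a = 0

/-- `R_m(Λ, p) = [1 - K((1 + Λ/m)²)] K(p²/Λ²)`; it vanishes at `Λ = 0`. -/
def cutoffLight (K : ℝ → ℝ) (m Λ : ℝ) (p : Mom) : ℝ :=
  (1 - K ((1 + Λ / m) ^ 2)) * K (‖p‖ ^ 2 / Λ ^ 2)

/-- `R_M(Λ, p) = [1 - K(Λ²/M²)] K(p²/Λ²)`; it vanishes for `0 ≤ Λ ≤ M`. -/
def cutoffHeavy (K : ℝ → ℝ) (M Λ : ℝ) (p : Mom) : ℝ :=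
  (1 - K (Λ ^ 2 / M ^ 2)) * K (‖p‖ ^ 2 / Λ ^ 2)

/-- The cutoff propagator `R_m(Λ, p) / (p² + m²)` of the light field. -/
def propLight (K : ℝ → ℝ) (m Λ : ℝ) (p : Mom) : ℝ :=
  cutoffLight K m Λ p / (‖p‖ ^ 2 + m ^ 2)

/-- The cutoff propagator `R_M(Λ, p) / (p² + M²)` of the heavy field. -/
def propHeavy (K : ℝ → ℝ) (M Λ : ℝ) (p : Mom) : ℝ :=
  cutoffHeavy K M Λ p / (‖p‖ ^ 2 + M ^ 2)

/-- `∂_Λ` of the light propagator. -/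
def dpropLight (K : ℝ → ℝ) (m Λ : ℝ) (p : Mom) : ℝ :=
  deriv (fun s => propLight K m s p) Λ

/-- `∂_Λ` of the heavy propagator. -/
def dpropHeavy (K : ℝ → ℝ) (M Λ : ℝ) (p : Mom) : ℝ :=
  deriv (fun s => propHeavy K M s p) Λ

/-- Independent momenta of a vertex with `2 n₁` light and `2 n₂` heavy legs: the legs are listed
with the light ones first, and the momentum of the last leg (heavy if `n₂ ≠ 0`, light if `n₂ = 0`)
is eliminated by momentum conservation. -/
abbrev Config (n₁ n₂ : ℕ) : Type := Fin (2 * n₁ + 2 * n₂ - 1) → Mom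

/-- A family of vertex functions `𝓛 r n₁ n₂ Λ k`: the order in the couplings is
`r = (r₁, r₂, r₃)`, there are `2 n₁` light and `2 n₂` heavy legs, the scale is `Λ`, and `k` are the
independent momenta. -/
abbrev VertexFamily : Type :=
  (Fin 3 → ℕ) → (n₁ n₂ : ℕ) → ℝ → Config n₁ n₂ → ℝ

/-- The momenta of all `2 n₁ + 2 n₂` legs (numbered from `0`), the last one being minus the sum of
the others. -/
def allLegs (n₁ n₂ : ℕ) (k : Config n₁ n₂) (j : ℕ) : Mom :=
  if h : j < 2 * n₁ + 2 * n₂ - 1 then k ⟨j, h⟩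
  else if j = 2 * n₁ + 2 * n₂ - 1 then -∑ i, k i else 0

/-- The momenta of the light legs. -/
def lightLegs (n₁ n₂ : ℕ) (k : Config n₁ n₂) (j : ℕ) : Mom := allLegs n₁ n₂ k j

/-- The momenta of the heavy legs. -/
def heavyLegs (n₁ n₂ : ℕ) (k : Config n₁ n₂) (j : ℕ) : Mom := allLegs n₁ n₂ k (2 * n₁ + j)

/-- The independent momenta of the configuration whose light legs carry `p 0, …, p (2 n₁ - 1)` and
whose heavy legs carry `p' 0, …, p' (2 n₂ - 1)`; used only when all these momenta add up to zero. -/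
def config (n₁ n₂ : ℕ) (p p' : ℕ → Mom) : Config n₁ n₂ :=
  fun j => if (j : ℕ) < 2 * n₁ then p (j : ℕ) else p' ((j : ℕ) - 2 * n₁)

/-- The first `a` momenta of `p`, followed by `q` and `-q`. -/
def appendPair (a : ℕ) (p : ℕ → Mom) (q : Mom) (j : ℕ) : Mom :=
  if j < a then p j else if j = a then q else -q

/-- The first `a` momenta of `p`, followed by `q`. -/
def appendOne (a : ℕ) (p : ℕ → Mom) (q : Mom) (j : ℕ) : Mom :=
  if j < a then p j else q

/-- The first `a` momenta of `p`, permuted by `π`. -/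
def permute (a : ℕ) (π : Equiv.Perm (Fin a)) (p : ℕ → Mom) (j : ℕ) : Mom :=
  if h : j < a then p (π ⟨j, h⟩) else 0

/-- Symmetrization in the `a` light and in the `b` heavy external momenta. -/
def symm (a b : ℕ) (F : (ℕ → Mom) → (ℕ → Mom) → ℝ) (p p' : ℕ → Mom) : ℝ :=
  (∑ π : Equiv.Perm (Fin a), ∑ σ : Equiv.Perm (Fin b), F (permute a π p) (permute b σ p')) /
    ((a.factorial : ℝ) * (b.factorial : ℝ))

/-- Two vertices joined by a light line: the first has `2 l₁` light and `2 l₂` heavy legs, the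
second `2 l₁'` and `2 l₂'`.  The first takes the first `2 l₁ - 1` light and the first `2 l₂` heavy
external momenta, and the line carries minus their sum. -/
def treeLight (K : ℝ → ℝ) (m Λ : ℝ) (l₁ l₂ l₁' l₂' : ℕ)
    (f : Config l₁ l₂ → ℝ) (g : Config l₁' l₂' → ℝ) (p p' : ℕ → Mom) : ℝ :=
  let P : Mom := -(∑ j ∈ Finset.range (2 * l₁ - 1), p j + ∑ j ∈ Finset.range (2 * l₂), p' j)
  dpropLight K m Λ P *
    f (config l₁ l₂ (appendOne (2 * l₁ - 1) p P) p') *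
    g (config l₁' l₂' (appendOne (2 * l₁' - 1) (fun j => p (2 * l₁ - 1 + j)) (-P))
      (fun j => p' (2 * l₂ + j)))

/-- Two vertices joined by a heavy line: the first takes the first `2 l₁` light and the first
`2 l₂ - 1` heavy external momenta, and the line carries minus their sum. -/
def treeHeavy (K : ℝ → ℝ) (M Λ : ℝ) (l₁ l₂ l₁' l₂' : ℕ)
    (f : Config l₁ l₂ → ℝ) (g : Config l₁' l₂' → ℝ) (p p' : ℕ → Mom) : ℝ :=
  let P : Mom := -(∑ j ∈ Finset.range (2 * l₁), p j + ∑ j ∈ Finset.range (2 * l₂ - 1), p' j)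
  dpropHeavy K M Λ P *
    f (config l₁ l₂ p (appendOne (2 * l₂ - 1) p' P)) *
    g (config l₁' l₂' (fun j => p (2 * l₁ + j))
      (appendOne (2 * l₂' - 1) (fun j => p' (2 * l₂ - 1 + j)) (-P)))

/-- The right-hand side of the flow equation for the vertex function of order `r` with `2 n₁` light
and `2 n₂` heavy legs: light loop, light tree, heavy loop and heavy tree. -/
def flowRHS (K : ℝ → ℝ) (m M : ℝ) (L : VertexFamily) (r : Fin 3 → ℕ) (n₁ n₂ : ℕ) (Λ : ℝ)
    (k : Config n₁ n₂) : ℝ :=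
  let p := lightLegs n₁ n₂ k;
  let p' := heavyLegs n₁ n₂ k;
  -((2 * n₁ + 2).choose 2 : ℝ) *
      ((∫ q : Mom, dpropLight K m Λ q *
        L r (n₁ + 1) n₂ Λ (config (n₁ + 1) n₂ (appendPair (2 * n₁) p q) p')) /
        (2 * Real.pi) ^ 4)
  + 2 * ∑ s ∈ Finset.Iic r, ∑ l ∈ Finset.HasAntidiagonal.antidiagonal (n₁ + 1),
      ∑ h ∈ Finset.HasAntidiagonal.antidiagonal n₂,
      (l.1 : ℝ) * (l.2 : ℝ) *
        symm (2 * n₁) (2 * n₂)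
          (treeLight K m Λ l.1 h.1 l.2 h.2 (L s l.1 h.1 Λ) (L (r - s) l.2 h.2 Λ)) p p'
  - ((2 * n₂ + 2).choose 2 : ℝ) *
      ((∫ q : Mom, dpropHeavy K M Λ q *
        L r n₁ (n₂ + 1) Λ (config n₁ (n₂ + 1) p (appendPair (2 * n₂) p' q))) /
        (2 * Real.pi) ^ 4)
  + 2 * ∑ s ∈ Finset.Iic r, ∑ l ∈ Finset.HasAntidiagonal.antidiagonal n₁,
      ∑ h ∈ Finset.HasAntidiagonal.antidiagonal (n₂ + 1),
      (h.1 : ℝ) * (h.2 : ℝ) *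
        symm (2 * n₁) (2 * n₂)
          (treeHeavy K M Λ l.1 h.1 l.2 h.2 (L s l.1 h.1 Λ) (L (r - s) l.2 h.2 Λ)) p p'

/-- The vertex functions of the local bare action
`∫ ρ₀/2 φ² + ρ₁/2 (∂φ)² + ρ₂/4! φ⁴ + ρ₃/2 ψ² + ρ₄/2 (∂ψ)² + ρ₅/4! ψ⁴ + ρ₆/4 φ²ψ²`. -/
def bareVertex (ρ : Fin 7 → ℝ) : (n₁ n₂ : ℕ) → Config n₁ n₂ → ℝ
  | 1, 0, k => (ρ 0 + ρ 1 * ‖k ⟨0, by norm_num⟩‖ ^ 2) / 2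
  | 2, 0, _ => ρ 2 / 24
  | 0, 1, k => (ρ 3 + ρ 4 * ‖k ⟨0, by norm_num⟩‖ ^ 2) / 2
  | 0, 2, _ => ρ 5 / 24
  | 1, 1, _ => ρ 6 / 4
  | _, _, _ => 0

/-- The partial derivative of order `z` in the independent momenta, taken once for each of the
`z` components `d 0, …, d (z - 1)`; a component is a pair (leg, Lorentz index).  For a smooth
function these are exactly the derivatives `∂^w` with multiindices `w` of length `|w| = z`. -/
def momDeriv {n₁ n₂ : ℕ} (z : ℕ) (d : Fin z → Fin (2 * n₁ + 2 * n₂ - 1) × Fin 4)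
    (f : Config n₁ n₂ → ℝ) (k : Config n₁ n₂) : ℝ :=
  iteratedFDeriv ℝ z f k (fun i => Pi.single (d i).1 (EuclideanSpace.single (d i).2 (1 : ℝ)))

/-- `L` is the family of perturbative vertex functions, with ultraviolet cutoff `Λ₀`, of the theory
of a light field of mass `m` and a heavy field of mass `M`, renormalized at the points `0` and
`pbar`. -/
structure IsVertexFamily (K : ℝ → ℝ) (m M : ℝ) (pbar : Fin 5 → Mom) (Λ₀ : ℝ)
    (L : VertexFamily) : Prop where
  /-- smoothness in the scale and in the momenta -/
  smooth : ∀ r n₁ n₂, 1 ≤ n₁ + n₂ →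
    ContDiffOn ℝ ∞ (fun x : ℝ × Config n₁ n₂ => L r n₁ n₂ x.1 x.2) (Icc 0 Λ₀ ×ˢ univ)
  /-- the perturbation expansion has no term of order zero -/
  order_zero : ∀ n₁ n₂, 1 ≤ n₁ + n₂ → ∀ Λ ∈ Icc 0 Λ₀, ∀ k, L 0 n₁ n₂ Λ k = 0
  /-- only connected diagrams contribute -/
  connected : ∀ r n₁ n₂, (∑ i, r i) + 1 < n₁ + n₂ → ∀ Λ ∈ Icc 0 Λ₀, ∀ k, L r n₁ n₂ Λ k = 0
  /-- the flow equation -/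
  flow : ∀ r n₁ n₂, 1 ≤ n₁ + n₂ → ∀ Λ ∈ Icc 0 Λ₀, ∀ k,
    HasDerivWithinAt (fun s => L r n₁ n₂ s k) (flowRHS K m M L r n₁ n₂ Λ k) (Icc 0 Λ₀) Λ
  /-- at the cutoff scale the vertex functions are those of a local bare action, whose coefficients
  are formal power series in the renormalized couplings -/
  bare : ∀ r, ∃ ρ : Fin 7 → ℝ, ∀ n₁ n₂, 1 ≤ n₁ + n₂ → ∀ k,
    L r n₁ n₂ Λ₀ k = bareVertex ρ n₁ n₂ k
  /-- renormalization conditions for the light two-point function -/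
  ren_light_mass : ∀ r, L r 1 0 0 0 = 0
  ren_light_field : ∀ r d, momDeriv 2 d (L r 1 0 0) 0 = 0
  /-- renormalization condition for the light four-point function -/
  ren_light_quartic : ∀ r, L r 2 0 0 0 = if r = ![1, 0, 0] then 1 / 24 else 0
  /-- renormalization conditions for the heavy two-point function; a function of `p²` has second
  derivatives `A δ_{μν} + B p_μ p_ν`, and the condition is `A = 0` at the point `pbar 0` -/
  ren_heavy_mass : ∀ r, L r 0 1 0 (fun _ => pbar 0) = 0
  ren_heavy_field : ∀ r, ∃ c : ℝ, ∀ d : Fin 2 → Fin (2 * 0 + 2 * 1 - 1) × Fin 4,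
    momDeriv 2 d (L r 0 1 0) (fun _ => pbar 0) = c * (pbar 0 (d 0).2 * pbar 0 (d 1).2)
  /-- renormalization condition for the heavy four-point function -/
  ren_heavy_quartic : ∀ r, L r 0 2 0 ![pbar 1, pbar 2, pbar 3] =
    if r = ![0, 1, 0] then 1 / 24 else 0
  /-- renormalization condition for the mixed four-point function -/
  ren_mixed_quartic : ∀ r, L r 1 1 0 ![0, 0, pbar 4] = if r = ![0, 0, 1] then 1 / 4 else 0

/-- The momenta over which the norm with parameters `(a, b, b')` takes the maximum: independent
light momenta up to `max a b`, independent heavy momenta up to `max a b'`. -/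
def region (n₁ n₂ : ℕ) (a b b' : ℝ) : Set (Config n₁ n₂) :=
  {k | ∀ j : Fin (2 * n₁ + 2 * n₂ - 1), ((j : ℕ) < 2 * n₁ → ‖k j‖ ≤ max a b) ∧
    (2 * n₁ ≤ (j : ℕ) → ‖k j‖ ≤ max a b')}

end

end PhiPsi

open PhiPsi

/-! The flow equation is triangular. Order the vertex functions by `|r|` first and by decreasing
number of legs second. Both factors of a tree then have lower order, since order zero vanishes, and
a loop raises the number of legs, which connectedness bounds by `|n| ≤ |r| + 1`. So each vertex
function is a local term `a + b p²` minus the integral over scales from `Λ` to `Λ₀` of an already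
known right-hand side, and the renormalization conditions at scale `0` fix `a` and `b`. This yields
the explicit family `vertex`, smooth in all real `Λ` and `Λ₀` because the infrared regulators are
flat at `Λ = 0` (`contDiff_flat_smul`). The same induction gives uniqueness
(`IsVertexFamily.unique`), so statements about arbitrary families reduce to `vertex` (`eq_vertex`).

The bounds are power counting with two infrared scales: `u = Λ + m`, and `X`, which is `u` without
heavy legs and `Λ + M` with them. With `D = 2|n| + z`, the derivatives of `L` are bounded by `weight
0` and those of `Λ₀³ ∂L/∂Λ₀` by `weight 2`, up to powers of logarithms; `weight 2` divided by `Λ₀³`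
is the bound to be proved. Relative to its weight the right-hand side of the flow gains a factor
`1/u`, so that an integration over scales costs one logarithm. For light lines this is plain power
counting; the only vertex whose weight is not of the naive form, the heavy two-point function, never
meets a light line. Heavy lines vanish below `M`, and above `M` the scales `u` and `X` are
comparable.

Integration (`IsFlowPair.hasWeight`) depends on `D`. For `D ≥ 6` one integrates down from `Λ₀`,
where the action is local. For `D = 5` the derivative is odd, hence vanishes at zero momentum, and
the bound for `D = 6` spreads this over the ball of momenta. For `D ≤ 4` one integrates up from the
renormalization condition at scale `0`, at the renormalization point, and spreads the result by the
bound for `D + 1`. With heavy legs the spreading is done for `Λ ≥ M`; one then integrates down from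
`M`, where `X` varies by at most a factor two.

Invariance under isometries gives the parity argument. It also makes the second derivatives of a
two-point function at `p` equal to `A δ + B p p`, with `A` read off on a unit vector orthogonal to
`p`.

The derivative in `Λ₀` obeys the linearized flow with homogeneous renormalization conditions; at `Λ
= Λ₀` its irrelevant part is minus the right-hand side of the flow (`IsRenormalizedFlow.dot_bare`).
Trading the logarithms for one power of `Λ₀` leaves a decay like `Λ₀⁻²`, which is integrable, so the
vertex functions converge. -/

namespace PhiPsi

/-! ### Calculus with parameters: derivatives and integrals over compact sets -/

section Calculus

variable {P X Q F : Type} [NormedAddCommGroup P] [NormedSpace ℝ P] [NormedAddCommGroup X]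
  [NormedSpace ℝ X] [NormedAddCommGroup Q] [NormedSpace ℝ Q]
  [NormedAddCommGroup F] [NormedSpace ℝ F]

/-- The uncurrying isomorphism, as a continuous linear equivalence of normed spaces. -/
noncomputable def uncurryEquiv (X F : Type) [NormedAddCommGroup X] [NormedSpace ℝ X]
    [NormedAddCommGroup F] [NormedSpace ℝ F] (z : ℕ) :
    (X →L[ℝ] ContinuousMultilinearMap ℝ (fun _ : Fin z => X) F) ≃L[ℝ]
      ContinuousMultilinearMap ℝ (fun _ : Fin (z + 1) => X) F := by
  exact (continuousMultilinearCurryLeftEquiv ℝ (fun _ : Fin (z + 1) => X)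
      F).symm.toContinuousLinearEquiv

/-- Derivatives in part of the variables depend smoothly on all variables. -/
theorem contDiff_iteratedFDeriv_param {f : P → X → F} (hf : ContDiff ℝ ∞ (fun x : P × X => f x.1 x.2))
    (z : ℕ) : ContDiff ℝ ∞ (fun x : P × X => iteratedFDeriv ℝ z (f x.1) x.2) := by
  induction z with
  | zero =>
    have : (fun x : P × X => iteratedFDeriv ℝ 0 (f x.1) x.2) =
        fun x => (continuousMultilinearCurryFin0 ℝ X F).symm (f x.1 x.2) := by
      ext x; simp [iteratedFDeriv_zero_eq_comp]
    rw [this]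
    exact (continuousMultilinearCurryFin0 ℝ X F).symm.contDiff.comp hf
  | succ z ih =>
    have : (fun x : P × X => iteratedFDeriv ℝ (z + 1) (f x.1) x.2) = fun x =>
        uncurryEquiv X F z (fderiv ℝ (iteratedFDeriv ℝ z (f x.1)) x.2) := rfl
    rw [this]
    have e : ContDiff ℝ ∞ (uncurryEquiv X F z) := ContinuousLinearMap.contDiff (𝕜 := ℝ)
      (E := X →L[ℝ] ContinuousMultilinearMap ℝ (fun _ : Fin z => X) F)
      (F := ContinuousMultilinearMap ℝ (fun _ : Fin (z + 1) => X) F)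
      (uncurryEquiv X F z).toContinuousLinearMap
    have h1 : ContDiff ℝ ∞ (fun x : P × X => fderiv ℝ (iteratedFDeriv ℝ z (f x.1)) x.2) := by
      refine ContDiff.fderiv (f := fun x : P × X => iteratedFDeriv ℝ z (f x.1)) (m := ∞) ?_
        contDiff_snd (by simp)
      exact ih.comp ((contDiff_fst.fst).prodMk contDiff_snd)
    exact e.comp h1

theorem contDiff_deriv_param {h : ℝ → X → F} (hh : ContDiff ℝ ∞ (fun x : ℝ × X => h x.1 x.2)) :
    ContDiff ℝ ∞ (fun x : ℝ × X => deriv (fun s => h s x.2) x.1) := by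
  have h1 : ContDiff ℝ ∞ (fun x : ℝ × X => fderiv ℝ (fun s => h s x.2) x.1) := by
    refine ContDiff.fderiv (f := fun x : ℝ × X => fun s => h s x.2) (m := ∞) ?_
      contDiff_fst (by simp)
    exact hh.comp (contDiff_snd.prodMk contDiff_fst.snd)
  exact h1.clm_apply contDiff_const

theorem contDiff_comp_pair {G H : Type} [NormedAddCommGroup G] [NormedSpace ℝ G]
    [NormedAddCommGroup H] [NormedSpace ℝ H] {f : P → X → G}
    (hf : ContDiff ℝ ∞ (fun x : P × X => f x.1 x.2)) {a : H → P} {b : H → X}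
    (ha : ContDiff ℝ ∞ a) (hb : ContDiff ℝ ∞ b) : ContDiff ℝ ∞ (fun x => f (a x) (b x)) :=
  hf.comp (ha.prodMk hb)

theorem contDiff_left_param {h : P → X → F} (hh : ContDiff ℝ ∞ (fun x : P × X => h x.1 x.2))
    (p : P) : ContDiff ℝ ∞ (h p) := hh.comp (contDiff_const.prodMk contDiff_id)

theorem contDiff_right_param {h : P → X → F} (hh : ContDiff ℝ ∞ (fun x : P × X => h x.1 x.2))
    (x : X) : ContDiff ℝ ∞ (fun p => h p x) := hh.comp (contDiff_id.prodMk contDiff_const)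

theorem hasDerivAt_right_param {h : ℝ → X → F} (hh : ContDiff ℝ ∞ (fun x : ℝ × X => h x.1 x.2))
    (x : X) (s : ℝ) : HasDerivAt (fun s => h s x) (deriv (fun s => h s x) s) s :=
  (((contDiff_right_param hh x).differentiable (by simp)) s).hasDerivAt

/-- Both sides are second derivatives of the joint function, in the directions `(1, 0)` and `(0, v)`
taken in either order; they agree by symmetry. -/
theorem hasDerivAt_fderiv_param {h : ℝ → X → F} (hh : ContDiff ℝ ∞ (fun x : ℝ × X => h x.1 x.2))
    (k : X) (s₀ : ℝ) :
    HasDerivAt (fun s => fderiv ℝ (h s) k)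
      (fderiv ℝ (fun k => deriv (fun s => h s k) s₀) k) s₀ := by
  set Φ : ℝ × X → F := fun x => h x.1 x.2 with hΦ
  have hd : ∀ x, HasFDerivAt Φ (fderiv ℝ Φ x) x := fun x =>
    ((hh.differentiable (by simp)) x).hasFDerivAt
  have hc1 : ContDiff ℝ ∞ (fderiv ℝ Φ) := hh.fderiv_right (by simp)
  have hd2 : ∀ x, HasFDerivAt (fderiv ℝ Φ) (fderiv ℝ (fderiv ℝ Φ) x) x := fun x =>
    ((hc1.differentiable (by simp)) x).hasFDerivAt
  have e1 : ∀ s k, fderiv ℝ (h s) k = (fderiv ℝ Φ (s, k)).comp (ContinuousLinearMap.inr ℝ ℝ X) := by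
    intro s k
    exact ((hd (s, k)).comp k (hasFDerivAt_prodMk_right s k)).fderiv
  have e2 : ∀ k, deriv (fun s => h s k) s₀ = fderiv ℝ Φ (s₀, k) (1, 0) := by
    intro k
    have := ((hd (s₀, k)).comp s₀ (hasFDerivAt_prodMk_left s₀ k)).hasDerivAt.deriv
    exact this.trans (by simp)
  have hsymm : IsSymmSndFDerivAt ℝ Φ (s₀, k) := by
    refine ContDiffAt.isSymmSndFDerivAt (n := ∞) hh.contDiffAt ?_
    simp only [minSmoothness_of_isRCLikeNormedField]
    exact ENat.LEInfty.out
  have e3 : fderiv ℝ (fun k => deriv (fun s => h s k) s₀) k =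
      ((ContinuousLinearMap.apply ℝ F ((1 : ℝ), (0 : X))).comp
        (fderiv ℝ (fderiv ℝ Φ) (s₀, k))).comp (ContinuousLinearMap.inr ℝ ℝ X) := by
    simp_rw [e2]
    have := ((ContinuousLinearMap.apply ℝ F ((1 : ℝ), (0 : X))).hasFDerivAt.comp (s₀, k)
      (hd2 (s₀, k))).comp k (hasFDerivAt_prodMk_right s₀ k)
    exact this.fderiv
  have h4 : HasDerivAt (fun s => fderiv ℝ Φ (s, k)) (fderiv ℝ (fderiv ℝ Φ) (s₀, k) (1, 0)) s₀ := by
    have := ((hd2 (s₀, k)).comp s₀ (hasFDerivAt_prodMk_left s₀ k)).hasDerivAt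
    rwa [ContinuousLinearMap.comp_apply, ContinuousLinearMap.inl_apply] at this
  simp_rw [e1]
  have h5 := (((ContinuousLinearMap.compL ℝ X (ℝ × X) F).flip
    (ContinuousLinearMap.inr ℝ ℝ X)).hasFDerivAt.comp_hasDerivAt s₀ h4)
  refine h5.congr_deriv ?_
  rw [e3]
  ext v
  simpa using (hsymm.eq (0, v) (1, 0)).symm

/-- Derivatives in a parameter and in the remaining variables commute. -/
theorem hasDerivAt_iteratedFDeriv_param {h : ℝ → X → F}
    (hh : ContDiff ℝ ∞ (fun x : ℝ × X => h x.1 x.2)) (z : ℕ) (k : X) (s₀ : ℝ) :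
    HasDerivAt (fun s => iteratedFDeriv ℝ z (h s) k)
      (iteratedFDeriv ℝ z (fun k => deriv (fun s => h s k) s₀) k) s₀ := by
  induction z generalizing k s₀ with
  | zero =>
    have h1 := hasDerivAt_right_param hh k s₀
    exact ((continuousMultilinearCurryFin0 ℝ X F).symm.toContinuousLinearEquiv
      |>.toContinuousLinearMap.hasFDerivAt.comp_hasDerivAt s₀ h1)
  | succ z ih =>
    have h1 := hasDerivAt_fderiv_param 
      (h := fun s => iteratedFDeriv ℝ z (h s)) (contDiff_iteratedFDeriv_param hh z) k s₀
    have h2 : (fun k => deriv (fun s => iteratedFDeriv ℝ z (h s) k) s₀) =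
        iteratedFDeriv ℝ z (fun k => deriv (fun s => h s k) s₀) := by
      ext1 k; exact (ih k s₀).deriv
    rw [h2] at h1
    exact ((uncurryEquiv X F z).toContinuousLinearMap.hasFDerivAt.comp_hasDerivAt s₀ h1)

variable [MeasurableSpace Q] [BorelSpace Q] [FiniteDimensional ℝ X]
  {μ : Measure Q} [IsFiniteMeasureOnCompacts μ]

/-- Compactness supplies the dominating function: the derivative is bounded on a closed unit ball
times `s`, and constants are integrable on `s`. -/
theorem hasFDerivAt_setIntegral_param {g : X → Q → F} {s : Set Q} (hs : IsCompact s)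
    (hg : ContDiff ℝ ∞ (fun x : X × Q => g x.1 x.2)) (x₀ : X) :
    HasFDerivAt (fun x => ∫ q in s, g x q ∂μ) (∫ q in s, fderiv ℝ (fun y => g y q) x₀ ∂μ) x₀ := by
  have hfd : Continuous (fun x : X × Q => fderiv ℝ (fun y : X => g y x.2) x.1) := by
    have : ContDiff ℝ ∞ (fun x : X × Q => fderiv ℝ (fun y => g y x.2) x.1) := by
      refine ContDiff.fderiv (f := fun x : X × Q => fun y => g y x.2) (m := ∞) ?_
        contDiff_fst (by simp)
      exact hg.comp (contDiff_snd.prodMk contDiff_fst.snd)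
    exact this.continuous
  have : ProperSpace X := FiniteDimensional.proper ℝ X
  obtain ⟨C, hC⟩ := ((isCompact_closedBall x₀ 1).prod hs).exists_bound_of_continuousOn
    hfd.continuousOn
  have hint : ∀ x, IntegrableOn (g x) s μ := fun x =>
    ((hg.continuous.comp (Continuous.prodMk_right x)).continuousOn).integrableOn_compact hs
  have : IsFiniteMeasure (μ.restrict s) := ⟨by simpa using hs.measure_lt_top⟩
  refine hasFDerivAt_integral_of_dominated_of_fderiv_le (𝕜 := ℝ) (bound := fun _ => C)
    (F := g) (F' := fun x q => fderiv ℝ (fun y => g y q) x)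
    (Metric.closedBall_mem_nhds x₀ one_pos) (Eventually.of_forall fun x => (hint x).1) (hint x₀)
    ?_ ?_ (integrable_const C) ?_
  · exact ((hfd.comp (Continuous.prodMk_right x₀)).continuousOn.integrableOn_compact hs).1
  · filter_upwards [ae_restrict_mem hs.measurableSet] with q hq x hx
    exact hC (x, q) ⟨hx, hq⟩
  · refine Eventually.of_forall fun q x _ => ?_
    exact (((contDiff_right_param hg q).differentiable (by simp)) x).hasFDerivAt

theorem contDiff_setIntegral_param {g : X → Q → F} {s : Set Q} (hs : IsCompact s)
    (hg : ContDiff ℝ ∞ (fun x : X × Q => g x.1 x.2)) :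
    ContDiff ℝ ∞ (fun x => ∫ q in s, g x q ∂μ) := by
  rw [contDiff_infty]
  intro n
  induction n generalizing F with
  | zero =>
    refine contDiff_zero.2 ?_
    have : Differentiable ℝ (fun x => ∫ q in s, g x q ∂μ) := fun x =>
      (hasFDerivAt_setIntegral_param hs hg x).differentiableAt
    exact this.continuous
  | succ n ih =>
    push_cast
    rw [contDiff_succ_iff_fderiv]
    refine ⟨fun x => (hasFDerivAt_setIntegral_param hs hg x).differentiableAt, by simp, ?_⟩
    have : fderiv ℝ (fun x => ∫ q in s, g x q ∂μ) =
        fun x => ∫ q in s, fderiv ℝ (fun y => g y q) x ∂μ := by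
      ext1 x; exact (hasFDerivAt_setIntegral_param hs hg x).fderiv
    rw [this]
    refine ih (g := fun x q => fderiv ℝ (fun y => g y q) x) ?_
    refine ContDiff.fderiv (f := fun x : X × Q => fun y => g y x.2) (m := ∞) ?_
        contDiff_fst (by simp)
    exact hg.comp (contDiff_snd.prodMk contDiff_fst.snd)

theorem iteratedFDeriv_setIntegral_param {g : X → Q → F} {s : Set Q} (hs : IsCompact s)
    (hg : ContDiff ℝ ∞ (fun x : X × Q => g x.1 x.2)) (z : ℕ) (x : X) :
    iteratedFDeriv ℝ z (fun x => ∫ q in s, g x q ∂μ) x =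
      ∫ q in s, iteratedFDeriv ℝ z (fun y => g y q) x ∂μ := by
  induction z generalizing x with
  | zero =>
    exact (ContinuousLinearEquiv.integral_comp_comm
      (continuousMultilinearCurryFin0 ℝ X F).symm.toContinuousLinearEquiv (fun q => g x q)).symm
  | succ z ih =>
    have hg' : ContDiff ℝ ∞ (fun x : X × Q => iteratedFDeriv ℝ z (fun y => g y x.2) x.1) :=
      (contDiff_iteratedFDeriv_param (f := fun q y => g y q)
        (hg.comp (contDiff_snd.prodMk contDiff_fst)) z).comp (contDiff_snd.prodMk contDiff_fst)
    have h1 := (hasFDerivAt_setIntegral_param (μ := μ)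
      (g := fun x q => iteratedFDeriv ℝ z (fun y => g y q) x) hs hg' x).fderiv
    have h2 : iteratedFDeriv ℝ z (fun x => ∫ q in s, g x q ∂μ) =
      fun x => ∫ q in s, iteratedFDeriv ℝ z (fun y => g y q) x ∂μ := by ext1 x; exact ih x
    rw [← h2] at h1
    have h3 := ContinuousLinearEquiv.integral_comp_comm (μ := μ.restrict s) (𝕜 := ℝ)
      (E := X →L[ℝ] ContinuousMultilinearMap ℝ (fun _ : Fin z => X) F)
      (F := ContinuousMultilinearMap ℝ (fun _ : Fin (z + 1) => X) F)
      (uncurryEquiv X F z)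
      (fun q => fderiv ℝ (iteratedFDeriv ℝ z (fun y => g y q)) x)
    rw [← h1] at h3
    exact h3.symm

theorem norm_iteratedFDeriv_setIntegral_param_le {g : X → Q → F} {s : Set Q} (hs : IsCompact s)
    (hg : ContDiff ℝ ∞ (fun x : X × Q => g x.1 x.2)) (z : ℕ) (x : X) {B : ℝ}
    (hB : ∀ q ∈ s, ‖iteratedFDeriv ℝ z (fun y => g y q) x‖ ≤ B) :
    ‖iteratedFDeriv ℝ z (fun x => ∫ q in s, g x q ∂μ) x‖ ≤ B * μ.real s := by
  rw [iteratedFDeriv_setIntegral_param hs hg]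
  exact norm_setIntegral_le_of_norm_le_const hs.measure_lt_top hB

theorem hasDerivAt_setIntegral_param {g : ℝ → Q → F} {s : Set Q} (hs : IsCompact s)
    (hg : ContDiff ℝ ∞ (fun x : ℝ × Q => g x.1 x.2)) (x₀ : ℝ) :
    HasDerivAt (fun x => ∫ q in s, g x q ∂μ) (∫ q in s, deriv (fun y => g y q) x₀ ∂μ) x₀ := by
  -- In an incomplete space the Bochner integral is zero by definition, and both sides vanish.
  by_cases hF : CompleteSpace F
  swap
  · simp only [integral, hF, dite_false]
    exact hasDerivAt_const _ _
  have h := (hasFDerivAt_setIntegral_param (μ := μ) hs hg x₀).hasDerivAt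
  convert h using 1
  rw [ContinuousLinearMap.integral_apply]
  · rfl
  · have hfd : Continuous (fun x : ℝ × Q => fderiv ℝ (fun y => g y x.2) x.1) := by
      have : ContDiff ℝ ∞ (fun x : ℝ × Q => fderiv ℝ (fun y => g y x.2) x.1) := by
        refine ContDiff.fderiv (f := fun x : ℝ × Q => fun y => g y x.2) (m := ∞) ?_
          contDiff_fst (by simp)
        exact hg.comp (contDiff_snd.prodMk contDiff_fst.snd)
      exact this.continuous
    exact ((hfd.comp (Continuous.prodMk_right x₀)).continuousOn.integrableOn_compact hs)

end Calculus

/-! ### Smooth limits -/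

section Limits

variable {X F : Type} [NormedAddCommGroup X] [NormedSpace ℝ X] [NormedAddCommGroup F]
  [NormedSpace ℝ F]

/-- A family of smooth functions whose derivatives are uniformly Cauchy on bounded sets converges to
a smooth function, together with all derivatives. -/
theorem exists_contDiff_limit [CompleteSpace F] (u : ℝ → X → F) (hu : ∀ s, ContDiff ℝ ∞ (u s))
    (hc : ∀ (z : ℕ) (R : ℝ), UniformCauchySeqOn (fun s x => iteratedFDeriv ℝ z (u s) x) atTop
      (Metric.closedBall 0 R)) :
    ∃ G : X → F, ContDiff ℝ ∞ G ∧ ∀ (z : ℕ) (R : ℝ), TendstoUniformlyOn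
      (fun s x => iteratedFDeriv ℝ z (u s) x) (iteratedFDeriv ℝ z G) atTop
      (Metric.closedBall 0 R) := by
  have hlim : ∀ z x, ∃ y, Tendsto (fun s => iteratedFDeriv ℝ z (u s) x) atTop (𝓝 y) := fun z x =>
    cauchy_map_iff_exists_tendsto.1 ((hc z ‖x‖).cauchy_map (by simp))
  choose p hp using hlim
  have hunif : ∀ (z : ℕ) (R : ℝ), TendstoUniformlyOn (fun s x => iteratedFDeriv ℝ z (u s) x) (p z)
      atTop (Metric.closedBall 0 R) := fun z R =>
    (hc z R).tendstoUniformlyOn_of_tendsto fun x _ => hp z x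
  have hder : ∀ z x, HasFDerivAt (p z) (p (z + 1) x).curryLeft x := by
    intro z x
    have h1 : TendstoUniformlyOn (fun s x => fderiv ℝ (iteratedFDeriv ℝ z (u s)) x)
        (fun x => (p (z + 1) x).curryLeft) atTop (Metric.ball 0 (‖x‖ + 1)) := by
      have h2 := ((hunif (z + 1) (‖x‖ + 1)).mono Metric.ball_subset_closedBall)
      have h3 := (continuousMultilinearCurryLeftEquiv ℝ (fun _ : Fin (z + 1) => X)
        F).isometry.uniformContinuous
      exact h3.comp_tendstoUniformlyOn h2
    refine hasFDerivAt_of_tendstoUniformlyOn Metric.isOpen_ball h1 (fun s y _ => ?_)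
      (fun y _ => hp z y) (by simp)
    have : ContDiff ℝ ∞ (iteratedFDeriv ℝ z (u s)) := (hu s).iteratedFDeriv_right (by exact_mod_cast le_top)
    exact ((this.differentiable (by simp)) y).hasFDerivAt
  -- The pointwise limits of the derivatives form a Taylor series of the limit function; its
  -- smoothness and its derivatives are read off from this.
  have hT : HasFTaylorSeriesUpTo ∞ (fun x => (p 0 x).curry0) (fun x z => p z x) :=
    { zero_eq := fun x => rfl
      fderiv := fun z _ x => hder z x
      cont := fun z _ => continuous_iff_continuousAt.2 fun x => (hder z x).continuousAt }
  refine ⟨fun x => (p 0 x).curry0, contDiff_infty.2 fun n => ?_, fun z R => ?_⟩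
  · exact (hT.of_le (by exact_mod_cast le_top)).contDiff
  · have : iteratedFDeriv ℝ z (fun x => (p 0 x).curry0) = p z := by
      ext1 x
      exact (hT.eq_iteratedFDeriv (by exact_mod_cast le_top) x).symm
    rw [this]
    exact hunif z R

end Limits


/-! ### Flat functions and smoothness of `χ s • k (s⁻¹ • u)` across `s = 0` -/

section Flat

variable {E F : Type} [NormedAddCommGroup E] [NormedSpace ℝ E] [NormedAddCommGroup F]
  [NormedSpace ℝ F]

theorem norm_iteratedFDeriv_comp_clm_le {Y : Type} [NormedAddCommGroup Y] [NormedSpace ℝ Y]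
    (A : E →L[ℝ] Y) {f : Y → F} (hf : ContDiff ℝ ∞ f) (z : ℕ) (x : E) :
    ‖iteratedFDeriv ℝ z (fun y => f (A y)) x‖ ≤ ‖iteratedFDeriv ℝ z f (A x)‖ * ‖A‖ ^ z := by
  have h := A.iteratedFDeriv_comp_right hf x (i := z) (by exact_mod_cast le_top)
  have h' : iteratedFDeriv ℝ z (fun y => f (A y)) x = _ := h
  rw [h']
  refine (ContinuousMultilinearMap.norm_compContinuousLinearMap_le _ _).trans ?_
  simp

theorem norm_iteratedFDeriv_comp_smul_le (c : ℝ) {f : E → F} (hf : ContDiff ℝ ∞ f) (z : ℕ) (x : E) :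
    ‖iteratedFDeriv ℝ z (fun y => f (c • y)) x‖ ≤ ‖iteratedFDeriv ℝ z f (c • x)‖ * |c| ^ z := by
  refine (norm_iteratedFDeriv_comp_clm_le (c • ContinuousLinearMap.id ℝ E) hf z x).trans ?_
  gcongr
  · simp
  · refine (norm_smul_le c (ContinuousLinearMap.id ℝ E)).trans ?_
    rw [Real.norm_eq_abs]
    exact mul_le_of_le_one_right (abs_nonneg _) ContinuousLinearMap.norm_id_le

theorem norm_iteratedFDeriv_const_mul_le {f : E → ℝ} (hf : ContDiff ℝ ∞ f) (c : ℝ) (z : ℕ) (x : E) :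
    ‖iteratedFDeriv ℝ z (fun y => c * f y) x‖ = |c| * ‖iteratedFDeriv ℝ z f x‖ := by
  have h : iteratedFDeriv ℝ z (c • f) x = c • iteratedFDeriv ℝ z f x :=
    iteratedFDeriv_const_smul_apply (hf.contDiffAt.of_le (by exact_mod_cast le_top))
  rw [show (fun y => c * f y) = c • f from rfl, h, norm_smul, Real.norm_eq_abs]

/-- A smooth function on the line that vanishes on an interval ending at `0`. -/
structure IsFlat (χ : ℝ → ℝ) : Prop where
  smooth : ContDiff ℝ ∞ χ
  vanish : ∃ δ > 0, ∀ s ∈ Icc (-δ) 0, χ s = 0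

theorem IsFlat.zero {χ : ℝ → ℝ} (h : IsFlat χ) : χ 0 = 0 := by
  obtain ⟨δ, hδ, h0⟩ := h.vanish
  exact h0 0 ⟨by linarith, le_rfl⟩

/-- An interval has unique derivatives at all its points, the endpoint `0` included, so the
derivative there is determined by the values on the interval alone. -/
theorem IsFlat.deriv {χ : ℝ → ℝ} (h : IsFlat χ) : IsFlat (deriv χ) := by
  obtain ⟨δ, hδ, h0⟩ := h.vanish
  refine ⟨h.smooth.deriv' , δ, hδ, fun s hs => ?_⟩
  have hd : HasDerivAt χ (_root_.deriv χ s) s :=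
    ((h.smooth.differentiable (by simp)) s).hasDerivAt
  have h1 : HasDerivWithinAt χ (_root_.deriv χ s) (Icc (-δ) 0) s := hd.hasDerivWithinAt
  have h2 : HasDerivWithinAt χ 0 (Icc (-δ) 0) s :=
    (hasDerivWithinAt_const s _ (0 : ℝ)).congr (fun x hx => h0 x hx) (h0 s hs)
  exact (uniqueDiffOn_Icc (by linarith) s hs).eq_deriv _ h1 h2

/-- Hadamard's quotient `∫₀¹ χ'(t s) dt` works: it is smooth, and it inherits flatness from `χ'`
because `t s` stays in the interval. -/
theorem IsFlat.exists_div {χ : ℝ → ℝ} (h : IsFlat χ) :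
    ∃ χ₁, IsFlat χ₁ ∧ ∀ s, χ s = s * χ₁ s := by
  obtain ⟨δ, hδ, h0⟩ := h.deriv.vanish
  refine ⟨fun s => ∫ t in Icc (0 : ℝ) 1, _root_.deriv χ (t * s), ⟨?_, δ, hδ, ?_⟩, ?_⟩
  · exact contDiff_setIntegral_param (g := fun s t => _root_.deriv χ (t * s)) isCompact_Icc
      (h.deriv.smooth.comp (contDiff_snd.mul contDiff_fst))
  · intro s hs
    refine setIntegral_eq_zero_of_forall_eq_zero fun t ht => h0 _ ⟨?_, ?_⟩
    · nlinarith [hs.1, hs.2, ht.1, ht.2]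
    · nlinarith [hs.1, hs.2, ht.1, ht.2]
  · intro s
    have h1 : ∫ t in (0 : ℝ)..1, _root_.deriv χ (t * s) * s = χ (1 * s) - χ (0 * s) := by
      refine intervalIntegral.integral_eq_sub_of_hasDerivAt (f := fun t => χ (t * s))
        (fun t _ => ?_) ?_
      · have hd : HasDerivAt χ (_root_.deriv χ (t * s)) (t * s) :=
          ((h.smooth.differentiable (by simp)) _).hasDerivAt
        exact (hd.comp t ((hasDerivAt_id t).mul_const s)).congr_deriv (by simp)
      · exact ((h.deriv.smooth.continuous.comp (by fun_prop)).mul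
          continuous_const).intervalIntegrable _ _
    rw [intervalIntegral.integral_mul_const, intervalIntegral.integral_of_le zero_le_one,
      ← integral_Icc_eq_integral_Ioc] at h1
    simp only [one_mul, zero_mul, h.zero, sub_zero] at h1
    rw [← h1, mul_comm]

/-- The part of the derivative of `(s, u) ↦ χ s • k (s⁻¹ • u)` that involves `χ'`. -/
noncomputable def flatDeriv₁ (k : E → F) (v : E) : ℝ × E →L[ℝ] F :=
  (ContinuousLinearMap.fst ℝ ℝ E).smulRight (k v)

/-- The part of the derivative of `(s, u) ↦ χ s • k (s⁻¹ • u)` that involves `χ s / s`. -/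
noncomputable def flatDeriv₂ (k : E → F) (v : E) : ℝ × E →L[ℝ] F :=
  (fderiv ℝ k v).comp (ContinuousLinearMap.snd ℝ ℝ E) -
    (ContinuousLinearMap.fst ℝ ℝ E).smulRight (fderiv ℝ k v v)

/-- Differentiating the argument `s⁻¹ • u` produces a factor `1/s`, which the factorization `χ s = s
χ₁ s` absorbs. The derivative is again a sum of functions of the original form, so the argument can
be iterated. -/
theorem exists_hasFDerivAt_flat_smul {χ : ℝ → ℝ} (hχ : IsFlat χ) {k : E → F}
    (hk : ContDiff ℝ ∞ k) (hkc : HasCompactSupport k) : ∃ χ₁, IsFlat χ₁ ∧ ∀ x : ℝ × E,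
      HasFDerivAt (fun x : ℝ × E => χ x.1 • k (x.1⁻¹ • x.2))
        (deriv χ x.1 • flatDeriv₁ k (x.1⁻¹ • x.2) + χ₁ x.1 • flatDeriv₂ k (x.1⁻¹ • x.2)) x := by
  obtain ⟨C, hC⟩ := hk.continuous.bounded_above_of_compact_support hkc
  obtain ⟨χ₁, hχ₁, hdiv⟩ := hχ.exists_div
  have hχd : ∀ s, HasDerivAt χ (deriv χ s) s := fun s =>
    ((hχ.smooth.differentiable (by simp)) s).hasDerivAt
  set D : ℝ × E → (ℝ × E →L[ℝ] F) := fun x =>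
    deriv χ x.1 • flatDeriv₁ k (x.1⁻¹ • x.2) + χ₁ x.1 • flatDeriv₂ k (x.1⁻¹ • x.2) with hD
  have hder : ∀ x, HasFDerivAt (fun x : ℝ × E => χ x.1 • k (x.1⁻¹ • x.2)) (D x) x := by
    rintro ⟨s, u⟩
    -- At `s = 0` the function is bounded by `C |χ s| = o(s)`, whatever the default value of `s⁻¹`.
    by_cases h0 : s = 0
    · subst h0
      have hD0 : D (0, u) = 0 := by
        simp [hD, hχ.deriv.zero, hχ₁.zero]
      rw [hD0, hasFDerivAt_iff_isLittleO_nhds_zero]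
      have h1 : (fun h : ℝ => χ h) =o[𝓝 0] fun h => h := by
        have := (hasDerivAt_iff_isLittleO_nhds_zero.1 (hχd 0))
        simpa [hχ.zero, hχ.deriv.zero] using this
      have h2 : Tendsto (fun h : ℝ × E => h.1) (𝓝 0) (𝓝 0) := by
        simpa using (continuous_fst (X := ℝ) (Y := E)).tendsto 0
      have h3 := (h1.comp_tendsto h2).trans_isBigO
        (k := fun h : ℝ × E => h) (Asymptotics.isBigO_of_le _ fun h => norm_fst_le h)
      refine Asymptotics.IsBigO.trans_isLittleO ?_ h3
      refine Asymptotics.IsBigO.of_bound C (Eventually.of_forall fun h => ?_)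
      simp only [hχ.zero, zero_smul, sub_zero, zero_apply, norm_smul,
        Function.comp, Prod.fst_add, zero_add]
      rw [mul_comm]
      gcongr
      exact hC _
    · have hv : HasFDerivAt (fun x : ℝ × E => x.1⁻¹ • x.2)
          (s⁻¹ • ContinuousLinearMap.snd ℝ ℝ E +
            ((-(s ^ 2)⁻¹) • ContinuousLinearMap.fst ℝ ℝ E).smulRight u) (s, u) := by
        have h1 : HasFDerivAt (fun x : ℝ × E => x.1⁻¹)
            ((-(s ^ 2)⁻¹) • ContinuousLinearMap.fst ℝ ℝ E) (s, u) :=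
          (hasDerivAt_inv h0).comp_hasFDerivAt (s, u) hasFDerivAt_fst
        exact h1.smul hasFDerivAt_snd
      have hk1 : HasFDerivAt k (fderiv ℝ k (s⁻¹ • u)) (s⁻¹ • u) :=
        ((hk.differentiable (by simp)) _).hasFDerivAt
      have hk2 := hk1.comp (s, u) hv
      have hc : HasFDerivAt (fun x : ℝ × E => χ x.1)
          ((deriv χ s) • ContinuousLinearMap.fst ℝ ℝ E) (s, u) :=
        (hχd s).comp_hasFDerivAt (s, u) hasFDerivAt_fst
      refine (hc.smul hk2).congr_fderiv ?_
      refine ContinuousLinearMap.ext fun w => ?_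
      have e1 : χ s * s⁻¹ = χ₁ s := by rw [hdiv s]; field_simp
      have e2 : χ s * (s ^ 2)⁻¹ = χ₁ s * s⁻¹ := by rw [hdiv s]; field_simp
      simp only [hD, flatDeriv₁, flatDeriv₂, add_apply,
        smul_apply, ContinuousLinearMap.smulRight_apply,
        ContinuousLinearMap.comp_apply, sub_apply,
        ContinuousLinearMap.coe_fst', ContinuousLinearMap.coe_snd', map_add, map_smul, smul_add,
        smul_sub, smul_smul, smul_eq_mul, Function.comp]
      rw [e1]
      have e3 : χ s * (-(s ^ 2)⁻¹ * w.1) = -(χ s * (s ^ 2)⁻¹ * w.1) := by ring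
      have e4 : χ₁ s * (w.1 * s⁻¹) = χ s * (s ^ 2)⁻¹ * w.1 := by rw [e2]; ring
      rw [e3, neg_smul, e4]
      abel
  exact ⟨χ₁, hχ₁, hder⟩

/-- Induction on the order, with `χ` and the target space varying, since the derivative takes values
in linear maps. Compact support passes to the two functions in the derivative, although one of them
has an explicit factor `v`. -/
theorem contDiff_flat_smul {χ : ℝ → ℝ} (hχ : IsFlat χ) {k : E → F} (hk : ContDiff ℝ ∞ k)
    (hkc : HasCompactSupport k) : ContDiff ℝ ∞ (fun x : ℝ × E => χ x.1 • k (x.1⁻¹ • x.2)) := by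
  rw [contDiff_infty]
  intro n
  induction n generalizing F χ with
  | zero =>
    obtain ⟨χ₁, -, hder⟩ := exists_hasFDerivAt_flat_smul hχ hk hkc
    have : Differentiable ℝ (fun x : ℝ × E => χ x.1 • k (x.1⁻¹ • x.2)) := fun x =>
      (hder x).differentiableAt
    exact contDiff_zero.2 this.continuous
  | succ n ih =>
    obtain ⟨χ₁, hχ₁, hder⟩ := exists_hasFDerivAt_flat_smul hχ hk hkc
    push_cast
    rw [contDiff_succ_iff_fderiv]
    refine ⟨fun x => (hder x).differentiableAt, by simp, ?_⟩
    rw [show fderiv ℝ (fun x : ℝ × E => χ x.1 • k (x.1⁻¹ • x.2)) = fun x =>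
        deriv χ x.1 • flatDeriv₁ k (x.1⁻¹ • x.2) + χ₁ x.1 • flatDeriv₂ k (x.1⁻¹ • x.2) from
      funext fun x => (hder x).fderiv]
    have hdk : ContDiff ℝ ∞ (fderiv ℝ k) := hk.fderiv_right (by simp)
    refine ContDiff.add (ih hχ.deriv (k := flatDeriv₁ k) ?_ ?_)
      (ih hχ₁ (k := flatDeriv₂ k) ?_ ?_)
    · exact contDiff_const.smulRight hk
    · exact hkc.comp_left (g := fun y : F => (ContinuousLinearMap.fst ℝ ℝ E).smulRight y)
        (by ext <;> simp)
    · exact (hdk.clm_comp contDiff_const).sub (contDiff_const.smulRight (hdk.clm_apply contDiff_id))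
    · refine HasCompactSupport.of_support_subset_isCompact (hkc.fderiv ℝ) ?_
      intro v hv
      by_contra h
      have : fderiv ℝ k v = 0 := by
        by_contra h2
        exact h (subset_closure h2)
      exact hv (by ext <;> simp [flatDeriv₂, this])

end Flat

/-! ### Smoothness, support and size of the propagators -/

section Profile

/-- The cutoff profile extended by `1` to the negative half-line. -/
noncomputable def extProfile (K : ℝ → ℝ) (a : ℝ) : ℝ := if a < 0 then 1 else K a

variable {K : ℝ → ℝ}

theorem extProfile_of_nonneg {a : ℝ} (ha : 0 ≤ a) : extProfile K a = K a := by
  simp [extProfile, not_lt.2 ha]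

theorem extProfile_eq_one (hK : IsCutoffProfile K) {a : ℝ} (ha : a ≤ 1) : extProfile K a = 1 := by
  unfold extProfile
  split_ifs with h
  · rfl
  · exact hK.eq_one a ⟨not_lt.1 h, ha⟩

theorem extProfile_eq_zero (hK : IsCutoffProfile K) {a : ℝ} (ha : 4 ≤ a) : extProfile K a = 0 := by
  rw [extProfile_of_nonneg (by linarith), hK.eq_zero a ha]

/-- The profile is only assumed smooth on the half-line, but it is constant near its end, so the
constant continues it smoothly. -/
theorem contDiff_extProfile (hK : IsCutoffProfile K) : ContDiff ℝ ∞ (extProfile K) := by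
  rw [contDiff_iff_contDiffAt]
  intro a
  rcases lt_or_ge a 1 with h | h
  · refine (contDiffAt_const (c := (1 : ℝ))).congr_of_eventuallyEq ?_
    filter_upwards [Iio_mem_nhds h] with b hb using extProfile_eq_one hK (le_of_lt hb)
  · refine ((hK.smooth a (by simp; linarith)).contDiffAt (Ici_mem_nhds (by linarith))
      ).congr_of_eventuallyEq ?_
    filter_upwards [Ioi_mem_nhds (show (0 : ℝ) < a by linarith)] with b hb
      using extProfile_of_nonneg (le_of_lt hb)

/-- The cutoff function in the momentum. -/
noncomputable def momProfile (K : ℝ → ℝ) (v : Mom) : ℝ := extProfile K (‖v‖ ^ 2)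

theorem contDiff_momProfile (hK : IsCutoffProfile K) : ContDiff ℝ ∞ (momProfile K) :=
  (contDiff_extProfile hK).comp (contDiff_norm_sq ℝ)

theorem momProfile_eq_zero (hK : IsCutoffProfile K) {v : Mom} (hv : 2 ≤ ‖v‖) :
    momProfile K v = 0 := extProfile_eq_zero hK (by nlinarith)

theorem hasCompactSupport_momProfile (hK : IsCutoffProfile K) :
    HasCompactSupport (momProfile K) := by
  refine HasCompactSupport.intro (isCompact_closedBall (0 : Mom) 2) fun v hv => ?_
  refine momProfile_eq_zero hK ?_
  simp at hv
  exact hv.le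

/-- The propagator in units of the mass, with infrared regulator `χ`. -/
noncomputable def unitProp (K χ : ℝ → ℝ) (s : ℝ) (u : Mom) : ℝ :=
  χ s * momProfile K (s⁻¹ • u) / (‖u‖ ^ 2 + 1)

/-- The scale derivative of the propagator in units of the mass. -/
noncomputable def unitDprop (K χ : ℝ → ℝ) (s : ℝ) (u : Mom) : ℝ :=
  deriv (fun s => unitProp K χ s u) s

theorem contDiff_unitProp (hK : IsCutoffProfile K) {χ : ℝ → ℝ} (hχ : IsFlat χ) :
    ContDiff ℝ ∞ (fun x : ℝ × Mom => unitProp K χ x.1 x.2) := by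
  have h := contDiff_flat_smul hχ (contDiff_momProfile hK) (hasCompactSupport_momProfile hK)
  refine h.div ?_ (fun x => by positivity)
  exact ((contDiff_norm_sq ℝ).comp contDiff_snd).add contDiff_const

theorem contDiff_unitDprop (hK : IsCutoffProfile K) {χ : ℝ → ℝ} (hχ : IsFlat χ) :
    ContDiff ℝ ∞ (fun x : ℝ × Mom => unitDprop K χ x.1 x.2) :=
  contDiff_deriv_param (contDiff_unitProp hK hχ)

theorem unitDprop_eq_zero (hK : IsCutoffProfile K) {χ : ℝ → ℝ} (hχ : IsFlat χ) {s : ℝ} {u : Mom}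
    (h : 2 * |s| < ‖u‖) : unitDprop K χ s u = 0 := by
  have : (fun s => unitProp K χ s u) =ᶠ[𝓝 s] fun _ => 0 := by
    have h1 : ∀ᶠ t in 𝓝 s, 2 * |t| < ‖u‖ :=
      (continuous_const.mul continuous_abs).continuousAt.eventually_lt continuousAt_const h
    filter_upwards [h1] with t ht
    by_cases h0 : t = 0
    · simp [unitProp, h0, hχ.zero]
    · rw [unitProp, momProfile_eq_zero hK]
      · simp
      · rw [norm_smul, norm_inv, Real.norm_eq_abs, inv_mul_eq_div,
          le_div_iff₀ (abs_pos.2 h0)]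
        exact ht.le
  rw [unitDprop, this.deriv_eq]
  simp

/-- The scaling function of the propagator at scales far above the mass. -/
noncomputable def scalingDprop (K : ℝ → ℝ) (τ : ℝ) (v : Mom) : ℝ :=
  -2 * ‖v‖ ^ 2 * deriv (extProfile K) (‖v‖ ^ 2) / (‖v‖ ^ 2 + τ ^ 2)

theorem deriv_extProfile_eq_zero (hK : IsCutoffProfile K) {a : ℝ} (ha : a < 1) :
    deriv (extProfile K) a = 0 := by
  have : extProfile K =ᶠ[𝓝 a] fun _ => 1 := by
    filter_upwards [Iio_mem_nhds ha] with b hb using extProfile_eq_one hK (le_of_lt hb)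
  rw [this.deriv_eq]; simp

theorem deriv_extProfile_eq_zero' (hK : IsCutoffProfile K) {a : ℝ} (ha : 4 < a) :
    deriv (extProfile K) a = 0 := by
  have : extProfile K =ᶠ[𝓝 a] fun _ => 0 := by
    filter_upwards [Ioi_mem_nhds ha] with b hb using extProfile_eq_zero hK (le_of_lt hb)
  rw [this.deriv_eq]; simp

/-- The denominator vanishes at `τ = 0`, `v = 0`, but the numerator is zero for `‖v‖ < 1`.
Smoothness up to `τ = 0` is what makes bounds uniform at large scales. -/
theorem contDiff_scalingDprop (hK : IsCutoffProfile K) :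
    ContDiff ℝ ∞ (fun x : ℝ × Mom => scalingDprop K x.1 x.2) := by
  rw [contDiff_iff_contDiffAt]
  intro x
  by_cases h : x.2 = 0
  · refine (contDiffAt_const (c := (0 : ℝ))).congr_of_eventuallyEq ?_
    have h1 : ∀ᶠ y : ℝ × Mom in 𝓝 x, ‖y.2‖ ^ 2 < 1 := by
      refine ContinuousAt.eventually_lt (by fun_prop) continuousAt_const ?_
      simp [h]
    filter_upwards [h1] with y hy
    rw [scalingDprop, deriv_extProfile_eq_zero hK hy]
    simp
  · have hn : ContDiff ℝ ∞ (fun x : ℝ × Mom => ‖x.2‖ ^ 2) :=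
      (contDiff_norm_sq ℝ).comp contDiff_snd
    have hk : ContDiff ℝ ∞ (fun x : ℝ × Mom => deriv (extProfile K) (‖x.2‖ ^ 2)) :=
      ((contDiff_extProfile hK).deriv').comp hn
    refine ContDiffAt.div ((contDiff_const.mul hn).mul hk).contDiffAt
      (hn.add (contDiff_fst.pow 2)).contDiffAt ?_
    have : 0 < ‖x.2‖ := norm_pos_iff.2 h
    positivity

/-- Once the regulator equals one near `s`, only the cutoff in `u/s` depends on the scale, and the
chain rule gives a function of `v = u/s` and `τ = 1/s`. -/
theorem unitDprop_eq_scaling (hK : IsCutoffProfile K) {χ : ℝ → ℝ} (h1 : ∀ s, 2 ≤ s → χ s = 1)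
    {s : ℝ} (hs : 3 ≤ s) (u : Mom) :
    unitDprop K χ s u = s⁻¹ ^ 3 * scalingDprop K s⁻¹ (s⁻¹ • u) := by
  have h0 : (fun s => unitProp K χ s u) =ᶠ[𝓝 s]
      fun s => extProfile K (s⁻¹ ^ 2 * ‖u‖ ^ 2) / (‖u‖ ^ 2 + 1) := by
    filter_upwards [Ioi_mem_nhds (show (2 : ℝ) < s by linarith)] with t ht
    rw [unitProp, h1 t (le_of_lt ht), one_mul, momProfile, norm_smul, mul_pow, norm_inv,
      Real.norm_eq_abs, inv_pow, sq_abs, inv_pow]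
  have hs0 : s ≠ 0 := by linarith
  have hd : HasDerivAt (fun s : ℝ => s⁻¹ ^ 2 * ‖u‖ ^ 2) (-2 * s⁻¹ ^ 3 * ‖u‖ ^ 2) s := by
    have := ((hasDerivAt_inv hs0).pow 2).mul_const (‖u‖ ^ 2)
    refine this.congr_deriv ?_
    field_simp
    simp
    field_simp
  have hd2 : HasDerivAt (extProfile K) (deriv (extProfile K) (s⁻¹ ^ 2 * ‖u‖ ^ 2))
      (s⁻¹ ^ 2 * ‖u‖ ^ 2) := (((contDiff_extProfile hK).differentiable (by simp)) _).hasDerivAt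
  have hd3 := (hd2.comp s hd).div_const (‖u‖ ^ 2 + 1)
  rw [unitDprop, h0.deriv_eq]
  refine Eq.trans hd3.deriv ?_
  have hnn : ‖s⁻¹ • u‖ ^ 2 = s⁻¹ ^ 2 * ‖u‖ ^ 2 := by
    rw [norm_smul, mul_pow, norm_inv, Real.norm_eq_abs, inv_pow, sq_abs, inv_pow]
  rw [scalingDprop, hnn]
  have : ‖u‖ ^ 2 + 1 ≠ 0 := by positivity
  have h5 : s⁻¹ ^ 2 * ‖u‖ ^ 2 + s⁻¹ ^ 2 = (‖u‖ ^ 2 + 1) / s ^ 2 := by field_simp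
  rw [h5]
  field_simp

/-- Two compactness arguments: scales up to `3` directly, larger ones through the scaling function
with `τ = 1/s` in `[0, 1]`. The radii `6` and `2` are those of the supports. -/
theorem exists_unitDprop_bound (hK : IsCutoffProfile K) {χ : ℝ → ℝ} (hχ : IsFlat χ)
    (h1 : ∀ s, 2 ≤ s → χ s = 1) (z : ℕ) :
    ∃ C, 0 ≤ C ∧ ∀ s, 0 ≤ s → ∀ u,
      ‖iteratedFDeriv ℝ z (unitDprop K χ s) u‖ ≤ C * ((1 + s)⁻¹) ^ (3 + z) := by
  have hvan : ∀ (s : ℝ) (u : Mom), 2 * |s| < ‖u‖ → iteratedFDeriv ℝ z (unitDprop K χ s) u = 0 := by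
    intro s u h
    have : unitDprop K χ s =ᶠ[𝓝 u] fun _ => 0 := by
      filter_upwards [continuousAt_const.eventually_lt continuous_norm.continuousAt h] with v hv
      exact unitDprop_eq_zero hK hχ hv
    rw [(this.iteratedFDeriv ℝ z).eq_of_nhds]
    simp
  have hvan2 : ∀ (τ : ℝ) (u : Mom), 2 < ‖u‖ → iteratedFDeriv ℝ z (scalingDprop K τ) u = 0 := by
    intro s u h
    have : scalingDprop K s =ᶠ[𝓝 u] fun _ => 0 := by
      filter_upwards [continuousAt_const.eventually_lt continuous_norm.continuousAt h] with v hv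
      rw [scalingDprop, deriv_extProfile_eq_zero' hK (by nlinarith)]
      simp
    rw [(this.iteratedFDeriv ℝ z).eq_of_nhds]
    simp
  obtain ⟨B₁, hB₁⟩ := ((isCompact_Icc (a := (0 : ℝ)) (b := 3)).prod
    (isCompact_closedBall (0 : Mom) 6)).exists_bound_of_continuousOn
    (contDiff_iteratedFDeriv_param (contDiff_unitDprop hK hχ) z).continuous.continuousOn
  obtain ⟨B₂, hB₂⟩ := ((isCompact_Icc (a := (0 : ℝ)) (b := 1)).prod
    (isCompact_closedBall (0 : Mom) 2)).exists_bound_of_continuousOn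
    (contDiff_iteratedFDeriv_param (contDiff_scalingDprop hK) z).continuous.continuousOn
  -- The factor `4` bounds `1 + s` for `s ≤ 3`; the factor `2` comes from `s⁻¹ ≤ 2 (1 + s)⁻¹` for
  -- larger `s`.
  refine ⟨max B₁ 0 * 4 ^ (3 + z) + max B₂ 0 * 2 ^ (3 + z), by positivity, fun s hs u => ?_⟩
  rcases le_or_gt s 3 with h3 | h3
  · have hb : ‖iteratedFDeriv ℝ z (unitDprop K χ s) u‖ ≤ max B₁ 0 := by
      by_cases hu : ‖u‖ ≤ 6
      · exact (hB₁ (s, u) ⟨⟨hs, h3⟩, by simpa using hu⟩).trans (le_max_left _ _)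
      · rw [hvan s u (by rw [abs_of_nonneg hs]; linarith [not_le.1 hu]), norm_zero]
        exact le_max_right _ _
    have h4 : 1 ≤ 4 ^ (3 + z) * ((1 + s)⁻¹) ^ (3 + z) := by
      rw [← mul_pow]
      refine one_le_pow₀ ?_
      rw [← div_eq_mul_inv, le_div_iff₀ (by linarith)]
      linarith
    calc _ ≤ max B₁ 0 := hb
      _ ≤ max B₁ 0 * (4 ^ (3 + z) * ((1 + s)⁻¹) ^ (3 + z)) :=
        le_mul_of_one_le_right (le_max_right _ _) h4
      _ ≤ _ := by
        rw [add_mul, mul_assoc, mul_assoc]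
        have : 0 ≤ max B₂ 0 * (2 ^ (3 + z) * ((1 + s)⁻¹) ^ (3 + z)) := by positivity
        linarith
  · have hb : ‖iteratedFDeriv ℝ z (scalingDprop K s⁻¹) (s⁻¹ • u)‖ ≤ max B₂ 0 := by
      by_cases hu : ‖s⁻¹ • u‖ ≤ 2
      · exact (hB₂ (s⁻¹, s⁻¹ • u) ⟨⟨by positivity, inv_le_one_of_one_le₀ (by linarith)⟩,
          by simpa using hu⟩).trans (le_max_left _ _)
      · rw [hvan2 s⁻¹ _ (not_le.1 hu), norm_zero]
        exact le_max_right _ _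
    have hc := contDiff_left_param (contDiff_scalingDprop hK) s⁻¹
    have heq : unitDprop K χ s = fun u => s⁻¹ ^ 3 * scalingDprop K s⁻¹ (s⁻¹ • u) := by
      ext1 u; exact unitDprop_eq_scaling hK h1 h3.le u
    rw [heq, norm_iteratedFDeriv_const_mul_le (f := fun u => scalingDprop K s⁻¹ (s⁻¹ • u))
      (hc.comp (contDiff_const_smul _))]
    have h5 := norm_iteratedFDeriv_comp_smul_le s⁻¹ hc z u
    have hs' : |s⁻¹| = s⁻¹ := abs_of_pos (by positivity)
    rw [hs'] at h5
    rw [abs_pow, hs']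
    have h6 : s⁻¹ ≤ 2 * (1 + s)⁻¹ := by
      rw [← div_eq_mul_inv, le_div_iff₀ (by linarith), inv_mul_le_iff₀ (by linarith)]
      linarith
    calc s⁻¹ ^ 3 * ‖iteratedFDeriv ℝ z (fun y => scalingDprop K s⁻¹ (s⁻¹ • y)) u‖
        ≤ s⁻¹ ^ 3 * (max B₂ 0 * s⁻¹ ^ z) := by gcongr; exact h5.trans (by gcongr)
      _ = max B₂ 0 * s⁻¹ ^ (3 + z) := by ring
      _ ≤ max B₂ 0 * (2 * (1 + s)⁻¹) ^ (3 + z) := by gcongr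
      _ ≤ _ := by
        rw [mul_pow, add_mul, mul_assoc, mul_assoc]
        have : 0 ≤ max B₁ 0 * (4 ^ (3 + z) * ((1 + s)⁻¹) ^ (3 + z)) := by positivity
        linarith

/-- The infrared regulator of the light field in units of the mass. -/
noncomputable def lightReg (K : ℝ → ℝ) (s : ℝ) : ℝ := 1 - extProfile K ((1 + s) ^ 2)

/-- The infrared regulator of the heavy field in units of the mass. -/
noncomputable def heavyReg (K : ℝ → ℝ) (s : ℝ) : ℝ := 1 - extProfile K (s ^ 2)

theorem isFlat_lightReg (hK : IsCutoffProfile K) : IsFlat (lightReg K) := by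
  refine ⟨contDiff_const.sub ((contDiff_extProfile hK).comp (by fun_prop)), 1, one_pos,
    fun s hs => ?_⟩
  rw [lightReg, extProfile_eq_one hK (by nlinarith [hs.1, hs.2]), sub_self]

theorem isFlat_heavyReg (hK : IsCutoffProfile K) : IsFlat (heavyReg K) := by
  refine ⟨contDiff_const.sub ((contDiff_extProfile hK).comp (by fun_prop)), 1, one_pos,
    fun s hs => ?_⟩
  rw [heavyReg, extProfile_eq_one hK (by nlinarith [hs.1, hs.2]), sub_self]

theorem lightReg_eq_one (hK : IsCutoffProfile K) (s : ℝ) (hs : 2 ≤ s) : lightReg K s = 1 := by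
  rw [lightReg, extProfile_eq_zero hK (by nlinarith), sub_zero]

theorem heavyReg_eq_one (hK : IsCutoffProfile K) (s : ℝ) (hs : 2 ≤ s) : heavyReg K s = 1 := by
  rw [heavyReg, extProfile_eq_zero hK (by nlinarith), sub_zero]

theorem momProfile_scaled {m : ℝ} (hm : 0 < m) (s : ℝ) (p : Mom) :
    momProfile K ((s / m)⁻¹ • m⁻¹ • p) = K (‖p‖ ^ 2 / s ^ 2) := by
  rw [momProfile, extProfile_of_nonneg (by positivity)]
  congr 1
  rw [smul_smul, norm_smul, mul_pow, Real.norm_eq_abs, sq_abs]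
  have : (s / m)⁻¹ * m⁻¹ = s⁻¹ := by rw [inv_div]; field_simp
  rw [this]
  ring

theorem norm_scaled {m : ℝ} (hm : 0 < m) (p : Mom) :
    ‖p‖ ^ 2 + m ^ 2 = m ^ 2 * (‖m⁻¹ • p‖ ^ 2 + 1) := by
  rw [norm_smul, mul_pow, Real.norm_eq_abs, sq_abs]
  field_simp

theorem propLight_eq_unitProp {m : ℝ} (hm : 0 < m) (s : ℝ) (p : Mom) :
    propLight K m s p = m⁻¹ ^ 2 * unitProp K (lightReg K) (s / m) (m⁻¹ • p) := by
  rw [propLight, cutoffLight, unitProp, momProfile_scaled hm, lightReg,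
    extProfile_of_nonneg (by positivity), norm_scaled hm]
  field_simp

theorem propHeavy_eq_unitProp {m : ℝ} (hm : 0 < m) (s : ℝ) (p : Mom) :
    propHeavy K m s p = m⁻¹ ^ 2 * unitProp K (heavyReg K) (s / m) (m⁻¹ • p) := by
  rw [propHeavy, cutoffHeavy, unitProp, momProfile_scaled hm, heavyReg,
    extProfile_of_nonneg (by positivity), norm_scaled hm, div_pow]
  field_simp

theorem deriv_scaled_unitProp (hK : IsCutoffProfile K) {χ : ℝ → ℝ} (hχ : IsFlat χ) {m : ℝ}
    (s : ℝ) (p : Mom) :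
    deriv (fun s => m⁻¹ ^ 2 * unitProp K χ (s / m) (m⁻¹ • p)) s =
      m⁻¹ ^ 3 * unitDprop K χ (s / m) (m⁻¹ • p) := by
  have h1 : HasDerivAt (fun s => unitProp K χ s (m⁻¹ • p)) (unitDprop K χ (s / m) (m⁻¹ • p))
    (s / m) := hasDerivAt_right_param (contDiff_unitProp hK hχ) _ _
  have h2 := (h1.comp s ((hasDerivAt_id s).div_const m)).const_mul (m⁻¹ ^ 2)
  refine Eq.trans h2.deriv ?_
  ring

theorem dpropLight_eq_unitDprop (hK : IsCutoffProfile K) {m : ℝ} (hm : 0 < m) (s : ℝ) (p : Mom) :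
    dpropLight K m s p = m⁻¹ ^ 3 * unitDprop K (lightReg K) (s / m) (m⁻¹ • p) := by
  rw [← deriv_scaled_unitProp hK (isFlat_lightReg hK), dpropLight]
  simp_rw [propLight_eq_unitProp hm]

theorem dpropHeavy_eq_unitDprop (hK : IsCutoffProfile K) {m : ℝ} (hm : 0 < m) (s : ℝ) (p : Mom) :
    dpropHeavy K m s p = m⁻¹ ^ 3 * unitDprop K (heavyReg K) (s / m) (m⁻¹ • p) := by
  rw [← deriv_scaled_unitProp hK (isFlat_heavyReg hK), dpropHeavy]
  simp_rw [propHeavy_eq_unitProp hm]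

/-- The properties of the scale derivative of a propagator that do not involve bounds. -/
structure IsLine (d : ℝ → Mom → ℝ) : Prop where
  smooth : ContDiff ℝ ∞ (fun x : ℝ × Mom => d x.1 x.2)
  invariant : ∀ (R : Mom ≃ₗᵢ[ℝ] Mom) Λ p, d Λ (R p) = d Λ p
  support : ∀ Λ p, 2 * |Λ| < ‖p‖ → d Λ p = 0

/-- The scale derivative of a propagator of mass `m`, in physical units. -/
noncomputable def scaledDprop (K χ : ℝ → ℝ) (m s : ℝ) (p : Mom) : ℝ :=
  m⁻¹ ^ 3 * unitDprop K χ (s / m) (m⁻¹ • p)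

theorem contDiff_scaledDprop (hK : IsCutoffProfile K) {χ : ℝ → ℝ} (hχ : IsFlat χ) (m : ℝ) :
    ContDiff ℝ ∞ (fun x : ℝ × Mom => scaledDprop K χ m x.1 x.2) :=
  contDiff_const.mul (contDiff_comp_pair (contDiff_unitDprop hK hχ) (contDiff_fst.div_const m)
    (contDiff_snd.const_smul m⁻¹))

theorem unitDprop_isometry (χ : ℝ → ℝ) (R : Mom ≃ₗᵢ[ℝ] Mom) (s : ℝ) (u : Mom) :
    unitDprop K χ s (R u) = unitDprop K χ s u := by
  unfold unitDprop unitProp momProfile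
  simp only [norm_smul, LinearIsometryEquiv.norm_map]

theorem isLine_of_unit (hK : IsCutoffProfile K) {χ : ℝ → ℝ} (hχ : IsFlat χ) {m : ℝ} (hm : 0 < m) :
    IsLine (scaledDprop K χ m) where
  smooth := contDiff_scaledDprop hK hχ m
  invariant R Λ p := by
    rw [scaledDprop, ← map_smul, unitDprop_isometry, scaledDprop]
  support Λ p h := by
    rw [scaledDprop, unitDprop_eq_zero hK hχ, mul_zero]
    rw [norm_smul, abs_div, abs_of_pos hm, Real.norm_eq_abs, abs_inv, abs_of_pos hm,
      inv_mul_eq_div, ← mul_div_assoc]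
    exact div_lt_div_of_pos_right h hm

theorem isLine_dpropLight (hK : IsCutoffProfile K) {m : ℝ} (hm : 0 < m) :
    IsLine (dpropLight K m) := by
  have : dpropLight K m = scaledDprop K (lightReg K) m := by
    ext s p; exact dpropLight_eq_unitDprop hK hm s p
  rw [this]
  exact isLine_of_unit hK (isFlat_lightReg hK) hm

theorem isLine_dpropHeavy (hK : IsCutoffProfile K) {m : ℝ} (hm : 0 < m) :
    IsLine (dpropHeavy K m) := by
  have : dpropHeavy K m = scaledDprop K (heavyReg K) m := by
    ext s p; exact dpropHeavy_eq_unitDprop hK hm s p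
  rw [this]
  exact isLine_of_unit hK (isFlat_heavyReg hK) hm

theorem exists_scaled_unitDprop_bound (hK : IsCutoffProfile K) {χ : ℝ → ℝ} (hχ : IsFlat χ)
    (h1 : ∀ s, 2 ≤ s → χ s = 1) (z : ℕ) :
    ∃ C, 0 ≤ C ∧ ∀ m Λ, 0 < m → 0 ≤ Λ → ∀ p,
      ‖iteratedFDeriv ℝ z (fun p => m⁻¹ ^ 3 * unitDprop K χ (Λ / m) (m⁻¹ • p)) p‖ ≤
        C * ((Λ + m)⁻¹) ^ (3 + z) := by
  obtain ⟨C, hC, hb⟩ := exists_unitDprop_bound hK hχ h1 z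
  refine ⟨C, hC, fun m Λ hm hΛ p => ?_⟩
  have hc := contDiff_left_param (contDiff_unitDprop hK hχ) (Λ / m)
  have h5 := norm_iteratedFDeriv_comp_smul_le m⁻¹ hc z p
  have hm' : |m⁻¹| = m⁻¹ := abs_of_pos (by positivity)
  rw [norm_iteratedFDeriv_const_mul_le (f := fun p => unitDprop K χ (Λ / m) (m⁻¹ • p))
    (hc.comp (contDiff_const_smul _)), abs_pow, hm']
  rw [hm'] at h5
  have h6 : (Λ + m)⁻¹ = m⁻¹ * (1 + Λ / m)⁻¹ := by
    rw [← mul_inv]; congr 1; field_simp; ring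
  calc m⁻¹ ^ 3 * ‖iteratedFDeriv ℝ z (fun p => unitDprop K χ (Λ / m) (m⁻¹ • p)) p‖
      ≤ m⁻¹ ^ 3 * (C * ((1 + Λ / m)⁻¹) ^ (3 + z) * m⁻¹ ^ z) := by
        gcongr
        refine h5.trans ?_
        gcongr
        exact hb _ (by positivity) _
    _ = C * ((Λ + m)⁻¹) ^ (3 + z) := by rw [h6]; ring

theorem exists_dpropLight_bound (hK : IsCutoffProfile K) (z : ℕ) :
    ∃ C, 0 ≤ C ∧ ∀ m Λ, 0 < m → 0 ≤ Λ → ∀ p,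
      ‖iteratedFDeriv ℝ z (dpropLight K m Λ) p‖ ≤ C * ((Λ + m)⁻¹) ^ (3 + z) := by
  obtain ⟨C, hC, hb⟩ := exists_scaled_unitDprop_bound hK (isFlat_lightReg hK)
    (lightReg_eq_one hK) z
  refine ⟨C, hC, fun m Λ hm hΛ p => ?_⟩
  have := hb m Λ hm hΛ p
  simp_rw [← dpropLight_eq_unitDprop hK hm] at this
  exact this

theorem exists_dpropHeavy_bound (hK : IsCutoffProfile K) (z : ℕ) :
    ∃ C, 0 ≤ C ∧ ∀ m Λ, 0 < m → 0 ≤ Λ → ∀ p,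
      ‖iteratedFDeriv ℝ z (dpropHeavy K m Λ) p‖ ≤ C * ((Λ + m)⁻¹) ^ (3 + z) := by
  obtain ⟨C, hC, hb⟩ := exists_scaled_unitDprop_bound hK (isFlat_heavyReg hK)
    (heavyReg_eq_one hK) z
  refine ⟨C, hC, fun m Λ hm hΛ p => ?_⟩
  have := hb m Λ hm hΛ p
  simp_rw [← dpropHeavy_eq_unitDprop hK hm] at this
  exact this

/-- The whole regulator is zero near `Λ`. Hence heavy lines act only at scales where `Λ + m` and `Λ
+ M` are comparable, which keeps the heavy mass out of the power counting of lines. -/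
theorem dpropHeavy_eq_zero (hK : IsCutoffProfile K) {M Λ : ℝ} (h0 : 0 ≤ Λ) (h : Λ < M) (p : Mom) :
    dpropHeavy K M Λ p = 0 := by
  have : (fun s => propHeavy K M s p) =ᶠ[𝓝 Λ] fun _ => 0 := by
    have h1 : ∀ᶠ s in 𝓝 Λ, |s| < M :=
      continuous_abs.continuousAt.eventually_lt continuousAt_const (by rwa [abs_of_nonneg h0])
    filter_upwards [h1] with s hs
    have hM : 0 < M := h0.trans_lt h
    rw [propHeavy, cutoffHeavy, hK.eq_one (s ^ 2 / M ^ 2)]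
    · simp
    · refine ⟨by positivity, ?_⟩
      rw [div_le_one (by positivity), ← sq_abs]
      exact pow_le_pow_left₀ (abs_nonneg s) hs.le 2
  rw [dpropHeavy, this.deriv_eq]
  simp

end Profile


/-! ### Linear combinations of momenta -/

section Legs

variable {I J : Type} [Fintype I]

/-- Linear combinations of the momenta `k` and of an additional momentum `q`. -/
def IsLeg (φ : (I → Mom) → Mom → Mom) : Prop :=
  ∃ (c : I → ℝ) (d : ℝ), ∀ k q, φ k q = ∑ i, c i • k i + d • q

theorem IsLeg.zero : IsLeg (fun (_ : I → Mom) _ => (0 : Mom)) := ⟨0, 0, by simp⟩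

theorem IsLeg.coord (i : I) : IsLeg (fun (k : I → Mom) _ => k i) := by
  classical
  exact ⟨Pi.single i 1, 0, fun k q => by simp [Pi.single_apply]⟩

theorem IsLeg.extra : IsLeg (fun (_ : I → Mom) q => q) := ⟨0, 1, by simp⟩

theorem IsLeg.add {φ ψ : (I → Mom) → Mom → Mom} (hφ : IsLeg φ) (hψ : IsLeg ψ) :
    IsLeg (fun k q => φ k q + ψ k q) := by
  obtain ⟨c, d, h⟩ := hφ
  obtain ⟨c', d', h'⟩ := hψ
  refine ⟨c + c', d + d', fun k q => ?_⟩
  dsimp only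
  rw [h, h']
  simp only [Pi.add_apply, add_smul, Finset.sum_add_distrib]
  abel

theorem IsLeg.neg {φ : (I → Mom) → Mom → Mom} (hφ : IsLeg φ) : IsLeg (fun k q => -φ k q) := by
  obtain ⟨c, d, h⟩ := hφ
  refine ⟨-c, -d, fun k q => ?_⟩
  dsimp only
  rw [h]
  simp only [Pi.neg_apply, neg_smul, Finset.sum_neg_distrib]
  abel

theorem IsLeg.sum {α : Type} (s : Finset α) {φ : α → (I → Mom) → Mom → Mom}
    (hφ : ∀ a, IsLeg (φ a)) : IsLeg (fun k q => ∑ a ∈ s, φ a k q) := by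
  classical
  induction s using Finset.induction_on with
  | empty => simpa using IsLeg.zero
  | insert a s ha ih =>
    simp only [Finset.sum_insert ha]
    exact (hφ a).add ih

theorem IsLeg.ite (P : Prop) [Decidable P] {φ ψ : (I → Mom) → Mom → Mom} (hφ : IsLeg φ)
    (hψ : IsLeg ψ) : IsLeg (fun k q => if P then φ k q else ψ k q) := by
  split_ifs <;> assumption

/-- Scalar coefficients commute with an isometry applied to every momentum. Smoothness and
equivariance of all assignments of momenta to legs follow from this one linear map. -/
theorem exists_clm_of_isLeg [Fintype J] {φ : J → (I → Mom) → Mom → Mom} (h : ∀ j, IsLeg (φ j)) :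
    ∃ T : (I → Mom) × Mom →L[ℝ] (J → Mom), (∀ k q, T (k, q) = fun j => φ j k q) ∧
      ∀ (R : Mom ≃ₗᵢ[ℝ] Mom) k q, T (fun i => R (k i), R q) = fun j => R (T (k, q) j) := by
  choose c d hcd using h
  refine ⟨ContinuousLinearMap.pi fun j =>
    (∑ i, c j i • (ContinuousLinearMap.proj i).comp (ContinuousLinearMap.fst ℝ (I → Mom) Mom)) +
      d j • ContinuousLinearMap.snd ℝ (I → Mom) Mom, fun k q => ?_, fun R k q => ?_⟩
  · ext1 j
    simp [hcd]
  · ext1 j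
    simp [map_sum]

/-- Families of linear combinations of momenta. -/
def IsLegs (p : (I → Mom) → Mom → ℕ → Mom) : Prop := ∀ j, IsLeg (fun k q => p k q j)

theorem IsLegs.appendPair {p : (I → Mom) → Mom → ℕ → Mom} (hp : IsLegs p) (a : ℕ) :
    IsLegs (fun k q => appendPair a (p k q) q) := fun j => by
  unfold PhiPsi.appendPair
  exact (hp j).ite _ (IsLeg.extra.ite _ IsLeg.extra.neg)

theorem IsLegs.appendOne {p : (I → Mom) → Mom → ℕ → Mom} (hp : IsLegs p) (a : ℕ)
    {φ : (I → Mom) → Mom → Mom} (hφ : IsLeg φ) :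
    IsLegs (fun k q => appendOne a (p k q) (φ k q)) := fun j => by
  unfold PhiPsi.appendOne
  exact (hp j).ite _ hφ

theorem IsLegs.permute {p : (I → Mom) → Mom → ℕ → Mom} (hp : IsLegs p) (a : ℕ)
    (π : Equiv.Perm (Fin a)) : IsLegs (fun k q => permute a π (p k q)) := fun j => by
  unfold PhiPsi.permute
  dsimp only
  split_ifs with h
  · exact hp _
  · exact IsLeg.zero

theorem IsLegs.shift {p : (I → Mom) → Mom → ℕ → Mom} (hp : IsLegs p) (a : ℕ) :
    IsLegs (fun k q j => p k q (a + j)) := fun j => hp (a + j)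

theorem isLegs_allLegs (n₁ n₂ : ℕ) : IsLegs (fun k _ => allLegs n₁ n₂ k) := fun j => by
  unfold allLegs
  dsimp only
  split_ifs with h h'
  · exact IsLeg.coord _
  · exact (IsLeg.sum _ fun i => IsLeg.coord i).neg
  · exact IsLeg.zero

theorem isLegs_lightLegs (n₁ n₂ : ℕ) : IsLegs (fun k _ => lightLegs n₁ n₂ k) :=
  isLegs_allLegs n₁ n₂

theorem isLegs_heavyLegs (n₁ n₂ : ℕ) : IsLegs (fun k _ => heavyLegs n₁ n₂ k) :=
  (isLegs_allLegs n₁ n₂).shift (2 * n₁)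

theorem isLeg_config {n₁ n₂ : ℕ} {p p' : (I → Mom) → Mom → ℕ → Mom} (hp : IsLegs p)
    (hp' : IsLegs p') (j : Fin (2 * n₁ + 2 * n₂ - 1)) :
    IsLeg (fun k q => config n₁ n₂ (p k q) (p' k q) j) :=
  (hp j).ite _ (hp' _)

end Legs

/-! ### Momentum conservation in loops and trees -/

section Conservation

theorem sum_legs {n₁ n₂ : ℕ} (hn : 1 ≤ n₁ + n₂) (k : Config n₁ n₂) :
    ∑ j ∈ Finset.range (2 * n₁), lightLegs n₁ n₂ k j +
      ∑ j ∈ Finset.range (2 * n₂), heavyLegs n₁ n₂ k j = 0 := by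
  have h : 2 * n₁ + 2 * n₂ = 2 * n₁ + 2 * n₂ - 1 + 1 := by omega
  unfold lightLegs heavyLegs
  rw [← Finset.sum_range_add, h, Finset.sum_range_succ, Finset.sum_range]
  simp [allLegs]

/-- `config` drops the last leg and `allLegs` restores it as minus the sum of the others, which is
the dropped momentum because the total is zero. -/
theorem legs_config {n₁ n₂ : ℕ} (hn : 1 ≤ n₁ + n₂) {p p' : ℕ → Mom}
    (h0 : ∑ j ∈ Finset.range (2 * n₁), p j + ∑ j ∈ Finset.range (2 * n₂), p' j = 0) :
    (∀ j < 2 * n₁, lightLegs n₁ n₂ (config n₁ n₂ p p') j = p j) ∧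
      ∀ j < 2 * n₂, heavyLegs n₁ n₂ (config n₁ n₂ p p') j = p' j := by
  set f : ℕ → Mom := fun j => if j < 2 * n₁ then p j else p' (j - 2 * n₁) with hf
  have hN : 2 * n₁ + 2 * n₂ - 1 + 1 = 2 * n₁ + 2 * n₂ := by omega
  have hs : ∑ j ∈ Finset.range (2 * n₁ + 2 * n₂), f j = 0 := by
    rw [Finset.sum_range_add, ← h0]
    congr 1
    · refine Finset.sum_congr rfl fun j hj => ?_
      simp [hf, Finset.mem_range.1 hj]
    · refine Finset.sum_congr rfl fun j hj => ?_
      simp [hf]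
  rw [← hN, Finset.sum_range_succ, Finset.sum_range] at hs
  have hall : ∀ j < 2 * n₁ + 2 * n₂, allLegs n₁ n₂ (config n₁ n₂ p p') j = f j := by
    intro j hj
    unfold allLegs
    split_ifs with h1 h2
    · rfl
    · subst h2
      exact (eq_neg_of_add_eq_zero_right hs).symm
    · omega
  refine ⟨fun j hj => ?_, fun j hj => ?_⟩
  · rw [lightLegs, hall j (by omega)]
    simp [hf, hj]
  · rw [heavyLegs, hall _ (by omega)]
    simp [hf]

/-- Configurations all of whose light legs carry momenta up to `a` and all of whose heavy legs carry
momenta up to `b`, including the dependent leg. -/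
def legBall (a b : ℝ) (n₁ n₂ : ℕ) : Set (Config n₁ n₂) :=
  {k | (∀ j < 2 * n₁, ‖lightLegs n₁ n₂ k j‖ ≤ a) ∧ ∀ j < 2 * n₂, ‖heavyLegs n₁ n₂ k j‖ ≤ b}

theorem config_mem_legBall {n₁ n₂ : ℕ} (hn : 1 ≤ n₁ + n₂) {p p' : ℕ → Mom} {a b : ℝ}
    (h0 : ∑ j ∈ Finset.range (2 * n₁), p j + ∑ j ∈ Finset.range (2 * n₂), p' j = 0)
    (hp : ∀ j < 2 * n₁, ‖p j‖ ≤ a) (hp' : ∀ j < 2 * n₂, ‖p' j‖ ≤ b) :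
    config n₁ n₂ p p' ∈ legBall a b n₁ n₂ :=
  ⟨fun j hj => by rw [(legs_config hn h0).1 j hj]; exact hp j hj,
    fun j hj => by rw [(legs_config hn h0).2 j hj]; exact hp' j hj⟩

theorem sum_appendOne {a b : ℕ} (h : b = a + 1) (p : ℕ → Mom) (q : Mom) :
    ∑ j ∈ Finset.range b, appendOne a p q j = ∑ j ∈ Finset.range a, p j + q := by
  rw [h, Finset.sum_range_succ]
  congr 1
  · exact Finset.sum_congr rfl fun j hj => by simp [appendOne, Finset.mem_range.1 hj]
  · simp [appendOne]

theorem sum_appendPair (a : ℕ) (p : ℕ → Mom) (q : Mom) :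
    ∑ j ∈ Finset.range (a + 2), appendPair a p q j = ∑ j ∈ Finset.range a, p j := by
  rw [Finset.sum_range_succ, Finset.sum_range_succ]
  have : ∑ j ∈ Finset.range a, appendPair a p q j = ∑ j ∈ Finset.range a, p j :=
    Finset.sum_congr rfl fun j hj => by simp [appendPair, Finset.mem_range.1 hj]
  rw [this]
  simp [appendPair]

theorem sum_permute (a : ℕ) (π : Equiv.Perm (Fin a)) (p : ℕ → Mom) :
    ∑ j ∈ Finset.range a, permute a π p j = ∑ j ∈ Finset.range a, p j := by
  rw [Finset.sum_range, Finset.sum_range]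
  simp only [permute, Fin.is_lt, dite_true, Fin.eta]
  exact Equiv.sum_comp π (fun i : Fin a => p i)

theorem norm_permute_le {a : ℕ} (π : Equiv.Perm (Fin a)) {p : ℕ → Mom} {r : ℝ}
    (hp : ∀ j < a, ‖p j‖ ≤ r) : ∀ j < a, ‖permute a π p j‖ ≤ r := fun j hj => by
  simpa [permute, hj] using hp _ (π ⟨j, hj⟩).2

theorem norm_appendOne_le {a : ℕ} {p : ℕ → Mom} {q : Mom} {r : ℝ}
    (hp : ∀ j < a, ‖p j‖ ≤ r) (hq : ‖q‖ ≤ r) (j : ℕ) : ‖appendOne a p q j‖ ≤ r := by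
  unfold appendOne
  split_ifs with h
  · exact hp j h
  · exact hq

theorem norm_appendPair_le {a : ℕ} {p : ℕ → Mom} {q : Mom} {r : ℝ}
    (hp : ∀ j < a, ‖p j‖ ≤ r) (hq : ‖q‖ ≤ r) (j : ℕ) : ‖appendPair a p q j‖ ≤ r := by
  unfold appendPair
  split_ifs with h
  · exact hp j h
  · exact hq
  · rwa [norm_neg]

/-- Maps that insert a pair of opposite momenta. -/
structure IsInsertion {n₁ n₂ l₁ l₂ : ℕ} (T : Config n₁ n₂ × Mom →L[ℝ] Config l₁ l₂) : Prop where
  equivariant : ∀ (R : Mom ≃ₗᵢ[ℝ] Mom) k q, T (fun i => R (k i), R q) = fun j => R (T (k, q) j)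
  mem : ∀ a b, ∀ k ∈ legBall a b n₁ n₂, ∀ q, ‖q‖ ≤ a → ‖q‖ ≤ b → T (k, q) ∈ legBall a b l₁ l₂

theorem exists_insertLight {n₁ n₂ : ℕ} (hn : 1 ≤ n₁ + n₂) :
    ∃ T : Config n₁ n₂ × Mom →L[ℝ] Config (n₁ + 1) n₂, IsInsertion T ∧ ∀ k q, T (k, q) =
      config (n₁ + 1) n₂ (appendPair (2 * n₁) (lightLegs n₁ n₂ k) q) (heavyLegs n₁ n₂ k) := by
  obtain ⟨T, hT, hR⟩ := exists_clm_of_isLeg (isLeg_config (n₁ := n₁ + 1) (n₂ := n₂)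
    ((isLegs_lightLegs n₁ n₂).appendPair (2 * n₁)) (isLegs_heavyLegs n₁ n₂))
  refine ⟨T, ⟨hR, fun a b k hk q hqa hqb => ?_⟩, hT⟩
  rw [hT]
  refine config_mem_legBall (by omega) ?_ (fun j _ => norm_appendPair_le hk.1 hqa j) hk.2
  rw [show 2 * (n₁ + 1) = 2 * n₁ + 2 by ring, sum_appendPair, sum_legs hn]

theorem exists_insertHeavy {n₁ n₂ : ℕ} (hn : 1 ≤ n₁ + n₂) :
    ∃ T : Config n₁ n₂ × Mom →L[ℝ] Config n₁ (n₂ + 1), IsInsertion T ∧ ∀ k q, T (k, q) =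
      config n₁ (n₂ + 1) (lightLegs n₁ n₂ k) (appendPair (2 * n₂) (heavyLegs n₁ n₂ k) q) := by
  obtain ⟨T, hT, hR⟩ := exists_clm_of_isLeg (isLeg_config (n₁ := n₁) (n₂ := n₂ + 1)
    (isLegs_lightLegs n₁ n₂) ((isLegs_heavyLegs n₁ n₂).appendPair (2 * n₂)))
  refine ⟨T, ⟨hR, fun a b k hk q hqa hqb => ?_⟩, hT⟩
  rw [hT]
  refine config_mem_legBall (by omega) ?_ hk.1 (fun j _ => norm_appendPair_le hk.2 hqb j)
  rw [show 2 * (n₂ + 1) = 2 * n₂ + 2 by ring, sum_appendPair, sum_legs hn]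

/-- Maps that distribute momenta over two vertices joined by a line of momentum `φ`. -/
structure IsSplitting {n₁ n₂ l₁ l₂ l₁' l₂' : ℕ} (φ : Config n₁ n₂ →L[ℝ] Mom)
    (A : Config n₁ n₂ →L[ℝ] Config l₁ l₂) (B : Config n₁ n₂ →L[ℝ] Config l₁' l₂') : Prop where
  equivariant_line : ∀ (R : Mom ≃ₗᵢ[ℝ] Mom) k, φ (fun i => R (k i)) = R (φ k)
  equivariant_left : ∀ (R : Mom ≃ₗᵢ[ℝ] Mom) k, A (fun i => R (k i)) = fun j => R (A k j)
  equivariant_right : ∀ (R : Mom ≃ₗᵢ[ℝ] Mom) k, B (fun i => R (k i)) = fun j => R (B k j)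
  mem : ∀ a b, ∀ k ∈ legBall a b n₁ n₂, ‖φ k‖ ≤ a → ‖φ k‖ ≤ b →
    A k ∈ legBall a b l₁ l₂ ∧ B k ∈ legBall a b l₁' l₂'

theorem exists_clm_left_of_isLeg {I J : Type} [Fintype I] [Fintype J]
    {φ : J → (I → Mom) → Mom → Mom} (h : ∀ j, IsLeg (φ j)) :
    ∃ T : (I → Mom) →L[ℝ] (J → Mom), (∀ k, T k = fun j => φ j k 0) ∧
      ∀ (R : Mom ≃ₗᵢ[ℝ] Mom) k, T (fun i => R (k i)) = fun j => R (T k j) := by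
  obtain ⟨T, hT, hR⟩ := exists_clm_of_isLeg h
  refine ⟨T.comp (ContinuousLinearMap.inl ℝ _ _), fun k => by simp [hT], fun R k => ?_⟩
  have := hR R k 0
  rw [map_zero] at this
  exact this

theorem exists_clm_leg {I : Type} [Fintype I] {φ : (I → Mom) → Mom → Mom} (h : IsLeg φ) :
    ∃ T : (I → Mom) →L[ℝ] Mom, (∀ k, T k = φ k 0) ∧
      ∀ (R : Mom ≃ₗᵢ[ℝ] Mom) k, T (fun i => R (k i)) = R (T k) := by
  obtain ⟨T, hT, hR⟩ := exists_clm_left_of_isLeg (J := Unit) (φ := fun _ => φ) fun _ => h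
  refine ⟨(ContinuousLinearMap.proj ()).comp T, fun k => by simp [hT], fun R k => ?_⟩
  exact congrFun (hR R k) ()

/-- The line momentum closes the momentum sum of the first vertex; its negative closes that of the
second, because the total vanishes. Positivity of `l₁` and `l₁'` keeps the subtractions `2 * l₁ - 1`
from being truncated. -/
theorem exists_splitLight {n₁ n₂ l₁ l₂ l₁' l₂' : ℕ} (hn : 1 ≤ n₁ + n₂) (h₁ : l₁ + l₁' = n₁ + 1)
    (h₂ : l₂ + l₂' = n₂) (hl : 0 < l₁) (hl' : 0 < l₁') (π : Equiv.Perm (Fin (2 * n₁)))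
    (σ : Equiv.Perm (Fin (2 * n₂))) :
    ∃ (φ : Config n₁ n₂ →L[ℝ] Mom) (A : Config n₁ n₂ →L[ℝ] Config l₁ l₂)
      (B : Config n₁ n₂ →L[ℝ] Config l₁' l₂'), IsSplitting φ A B ∧ ∀ K m Λ f g k,
      treeLight K m Λ l₁ l₂ l₁' l₂' f g (permute (2 * n₁) π (lightLegs n₁ n₂ k))
        (permute (2 * n₂) σ (heavyLegs n₁ n₂ k)) =
      dpropLight K m Λ (φ k) * f (A k) * g (B k) := by
  have hp := (isLegs_lightLegs n₁ n₂).permute (2 * n₁) π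
  have hp' := (isLegs_heavyLegs n₁ n₂).permute (2 * n₂) σ
  have hP := ((IsLeg.sum (Finset.range (2 * l₁ - 1)) hp).add
    (IsLeg.sum (Finset.range (2 * l₂)) hp')).neg
  obtain ⟨φ, hφ, hφR⟩ := exists_clm_leg hP
  obtain ⟨A, hA, hAR⟩ := exists_clm_left_of_isLeg (isLeg_config (n₁ := l₁) (n₂ := l₂)
    (hp.appendOne (2 * l₁ - 1) hP) hp')
  obtain ⟨B, hB, hBR⟩ := exists_clm_left_of_isLeg (isLeg_config (n₁ := l₁') (n₂ := l₂')
    ((hp.shift (2 * l₁ - 1)).appendOne (2 * l₁' - 1) hP.neg) (hp'.shift (2 * l₂)))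
  refine ⟨φ, A, B, ⟨hφR, hAR, hBR, fun a b k hk ha hb => ?_⟩, fun K m Λ f g k => ?_⟩
  · have hs := sum_legs hn k
    rw [← sum_permute _ π, ← sum_permute _ σ] at hs
    have hb1 := norm_permute_le π hk.1
    have hb2 := norm_permute_le σ hk.2
    rw [hA, hB]
    rw [hφ] at ha hb
    simp only at hs hb1 hb2 ha hb ⊢
    generalize permute (2 * n₁) π (lightLegs n₁ n₂ k) = p at *
    generalize permute (2 * n₂) σ (heavyLegs n₁ n₂ k) = p' at *
    constructor
    · refine config_mem_legBall (by omega) ?_ (fun j _ => norm_appendOne_le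
        (fun i hi => hb1 i (by omega)) ha j) (fun j hj => hb2 j (by omega))
      rw [sum_appendOne (by omega)]
      simp
    · refine config_mem_legBall (by omega) ?_ (fun j _ => norm_appendOne_le
        (fun i hi => hb1 _ (by omega)) (by rwa [norm_neg]) j) (fun j hj => hb2 _ (by omega))
      rw [show 2 * n₁ = (2 * l₁ - 1) + (2 * l₁' - 1) by omega,
        show 2 * n₂ = 2 * l₂ + 2 * l₂' by omega, Finset.sum_range_add, Finset.sum_range_add] at hs
      rw [sum_appendOne (by omega), ← hs]
      abel
  · rw [hA, hB, hφ]
    rfl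

theorem exists_splitHeavy {n₁ n₂ l₁ l₂ l₁' l₂' : ℕ} (hn : 1 ≤ n₁ + n₂) (h₁ : l₁ + l₁' = n₁)
    (h₂ : l₂ + l₂' = n₂ + 1) (hl : 0 < l₂) (hl' : 0 < l₂') (π : Equiv.Perm (Fin (2 * n₁)))
    (σ : Equiv.Perm (Fin (2 * n₂))) :
    ∃ (φ : Config n₁ n₂ →L[ℝ] Mom) (A : Config n₁ n₂ →L[ℝ] Config l₁ l₂)
      (B : Config n₁ n₂ →L[ℝ] Config l₁' l₂'), IsSplitting φ A B ∧ ∀ K m Λ f g k,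
      treeHeavy K m Λ l₁ l₂ l₁' l₂' f g (permute (2 * n₁) π (lightLegs n₁ n₂ k))
        (permute (2 * n₂) σ (heavyLegs n₁ n₂ k)) =
      dpropHeavy K m Λ (φ k) * f (A k) * g (B k) := by
  have hp := (isLegs_lightLegs n₁ n₂).permute (2 * n₁) π
  have hp' := (isLegs_heavyLegs n₁ n₂).permute (2 * n₂) σ
  have hP := ((IsLeg.sum (Finset.range (2 * l₁)) hp).add
    (IsLeg.sum (Finset.range (2 * l₂ - 1)) hp')).neg
  obtain ⟨φ, hφ, hφR⟩ := exists_clm_leg hP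
  obtain ⟨A, hA, hAR⟩ := exists_clm_left_of_isLeg (isLeg_config (n₁ := l₁) (n₂ := l₂)
    hp (hp'.appendOne (2 * l₂ - 1) hP))
  obtain ⟨B, hB, hBR⟩ := exists_clm_left_of_isLeg (isLeg_config (n₁ := l₁') (n₂ := l₂')
    (hp.shift (2 * l₁)) ((hp'.shift (2 * l₂ - 1)).appendOne (2 * l₂' - 1) hP.neg))
  refine ⟨φ, A, B, ⟨hφR, hAR, hBR, fun a b k hk ha hb => ?_⟩, fun K m Λ f g k => ?_⟩
  · have hs := sum_legs hn k
    rw [← sum_permute _ π, ← sum_permute _ σ] at hs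
    have hb1 := norm_permute_le π hk.1
    have hb2 := norm_permute_le σ hk.2
    rw [hA, hB]
    rw [hφ] at ha hb
    simp only at hs hb1 hb2 ha hb ⊢
    generalize permute (2 * n₁) π (lightLegs n₁ n₂ k) = p at *
    generalize permute (2 * n₂) σ (heavyLegs n₁ n₂ k) = p' at *
    constructor
    · refine config_mem_legBall (by omega) ?_ (fun j hj => hb1 j (by omega))
        (fun j _ => norm_appendOne_le (fun i hi => hb2 i (by omega)) hb j)
      rw [sum_appendOne (by omega)]
      simp
    · refine config_mem_legBall (by omega) ?_ (fun j hj => hb1 _ (by omega))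
        (fun j _ => norm_appendOne_le (fun i hi => hb2 _ (by omega)) (by rwa [norm_neg]) j)
      rw [show 2 * n₂ = (2 * l₂ - 1) + (2 * l₂' - 1) by omega,
        show 2 * n₁ = 2 * l₁ + 2 * l₁' by omega, Finset.sum_range_add, Finset.sum_range_add] at hs
      rw [sum_appendOne (by omega), ← hs]
      abel
  · rw [hA, hB, hφ]
    rfl

end Conservation


/-! ### Loops and trees as operations: smoothness, invariance, derivative in the cutoff -/

section Operations

/-- Joint smoothness in the two scales and the momenta. -/
def IsSmooth {X : Type} [NormedAddCommGroup X] [NormedSpace ℝ X] (f : ℝ → ℝ → X → ℝ) : Prop :=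
  ContDiff ℝ ∞ (fun x : ℝ × ℝ × X => f x.1 x.2.1 x.2.2)

/-- Invariance under isometries acting on all momenta. -/
def IsInvariant {I : Type} (f : (I → Mom) → ℝ) : Prop :=
  ∀ (R : Mom ≃ₗᵢ[ℝ] Mom) k, f (fun i => R (k i)) = f k

/-- The derivative with respect to the first scale. -/
noncomputable def dot {X : Type} (f : ℝ → ℝ → X → ℝ) (Λ₀ Λ : ℝ) (k : X) : ℝ :=
  deriv (fun s => f s Λ k) Λ₀

section Smooth

variable {X : Type} [NormedAddCommGroup X] [NormedSpace ℝ X] {f : ℝ → ℝ → X → ℝ}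

theorem IsSmooth.comp {Y : Type} [NormedAddCommGroup Y] [NormedSpace ℝ Y] (hf : IsSmooth f)
    {a b : Y → ℝ} {c : Y → X} (ha : ContDiff ℝ ∞ a) (hb : ContDiff ℝ ∞ b) (hc : ContDiff ℝ ∞ c) :
    ContDiff ℝ ∞ (fun y => f (a y) (b y) (c y)) :=
  ContDiff.comp (g := fun x : ℝ × ℝ × X => f x.1 x.2.1 x.2.2) hf (ha.prodMk (hb.prodMk hc))

theorem IsSmooth.snd_param (hf : IsSmooth f) (Λ₀ : ℝ) :
    ContDiff ℝ ∞ (fun x : ℝ × X => f Λ₀ x.1 x.2) :=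
  hf.comp contDiff_const contDiff_fst contDiff_snd

theorem IsSmooth.fst_param (hf : IsSmooth f) (Λ : ℝ) :
    ContDiff ℝ ∞ (fun x : ℝ × X => f x.1 Λ x.2) :=
  hf.comp contDiff_fst contDiff_const contDiff_snd

theorem IsSmooth.mom (hf : IsSmooth f) (Λ₀ Λ : ℝ) : ContDiff ℝ ∞ (f Λ₀ Λ) :=
  hf.comp contDiff_const contDiff_const contDiff_id

theorem IsSmooth.dot (hf : IsSmooth f) : IsSmooth (dot f) := by
  have h : ContDiff ℝ ∞ (fun x : ℝ × ℝ × X => f x.1 x.2.1 x.2.2) := hf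
  exact contDiff_deriv_param (h := fun (s : ℝ) (x : ℝ × X) => f s x.1 x.2) h

theorem IsSmooth.hasDerivAt_dot (hf : IsSmooth f) (Λ₀ Λ : ℝ) (k : X) :
    HasDerivAt (fun s => f s Λ k) (PhiPsi.dot f Λ₀ Λ k) Λ₀ :=
  hasDerivAt_right_param (h := fun s k => f s Λ k) (hf.fst_param Λ) k Λ₀

end Smooth

variable {n₁ n₂ l₁ l₂ l₁' l₂' : ℕ} {d : ℝ → Mom → ℝ}

/-- The support of the line makes a loop an integral over a compact ball. The radius is left free so
that one ball can serve nearby scales. -/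
theorem IsLine.integral_eq (hd : IsLine d) {Λ r : ℝ} (hr : 2 * |Λ| ≤ r) (f : Mom → ℝ) :
    ∫ q, d Λ q * f q = ∫ q in Metric.closedBall (0 : Mom) r, d Λ q * f q := by
  symm
  refine setIntegral_eq_integral_of_forall_compl_eq_zero fun q hq => ?_
  rw [hd.support Λ q, zero_mul]
  simp at hq
  linarith

theorem IsSmooth.loop_integrand (hd : IsLine d) (T : Config n₁ n₂ × Mom →L[ℝ] Config l₁ l₂)
    {f : ℝ → ℝ → Config l₁ l₂ → ℝ} (hf : IsSmooth f) :
    ContDiff ℝ ∞ (fun x : (ℝ × ℝ × Config n₁ n₂) × Mom =>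
      d x.1.2.1 x.2 * f x.1.1 x.1.2.1 (T (x.1.2.2, x.2))) :=
  (contDiff_comp_pair hd.smooth contDiff_fst.snd.fst contDiff_snd).mul
    (hf.comp contDiff_fst.fst contDiff_fst.snd.fst
      (T.contDiff.comp (contDiff_fst.snd.snd.prodMk contDiff_snd)))

theorem IsSmooth.loop (hd : IsLine d) (T : Config n₁ n₂ × Mom →L[ℝ] Config l₁ l₂)
    {f : ℝ → ℝ → Config l₁ l₂ → ℝ} (hf : IsSmooth f) :
    IsSmooth (fun Λ₀ Λ k => ∫ q, d Λ q * f Λ₀ Λ (T (k, q))) := by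
  refine contDiff_iff_contDiffAt.2 fun x₀ => ?_
  -- A ball with a margin contains the support for all scales near the given one, so the domain of
  -- integration can be kept fixed.
  have h1 : ∀ᶠ x : ℝ × ℝ × Config n₁ n₂ in 𝓝 x₀, 2 * |x.2.1| < 2 * |x₀.2.1| + 1 :=
    ContinuousAt.eventually_lt (by fun_prop) continuousAt_const (by linarith)
  have h2 := contDiff_setIntegral_param (μ := (volume : Measure Mom))
    (g := fun (x : ℝ × ℝ × Config n₁ n₂) q => d x.2.1 q * f x.1 x.2.1 (T (x.2.2, q)))
    (isCompact_closedBall (0 : Mom) (2 * |x₀.2.1| + 1)) (hf.loop_integrand hd T)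
  refine h2.contDiffAt.congr_of_eventuallyEq ?_
  filter_upwards [h1] with x hx
  exact hd.integral_eq hx.le fun q => f x.1 x.2.1 (T (x.2.2, q))

/-- Rotating the external momenta is undone by rotating the integration variable, which preserves
both the measure and the line. -/
theorem IsInvariant.loop (hd : IsLine d) {T : Config n₁ n₂ × Mom →L[ℝ] Config l₁ l₂}
    (hT : IsInsertion T) {f : Config l₁ l₂ → ℝ} (hf : IsInvariant f) (Λ : ℝ) :
    IsInvariant (fun k => ∫ q, d Λ q * f (T (k, q))) := by
  intro R k
  have h := R.measurePreserving.integral_comp R.toHomeomorph.measurableEmbedding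
    (fun q => d Λ q * f (T ((fun i => R (k i)), q)))
  dsimp only
  rw [← h]
  refine integral_congr_ae (Eventually.of_forall fun q => ?_)
  dsimp only
  rw [hd.invariant, hT.equivariant, hf]

theorem hasDerivAt_loop (hd : IsLine d) (T : Config n₁ n₂ × Mom →L[ℝ] Config l₁ l₂)
    {f : ℝ → ℝ → Config l₁ l₂ → ℝ} (hf : IsSmooth f) (Λ₀ Λ : ℝ) (k : Config n₁ n₂) :
    HasDerivAt (fun s => ∫ q, d Λ q * f s Λ (T (k, q)))
      (∫ q, d Λ q * dot f Λ₀ Λ (T (k, q))) Λ₀ := by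
  have h := hasDerivAt_setIntegral_param (μ := (volume : Measure Mom))
    (g := fun s q => d Λ q * f s Λ (T (k, q))) (isCompact_closedBall (0 : Mom) (2 * |Λ|))
    ((hf.loop_integrand hd T).comp ((contDiff_fst.prodMk (contDiff_const.prodMk
      contDiff_const)).prodMk contDiff_snd)) Λ₀
  rw [hd.integral_eq le_rfl (fun q => dot f Λ₀ Λ (T (k, q)))]
  have h2 : ∀ q, deriv (fun s => d Λ q * f s Λ (T (k, q))) Λ₀ = d Λ q * dot f Λ₀ Λ (T (k, q)) :=
    fun q => ((hf.hasDerivAt_dot Λ₀ Λ (T (k, q))).const_mul (d Λ q)).deriv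
  simp_rw [h2] at h
  refine h.congr_of_eventuallyEq (Eventually.of_forall fun s => ?_)
  exact hd.integral_eq le_rfl fun q => f s Λ (T (k, q))

theorem IsSmooth.tree (hd : IsLine d) (φ : Config n₁ n₂ →L[ℝ] Mom)
    (A : Config n₁ n₂ →L[ℝ] Config l₁ l₂) (B : Config n₁ n₂ →L[ℝ] Config l₁' l₂')
    {f : ℝ → ℝ → Config l₁ l₂ → ℝ} {g : ℝ → ℝ → Config l₁' l₂' → ℝ}
    (hf : IsSmooth f) (hg : IsSmooth g) :
    IsSmooth (fun Λ₀ Λ k => d Λ (φ k) * f Λ₀ Λ (A k) * g Λ₀ Λ (B k)) :=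
  ((contDiff_comp_pair hd.smooth contDiff_snd.fst (φ.contDiff.comp contDiff_snd.snd)).mul
    (hf.comp contDiff_fst contDiff_snd.fst (A.contDiff.comp contDiff_snd.snd))).mul
    (hg.comp contDiff_fst contDiff_snd.fst (B.contDiff.comp contDiff_snd.snd))

theorem IsInvariant.tree (hd : IsLine d) {φ : Config n₁ n₂ →L[ℝ] Mom}
    {A : Config n₁ n₂ →L[ℝ] Config l₁ l₂} {B : Config n₁ n₂ →L[ℝ] Config l₁' l₂'}
    (h : IsSplitting φ A B) {f : Config l₁ l₂ → ℝ} {g : Config l₁' l₂' → ℝ}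
    (hf : IsInvariant f) (hg : IsInvariant g) (Λ : ℝ) :
    IsInvariant (fun k => d Λ (φ k) * f (A k) * g (B k)) := by
  intro R k
  dsimp only
  rw [h.equivariant_line, h.equivariant_left, h.equivariant_right, hd.invariant, hf, hg]

theorem hasDerivAt_tree (φ : Config n₁ n₂ →L[ℝ] Mom)
    (A : Config n₁ n₂ →L[ℝ] Config l₁ l₂) (B : Config n₁ n₂ →L[ℝ] Config l₁' l₂')
    {f : ℝ → ℝ → Config l₁ l₂ → ℝ} {g : ℝ → ℝ → Config l₁' l₂' → ℝ}
    (hf : IsSmooth f) (hg : IsSmooth g) (Λ₀ Λ : ℝ) (k : Config n₁ n₂) :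
    HasDerivAt (fun s => d Λ (φ k) * f s Λ (A k) * g s Λ (B k))
      (d Λ (φ k) * dot f Λ₀ Λ (A k) * g Λ₀ Λ (B k) +
        d Λ (φ k) * f Λ₀ Λ (A k) * dot g Λ₀ Λ (B k)) Λ₀ :=
  (((hf.hasDerivAt_dot Λ₀ Λ (A k)).const_mul (d Λ (φ k))).mul (hg.hasDerivAt_dot Λ₀ Λ (B k)))

end Operations

/-! ### The terms of the flow equation as loops and finite sums of trees -/

section Terms

variable {K : ℝ → ℝ}

/-- The integral of the light loop. -/
noncomputable def loopLight (K : ℝ → ℝ) (m Λ : ℝ) (n₁ n₂ : ℕ) (f : Config (n₁ + 1) n₂ → ℝ)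
    (k : Config n₁ n₂) : ℝ :=
  ∫ q : Mom, dpropLight K m Λ q *
    f (config (n₁ + 1) n₂ (appendPair (2 * n₁) (lightLegs n₁ n₂ k) q) (heavyLegs n₁ n₂ k))

/-- The integral of the heavy loop. -/
noncomputable def loopHeavy (K : ℝ → ℝ) (M Λ : ℝ) (n₁ n₂ : ℕ) (f : Config n₁ (n₂ + 1) → ℝ)
    (k : Config n₁ n₂) : ℝ :=
  ∫ q : Mom, dpropHeavy K M Λ q *
    f (config n₁ (n₂ + 1) (lightLegs n₁ n₂ k) (appendPair (2 * n₂) (heavyLegs n₁ n₂ k) q))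

/-- The symmetrized light tree as a function of the independent momenta. -/
noncomputable def symmTreeLight (K : ℝ → ℝ) (m Λ : ℝ) (n₁ n₂ l₁ l₂ l₁' l₂' : ℕ)
    (f : Config l₁ l₂ → ℝ) (g : Config l₁' l₂' → ℝ) (k : Config n₁ n₂) : ℝ :=
  symm (2 * n₁) (2 * n₂) (treeLight K m Λ l₁ l₂ l₁' l₂' f g) (lightLegs n₁ n₂ k)
    (heavyLegs n₁ n₂ k)

/-- The symmetrized heavy tree as a function of the independent momenta. -/
noncomputable def symmTreeHeavy (K : ℝ → ℝ) (M Λ : ℝ) (n₁ n₂ l₁ l₂ l₁' l₂' : ℕ)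
    (f : Config l₁ l₂ → ℝ) (g : Config l₁' l₂' → ℝ) (k : Config n₁ n₂) : ℝ :=
  symm (2 * n₁) (2 * n₂) (treeHeavy K M Λ l₁ l₂ l₁' l₂' f g) (lightLegs n₁ n₂ k)
    (heavyLegs n₁ n₂ k)

theorem flowRHS_eq (K : ℝ → ℝ) (m M : ℝ) (L : VertexFamily) (r : Fin 3 → ℕ) (n₁ n₂ : ℕ) (Λ : ℝ)
    (k : Config n₁ n₂) : flowRHS K m M L r n₁ n₂ Λ k =
  -((2 * n₁ + 2).choose 2 : ℝ) *
      (loopLight K m Λ n₁ n₂ (L r (n₁ + 1) n₂ Λ) k / (2 * Real.pi) ^ 4)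
  + 2 * ∑ s ∈ Finset.Iic r, ∑ l ∈ Finset.HasAntidiagonal.antidiagonal (n₁ + 1),
      ∑ h ∈ Finset.HasAntidiagonal.antidiagonal n₂, (l.1 : ℝ) * (l.2 : ℝ) *
        symmTreeLight K m Λ n₁ n₂ l.1 h.1 l.2 h.2 (L s l.1 h.1 Λ) (L (r - s) l.2 h.2 Λ) k
  - ((2 * n₂ + 2).choose 2 : ℝ) *
      (loopHeavy K M Λ n₁ n₂ (L r n₁ (n₂ + 1) Λ) k / (2 * Real.pi) ^ 4)
  + 2 * ∑ s ∈ Finset.Iic r, ∑ l ∈ Finset.HasAntidiagonal.antidiagonal n₁,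
      ∑ h ∈ Finset.HasAntidiagonal.antidiagonal (n₂ + 1), (h.1 : ℝ) * (h.2 : ℝ) *
        symmTreeHeavy K M Λ n₁ n₂ l.1 h.1 l.2 h.2 (L s l.1 h.1 Λ) (L (r - s) l.2 h.2 Λ) k :=
  rfl

variable {n₁ n₂ l₁ l₂ l₁' l₂' : ℕ}

/-- There is one splitting for each pair of permutations. The linear maps do not depend on the
profile, the mass, the scale or the vertices, so constants derived from them are uniform in all
these. -/
theorem exists_symmTreeLight (hn : 1 ≤ n₁ + n₂) (h₁ : l₁ + l₁' = n₁ + 1) (h₂ : l₂ + l₂' = n₂)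
    (hl : 0 < l₁) (hl' : 0 < l₁') : ∃ (ι : Type) (_ : Fintype ι) (c : ℝ)
    (φ : ι → Config n₁ n₂ →L[ℝ] Mom) (A : ι → Config n₁ n₂ →L[ℝ] Config l₁ l₂)
    (B : ι → Config n₁ n₂ →L[ℝ] Config l₁' l₂'), (∀ i, IsSplitting (φ i) (A i) (B i)) ∧
      ∀ K m Λ f g k, symmTreeLight K m Λ n₁ n₂ l₁ l₂ l₁' l₂' f g k =
        c * ∑ i, dpropLight K m Λ (φ i k) * f (A i k) * g (B i k) := by
  choose φ A B hs he using fun x : Equiv.Perm (Fin (2 * n₁)) × Equiv.Perm (Fin (2 * n₂)) =>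
    exists_splitLight hn h₁ h₂ hl hl' x.1 x.2
  refine ⟨_, inferInstance, (((2 * n₁).factorial : ℝ) * ((2 * n₂).factorial : ℝ))⁻¹, φ, A, B, hs,
    fun K m Λ f g k => ?_⟩
  rw [symmTreeLight, symm, div_eq_inv_mul, Fintype.sum_prod_type]
  congr 1
  exact Finset.sum_congr rfl fun π _ => Finset.sum_congr rfl fun σ _ => he (π, σ) K m Λ f g k

theorem exists_symmTreeHeavy (hn : 1 ≤ n₁ + n₂) (h₁ : l₁ + l₁' = n₁) (h₂ : l₂ + l₂' = n₂ + 1)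
    (hl : 0 < l₂) (hl' : 0 < l₂') : ∃ (ι : Type) (_ : Fintype ι) (c : ℝ)
    (φ : ι → Config n₁ n₂ →L[ℝ] Mom) (A : ι → Config n₁ n₂ →L[ℝ] Config l₁ l₂)
    (B : ι → Config n₁ n₂ →L[ℝ] Config l₁' l₂'), (∀ i, IsSplitting (φ i) (A i) (B i)) ∧
      ∀ K m Λ f g k, symmTreeHeavy K m Λ n₁ n₂ l₁ l₂ l₁' l₂' f g k =
        c * ∑ i, dpropHeavy K m Λ (φ i k) * f (A i k) * g (B i k) := by
  choose φ A B hs he using fun x : Equiv.Perm (Fin (2 * n₁)) × Equiv.Perm (Fin (2 * n₂)) =>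
    exists_splitHeavy hn h₁ h₂ hl hl' x.1 x.2
  refine ⟨_, inferInstance, (((2 * n₁).factorial : ℝ) * ((2 * n₂).factorial : ℝ))⁻¹, φ, A, B, hs,
    fun K m Λ f g k => ?_⟩
  rw [symmTreeHeavy, symm, div_eq_inv_mul, Fintype.sum_prod_type]
  congr 1
  exact Finset.sum_congr rfl fun π _ => Finset.sum_congr rfl fun σ _ => he (π, σ) K m Λ f g k

end Terms


/-! ### Properties of the individual terms -/

section TermProperties

variable {K : ℝ → ℝ} {m M : ℝ} {n₁ n₂ l₁ l₂ l₁' l₂' : ℕ}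

theorem IsSmooth.loopLight (hK : IsCutoffProfile K) (hm : 0 < m) (hn : 1 ≤ n₁ + n₂)
    {f : ℝ → ℝ → Config (n₁ + 1) n₂ → ℝ} (hf : IsSmooth f) :
    IsSmooth (fun Λ₀ Λ k => loopLight K m Λ n₁ n₂ (f Λ₀ Λ) k) := by
  obtain ⟨T, -, hT⟩ := exists_insertLight hn
  simp_rw [PhiPsi.loopLight, ← hT]
  exact hf.loop (isLine_dpropLight hK hm) T

theorem IsSmooth.loopHeavy (hK : IsCutoffProfile K) (hM : 0 < M) (hn : 1 ≤ n₁ + n₂)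
    {f : ℝ → ℝ → Config n₁ (n₂ + 1) → ℝ} (hf : IsSmooth f) :
    IsSmooth (fun Λ₀ Λ k => loopHeavy K M Λ n₁ n₂ (f Λ₀ Λ) k) := by
  obtain ⟨T, -, hT⟩ := exists_insertHeavy hn
  simp_rw [PhiPsi.loopHeavy, ← hT]
  exact hf.loop (isLine_dpropHeavy hK hM) T

theorem IsInvariant.loopLight (hK : IsCutoffProfile K) (hm : 0 < m) (hn : 1 ≤ n₁ + n₂)
    {f : Config (n₁ + 1) n₂ → ℝ} (hf : IsInvariant f) (Λ : ℝ) :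
    IsInvariant (loopLight K m Λ n₁ n₂ f) := by
  obtain ⟨T, hT', hT⟩ := exists_insertLight hn
  have := hf.loop (isLine_dpropLight hK hm) hT' Λ
  simp_rw [hT] at this
  exact this

theorem IsInvariant.loopHeavy (hK : IsCutoffProfile K) (hM : 0 < M) (hn : 1 ≤ n₁ + n₂)
    {f : Config n₁ (n₂ + 1) → ℝ} (hf : IsInvariant f) (Λ : ℝ) :
    IsInvariant (loopHeavy K M Λ n₁ n₂ f) := by
  obtain ⟨T, hT', hT⟩ := exists_insertHeavy hn
  have := hf.loop (isLine_dpropHeavy hK hM) hT' Λ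
  simp_rw [hT] at this
  exact this

theorem hasDerivAt_loopLight (hK : IsCutoffProfile K) (hm : 0 < m) (hn : 1 ≤ n₁ + n₂)
    {f : ℝ → ℝ → Config (n₁ + 1) n₂ → ℝ} (hf : IsSmooth f) (Λ₀ Λ : ℝ) (k : Config n₁ n₂) :
    HasDerivAt (fun s => loopLight K m Λ n₁ n₂ (f s Λ) k)
      (loopLight K m Λ n₁ n₂ (dot f Λ₀ Λ) k) Λ₀ := by
  obtain ⟨T, -, hT⟩ := exists_insertLight hn
  simp_rw [PhiPsi.loopLight, ← hT]
  exact hasDerivAt_loop (isLine_dpropLight hK hm) T hf Λ₀ Λ k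

theorem hasDerivAt_loopHeavy (hK : IsCutoffProfile K) (hM : 0 < M) (hn : 1 ≤ n₁ + n₂)
    {f : ℝ → ℝ → Config n₁ (n₂ + 1) → ℝ} (hf : IsSmooth f) (Λ₀ Λ : ℝ) (k : Config n₁ n₂) :
    HasDerivAt (fun s => loopHeavy K M Λ n₁ n₂ (f s Λ) k)
      (loopHeavy K M Λ n₁ n₂ (dot f Λ₀ Λ) k) Λ₀ := by
  obtain ⟨T, -, hT⟩ := exists_insertHeavy hn
  simp_rw [PhiPsi.loopHeavy, ← hT]
  exact hasDerivAt_loop (isLine_dpropHeavy hK hM) T hf Λ₀ Λ k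

theorem IsSmooth.const_mul {X : Type} [NormedAddCommGroup X] [NormedSpace ℝ X]
    {f : ℝ → ℝ → X → ℝ} (hf : IsSmooth f) (c : ℝ) : IsSmooth (fun Λ₀ Λ k => c * f Λ₀ Λ k) :=
  contDiff_const.mul hf

theorem IsSmooth.sum {X α : Type} [NormedAddCommGroup X] [NormedSpace ℝ X] {s : Finset α}
    {f : α → ℝ → ℝ → X → ℝ} (hf : ∀ a ∈ s, IsSmooth (f a)) :
    IsSmooth (fun Λ₀ Λ k => ∑ a ∈ s, f a Λ₀ Λ k) :=
  ContDiff.sum (f := fun a (x : ℝ × ℝ × X) => f a x.1 x.2.1 x.2.2) hf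

theorem isSmooth_zero {X : Type} [NormedAddCommGroup X] [NormedSpace ℝ X] :
    IsSmooth (fun _ _ (_ : X) => 0) := contDiff_const

/-- The weight `l₁ l₁'` removes the terms in which a line would end on a vertex without light legs;
for all others a splitting exists and both vertices are nonempty. -/
theorem IsSmooth.weighted_symmTreeLight (hK : IsCutoffProfile K) (hm : 0 < m) (hn : 1 ≤ n₁ + n₂)
    (h₁ : l₁ + l₁' = n₁ + 1) (h₂ : l₂ + l₂' = n₂)
    {f : ℝ → ℝ → Config l₁ l₂ → ℝ} {g : ℝ → ℝ → Config l₁' l₂' → ℝ}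
    (hf : 1 ≤ l₁ + l₂ → IsSmooth f) (hg : 1 ≤ l₁' + l₂' → IsSmooth g) :
    IsSmooth (fun Λ₀ Λ (k : Config n₁ n₂) => (l₁ : ℝ) * (l₁' : ℝ) *
      symmTreeLight K m Λ n₁ n₂ l₁ l₂ l₁' l₂' (f Λ₀ Λ) (g Λ₀ Λ) k) := by
  rcases Nat.eq_zero_or_pos l₁ with h | hl
  · simp only [h, Nat.cast_zero, zero_mul]; exact isSmooth_zero
  rcases Nat.eq_zero_or_pos l₁' with h | hl'
  · simp only [h, Nat.cast_zero, zero_mul, mul_zero]; exact isSmooth_zero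
  obtain ⟨ι, _, c, φ, A, B, -, he⟩ := exists_symmTreeLight hn h₁ h₂ hl hl'
  simp_rw [he]
  exact (((IsSmooth.sum fun i _ => IsSmooth.tree (isLine_dpropLight hK hm) (φ i) (A i) (B i)
    (hf (by omega)) (hg (by omega))).const_mul c).const_mul _)

theorem IsSmooth.weighted_symmTreeHeavy (hK : IsCutoffProfile K) (hM : 0 < M) (hn : 1 ≤ n₁ + n₂)
    (h₁ : l₁ + l₁' = n₁) (h₂ : l₂ + l₂' = n₂ + 1)
    {f : ℝ → ℝ → Config l₁ l₂ → ℝ} {g : ℝ → ℝ → Config l₁' l₂' → ℝ}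
    (hf : 1 ≤ l₁ + l₂ → IsSmooth f) (hg : 1 ≤ l₁' + l₂' → IsSmooth g) :
    IsSmooth (fun Λ₀ Λ (k : Config n₁ n₂) => (l₂ : ℝ) * (l₂' : ℝ) *
      symmTreeHeavy K M Λ n₁ n₂ l₁ l₂ l₁' l₂' (f Λ₀ Λ) (g Λ₀ Λ) k) := by
  rcases Nat.eq_zero_or_pos l₂ with h | hl
  · simp only [h, Nat.cast_zero, zero_mul]; exact isSmooth_zero
  rcases Nat.eq_zero_or_pos l₂' with h | hl'
  · simp only [h, Nat.cast_zero, zero_mul, mul_zero]; exact isSmooth_zero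
  obtain ⟨ι, _, c, φ, A, B, -, he⟩ := exists_symmTreeHeavy hn h₁ h₂ hl hl'
  simp_rw [he]
  exact (((IsSmooth.sum fun i _ => IsSmooth.tree (isLine_dpropHeavy hK hM) (φ i) (A i) (B i)
    (hf (by omega)) (hg (by omega))).const_mul c).const_mul _)

theorem IsInvariant.const_mul {I : Type} {f : (I → Mom) → ℝ} (hf : IsInvariant f) (c : ℝ) :
    IsInvariant (fun k => c * f k) := fun R k => by dsimp only; rw [hf]

theorem IsInvariant.add {I : Type} {f g : (I → Mom) → ℝ} (hf : IsInvariant f)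
    (hg : IsInvariant g) : IsInvariant (fun k => f k + g k) := fun R k => by
  dsimp only; rw [hf, hg]

theorem IsInvariant.sum {I α : Type} {s : Finset α} {f : α → (I → Mom) → ℝ}
    (hf : ∀ a ∈ s, IsInvariant (f a)) : IsInvariant (fun k => ∑ a ∈ s, f a k) := fun R k =>
  Finset.sum_congr rfl fun a ha => hf a ha R k

theorem isInvariant_const {I : Type} (c : ℝ) : IsInvariant (fun _ : I → Mom => c) :=
  fun _ _ => rfl

theorem IsInvariant.weighted_symmTreeLight (hK : IsCutoffProfile K) (hm : 0 < m)
    (hn : 1 ≤ n₁ + n₂) (h₁ : l₁ + l₁' = n₁ + 1) (h₂ : l₂ + l₂' = n₂)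
    {f : Config l₁ l₂ → ℝ} {g : Config l₁' l₂' → ℝ}
    (hf : 1 ≤ l₁ + l₂ → IsInvariant f) (hg : 1 ≤ l₁' + l₂' → IsInvariant g) (Λ : ℝ) :
    IsInvariant (fun k : Config n₁ n₂ => (l₁ : ℝ) * (l₁' : ℝ) *
      symmTreeLight K m Λ n₁ n₂ l₁ l₂ l₁' l₂' f g k) := by
  rcases Nat.eq_zero_or_pos l₁ with h | hl
  · simp only [h, Nat.cast_zero, zero_mul]; exact isInvariant_const 0
  rcases Nat.eq_zero_or_pos l₁' with h | hl'
  · simp only [h, Nat.cast_zero, zero_mul, mul_zero]; exact isInvariant_const 0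
  obtain ⟨ι, _, c, φ, A, B, hs, he⟩ := exists_symmTreeLight hn h₁ h₂ hl hl'
  simp_rw [he]
  exact (((IsInvariant.sum fun i _ => IsInvariant.tree (isLine_dpropLight hK hm) (hs i)
    (hf (by omega)) (hg (by omega)) Λ).const_mul c).const_mul _)

theorem IsInvariant.weighted_symmTreeHeavy (hK : IsCutoffProfile K) (hM : 0 < M)
    (hn : 1 ≤ n₁ + n₂) (h₁ : l₁ + l₁' = n₁) (h₂ : l₂ + l₂' = n₂ + 1)
    {f : Config l₁ l₂ → ℝ} {g : Config l₁' l₂' → ℝ}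
    (hf : 1 ≤ l₁ + l₂ → IsInvariant f) (hg : 1 ≤ l₁' + l₂' → IsInvariant g) (Λ : ℝ) :
    IsInvariant (fun k : Config n₁ n₂ => (l₂ : ℝ) * (l₂' : ℝ) *
      symmTreeHeavy K M Λ n₁ n₂ l₁ l₂ l₁' l₂' f g k) := by
  rcases Nat.eq_zero_or_pos l₂ with h | hl
  · simp only [h, Nat.cast_zero, zero_mul]; exact isInvariant_const 0
  rcases Nat.eq_zero_or_pos l₂' with h | hl'
  · simp only [h, Nat.cast_zero, zero_mul, mul_zero]; exact isInvariant_const 0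
  obtain ⟨ι, _, c, φ, A, B, hs, he⟩ := exists_symmTreeHeavy hn h₁ h₂ hl hl'
  simp_rw [he]
  exact (((IsInvariant.sum fun i _ => IsInvariant.tree (isLine_dpropHeavy hK hM) (hs i)
    (hf (by omega)) (hg (by omega)) Λ).const_mul c).const_mul _)

theorem hasDerivAt_weighted_symmTreeLight (hn : 1 ≤ n₁ + n₂)
    (h₁ : l₁ + l₁' = n₁ + 1) (h₂ : l₂ + l₂' = n₂)
    {f : ℝ → ℝ → Config l₁ l₂ → ℝ} {g : ℝ → ℝ → Config l₁' l₂' → ℝ}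
    (hf : 1 ≤ l₁ + l₂ → IsSmooth f) (hg : 1 ≤ l₁' + l₂' → IsSmooth g)
    (Λ₀ Λ : ℝ) (k : Config n₁ n₂) :
    HasDerivAt (fun s => (l₁ : ℝ) * (l₁' : ℝ) *
        symmTreeLight K m Λ n₁ n₂ l₁ l₂ l₁' l₂' (f s Λ) (g s Λ) k)
      ((l₁ : ℝ) * (l₁' : ℝ) *
        (symmTreeLight K m Λ n₁ n₂ l₁ l₂ l₁' l₂' (dot f Λ₀ Λ) (g Λ₀ Λ) k +
          symmTreeLight K m Λ n₁ n₂ l₁ l₂ l₁' l₂' (f Λ₀ Λ) (dot g Λ₀ Λ) k)) Λ₀ := by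
  rcases Nat.eq_zero_or_pos l₁ with h | hl
  · simp only [h, Nat.cast_zero, zero_mul]; exact hasDerivAt_const _ _
  rcases Nat.eq_zero_or_pos l₁' with h | hl'
  · simp only [h, Nat.cast_zero, zero_mul, mul_zero]; exact hasDerivAt_const _ _
  obtain ⟨ι, _, c, φ, A, B, -, he⟩ := exists_symmTreeLight hn h₁ h₂ hl hl'
  simp_rw [he, ← mul_add, ← Finset.sum_add_distrib]
  exact ((HasDerivAt.fun_sum fun i _ => hasDerivAt_tree (φ i) (A i) (B i)
    (hf (by omega)) (hg (by omega)) Λ₀ Λ k).const_mul c).const_mul _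

theorem hasDerivAt_weighted_symmTreeHeavy (hn : 1 ≤ n₁ + n₂)
    (h₁ : l₁ + l₁' = n₁) (h₂ : l₂ + l₂' = n₂ + 1)
    {f : ℝ → ℝ → Config l₁ l₂ → ℝ} {g : ℝ → ℝ → Config l₁' l₂' → ℝ}
    (hf : 1 ≤ l₁ + l₂ → IsSmooth f) (hg : 1 ≤ l₁' + l₂' → IsSmooth g)
    (Λ₀ Λ : ℝ) (k : Config n₁ n₂) :
    HasDerivAt (fun s => (l₂ : ℝ) * (l₂' : ℝ) *
        symmTreeHeavy K M Λ n₁ n₂ l₁ l₂ l₁' l₂' (f s Λ) (g s Λ) k)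
      ((l₂ : ℝ) * (l₂' : ℝ) *
        (symmTreeHeavy K M Λ n₁ n₂ l₁ l₂ l₁' l₂' (dot f Λ₀ Λ) (g Λ₀ Λ) k +
          symmTreeHeavy K M Λ n₁ n₂ l₁ l₂ l₁' l₂' (f Λ₀ Λ) (dot g Λ₀ Λ) k)) Λ₀ := by
  rcases Nat.eq_zero_or_pos l₂ with h | hl
  · simp only [h, Nat.cast_zero, zero_mul]; exact hasDerivAt_const _ _
  rcases Nat.eq_zero_or_pos l₂' with h | hl'
  · simp only [h, Nat.cast_zero, zero_mul, mul_zero]; exact hasDerivAt_const _ _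
  obtain ⟨ι, _, c, φ, A, B, -, he⟩ := exists_symmTreeHeavy hn h₁ h₂ hl hl'
  simp_rw [he, ← mul_add, ← Finset.sum_add_distrib]
  exact ((HasDerivAt.fun_sum fun i _ => hasDerivAt_tree (φ i) (A i) (B i)
    (hf (by omega)) (hg (by omega)) Λ₀ Λ k).const_mul c).const_mul _

theorem symmTreeLight_zero_left {f : Config l₁ l₂ → ℝ} (hf : ∀ k, f k = 0)
    (g : Config l₁' l₂' → ℝ) (Λ : ℝ) (k : Config n₁ n₂) :
    symmTreeLight K m Λ n₁ n₂ l₁ l₂ l₁' l₂' f g k = 0 := by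
  simp [symmTreeLight, symm, treeLight, hf]

theorem symmTreeLight_zero_right (f : Config l₁ l₂ → ℝ) {g : Config l₁' l₂' → ℝ}
    (hg : ∀ k, g k = 0) (Λ : ℝ) (k : Config n₁ n₂) :
    symmTreeLight K m Λ n₁ n₂ l₁ l₂ l₁' l₂' f g k = 0 := by
  simp [symmTreeLight, symm, treeLight, hg]

theorem symmTreeHeavy_zero_left {f : Config l₁ l₂ → ℝ} (hf : ∀ k, f k = 0)
    (g : Config l₁' l₂' → ℝ) (Λ : ℝ) (k : Config n₁ n₂) :
    symmTreeHeavy K M Λ n₁ n₂ l₁ l₂ l₁' l₂' f g k = 0 := by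
  simp [symmTreeHeavy, symm, treeHeavy, hf]

theorem symmTreeHeavy_zero_right (f : Config l₁ l₂ → ℝ) {g : Config l₁' l₂' → ℝ}
    (hg : ∀ k, g k = 0) (Λ : ℝ) (k : Config n₁ n₂) :
    symmTreeHeavy K M Λ n₁ n₂ l₁ l₂ l₁' l₂' f g k = 0 := by
  simp [symmTreeHeavy, symm, treeHeavy, hg]

end TermProperties

/-! ### The flow equation as a triangular system -/

section Flow

variable {K : ℝ → ℝ} {m M : ℝ}

/-- The light trees whose first vertices are taken from `L` and whose second ones from `D`. -/
noncomputable def treesLight (K : ℝ → ℝ) (m : ℝ) (L D : VertexFamily) (r : Fin 3 → ℕ) (n₁ n₂ : ℕ)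
    (Λ : ℝ) (k : Config n₁ n₂) : ℝ :=
  ∑ s ∈ Finset.Iic r, ∑ l ∈ Finset.HasAntidiagonal.antidiagonal (n₁ + 1),
    ∑ h ∈ Finset.HasAntidiagonal.antidiagonal n₂, (l.1 : ℝ) * (l.2 : ℝ) *
      symmTreeLight K m Λ n₁ n₂ l.1 h.1 l.2 h.2 (L s l.1 h.1 Λ) (D (r - s) l.2 h.2 Λ) k

/-- The heavy trees whose first vertices are taken from `L` and whose second ones from `D`. -/
noncomputable def treesHeavy (K : ℝ → ℝ) (M : ℝ) (L D : VertexFamily) (r : Fin 3 → ℕ) (n₁ n₂ : ℕ)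
    (Λ : ℝ) (k : Config n₁ n₂) : ℝ :=
  ∑ s ∈ Finset.Iic r, ∑ l ∈ Finset.HasAntidiagonal.antidiagonal n₁,
    ∑ h ∈ Finset.HasAntidiagonal.antidiagonal (n₂ + 1), (h.1 : ℝ) * (h.2 : ℝ) *
      symmTreeHeavy K M Λ n₁ n₂ l.1 h.1 l.2 h.2 (L s l.1 h.1 Λ) (D (r - s) l.2 h.2 Λ) k

/-- The coefficient of a loop in which a pair of legs is joined to a vertex with `2 n` such legs. -/
noncomputable def loopCoeff (n : ℕ) : ℝ := -((2 * n + 2).choose 2 : ℝ) / (2 * Real.pi) ^ 4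

theorem flowRHS_eq_trees (K : ℝ → ℝ) (m M : ℝ) (L : VertexFamily) (r : Fin 3 → ℕ) (n₁ n₂ : ℕ)
    (Λ : ℝ) (k : Config n₁ n₂) :
    flowRHS K m M L r n₁ n₂ Λ k =
      loopCoeff n₁ * loopLight K m Λ n₁ n₂ (L r (n₁ + 1) n₂ Λ) k
        + 2 * treesLight K m L L r n₁ n₂ Λ k
        + loopCoeff n₂ * loopHeavy K M Λ n₁ n₂ (L r n₁ (n₂ + 1) Λ) k
        + 2 * treesHeavy K M L L r n₁ n₂ Λ k := by
  rw [flowRHS_eq, treesLight, treesHeavy, loopCoeff, loopCoeff]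
  ring

/-- The derivative of the right-hand side of the flow equation at `L` in the direction `D`. -/
noncomputable def linRHS (K : ℝ → ℝ) (m M : ℝ) (L D : VertexFamily) (r : Fin 3 → ℕ) (n₁ n₂ : ℕ)
    (Λ : ℝ) (k : Config n₁ n₂) : ℝ :=
  loopCoeff n₁ * loopLight K m Λ n₁ n₂ (D r (n₁ + 1) n₂ Λ) k
    + 2 * (treesLight K m D L r n₁ n₂ Λ k + treesLight K m L D r n₁ n₂ Λ k)
    + loopCoeff n₂ * loopHeavy K M Λ n₁ n₂ (D r n₁ (n₂ + 1) Λ) k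
    + 2 * (treesHeavy K M D L r n₁ n₂ Λ k + treesHeavy K M L D r n₁ n₂ Λ k)

/-- All vertex functions of a family that depends on the ultraviolet cutoff are smooth. -/
def IsSmoothFamily (L : ℝ → VertexFamily) : Prop :=
  ∀ r n₁ n₂, 1 ≤ n₁ + n₂ → IsSmooth (fun Λ₀ Λ k => L Λ₀ r n₁ n₂ Λ k)

/-- The derivative of a family of vertex functions with respect to the ultraviolet cutoff. -/
noncomputable def dotFamily (L : ℝ → VertexFamily) (Λ₀ : ℝ) : VertexFamily :=
  fun r n₁ n₂ Λ k => dot (fun Λ₀ Λ k => L Λ₀ r n₁ n₂ Λ k) Λ₀ Λ k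

theorem IsSmoothFamily.dotFamily {L : ℝ → VertexFamily} (hL : IsSmoothFamily L) :
    IsSmoothFamily (dotFamily L) := fun r n₁ n₂ hn => (hL r n₁ n₂ hn).dot

theorem IsSmoothFamily.treesLight (hK : IsCutoffProfile K) (hm : 0 < m)
    {L D : ℝ → VertexFamily} (hL : IsSmoothFamily L) (hD : IsSmoothFamily D)
    (r : Fin 3 → ℕ) {n₁ n₂ : ℕ} (hn : 1 ≤ n₁ + n₂) :
    IsSmooth (fun Λ₀ Λ k => treesLight K m (L Λ₀) (D Λ₀) r n₁ n₂ Λ k) := by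
  unfold PhiPsi.treesLight
  refine IsSmooth.sum fun s _ => IsSmooth.sum fun l hl => IsSmooth.sum fun h hh => ?_
  exact IsSmooth.weighted_symmTreeLight (f := fun Λ₀ Λ => L Λ₀ s l.1 h.1 Λ)
    (g := fun Λ₀ Λ => D Λ₀ (r - s) l.2 h.2 Λ) hK hm hn
    (Finset.HasAntidiagonal.mem_antidiagonal.1 hl) (Finset.HasAntidiagonal.mem_antidiagonal.1 hh)
    (hL _ _ _) (hD _ _ _)

theorem IsSmoothFamily.treesHeavy (hK : IsCutoffProfile K) (hM : 0 < M)
    {L D : ℝ → VertexFamily} (hL : IsSmoothFamily L) (hD : IsSmoothFamily D)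
    (r : Fin 3 → ℕ) {n₁ n₂ : ℕ} (hn : 1 ≤ n₁ + n₂) :
    IsSmooth (fun Λ₀ Λ k => treesHeavy K M (L Λ₀) (D Λ₀) r n₁ n₂ Λ k) := by
  unfold PhiPsi.treesHeavy
  refine IsSmooth.sum fun s _ => IsSmooth.sum fun l hl => IsSmooth.sum fun h hh => ?_
  exact IsSmooth.weighted_symmTreeHeavy (f := fun Λ₀ Λ => L Λ₀ s l.1 h.1 Λ)
    (g := fun Λ₀ Λ => D Λ₀ (r - s) l.2 h.2 Λ) hK hM hn
    (Finset.HasAntidiagonal.mem_antidiagonal.1 hl) (Finset.HasAntidiagonal.mem_antidiagonal.1 hh)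
    (hL _ _ _) (hD _ _ _)

theorem hasDerivAt_treesLight {L : ℝ → VertexFamily} (hL : IsSmoothFamily L)
    (r : Fin 3 → ℕ) {n₁ n₂ : ℕ} (hn : 1 ≤ n₁ + n₂) (Λ₀ Λ : ℝ) (k : Config n₁ n₂) :
    HasDerivAt (fun s => treesLight K m (L s) (L s) r n₁ n₂ Λ k)
      (treesLight K m (dotFamily L Λ₀) (L Λ₀) r n₁ n₂ Λ k +
        treesLight K m (L Λ₀) (dotFamily L Λ₀) r n₁ n₂ Λ k) Λ₀ := by
  unfold treesLight
  simp_rw [← Finset.sum_add_distrib, ← mul_add]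
  refine HasDerivAt.fun_sum fun s _ => HasDerivAt.fun_sum fun l hl =>
    HasDerivAt.fun_sum fun h hh => ?_
  exact hasDerivAt_weighted_symmTreeLight (f := fun Λ₀ Λ => L Λ₀ s l.1 h.1 Λ)
    (g := fun Λ₀ Λ => L Λ₀ (r - s) l.2 h.2 Λ) hn
    (Finset.HasAntidiagonal.mem_antidiagonal.1 hl) (Finset.HasAntidiagonal.mem_antidiagonal.1 hh)
    (hL _ _ _) (hL _ _ _) Λ₀ Λ k

theorem hasDerivAt_treesHeavy {L : ℝ → VertexFamily} (hL : IsSmoothFamily L)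
    (r : Fin 3 → ℕ) {n₁ n₂ : ℕ} (hn : 1 ≤ n₁ + n₂) (Λ₀ Λ : ℝ) (k : Config n₁ n₂) :
    HasDerivAt (fun s => treesHeavy K M (L s) (L s) r n₁ n₂ Λ k)
      (treesHeavy K M (dotFamily L Λ₀) (L Λ₀) r n₁ n₂ Λ k +
        treesHeavy K M (L Λ₀) (dotFamily L Λ₀) r n₁ n₂ Λ k) Λ₀ := by
  unfold treesHeavy
  simp_rw [← Finset.sum_add_distrib, ← mul_add]
  refine HasDerivAt.fun_sum fun s _ => HasDerivAt.fun_sum fun l hl =>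
    HasDerivAt.fun_sum fun h hh => ?_
  exact hasDerivAt_weighted_symmTreeHeavy (f := fun Λ₀ Λ => L Λ₀ s l.1 h.1 Λ)
    (g := fun Λ₀ Λ => L Λ₀ (r - s) l.2 h.2 Λ) hn
    (Finset.HasAntidiagonal.mem_antidiagonal.1 hl) (Finset.HasAntidiagonal.mem_antidiagonal.1 hh)
    (hL _ _ _) (hL _ _ _) Λ₀ Λ k

theorem IsSmooth.add {X : Type} [NormedAddCommGroup X] [NormedSpace ℝ X]
    {f g : ℝ → ℝ → X → ℝ} (hf : IsSmooth f) (hg : IsSmooth g) :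
    IsSmooth (fun Λ₀ Λ k => f Λ₀ Λ k + g Λ₀ Λ k) := ContDiff.add hf hg

theorem IsSmoothFamily.flowRHS (hK : IsCutoffProfile K) (hm : 0 < m) (hM : 0 < M)
    {L : ℝ → VertexFamily} (hL : IsSmoothFamily L)
    (r : Fin 3 → ℕ) {n₁ n₂ : ℕ} (hn : 1 ≤ n₁ + n₂) :
    IsSmooth (fun Λ₀ Λ k => flowRHS K m M (L Λ₀) r n₁ n₂ Λ k) := by
  simp_rw [flowRHS_eq_trees]
  have h1 := (IsSmooth.loopLight hK hm hn (hL r (n₁ + 1) n₂ (by omega))).const_mul (loopCoeff n₁)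
  have h2 := (IsSmooth.loopHeavy hK hM hn (hL r n₁ (n₂ + 1) (by omega))).const_mul (loopCoeff n₂)
  exact ((h1.add ((hL.treesLight hK hm hL r hn).const_mul 2)).add h2).add
    ((hL.treesHeavy hK hM hL r hn).const_mul 2)

theorem IsInvariant.flowRHS (hK : IsCutoffProfile K) (hm : 0 < m) (hM : 0 < M)
    {L : VertexFamily} {Λ : ℝ} (hL : ∀ r n₁ n₂, 1 ≤ n₁ + n₂ → IsInvariant (L r n₁ n₂ Λ))
    (r : Fin 3 → ℕ) {n₁ n₂ : ℕ} (hn : 1 ≤ n₁ + n₂) :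
    IsInvariant (flowRHS K m M L r n₁ n₂ Λ) := by
  have h1 := (IsInvariant.loopLight hK hm hn (hL r (n₁ + 1) n₂ (by omega)) Λ).const_mul
    (loopCoeff n₁)
  have h2 := (IsInvariant.loopHeavy hK hM hn (hL r n₁ (n₂ + 1) (by omega)) Λ).const_mul
    (loopCoeff n₂)
  have h3 : IsInvariant (treesLight K m L L r n₁ n₂ Λ) := by
    refine IsInvariant.sum fun s _ => IsInvariant.sum fun l hl => IsInvariant.sum fun h hh => ?_
    exact IsInvariant.weighted_symmTreeLight (f := L s l.1 h.1 Λ) (g := L (r - s) l.2 h.2 Λ) hK hm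
      hn (Finset.HasAntidiagonal.mem_antidiagonal.1 hl)
      (Finset.HasAntidiagonal.mem_antidiagonal.1 hh) (hL _ _ _) (hL _ _ _) Λ
  have h4 : IsInvariant (treesHeavy K M L L r n₁ n₂ Λ) := by
    refine IsInvariant.sum fun s _ => IsInvariant.sum fun l hl => IsInvariant.sum fun h hh => ?_
    exact IsInvariant.weighted_symmTreeHeavy (f := L s l.1 h.1 Λ) (g := L (r - s) l.2 h.2 Λ) hK hM
      hn (Finset.HasAntidiagonal.mem_antidiagonal.1 hl)
      (Finset.HasAntidiagonal.mem_antidiagonal.1 hh) (hL _ _ _) (hL _ _ _) Λ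
  have h5 := ((h1.add (h3.const_mul 2)).add h2).add (h4.const_mul 2)
  intro R k
  have := h5 R k
  rw [flowRHS_eq_trees, flowRHS_eq_trees]
  exact this

theorem hasDerivAt_flowRHS (hK : IsCutoffProfile K) (hm : 0 < m) (hM : 0 < M)
    {L : ℝ → VertexFamily} (hL : IsSmoothFamily L)
    (r : Fin 3 → ℕ) {n₁ n₂ : ℕ} (hn : 1 ≤ n₁ + n₂) (Λ₀ Λ : ℝ) (k : Config n₁ n₂) :
    HasDerivAt (fun s => flowRHS K m M (L s) r n₁ n₂ Λ k)
      (linRHS K m M (L Λ₀) (dotFamily L Λ₀) r n₁ n₂ Λ k) Λ₀ := by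
  simp_rw [flowRHS_eq_trees, linRHS]
  have h1 := (hasDerivAt_loopLight hK hm hn (hL r (n₁ + 1) n₂ (by omega)) Λ₀ Λ k).const_mul
    (loopCoeff n₁)
  have h2 := (hasDerivAt_loopHeavy hK hM hn (hL r n₁ (n₂ + 1) (by omega)) Λ₀ Λ k).const_mul
    (loopCoeff n₂)
  exact ((h1.add ((hasDerivAt_treesLight hL r hn Λ₀ Λ k).const_mul 2)).add h2).add
    ((hasDerivAt_treesHeavy hL r hn Λ₀ Λ k).const_mul 2)

/-- At the scale `Λ` the family has no terms of order zero and no disconnected terms. -/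
structure IsConnectedAt (L : VertexFamily) (Λ : ℝ) : Prop where
  zero : ∀ n₁ n₂, 1 ≤ n₁ + n₂ → ∀ k, L 0 n₁ n₂ Λ k = 0
  connected : ∀ r n₁ n₂, (∑ i, r i) + 1 < n₁ + n₂ → ∀ k, L r n₁ n₂ Λ k = 0

/-- The rank of a vertex function in the induction that solves the flow equation. -/
def rank (r : Fin 3 → ℕ) (n₁ n₂ : ℕ) : ℕ :=
  (∑ i, r i) * ((∑ i, r i) + 3) + ((∑ i, r i) + 1 - (n₁ + n₂))

/-- At order `a` the second summand of `rank` is at most `a + 1`, and `a (a + 3) + a + 1 < (a + 1)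
(a + 4)`. -/
theorem rank_lt_of_sum_lt {r s : Fin 3 → ℕ} (h : ∑ i, s i < ∑ i, r i) (n₁ n₂ n₁' n₂' : ℕ) :
    rank s n₁' n₂' < rank r n₁ n₂ := by
  unfold rank
  generalize ∑ i, s i = a at *
  generalize ∑ i, r i = b at *
  have h1 : a + 1 - (n₁' + n₂') ≤ a + 1 := Nat.sub_le _ _
  nlinarith

/-- The subtraction in `rank` is truncated; the bound on the number of legs ensures that it still
decreases. -/
theorem rank_lt_of_legs {r : Fin 3 → ℕ} {n₁ n₂ n₁' n₂' : ℕ} (h : n₁ + n₂ ≤ ∑ i, r i)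
    (h' : n₁ + n₂ < n₁' + n₂') : rank r n₁' n₂' < rank r n₁ n₂ := by
  unfold rank
  omega

theorem sum_lt_of_le_of_ne {r s : Fin 3 → ℕ} (h : s ≤ r) (hne : s ≠ r) :
    ∑ i, s i < ∑ i, r i := by
  refine Finset.sum_lt_sum (fun i _ => h i) ?_
  by_contra hc
  push Not at hc
  exact hne (le_antisymm h fun i => hc i (Finset.mem_univ i))

theorem sum_sub_lt {r s : Fin 3 → ℕ} (h : s ≤ r) (hne : s ≠ 0) :
    ∑ i, (r - s) i < ∑ i, r i := by
  refine sum_lt_of_le_of_ne (fun i => Nat.sub_le _ _) fun he => hne ?_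
  ext i
  have h1 := congrFun he i
  have h2 : s i ≤ r i := h i
  simp only [Pi.sub_apply, Pi.zero_apply] at h1 ⊢
  omega

theorem sum_add_sum_sub {r s : Fin 3 → ℕ} (h : s ≤ r) :
    ∑ i, s i + ∑ i, (r - s) i = ∑ i, r i := by
  rw [← Finset.sum_add_distrib]
  refine Finset.sum_congr rfl fun i _ => ?_
  have h2 : s i ≤ r i := h i
  simp only [Pi.sub_apply]
  omega

/-- Triangularity. A tree with a factor of order zero vanishes, so both factors may be taken of
lower order than `r`. A loop vertex has one more pair of legs: either its rank is smaller or it is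
zero by connectedness. -/
theorem flowRHS_congr {L L' : VertexFamily} {Λ : ℝ} (hL : IsConnectedAt L Λ)
    (hL' : IsConnectedAt L' Λ) {r : Fin 3 → ℕ} {n₁ n₂ : ℕ} (hn : 1 ≤ n₁ + n₂)
    (h : ∀ s l₁ l₂, 1 ≤ l₁ + l₂ → rank s l₁ l₂ < rank r n₁ n₂ → ∀ k,
      L s l₁ l₂ Λ k = L' s l₁ l₂ Λ k) (k : Config n₁ n₂) :
    flowRHS K m M L r n₁ n₂ Λ k = flowRHS K m M L' r n₁ n₂ Λ k := by
  have hloop : ∀ l₁ l₂, l₁ + l₂ = n₁ + n₂ + 1 → L r l₁ l₂ Λ = L' r l₁ l₂ Λ := by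
    intro l₁ l₂ hl
    ext1 k
    by_cases h1 : n₁ + n₂ ≤ ∑ i, r i
    · exact h r l₁ l₂ (by omega) (rank_lt_of_legs h1 (by omega)) k
    · rw [hL.connected r l₁ l₂ (by omega), hL'.connected r l₁ l₂ (by omega)]
  have hlow : ∀ s l₁ l₂, 1 ≤ l₁ + l₂ → ∑ i, s i < ∑ i, r i → L s l₁ l₂ Λ = L' s l₁ l₂ Λ :=
    fun s l₁ l₂ hl hs => funext fun k => h s l₁ l₂ hl (rank_lt_of_sum_lt hs _ _ _ _) k
  have e3 : treesLight K m L L r n₁ n₂ Λ k = treesLight K m L' L' r n₁ n₂ Λ k := by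
    refine Finset.sum_congr rfl fun s hs => Finset.sum_congr rfl fun l hl =>
      Finset.sum_congr rfl fun h hh => ?_
    rw [Finset.mem_Iic] at hs
    rcases Nat.eq_zero_or_pos l.1 with h0 | hl1
    · simp [h0]
    rcases Nat.eq_zero_or_pos l.2 with h0 | hl2
    · simp [h0]
    congr 1
    by_cases hs0 : s = 0
    · subst hs0
      rw [symmTreeLight_zero_left (hL.zero _ _ (by omega)),
        symmTreeLight_zero_left (hL'.zero _ _ (by omega))]
    by_cases hsr : s = r
    · subst hsr
      rw [tsub_self, symmTreeLight_zero_right _ (hL.zero _ _ (by omega)),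
        symmTreeLight_zero_right _ (hL'.zero _ _ (by omega))]
    rw [hlow s _ _ (by omega) (sum_lt_of_le_of_ne hs hsr),
      hlow (r - s) _ _ (by omega) (sum_sub_lt hs hs0)]
  have e4 : treesHeavy K M L L r n₁ n₂ Λ k = treesHeavy K M L' L' r n₁ n₂ Λ k := by
    refine Finset.sum_congr rfl fun s hs => Finset.sum_congr rfl fun l hl =>
      Finset.sum_congr rfl fun h hh => ?_
    rw [Finset.mem_Iic] at hs
    rcases Nat.eq_zero_or_pos h.1 with h0 | hl1
    · simp [h0]
    rcases Nat.eq_zero_or_pos h.2 with h0 | hl2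
    · simp [h0]
    congr 1
    by_cases hs0 : s = 0
    · subst hs0
      rw [symmTreeHeavy_zero_left (hL.zero _ _ (by omega)),
        symmTreeHeavy_zero_left (hL'.zero _ _ (by omega))]
    by_cases hsr : s = r
    · subst hsr
      rw [tsub_self, symmTreeHeavy_zero_right _ (hL.zero _ _ (by omega)),
        symmTreeHeavy_zero_right _ (hL'.zero _ _ (by omega))]
    rw [hlow s _ _ (by omega) (sum_lt_of_le_of_ne hs hsr),
      hlow (r - s) _ _ (by omega) (sum_sub_lt hs hs0)]
  rw [flowRHS_eq_trees, flowRHS_eq_trees, hloop (n₁ + 1) n₂ (by omega),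
    hloop n₁ (n₂ + 1) (by omega), e3, e4]

/-- Two vertices respecting `|n| ≤ |r| + 1` joined by a line respect it again, as orders add and one
pair of legs is lost. A violation by the whole therefore forces a violation by one factor. -/
theorem IsConnectedAt.vanishing_vertex {L D : VertexFamily} {Λ : ℝ} (hL : IsConnectedAt L Λ)
    (hD : IsConnectedAt D Λ) {r s : Fin 3 → ℕ} (hs : s ≤ r) {n₁ n₂ l₁ l₂ l₁' l₂' : ℕ}
    (h : r = 0 ∨ (∑ i, r i) + 1 < n₁ + n₂) (h1 : 1 ≤ l₁ + l₂)
    (h3 : l₁ + l₂ + (l₁' + l₂') = n₁ + n₂ + 1) :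
    (∀ k, L s l₁ l₂ Λ k = 0) ∨ ∀ k, D (r - s) l₁' l₂' Λ k = 0 := by
  rcases h with h | h
  · left
    have : s = 0 := by
      ext i
      have : s i ≤ r i := hs i
      simp only [h, Pi.zero_apply] at this ⊢
      omega
    subst this
    exact hL.zero _ _ h1
  · have hsum := sum_add_sum_sub hs
    by_cases h4 : (∑ i, s i) + 1 < l₁ + l₂
    · exact Or.inl (hL.connected _ _ _ h4)
    · exact Or.inr (hD.connected _ _ _ (by omega))

theorem treesLight_eq_zero {L D : VertexFamily} {Λ : ℝ} (hL : IsConnectedAt L Λ)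
    (hD : IsConnectedAt D Λ) {r : Fin 3 → ℕ} {n₁ n₂ : ℕ}
    (h : r = 0 ∨ (∑ i, r i) + 1 < n₁ + n₂) (k : Config n₁ n₂) :
    treesLight K m L D r n₁ n₂ Λ k = 0 := by
  refine Finset.sum_eq_zero fun s hs => Finset.sum_eq_zero fun l hl =>
    Finset.sum_eq_zero fun h hh => ?_
  rw [Finset.HasAntidiagonal.mem_antidiagonal] at hl hh
  rcases Nat.eq_zero_or_pos l.1 with h0 | hl1
  · simp [h0]
  rcases hL.vanishing_vertex (l₁ := l.1) (l₂ := h.1) (l₁' := l.2) (l₂' := h.2) hD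
    (Finset.mem_Iic.1 hs) ‹_› (by omega) (by omega) with h | h
  · rw [symmTreeLight_zero_left h, mul_zero]
  · rw [symmTreeLight_zero_right _ h, mul_zero]

theorem treesHeavy_eq_zero {L D : VertexFamily} {Λ : ℝ} (hL : IsConnectedAt L Λ)
    (hD : IsConnectedAt D Λ) {r : Fin 3 → ℕ} {n₁ n₂ : ℕ}
    (h : r = 0 ∨ (∑ i, r i) + 1 < n₁ + n₂) (k : Config n₁ n₂) :
    treesHeavy K M L D r n₁ n₂ Λ k = 0 := by
  refine Finset.sum_eq_zero fun s hs => Finset.sum_eq_zero fun l hl =>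
    Finset.sum_eq_zero fun h hh => ?_
  rw [Finset.HasAntidiagonal.mem_antidiagonal] at hl hh
  rcases Nat.eq_zero_or_pos h.1 with h0 | hl1
  · simp [h0]
  rcases hL.vanishing_vertex (l₁ := l.1) (l₂ := h.1) (l₁' := l.2) (l₂' := h.2) hD
    (Finset.mem_Iic.1 hs) ‹_› (by omega) (by omega) with h | h
  · rw [symmTreeHeavy_zero_left h, mul_zero]
  · rw [symmTreeHeavy_zero_right _ h, mul_zero]

theorem flowRHS_eq_zero {L : VertexFamily} {Λ : ℝ} (hL : IsConnectedAt L Λ) {r : Fin 3 → ℕ}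
    {n₁ n₂ : ℕ} (hn : 1 ≤ n₁ + n₂) (h : r = 0 ∨ (∑ i, r i) + 1 < n₁ + n₂) (k : Config n₁ n₂) :
    flowRHS K m M L r n₁ n₂ Λ k = 0 := by
  have hloop : ∀ l₁ l₂, l₁ + l₂ = n₁ + n₂ + 1 → ∀ k, L r l₁ l₂ Λ k = 0 := by
    intro l₁ l₂ hl k
    rcases h with h | h
    · subst h; exact hL.zero _ _ (by omega) k
    · exact hL.connected _ _ _ (by omega) k
  have e1 : loopLight K m Λ n₁ n₂ (L r (n₁ + 1) n₂ Λ) k = 0 := by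
    simp [loopLight, hloop (n₁ + 1) n₂ (by omega)]
  have e2 : loopHeavy K M Λ n₁ n₂ (L r n₁ (n₂ + 1) Λ) k = 0 := by
    simp [loopHeavy, hloop n₁ (n₂ + 1) (by omega)]
  rw [flowRHS_eq_trees, e1, e2, treesLight_eq_zero hL hL h, treesHeavy_eq_zero hL hL h]
  simp

end Flow


/-! ### Invariant bilinear forms -/

section BilinearForms

theorem exists_unit_orthogonal (p : Mom) : ∃ t : Mom, ‖t‖ = 1 ∧ inner ℝ p t = 0 := by
  have h : ∃ u ∈ (ℝ ∙ p)ᗮ, u ≠ 0 := by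
    refine Submodule.exists_mem_ne_zero_of_ne_bot fun h => ?_
    rw [Submodule.orthogonal_eq_bot_iff] at h
    have h1 := finrank_span_le_card (R := ℝ) ({p} : Set Mom)
    rw [h, finrank_top] at h1
    simp at h1
  obtain ⟨u, hu, hu0⟩ := h
  refine ⟨‖u‖⁻¹ • u, norm_smul_inv_norm hu0, ?_⟩
  rw [inner_smul_right, Submodule.mem_orthogonal_singleton_iff_inner_right.1 hu, mul_zero]

/-- A unit vector orthogonal to `p`. -/
noncomputable def perp (p : Mom) : Mom := (exists_unit_orthogonal p).choose

theorem norm_perp (p : Mom) : ‖perp p‖ = 1 := (exists_unit_orthogonal p).choose_spec.1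

theorem inner_perp (p : Mom) : inner ℝ p (perp p) = 0 := (exists_unit_orthogonal p).choose_spec.2

/-- A symmetric bilinear form that is invariant under the isometries fixing `p` is a combination of
the inner product and of the square of `⟪p, ·⟫`. -/
theorem exists_bilinForm_eq {B : Mom → Mom → ℝ} (hadd : ∀ u v w, B (u + v) w = B u w + B v w)
    (hsmul : ∀ (c : ℝ) u v, B (c • u) v = c * B u v) (hsymm : ∀ u v, B u v = B v u) {p t : Mom}
    (hinv : ∀ R : Mom ≃ₗᵢ[ℝ] Mom, R p = p → ∀ u v, B (R u) (R v) = B u v)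
    (ht : ‖t‖ = 1) (hpt : inner ℝ p t = 0) :
    ∃ c, ∀ u v, B u v = B t t * inner ℝ u v + c * (inner ℝ p u * inner ℝ p v) := by
  have hadd' : ∀ u v w, B u (v + w) = B u v + B u w := fun u v w => by
    rw [hsymm, hadd, hsymm v, hsymm w]
  have hsmul' : ∀ (c : ℝ) u v, B u (c • v) = c * B u v := fun c u v => by
    rw [hsymm, hsmul, hsymm v]
  have h1 : ∀ s : Mom, inner ℝ p s = 0 → ‖s‖ = 1 → B s s = B t t := by
    intro s hs hs1
    -- The reflection exchanging `t` and `s` fixes `p`, so `B` takes one value on all unit vectors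
    -- orthogonal to `p`.
    have hR : (ℝ ∙ (t - s))ᗮ.reflection p = p := by
      refine Submodule.reflection_mem_subspace_eq_self ?_
      rw [Submodule.mem_orthogonal_singleton_iff_inner_right, real_inner_comm, inner_sub_right, hs,
        hpt, sub_zero]
    have := hinv _ hR t t
    rwa [Submodule.reflection_sub (ht.trans hs1.symm)] at this
  have h2 : ∀ s : Mom, inner ℝ p s = 0 → B s s = B t t * ‖s‖ ^ 2 := by
    intro s hs
    by_cases hs0 : s = 0
    · subst hs0
      have := hsmul 0 (0 : Mom) 0
      simpa using this
    have h3 := h1 (‖s‖⁻¹ • s) (by rw [inner_smul_right, hs, mul_zero]) (norm_smul_inv_norm hs0)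
    rw [hsmul, hsmul'] at h3
    have : ‖s‖ ≠ 0 := norm_ne_zero_iff.2 hs0
    field_simp at h3
    linarith
  have h3 : ∀ s s' : Mom, inner ℝ p s = 0 → inner ℝ p s' = 0 → B s s' = B t t * inner ℝ s s' := by
    intro s s' hs hs'
    have e := h2 (s + s') (by rw [inner_add_right, hs, hs', add_zero])
    rw [hadd, hadd', hadd', h2 s hs, h2 s' hs', hsymm s' s, norm_add_sq_real] at e
    linarith
  have h4 : ∀ s : Mom, inner ℝ p s = 0 → B p s = 0 := by
    intro s hs
    -- This reflection fixes `p` and reverses `s`, so `B p s` is its own negative.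
    have hR : (ℝ ∙ s)ᗮ.reflection p = p := by
      refine Submodule.reflection_mem_subspace_eq_self ?_
      rw [Submodule.mem_orthogonal_singleton_iff_inner_right, real_inner_comm, hs]
    have h5 := hinv _ hR p s
    rw [hR, Submodule.reflection_orthogonalComplement_singleton_eq_neg,
      show -s = (-1 : ℝ) • s by simp, hsmul'] at h5
    linarith
  by_cases hp : p = 0
  · subst hp
    exact ⟨0, fun u v => by rw [h3 u v (inner_zero_left _) (inner_zero_left _)]; ring⟩
  have hp' : ‖p‖ ^ 2 ≠ 0 := by simpa using hp
  -- The coefficient is dictated by the case `u = v = p`.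
  refine ⟨(B p p - B t t * ‖p‖ ^ 2) / (‖p‖ ^ 2) ^ 2, fun u v => ?_⟩
  have hdec : ∀ u : Mom, ∃ s, inner ℝ p s = 0 ∧ u = (inner ℝ p u / ‖p‖ ^ 2) • p + s := by
    intro u
    refine ⟨u - (inner ℝ p u / ‖p‖ ^ 2) • p, ?_, by abel⟩
    rw [inner_sub_right, inner_smul_right, real_inner_self_eq_norm_sq, div_mul_cancel₀ _ hp',
      sub_self]
  obtain ⟨s, hs, hu⟩ := hdec u
  obtain ⟨s', hs', hv⟩ := hdec v
  generalize inner ℝ p u = α at *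
  generalize inner ℝ p v = β at *
  subst hu hv
  simp only [hadd, hadd', hsmul, hsmul', inner_add_left, inner_add_right, inner_smul_left,
    inner_smul_right, real_inner_self_eq_norm_sq, real_inner_comm p s, hs, hs', h3 s s' hs hs',
    hsymm s p, h4 s hs, h4 s' hs']
  simp
  field_simp
  ring

end BilinearForms

/-! ### Second derivatives of invariant two-point functions -/

section SecondDerivative

variable {n₁ n₂ : ℕ}

/-- The configuration in which all independent momenta agree. -/
def diag (n₁ n₂ : ℕ) (u : Mom) : Config n₁ n₂ := fun _ => u

/-- The isometry of configurations induced by an isometry of momenta. -/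
noncomputable def configMap (n₁ n₂ : ℕ) (R : Mom ≃ₗᵢ[ℝ] Mom) : Config n₁ n₂ →L[ℝ] Config n₁ n₂ :=
  ContinuousLinearMap.pi fun i => (R : Mom →L[ℝ] Mom).comp (ContinuousLinearMap.proj i)

theorem IsInvariant.iteratedFDeriv_apply {f : Config n₁ n₂ → ℝ} (hf : ContDiff ℝ ∞ f)
    (hi : IsInvariant f) (R : Mom ≃ₗᵢ[ℝ] Mom) (z : ℕ) (k : Config n₁ n₂)
    (v : Fin z → Config n₁ n₂) :
    iteratedFDeriv ℝ z f (fun i => R (k i)) (fun a i => R (v a i)) = iteratedFDeriv ℝ z f k v := by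
  have h := (configMap n₁ n₂ R).iteratedFDeriv_comp_right hf k (i := z) (by exact_mod_cast le_top)
  have h2 : f ∘ configMap n₁ n₂ R = f := funext fun k => hi R k
  rw [h2] at h
  rw [h]
  rfl

/-- The second derivatives of an invariant two-point function. -/
theorem IsInvariant.exists_secondDeriv_eq {f : Config n₁ n₂ → ℝ}
    (hf : ContDiff ℝ ∞ f) (hi : IsInvariant f) {p t : Mom} (ht : ‖t‖ = 1)
    (hpt : inner ℝ p t = 0) :
    ∃ c, ∀ v : Fin 2 → Mom, iteratedFDeriv ℝ 2 f (diag n₁ n₂ p) (fun a => diag n₁ n₂ (v a)) =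
      iteratedFDeriv ℝ 2 f (diag n₁ n₂ p) (fun _ => diag n₁ n₂ t) * inner ℝ (v 0) (v 1) +
        c * (inner ℝ p (v 0) * inner ℝ p (v 1)) := by
  set B : Mom → Mom → ℝ := fun u v => iteratedFDeriv ℝ 2 f (diag n₁ n₂ p)
    ![diag n₁ n₂ u, diag n₁ n₂ v] with hB
  have hB' : ∀ u v, B u v = fderiv ℝ (fderiv ℝ f) (diag n₁ n₂ p) (diag n₁ n₂ u)
      (diag n₁ n₂ v) := fun u v => by rw [hB]; simp [iteratedFDeriv_two_apply]
  have hd1 : ∀ u v, diag n₁ n₂ (u + v) = diag n₁ n₂ u + diag n₁ n₂ v := fun _ _ => rfl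
  have hd2 : ∀ (c : ℝ) u, diag n₁ n₂ (c • u) = c • diag n₁ n₂ u := fun _ _ => rfl
  have hs : IsSymmSndFDerivAt ℝ f (diag n₁ n₂ p) := by
    refine ContDiffAt.isSymmSndFDerivAt (n := ∞) hf.contDiffAt ?_
    simp only [minSmoothness_of_isRCLikeNormedField]
    exact ENat.LEInfty.out
  obtain ⟨c, hc⟩ := exists_bilinForm_eq (B := B) (p := p) (t := t)
    (fun u v w => by rw [hB', hB', hB', hd1, map_add]; rfl)
    (fun a u v => by rw [hB', hB', hd2, map_smul]; rfl)
    (fun u v => by rw [hB', hB']; exact hs.eq _ _)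
    (fun R hR u v => by
      have h := hi.iteratedFDeriv_apply hf R 2 (diag n₁ n₂ p) ![diag n₁ n₂ u, diag n₁ n₂ v]
      have e1 : (fun i => R (diag n₁ n₂ p i)) = diag n₁ n₂ p := funext fun i => hR
      rw [e1] at h
      rw [hB]
      dsimp only
      rw [← h]
      congr 1
      ext a : 1
      fin_cases a <;> rfl) ht hpt
  have e : ∀ v : Fin 2 → Mom, (fun a => diag n₁ n₂ (v a)) = ![diag n₁ n₂ (v 0), diag n₁ n₂ (v 1)] :=
    fun v => by ext a : 1; fin_cases a <;> rfl
  refine ⟨c, fun v => ?_⟩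
  rw [e v, e fun _ => t]
  exact hc (v 0) (v 1)

theorem single_eq_diag (hn : n₁ + n₂ = 1) (j : Fin (2 * n₁ + 2 * n₂ - 1)) (u : Mom) :
    (Pi.single j u : Config n₁ n₂) = diag n₁ n₂ u := by
  ext1 i
  have : i = j := Fin.ext (by omega)
  rw [this, Pi.single_eq_same, diag]

end SecondDerivative

/-! ### Integration over scales -/

section Integral

variable {n₁ n₂ : ℕ} {G : ℝ → ℝ → Config n₁ n₂ → ℝ}

/-- The integral of `G Λ₀` over the scales from `Λ` to `Λ₀`. -/
noncomputable def scaleIntegral (G : ℝ → ℝ → Config n₁ n₂ → ℝ) (Λ₀ Λ : ℝ) (k : Config n₁ n₂) : ℝ :=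
  ∫ t in Icc (0 : ℝ) 1, (Λ₀ - Λ) * G Λ₀ (Λ + t * (Λ₀ - Λ)) k

/-- On the fixed interval `[0, 1]` the endpoints have moved into the integrand, so joint smoothness
in both scales is a statement about a parametric integral over a compact set. -/
theorem IsSmooth.scaleIntegral (hG : IsSmooth G) : IsSmooth (scaleIntegral G) := by
  refine contDiff_setIntegral_param (g := fun (x : ℝ × ℝ × Config n₁ n₂) (t : ℝ) =>
    (x.1 - x.2.1) * G x.1 (x.2.1 + t * (x.1 - x.2.1)) x.2.2) isCompact_Icc ?_
  refine ContDiff.mul (by fun_prop) ?_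
  exact hG.comp (a := fun y : (ℝ × ℝ × Config n₁ n₂) × ℝ => y.1.1)
    (b := fun y => y.1.2.1 + y.2 * (y.1.1 - y.1.2.1)) (c := fun y => y.1.2.2)
    (by fun_prop) (by fun_prop) (by fun_prop)

theorem scaleIntegral_eq (G : ℝ → ℝ → Config n₁ n₂ → ℝ) (Λ₀ Λ : ℝ) (k : Config n₁ n₂) :
    scaleIntegral G Λ₀ Λ k = ∫ s in Λ..Λ₀, G Λ₀ s k := by
  rw [scaleIntegral, integral_Icc_eq_integral_Ioc, ← intervalIntegral.integral_of_le zero_le_one,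
    intervalIntegral.integral_const_mul]
  have h := intervalIntegral.mul_integral_comp_add_mul (a := 0) (b := 1)
    (f := fun s => G Λ₀ s k) (Λ₀ - Λ) Λ
  simp only [mul_zero, add_zero, mul_one, add_sub_cancel] at h
  rw [← h]
  simp_rw [mul_comm (Λ₀ - Λ)]

theorem IsSmooth.hasDerivAt_scaleIntegral (hG : IsSmooth G) (Λ₀ Λ : ℝ) (k : Config n₁ n₂) :
    HasDerivAt (fun s => PhiPsi.scaleIntegral G Λ₀ s k) (-G Λ₀ Λ k) Λ := by
  simp_rw [scaleIntegral_eq]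
  have hc : Continuous (fun s => G Λ₀ s k) :=
    (contDiff_right_param (hG.snd_param Λ₀) k).continuous
  exact intervalIntegral.integral_hasDerivAt_left (hc.intervalIntegrable _ _)
    (hc.stronglyMeasurableAtFilter _ _) hc.continuousAt

theorem scaleIntegral_self (G : ℝ → ℝ → Config n₁ n₂ → ℝ) (Λ : ℝ) (k : Config n₁ n₂) :
    scaleIntegral G Λ Λ k = 0 := by
  rw [scaleIntegral_eq, intervalIntegral.integral_same]

theorem isInvariant_scaleIntegral (hG : ∀ Λ₀ Λ, IsInvariant (G Λ₀ Λ)) (Λ₀ Λ : ℝ) :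
    IsInvariant (scaleIntegral G Λ₀ Λ) := fun R k => by
  simp_rw [scaleIntegral, fun Λ₀ Λ => hG Λ₀ Λ R k]

end Integral


/-! ### The kinetic term -/

section Quadratic

variable {n₁ n₂ : ℕ}

/-- The square of the first independent momentum. -/
noncomputable def quad (n₁ n₂ : ℕ) (k : Config n₁ n₂) : ℝ :=
  if h : 0 < 2 * n₁ + 2 * n₂ - 1 then ‖k ⟨0, h⟩‖ ^ 2 else 0

theorem quad_of_pos (h : 0 < 2 * n₁ + 2 * n₂ - 1) (k : Config n₁ n₂) :
    quad n₁ n₂ k = ‖k ⟨0, h⟩‖ ^ 2 := dif_pos h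

theorem contDiff_quad (hn : 1 ≤ n₁ + n₂) : ContDiff ℝ ∞ (quad n₁ n₂) := by
  have h : 0 < 2 * n₁ + 2 * n₂ - 1 := by omega
  have : quad n₁ n₂ = fun k => ‖k ⟨0, h⟩‖ ^ 2 := funext fun k => quad_of_pos h k
  rw [this]
  exact (contDiff_apply ℝ Mom (⟨0, h⟩ : Fin (2 * n₁ + 2 * n₂ - 1))).norm_sq ℝ

theorem isInvariant_quad (hn : 1 ≤ n₁ + n₂) : IsInvariant (quad n₁ n₂) := fun R k => by
  have h : 0 < 2 * n₁ + 2 * n₂ - 1 := by omega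
  rw [quad_of_pos h, quad_of_pos h, LinearIsometryEquiv.norm_map]

/-- The derivative of `quad`, as a linear map. -/
theorem exists_fderiv_quad (hn : 1 ≤ n₁ + n₂) :
    ∃ T : Config n₁ n₂ →L[ℝ] Config n₁ n₂ →L[ℝ] ℝ, (∀ k, fderiv ℝ (quad n₁ n₂) k = T k) ∧
      ∀ u v : Mom, T (diag n₁ n₂ u) (diag n₁ n₂ v) = 2 * inner ℝ u v := by
  have h : 0 < 2 * n₁ + 2 * n₂ - 1 := by omega
  set π : Config n₁ n₂ →L[ℝ] Mom := ContinuousLinearMap.proj ⟨0, h⟩ with hπ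
  refine ⟨(2 : ℝ) • ((ContinuousLinearMap.compL ℝ (Config n₁ n₂) Mom ℝ).flip π).comp
    ((innerSL ℝ).comp π), fun k => ?_, fun u v => ?_⟩
  · have h1 : quad n₁ n₂ = fun k => ‖π k‖ ^ 2 := funext fun k => quad_of_pos h k
    rw [h1]
    have h2 := (π.hasFDerivAt (x := k)).norm_sq
    rw [h2.fderiv]
    ext v
    simp
  · simp [hπ, diag]

theorem iteratedFDeriv_quad_two (hn : 1 ≤ n₁ + n₂) (k : Config n₁ n₂) (v : Fin 2 → Mom) :
    iteratedFDeriv ℝ 2 (quad n₁ n₂) k (fun a => diag n₁ n₂ (v a)) = 2 * inner ℝ (v 0) (v 1) := by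
  obtain ⟨T, hT, hT2⟩ := exists_fderiv_quad hn
  rw [iteratedFDeriv_two_apply, funext hT, T.fderiv, hT2]

theorem iteratedFDeriv_quad_eq_zero (hn : 1 ≤ n₁ + n₂) {z : ℕ} (hz : 3 ≤ z) (k : Config n₁ n₂) :
    iteratedFDeriv ℝ z (quad n₁ n₂) k = 0 := by
  obtain ⟨T, hT, -⟩ := exists_fderiv_quad hn
  obtain ⟨z, rfl⟩ := Nat.exists_eq_add_of_le hz
  have h3 : iteratedFDeriv ℝ (z + 1) (fderiv ℝ (fderiv ℝ (quad n₁ n₂))) k = 0 := by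
    have : fderiv ℝ (fderiv ℝ (quad n₁ n₂)) = fun _ => T := by
      rw [funext hT]; ext1 k; exact T.fderiv
    rw [this, iteratedFDeriv_succ_const]
    rfl
  rw [← norm_eq_zero, show 3 + z = z + 1 + 1 + 1 by ring, ← norm_iteratedFDeriv_fderiv,
    ← norm_iteratedFDeriv_fderiv, h3, norm_zero]

end Quadratic

/-! ### Construction of the vertex functions -/

section Solution

variable {n₁ n₂ : ℕ}

/-- The momenta at which the vertex function with `2 n₁` light and `2 n₂` heavy legs is
renormalized. -/
def renPoint (pbar : Fin 5 → Mom) : (n₁ n₂ : ℕ) → Config n₁ n₂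
  | 0, 1 => fun _ => pbar 0
  | 0, 2 => ![pbar 1, pbar 2, pbar 3]
  | 1, 1 => ![0, 0, pbar 4]
  | _, _ => 0

/-- The renormalized couplings. -/
noncomputable def renValue (r : Fin 3 → ℕ) : ℕ → ℕ → ℝ
  | 2, 0 => if r = ![1, 0, 0] then 1 / 24 else 0
  | 0, 2 => if r = ![0, 1, 0] then 1 / 24 else 0
  | 1, 1 => if r = ![0, 0, 1] then 1 / 4 else 0
  | _, _ => 0

theorem renPoint_eq_diag (pbar : Fin 5 → Mom) (hn : n₁ + n₂ = 1) :
    renPoint pbar n₁ n₂ = diag n₁ n₂ (if n₂ = 0 then 0 else pbar 0) := by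
  rcases Nat.eq_zero_or_pos n₂ with h | h
  · obtain rfl : n₁ = 1 := by omega
    subst h
    rfl
  · obtain rfl : n₂ = 1 := by omega
    obtain rfl : n₁ = 0 := by omega
    rfl

/-- The coefficient of the bare kinetic term. -/
noncomputable def bareField (pbar : Fin 5 → Mom) (n₁ n₂ : ℕ) (J : Config n₁ n₂ → ℝ) : ℝ :=
  if n₁ + n₂ = 1 then
    iteratedFDeriv ℝ 2 J (renPoint pbar n₁ n₂) (fun _ => diag n₁ n₂ (perp (pbar 0))) / 2
  else 0

/-- The constant term of the bare vertex. -/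
noncomputable def bareConst (pbar : Fin 5 → Mom) (r : Fin 3 → ℕ) (n₁ n₂ : ℕ)
    (J : Config n₁ n₂ → ℝ) : ℝ :=
  if n₁ + n₂ ≤ 2 then
    J (renPoint pbar n₁ n₂) - bareField pbar n₁ n₂ J * quad n₁ n₂ (renPoint pbar n₁ n₂)
      + renValue r n₁ n₂
  else 0

open scoped Classical in
/-- The solution of the flow equation with right-hand side `G` that satisfies the renormalization
conditions. -/
noncomputable def solveFlow (pbar : Fin 5 → Mom) (r : Fin 3 → ℕ) (n₁ n₂ : ℕ)
    (G : ℝ → ℝ → Config n₁ n₂ → ℝ) (Λ₀ Λ : ℝ) (k : Config n₁ n₂) : ℝ :=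
  if r = 0 ∨ (∑ i, r i) + 1 < n₁ + n₂ then 0
  else bareConst pbar r n₁ n₂ (scaleIntegral G Λ₀ 0) +
    bareField pbar n₁ n₂ (scaleIntegral G Λ₀ 0) * quad n₁ n₂ k - scaleIntegral G Λ₀ Λ k

/-- Approximate vertex functions: those of rank less than `N` are correct. -/
noncomputable def approxVertex (K : ℝ → ℝ) (m M : ℝ) (pbar : Fin 5 → Mom) : ℕ → ℝ → VertexFamily
  | 0 => fun _ _ _ _ _ _ => 0
  | N + 1 => fun Λ₀ r n₁ n₂ => solveFlow pbar r n₁ n₂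
      (fun Λ₀ Λ k => flowRHS K m M (approxVertex K m M pbar N Λ₀) r n₁ n₂ Λ k) Λ₀

/-- The perturbative vertex functions. -/
noncomputable def vertex (K : ℝ → ℝ) (m M : ℝ) (pbar : Fin 5 → Mom) (Λ₀ : ℝ) : VertexFamily :=
  fun r n₁ n₂ => approxVertex K m M pbar (rank r n₁ n₂ + 1) Λ₀ r n₁ n₂

variable {K : ℝ → ℝ} {m M : ℝ} {pbar : Fin 5 → Mom}

theorem solveFlow_congr {r : Fin 3 → ℕ} {G G' : ℝ → ℝ → Config n₁ n₂ → ℝ} {Λ₀ : ℝ}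
    (h : ∀ Λ k, G Λ₀ Λ k = G' Λ₀ Λ k) : solveFlow pbar r n₁ n₂ G Λ₀ = solveFlow pbar r n₁ n₂ G' Λ₀ := by
  have : scaleIntegral G Λ₀ = scaleIntegral G' Λ₀ := by
    ext Λ k
    simp_rw [scaleIntegral, h]
  ext Λ k
  rw [solveFlow, solveFlow, this]

theorem isConnectedAt_approxVertex (N : ℕ) (Λ₀ Λ : ℝ) :
    IsConnectedAt (approxVertex K m M pbar N Λ₀) Λ := by
  cases N with
  | zero => exact ⟨fun _ _ _ _ => rfl, fun _ _ _ _ _ => rfl⟩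
  | succ N =>
    exact ⟨fun _ _ _ _ => by simp [approxVertex, solveFlow],
      fun _ _ _ h _ => by simp [approxVertex, solveFlow, h]⟩

/-- By triangularity a further pass leaves unchanged whatever has rank below the number of passes
already made. -/
theorem approxVertex_succ (N : ℕ) {r : Fin 3 → ℕ} (hn : 1 ≤ n₁ + n₂) (h : rank r n₁ n₂ < N) (Λ₀ : ℝ) :
    approxVertex K m M pbar (N + 1) Λ₀ r n₁ n₂ = approxVertex K m M pbar N Λ₀ r n₁ n₂ := by
  induction N generalizing r n₁ n₂ with
  | zero => omega
  | succ N ih =>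
    refine solveFlow_congr fun Λ k => flowRHS_congr (isConnectedAt_approxVertex _ _ _)
      (isConnectedAt_approxVertex _ _ _) hn (fun s l₁ l₂ hl hs k => ?_) k
    rw [ih hl (by omega)]

theorem approxVertex_eq_vertex {N : ℕ} {r : Fin 3 → ℕ} (hn : 1 ≤ n₁ + n₂) (h : rank r n₁ n₂ < N)
    (Λ₀ : ℝ) : approxVertex K m M pbar N Λ₀ r n₁ n₂ = vertex K m M pbar Λ₀ r n₁ n₂ := by
  induction N, h using Nat.le_induction with
  | base => rfl
  | succ N h ih => rw [approxVertex_succ N hn h, ih]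

theorem isConnectedAt_vertex (Λ₀ Λ : ℝ) : IsConnectedAt (vertex K m M pbar Λ₀) Λ :=
  ⟨fun n₁ n₂ h k => (isConnectedAt_approxVertex _ Λ₀ Λ).zero n₁ n₂ h k,
    fun r n₁ n₂ h k => (isConnectedAt_approxVertex _ Λ₀ Λ).connected r n₁ n₂ h k⟩

/-- The right-hand side sees only smaller ranks, where the approximation has already stabilized.
Thus `vertex` solves the integrated flow equation with no trace of the approximation left. -/
theorem vertex_eq_solveFlow {r : Fin 3 → ℕ} (hn : 1 ≤ n₁ + n₂) (Λ₀ : ℝ) :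
    vertex K m M pbar Λ₀ r n₁ n₂ = solveFlow pbar r n₁ n₂
      (fun Λ₀ Λ k => flowRHS K m M (vertex K m M pbar Λ₀) r n₁ n₂ Λ k) Λ₀ := by
  refine solveFlow_congr fun Λ k => flowRHS_congr (isConnectedAt_approxVertex _ _ _)
      (isConnectedAt_vertex _ _) hn (fun s l₁ l₂ hl hs k => ?_) k
  rw [approxVertex_eq_vertex hl hs]

theorem IsSmooth.bareField {G : ℝ → ℝ → Config n₁ n₂ → ℝ} (hG : IsSmooth G) :
    ContDiff ℝ ∞ (fun Λ₀ => bareField pbar n₁ n₂ (G Λ₀ 0)) := by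
  unfold PhiPsi.bareField
  split_ifs
  · have h1 := contDiff_iteratedFDeriv_param (f := fun (s : ℝ) k => G s 0 k) (hG.fst_param 0) 2
    have h2 : ContDiff ℝ ∞ (fun Λ₀ => iteratedFDeriv ℝ 2 (G Λ₀ 0) (renPoint pbar n₁ n₂)) :=
      contDiff_right_param h1 _
    exact ((ContinuousMultilinearMap.apply ℝ (fun _ : Fin 2 => Config n₁ n₂) ℝ
      (fun _ => diag n₁ n₂ (perp (pbar 0)))).contDiff.comp h2).div_const 2
  · exact contDiff_const

theorem IsSmooth.bareConst {G : ℝ → ℝ → Config n₁ n₂ → ℝ} (hG : IsSmooth G)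
    (r : Fin 3 → ℕ) : ContDiff ℝ ∞ (fun Λ₀ => bareConst pbar r n₁ n₂ (G Λ₀ 0)) := by
  unfold PhiPsi.bareConst
  split_ifs
  · have h1 : ContDiff ℝ ∞ (fun Λ₀ => G Λ₀ 0 (renPoint pbar n₁ n₂)) :=
      hG.comp contDiff_id contDiff_const contDiff_const
    exact (h1.sub (hG.bareField.mul contDiff_const)).add contDiff_const
  · exact contDiff_const

theorem IsSmooth.solveFlow (hn : 1 ≤ n₁ + n₂) {G : ℝ → ℝ → Config n₁ n₂ → ℝ} (hG : IsSmooth G)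
    (r : Fin 3 → ℕ) : IsSmooth (solveFlow pbar r n₁ n₂ G) := by
  unfold IsSmooth PhiPsi.solveFlow
  split_ifs
  · exact contDiff_const
  · have h := hG.scaleIntegral
    refine (((h.bareConst r).comp contDiff_fst).add
      ((h.bareField.comp contDiff_fst).mul ?_)).sub h
    exact (contDiff_quad hn).comp contDiff_snd.snd

theorem isInvariant_solveFlow (hn : 1 ≤ n₁ + n₂) {G : ℝ → ℝ → Config n₁ n₂ → ℝ}
    (hG : ∀ Λ₀ Λ, IsInvariant (G Λ₀ Λ)) (r : Fin 3 → ℕ) (Λ₀ Λ : ℝ) :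
    IsInvariant (solveFlow pbar r n₁ n₂ G Λ₀ Λ) := fun R k => by
  rw [solveFlow, solveFlow, isInvariant_scaleIntegral hG, isInvariant_quad hn]

theorem isSmoothFamily_approxVertex (hK : IsCutoffProfile K) (hm : 0 < m) (hM : 0 < M) (N : ℕ) :
    IsSmoothFamily (approxVertex K m M pbar N) := by
  induction N with
  | zero => exact fun _ _ _ _ => contDiff_const
  | succ N ih =>
    intro r n₁ n₂ hn
    exact (ih.flowRHS hK hm hM r hn).solveFlow hn r

theorem isSmoothFamily_vertex (hK : IsCutoffProfile K) (hm : 0 < m) (hM : 0 < M) :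
    IsSmoothFamily (vertex K m M pbar) := fun r n₁ n₂ hn =>
  isSmoothFamily_approxVertex hK hm hM (rank r n₁ n₂ + 1) r n₁ n₂ hn

theorem isInvariant_approxVertex (hK : IsCutoffProfile K) (hm : 0 < m) (hM : 0 < M) (N : ℕ)
    (Λ₀ Λ : ℝ) (r : Fin 3 → ℕ) (hn : 1 ≤ n₁ + n₂) :
    IsInvariant (approxVertex K m M pbar N Λ₀ r n₁ n₂ Λ) := by
  induction N generalizing r n₁ n₂ Λ₀ Λ with
  | zero => exact fun _ _ => rfl
  | succ N ih =>
    exact isInvariant_solveFlow hn (fun Λ₀ Λ => IsInvariant.flowRHS hK hm hM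
      (fun r n₁ n₂ hn => ih Λ₀ Λ r hn) r hn) r Λ₀ Λ

theorem isInvariant_vertex (hK : IsCutoffProfile K) (hm : 0 < m) (hM : 0 < M)
    (Λ₀ Λ : ℝ) (r : Fin 3 → ℕ) (hn : 1 ≤ n₁ + n₂) :
    IsInvariant (vertex K m M pbar Λ₀ r n₁ n₂ Λ) :=
  isInvariant_approxVertex hK hm hM _ Λ₀ Λ r hn

/-- Families of solutions of the flow equation, one for each ultraviolet cutoff, that satisfy the
renormalization conditions. -/
structure IsRenormalizedFlow (K : ℝ → ℝ) (m M : ℝ) (pbar : Fin 5 → Mom) (F : ℝ → VertexFamily) :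
    Prop where
  smooth : IsSmoothFamily F
  invariant : ∀ Λ₀ Λ r n₁ n₂, 1 ≤ n₁ + n₂ → IsInvariant (F Λ₀ r n₁ n₂ Λ)
  connected : ∀ Λ₀ Λ, IsConnectedAt (F Λ₀) Λ
  flow : ∀ r n₁ n₂, 1 ≤ n₁ + n₂ → ∀ Λ₀ Λ k,
    HasDerivAt (fun s => F Λ₀ r n₁ n₂ s k) (flowRHS K m M (F Λ₀) r n₁ n₂ Λ k) Λ
  bare : ∀ r n₁ n₂, 1 ≤ n₁ + n₂ → ∃ a b : ℝ → ℝ, ContDiff ℝ ∞ a ∧ ContDiff ℝ ∞ b ∧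
    (2 < n₁ + n₂ → a = 0) ∧ (1 < n₁ + n₂ → b = 0) ∧
    ∀ Λ₀ k, F Λ₀ r n₁ n₂ Λ₀ k = a Λ₀ + b Λ₀ * quad n₁ n₂ k
  ren_value : ∀ r n₁ n₂, 1 ≤ n₁ + n₂ → n₁ + n₂ ≤ 2 → ∀ Λ₀,
    F Λ₀ r n₁ n₂ 0 (renPoint pbar n₁ n₂) = renValue r n₁ n₂
  ren_field : ∀ r n₁ n₂, n₁ + n₂ = 1 → ∀ Λ₀,
    iteratedFDeriv ℝ 2 (F Λ₀ r n₁ n₂ 0) (renPoint pbar n₁ n₂)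
      (fun _ => diag n₁ n₂ (perp (pbar 0))) = 0

/-- The couplings enter at `|r| = 1` and `|n| = 2 = |r| + 1`, so the renormalization conditions are
compatible with vanishing order zero and with connectedness. -/
theorem renValue_eq_zero {r : Fin 3 → ℕ} (h : r = 0 ∨ (∑ i, r i) + 1 < n₁ + n₂)
    : renValue r n₁ n₂ = 0 := by
  have h0 : ∀ {v : Fin 3 → ℕ} {i : Fin 3}, v i ≠ 0 → (∑ i, v i = 1) → n₁ + n₂ ≤ 2 → r ≠ v := by
    rintro v i hv hs hn rfl
    rcases h with rfl | h
    · exact hv rfl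
    · omega
  unfold renValue
  split
  · rw [if_neg (h0 (i := 0) (by simp) (by simp [Fin.sum_univ_three]) (by omega))]
  · rw [if_neg (h0 (i := 1) (by simp) (by simp [Fin.sum_univ_three]) (by omega))]
  · rw [if_neg (h0 (i := 2) (by simp) (by simp [Fin.sum_univ_three]) (by omega))]
  · rfl

theorem solveFlow_ren_value {r : Fin 3 → ℕ} {G : ℝ → ℝ → Config n₁ n₂ → ℝ} (hn : n₁ + n₂ ≤ 2)
    (Λ₀ : ℝ) : solveFlow pbar r n₁ n₂ G Λ₀ 0 (renPoint pbar n₁ n₂) = renValue r n₁ n₂ := by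
  unfold solveFlow
  split_ifs with h
  · exact (renValue_eq_zero h).symm
  · rw [bareConst, if_pos hn]
    ring

/-- The second derivative of `quad` on a unit vector is `2`, which explains the division by two in
`bareField`. -/
theorem solveFlow_ren_field {r : Fin 3 → ℕ} {G : ℝ → ℝ → Config n₁ n₂ → ℝ} (hG : IsSmooth G)
    (hn : n₁ + n₂ = 1) (Λ₀ : ℝ) :
    iteratedFDeriv ℝ 2 (solveFlow pbar r n₁ n₂ G Λ₀ 0) (renPoint pbar n₁ n₂)
      (fun _ => diag n₁ n₂ (perp (pbar 0))) = 0 := by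
  by_cases h : r = 0 ∨ (∑ i, r i) + 1 < n₁ + n₂
  · have : solveFlow pbar r n₁ n₂ G Λ₀ 0 = fun _ => 0 := funext fun k => by rw [solveFlow, if_pos h]
    rw [this, iteratedFDeriv_const_of_ne (by norm_num)]
    rfl
  · set b := bareField pbar n₁ n₂ (scaleIntegral G Λ₀ 0) with hb
    set a := bareConst pbar r n₁ n₂ (scaleIntegral G Λ₀ 0) with ha
    have hJ : ContDiff ℝ ∞ (scaleIntegral G Λ₀ 0) := hG.scaleIntegral.mom Λ₀ 0
    have hq := contDiff_quad (n₁ := n₁) (n₂ := n₂) hn.ge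
    have h2 : (2 : ℕ) ≤ (∞ : WithTop ℕ∞) := ENat.LEInfty.out
    have : solveFlow pbar r n₁ n₂ G Λ₀ 0 = ((fun _ => a) + b • quad n₁ n₂) -
        scaleIntegral G Λ₀ 0 := funext fun k => by
      rw [solveFlow, if_neg h]
      rfl
    have hA : ContDiff ℝ ∞ ((fun _ => a) + b • quad n₁ n₂) := contDiff_const.add (hq.const_smul b)
    rw [this, iteratedFDeriv_sub_apply (hA.contDiffAt.of_le h2) (hJ.contDiffAt.of_le h2),
      iteratedFDeriv_add_apply (contDiff_const.contDiffAt)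
        ((show ContDiff ℝ ∞ (b • quad n₁ n₂) from hq.const_smul b).contDiffAt.of_le h2),
      iteratedFDeriv_const_of_ne (by norm_num),
      iteratedFDeriv_const_smul_apply (hq.contDiffAt.of_le h2)]
    have e := iteratedFDeriv_quad_two hn.ge (renPoint pbar n₁ n₂) (fun _ => perp (pbar 0))
    simp only [real_inner_self_eq_norm_sq, norm_perp] at e
    simp only [Pi.zero_apply, zero_add, sub_apply, smul_apply, e]
    rw [hb, bareField, if_pos hn]
    simp

theorem isRenormalizedFlow_vertex (hK : IsCutoffProfile K) (hm : 0 < m) (hM : 0 < M) :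
    IsRenormalizedFlow K m M pbar (vertex K m M pbar) where
  smooth := isSmoothFamily_vertex hK hm hM
  invariant Λ₀ Λ r _ _ hn := isInvariant_vertex hK hm hM Λ₀ Λ r hn
  connected := isConnectedAt_vertex
  flow r n₁ n₂ hn Λ₀ Λ k := by
    rw [vertex_eq_solveFlow hn]
    unfold solveFlow
    split_ifs with h
    · rw [flowRHS_eq_zero (isConnectedAt_vertex _ _) hn h]
      exact hasDerivAt_const _ _
    · have := (((isSmoothFamily_vertex (pbar := pbar) hK hm hM).flowRHS hK hm hM r hn).hasDerivAt_scaleIntegral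
        Λ₀ Λ k).const_sub (bareConst pbar r n₁ n₂ (scaleIntegral
          (fun Λ₀ Λ k => flowRHS K m M (vertex K m M pbar Λ₀) r n₁ n₂ Λ k) Λ₀ 0) +
        bareField pbar n₁ n₂ (scaleIntegral
          (fun Λ₀ Λ k => flowRHS K m M (vertex K m M pbar Λ₀) r n₁ n₂ Λ k) Λ₀ 0) * quad n₁ n₂ k)
      rwa [neg_neg] at this
  bare r n₁ n₂ hn := by
    have hG := ((isSmoothFamily_vertex (pbar := pbar) hK hm hM).flowRHS hK hm hM r hn).scaleIntegral
    by_cases h : r = 0 ∨ (∑ i, r i) + 1 < n₁ + n₂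
    · refine ⟨0, 0, contDiff_const, contDiff_const, fun _ => rfl, fun _ => rfl, fun Λ₀ k => ?_⟩
      rw [vertex_eq_solveFlow hn, solveFlow, if_pos h]
      simp
    · refine ⟨_, _, hG.bareConst (pbar := pbar) r, hG.bareField (pbar := pbar), fun h2 => ?_, fun h2 => ?_, fun Λ₀ k => ?_⟩
      · ext1 s
        exact if_neg (by omega)
      · ext1 s
        exact if_neg (by omega)
      · rw [vertex_eq_solveFlow hn, solveFlow, if_neg h, scaleIntegral_self, sub_zero]
  ren_value r n₁ n₂ hn hn2 Λ₀ := by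
    rw [vertex_eq_solveFlow hn]
    exact solveFlow_ren_value hn2 Λ₀
  ren_field r n₁ n₂ hn Λ₀ := by
    rw [vertex_eq_solveFlow hn.ge]
    exact solveFlow_ren_field ((isSmoothFamily_vertex hK hm hM).flowRHS hK hm hM r hn.ge) hn Λ₀

end Solution


/-! ### Agreement with the defining conditions, and uniqueness -/

section VertexFamilies

variable {K : ℝ → ℝ} {m M : ℝ} {pbar : Fin 5 → Mom} {n₁ n₂ : ℕ}

theorem momDeriv_two_eq (hn : n₁ + n₂ = 1) (d : Fin 2 → Fin (2 * n₁ + 2 * n₂ - 1) × Fin 4)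
    (f : Config n₁ n₂ → ℝ) (k : Config n₁ n₂) :
    momDeriv 2 d f k = iteratedFDeriv ℝ 2 f k
      (fun a => diag n₁ n₂ (EuclideanSpace.single (d a).2 (1 : ℝ))) := by
  unfold momDeriv
  simp_rw [single_eq_diag hn]

theorem exists_bareVertex_eq (a b : ℕ → ℕ → ℝ) (ha : ∀ n₁ n₂, 2 < n₁ + n₂ → a n₁ n₂ = 0)
    (hb : ∀ n₁ n₂, 1 < n₁ + n₂ → b n₁ n₂ = 0) : ∃ ρ : Fin 7 → ℝ, ∀ n₁ n₂, 1 ≤ n₁ + n₂ →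
      ∀ k, a n₁ n₂ + b n₁ n₂ * quad n₁ n₂ k = bareVertex ρ n₁ n₂ k := by
  refine ⟨![2 * a 1 0, 2 * b 1 0, 24 * a 2 0, 2 * a 0 1, 2 * b 0 1, 24 * a 0 2, 4 * a 1 1],
    fun n₁ n₂ hn k => ?_⟩
  unfold bareVertex
  split
  · rw [quad_of_pos (by norm_num)]; simp; ring
  · rw [hb 2 0 (by norm_num)]; simp
  · rw [quad_of_pos (by norm_num)]; simp; ring
  · rw [hb 0 2 (by norm_num)]; simp
  · rw [hb 1 1 (by norm_num)]; simp
  · next h10 h20 h01 h02 h11 =>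
    have h3 : 2 < n₁ + n₂ := by
      by_contra hc
      have h1 : n₁ ≤ 2 := by omega
      have h2 : n₂ ≤ 2 := by omega
      interval_cases n₁ <;> interval_cases n₂ <;> first | omega | simp_all
    rw [ha _ _ h3, hb _ _ (by omega)]
    simp

theorem bareVertex_eq (ρ : Fin 7 → ℝ) (hn : 1 ≤ n₁ + n₂) : ∃ a b : ℝ, (2 < n₁ + n₂ → a = 0) ∧
    (1 < n₁ + n₂ → b = 0) ∧ ∀ k, bareVertex ρ n₁ n₂ k = a + b * quad n₁ n₂ k := by
  by_cases h : n₁ + n₂ ≤ 2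
  · have h1 : n₁ ≤ 2 := by omega
    have h2 : n₂ ≤ 2 := by omega
    interval_cases n₁ <;> interval_cases n₂ <;> first | omega | skip
    · exact ⟨ρ 3 / 2, ρ 4 / 2, by omega, by omega, fun k => by
        rw [quad_of_pos (by norm_num), bareVertex]; ring⟩
    · exact ⟨ρ 5 / 24, 0, by omega, fun _ => rfl, fun k => by rw [bareVertex]; ring⟩
    · exact ⟨ρ 0 / 2, ρ 1 / 2, by omega, by omega, fun k => by
        rw [quad_of_pos (by norm_num), bareVertex]; ring⟩
    · exact ⟨ρ 6 / 4, 0, by omega, fun _ => rfl, fun k => by rw [bareVertex]; ring⟩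
    · exact ⟨ρ 2 / 24, 0, by omega, fun _ => rfl, fun k => by rw [bareVertex]; ring⟩
  · refine ⟨0, 0, fun _ => rfl, fun _ => rfl, fun k => ?_⟩
    unfold bareVertex
    split <;> first | omega | ring

/-- Invariance leaves a multiple of the inner product and a rank-one part; the former is the value
on a unit vector orthogonal to the point, which the flow is built to cancel. One vector serves both
fields, as every vector is orthogonal to the light point `0`. -/
theorem IsRenormalizedFlow.momDeriv_two {F : ℝ → VertexFamily}
    (hF : IsRenormalizedFlow K m M pbar F) (r : Fin 3 → ℕ) (hn : n₁ + n₂ = 1) (Λ₀ : ℝ) :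
    ∃ c : ℝ, ∀ d, momDeriv 2 d (F Λ₀ r n₁ n₂ 0) (renPoint pbar n₁ n₂) =
      c * ((if n₂ = 0 then 0 else pbar 0) (d 0).2 * (if n₂ = 0 then 0 else pbar 0) (d 1).2) := by
  have h0 := hF.ren_field r n₁ n₂ hn Λ₀
  rw [renPoint_eq_diag pbar hn] at h0
  have hp : inner ℝ (if n₂ = 0 then (0 : Mom) else pbar 0) (perp (pbar 0)) = 0 := by
    split_ifs
    · exact inner_zero_left _
    · exact inner_perp _
  obtain ⟨c, hc⟩ := (hF.invariant Λ₀ 0 r n₁ n₂ hn.ge).exists_secondDeriv_eq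
    ((hF.smooth r n₁ n₂ hn.ge).mom Λ₀ 0) (norm_perp (pbar 0)) hp
  refine ⟨c, fun d => ?_⟩
  rw [momDeriv_two_eq hn, renPoint_eq_diag pbar hn, hc, h0]
  generalize (if n₂ = 0 then (0 : Mom) else pbar 0) = p
  simp [EuclideanSpace.inner_single_right]

theorem IsRenormalizedFlow.isVertexFamily {F : ℝ → VertexFamily}
    (hF : IsRenormalizedFlow K m M pbar F) (Λ₀ : ℝ) : IsVertexFamily K m M pbar Λ₀ (F Λ₀) where
  smooth r n₁ n₂ hn := ((hF.smooth r n₁ n₂ hn).snd_param Λ₀).contDiffOn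
  order_zero n₁ n₂ hn Λ _ k := (hF.connected Λ₀ Λ).zero n₁ n₂ hn k
  connected r n₁ n₂ hn Λ _ k := (hF.connected Λ₀ Λ).connected r n₁ n₂ hn k
  flow r n₁ n₂ hn Λ _ k := (hF.flow r n₁ n₂ hn Λ₀ Λ k).hasDerivWithinAt
  bare r := by
    have h : ∀ n₁ n₂, ∃ a b : ℝ, (2 < n₁ + n₂ → a = 0) ∧ (1 < n₁ + n₂ → b = 0) ∧
        (1 ≤ n₁ + n₂ → ∀ k, F Λ₀ r n₁ n₂ Λ₀ k = a + b * quad n₁ n₂ k) := by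
      intro n₁ n₂
      by_cases hn : 1 ≤ n₁ + n₂
      · obtain ⟨a, b, -, -, ha, hb, hab⟩ := hF.bare r n₁ n₂ hn
        exact ⟨a Λ₀, b Λ₀, fun h => by rw [ha h]; rfl, fun h => by rw [hb h]; rfl,
          fun _ k => hab Λ₀ k⟩
      · exact ⟨0, 0, fun _ => rfl, fun _ => rfl, fun h => absurd h hn⟩
    choose a b ha hb hab using h
    obtain ⟨ρ, hρ⟩ := exists_bareVertex_eq a b ha hb
    exact ⟨ρ, fun n₁ n₂ hn k => by rw [hab n₁ n₂ hn, hρ n₁ n₂ hn]⟩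
  ren_light_mass r := hF.ren_value r 1 0 (by norm_num) (by norm_num) Λ₀
  ren_light_field r d := by
    obtain ⟨c, hc⟩ := hF.momDeriv_two r (n₁ := 1) (n₂ := 0) (by norm_num) Λ₀
    refine (hc d).trans ?_
    simp
  ren_light_quartic r := hF.ren_value r 2 0 (by norm_num) (by norm_num) Λ₀
  ren_heavy_mass r := hF.ren_value r 0 1 (by norm_num) (by norm_num) Λ₀
  ren_heavy_field r := hF.momDeriv_two r (n₁ := 0) (n₂ := 1) (by norm_num) Λ₀
  ren_heavy_quartic r := hF.ren_value r 0 2 (by norm_num) (by norm_num) Λ₀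
  ren_mixed_quartic r := hF.ren_value r 1 1 (by norm_num) (by norm_num) Λ₀

variable {Λ₀ : ℝ} {L L' : VertexFamily}

theorem IsVertexFamily.ren_value (hL : IsVertexFamily K m M pbar Λ₀ L) (r : Fin 3 → ℕ)
    (hn : 1 ≤ n₁ + n₂) (hn2 : n₁ + n₂ ≤ 2) :
    L r n₁ n₂ 0 (renPoint pbar n₁ n₂) = renValue r n₁ n₂ := by
  have h1 : n₁ ≤ 2 := by omega
  have h2 : n₂ ≤ 2 := by omega
  interval_cases n₁ <;> interval_cases n₂ <;> first | omega | skip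
  · exact hL.ren_heavy_mass r
  · exact hL.ren_heavy_quartic r
  · exact hL.ren_light_mass r
  · exact hL.ren_mixed_quartic r
  · exact hL.ren_light_quartic r

theorem IsVertexFamily.ren_field (hL : IsVertexFamily K m M pbar Λ₀ L) (r : Fin 3 → ℕ)
    (hn : n₁ + n₂ = 1) :
    ∃ c : ℝ, ∀ d, momDeriv 2 d (L r n₁ n₂ 0) (renPoint pbar n₁ n₂) =
      c * ((if n₂ = 0 then 0 else pbar 0) (d 0).2 * (if n₂ = 0 then 0 else pbar 0) (d 1).2) := by
  rcases Nat.eq_zero_or_pos n₂ with h | h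
  · obtain rfl : n₁ = 1 := by omega
    subst h
    refine ⟨0, fun d => ?_⟩
    rw [zero_mul]
    exact hL.ren_light_field r d
  · obtain rfl : n₂ = 1 := by omega
    obtain rfl : n₁ = 0 := by omega
    exact hL.ren_heavy_field r

/-- A nonzero multiple of the identity has rank above one: the off-diagonal entry `c p₀ p₁ = 0`
makes one of the first two diagonal entries vanish. -/
theorem eq_zero_of_mul_delta_eq {b c : ℝ} {p : Mom}
    (h : ∀ i j : Fin 4, b * inner ℝ (EuclideanSpace.single i (1 : ℝ) : Mom)
      (EuclideanSpace.single j (1 : ℝ)) = c * (p i * p j)) : b = 0 := by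
  have h00 := h 0 0
  have h11 := h 1 1
  have h01 := h 0 1
  simp [EuclideanSpace.inner_single_left] at h00 h11 h01
  rcases h01 with h | h | h
  · rw [h00, h]; ring
  · rw [h00, h]; ring
  · rw [h11, h]; ring

theorem IsVertexFamily.contDiff_zero (hL : IsVertexFamily K m M pbar Λ₀ L) (h0 : 0 ≤ Λ₀)
    (r : Fin 3 → ℕ) (hn : 1 ≤ n₁ + n₂) : ContDiff ℝ ∞ (L r n₁ n₂ 0) := by
  have h := (hL.smooth r n₁ n₂ hn).comp
    (contDiff_const.prodMk contDiff_id : ContDiff ℝ ∞ (fun k => ((0 : ℝ), k))).contDiffOn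
    (s := univ) (fun k _ => ⟨⟨le_rfl, h0⟩, mem_univ _⟩)
  exact contDiffOn_univ.1 h

/-- The flow equation and the boundary conditions determine the vertex functions. -/
theorem IsVertexFamily.unique (h0 : 0 ≤ Λ₀) (hL : IsVertexFamily K m M pbar Λ₀ L)
    (hL' : IsVertexFamily K m M pbar Λ₀ L') (r : Fin 3 → ℕ) (hn : 1 ≤ n₁ + n₂) :
    ∀ Λ ∈ Icc 0 Λ₀, ∀ k, L r n₁ n₂ Λ k = L' r n₁ n₂ Λ k := by
  induction hN : rank r n₁ n₂ using Nat.strong_induction_on generalizing r n₁ n₂ with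
  | _ N ih =>
  subst hN
  have hc : ∀ Λ ∈ Icc 0 Λ₀, IsConnectedAt L Λ := fun Λ hΛ =>
    ⟨fun n₁ n₂ h k => hL.order_zero n₁ n₂ h Λ hΛ k, fun r n₁ n₂ h k => hL.connected r n₁ n₂ h Λ hΛ k⟩
  have hc' : ∀ Λ ∈ Icc 0 Λ₀, IsConnectedAt L' Λ := fun Λ hΛ =>
    ⟨fun n₁ n₂ h k => hL'.order_zero n₁ n₂ h Λ hΛ k,
      fun r n₁ n₂ h k => hL'.connected r n₁ n₂ h Λ hΛ k⟩
  have hd : ∀ k, ∀ Λ ∈ Icc 0 Λ₀,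
      HasDerivWithinAt (fun s => L r n₁ n₂ s k - L' r n₁ n₂ s k) 0 (Icc 0 Λ₀) Λ := by
    intro k Λ hΛ
    have h1 := (hL.flow r n₁ n₂ hn Λ hΛ k).sub (hL'.flow r n₁ n₂ hn Λ hΛ k)
    rwa [flowRHS_congr (hc Λ hΛ) (hc' Λ hΛ) hn
      (fun s l₁ l₂ hl hs k => ih _ hs s hl rfl Λ hΛ k), sub_self] at h1
  obtain ⟨ρ, hρ⟩ := hL.bare r
  obtain ⟨ρ', hρ'⟩ := hL'.bare r
  obtain ⟨a, b, ha, hb, hab⟩ := bareVertex_eq ρ hn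
  obtain ⟨a', b', ha', hb', hab'⟩ := bareVertex_eq ρ' hn
  -- The right-hand sides agree by induction, so the difference is constant in the scale and equals
  -- its local value at `Λ₀`.
  have hdiff : ∀ Λ ∈ Icc 0 Λ₀, ∀ k,
      L r n₁ n₂ Λ k - L' r n₁ n₂ Λ k = (a - a') + (b - b') * quad n₁ n₂ k := by
    intro Λ hΛ k
    have h1 := constant_of_has_deriv_right_zero (fun s hs => (hd k s hs).continuousWithinAt)
      (fun s hs => (hd k s (Ico_subset_Icc_self hs)).mono_of_mem_nhdsWithin
        (Icc_mem_nhdsGE_of_mem hs))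
    rw [h1 Λ hΛ, ← h1 Λ₀ (right_mem_Icc.2 h0), hρ n₁ n₂ hn, hρ' n₁ n₂ hn, hab, hab']
    ring
  have h00 : (0 : ℝ) ∈ Icc 0 Λ₀ := left_mem_Icc.2 h0
  have hbb : b - b' = 0 := by
    by_cases h1 : n₁ + n₂ = 1
    swap
    · rw [hb (by omega), hb' (by omega), sub_zero]
    obtain ⟨c, hc⟩ := hL.ren_field r h1
    obtain ⟨c', hc'⟩ := hL'.ren_field r h1
    have h2 : (2 : ℕ) ≤ (∞ : WithTop ℕ∞) := ENat.LEInfty.out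
    have hq := contDiff_quad (n₁ := n₁) (n₂ := n₂) hn
    have e : L r n₁ n₂ 0 = L' r n₁ n₂ 0 + ((fun _ => a - a') + (b - b') • quad n₁ n₂) := by
      ext k
      have := hdiff 0 h00 k
      simp only [Pi.add_apply, Pi.smul_apply, smul_eq_mul]
      linarith
    have hq2 : ContDiff ℝ ∞ ((b - b') • quad n₁ n₂) := hq.const_smul (b - b')
    have hA : ContDiff ℝ ∞ ((fun _ => a - a') + (b - b') • quad n₁ n₂) :=
      contDiff_const.add hq2
    have hpos : 0 < 2 * n₁ + 2 * n₂ - 1 := by omega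
    -- The renormalization conditions allow only a rank-one second derivative, while `quad`
    -- contributes a multiple of the identity.
    have key : ∀ i j : Fin 4, (2 * (b - b')) * inner ℝ (EuclideanSpace.single i (1 : ℝ) : Mom)
        (EuclideanSpace.single j (1 : ℝ)) = (c - c') * ((if n₂ = 0 then 0 else pbar 0) i *
          (if n₂ = 0 then 0 else pbar 0) j) := by
      intro i j
      have h3 := hc ![(⟨0, hpos⟩, i), (⟨0, hpos⟩, j)]
      have h4 := hc' ![(⟨0, hpos⟩, i), (⟨0, hpos⟩, j)]
      rw [momDeriv_two_eq h1] at h3 h4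
      rw [e, iteratedFDeriv_add_apply ((hL'.contDiff_zero h0 r hn).contDiffAt.of_le h2)
        (hA.contDiffAt.of_le h2), iteratedFDeriv_add_apply contDiff_const.contDiffAt
        (hq2.contDiffAt.of_le h2), iteratedFDeriv_const_of_ne (by norm_num),
        iteratedFDeriv_const_smul_apply (hq.contDiffAt.of_le h2)] at h3
      simp only [add_apply, smul_apply, iteratedFDeriv_quad_two hn] at h3
      rw [h4] at h3
      simp only [Pi.zero_apply, zero_add, Matrix.cons_val_zero, Matrix.cons_val_one, smul_eq_mul,
        zero_apply] at h3
      linarith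
    have := eq_zero_of_mul_delta_eq key
    linarith
  have haa : a - a' = 0 := by
    by_cases h2 : n₁ + n₂ ≤ 2
    · have h3 := hdiff 0 h00 (renPoint pbar n₁ n₂)
      rw [hL.ren_value r hn h2, hL'.ren_value r hn h2, hbb] at h3
      linarith
    · rw [ha (by omega), ha' (by omega), sub_zero]
  intro Λ hΛ k
  have := hdiff Λ hΛ k
  rw [haa, hbb] at this
  linarith

end VertexFamilies


/-! ### Parameters and infrared scales; all later constants are uniform over `Par` -/

/-- The masses, the renormalization points and the ultraviolet cutoff. -/
structure Par where
  m : ℝ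
  M : ℝ
  L0 : ℝ
  pbar : Fin 5 → Mom
  m_pos : 0 < m
  m_lt : m < M
  lt_L0 : M < L0
  norm_pbar : ∀ i, ‖pbar i‖ = M

namespace Par

theorem M_pos (p : Par) : 0 < p.M := p.m_pos.trans p.m_lt

theorem L0_pos (p : Par) : 0 < p.L0 := p.M_pos.trans p.lt_L0

/-- The logarithm in which the bounds are polynomial. -/
noncomputable def ell (p : Par) : ℝ := 1 + Real.log (p.L0 / p.m)

theorem one_le_ell (p : Par) : 1 ≤ p.ell := by
  have h : 1 ≤ p.L0 / p.m := (one_le_div p.m_pos).2 (p.m_lt.trans p.lt_L0).le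
  have := Real.log_nonneg h
  unfold ell
  linarith

theorem ell_pos (p : Par) : 0 < p.ell := zero_lt_one.trans_le p.one_le_ell

/-- The light infrared scale. -/
def u (p : Par) (Λ : ℝ) : ℝ := Λ + p.m

/-- The infrared scale of a vertex with `2 n₂` heavy legs. -/
noncomputable def X (p : Par) (n₂ : ℕ) (Λ : ℝ) : ℝ := if n₂ = 0 then Λ + p.m else Λ + p.M

theorem u_pos (p : Par) {Λ : ℝ} (hΛ : 0 ≤ Λ) : 0 < p.u Λ := add_pos_of_nonneg_of_pos hΛ p.m_pos

theorem u_le_X (p : Par) (n₂ : ℕ) (Λ : ℝ) : p.u Λ ≤ p.X n₂ Λ := by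
  unfold u X
  have := p.m_lt
  split_ifs <;> linarith

theorem X_pos (p : Par) (n₂ : ℕ) {Λ : ℝ} (hΛ : 0 ≤ Λ) : 0 < p.X n₂ Λ :=
  (p.u_pos hΛ).trans_le (p.u_le_X n₂ Λ)

theorem X_mono_legs (p : Par) {a b : ℕ} (h : a ≤ b) (Λ : ℝ) : p.X a Λ ≤ p.X b Λ := by
  unfold X
  have := p.m_lt
  split_ifs
  · exact le_rfl
  · linarith
  · omega
  · exact le_rfl

theorem X_mono (p : Par) (n₂ : ℕ) {s t : ℝ} (h : s ≤ t) : p.X n₂ s ≤ p.X n₂ t := by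
  unfold X
  split_ifs <;> linarith

theorem X_le_of_M_le (p : Par) (n₂ : ℕ) {Λ : ℝ} (h : p.M ≤ Λ) : p.X n₂ Λ ≤ 2 * p.u Λ := by
  unfold X u
  have := p.m_pos
  have := p.m_lt
  split_ifs <;> linarith

/-- The momenta at which vertex functions are estimated at the scale `Λ`. -/
def ball (p : Par) (C Λ : ℝ) (n₁ n₂ : ℕ) : Set (Config n₁ n₂) :=
  legBall (C * (Λ + p.m)) (C * (Λ + p.M)) n₁ n₂

end Par

/-! ### Polynomials in logarithms -/

section Plog

/-- Functions bounded by polynomials in the logarithm of the ultraviolet cutoff. -/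
def IsPlog (β : Par → ℝ) : Prop := (∀ p, 0 ≤ β p) ∧ ∃ (A : ℝ) (N : ℕ), ∀ p, β p ≤ A * p.ell ^ N

theorem IsPlog.exists_bound {β : Par → ℝ} (h : IsPlog β) :
    ∃ (A : ℝ) (N : ℕ), 0 ≤ A ∧ ∀ p, β p ≤ A * p.ell ^ N := by
  obtain ⟨A, N, hA⟩ := h.2
  refine ⟨|A|, N, abs_nonneg A, fun p => (hA p).trans ?_⟩
  have := p.ell_pos
  gcongr
  exact le_abs_self A

theorem IsPlog.const {c : ℝ} (hc : 0 ≤ c) : IsPlog (fun _ => c) :=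
  ⟨fun _ => hc, c, 0, fun p => by simp⟩

theorem isPlog_ell : IsPlog Par.ell := ⟨fun p => p.ell_pos.le, 1, 1, fun p => by simp⟩

theorem IsPlog.add {β γ : Par → ℝ} (hβ : IsPlog β) (hγ : IsPlog γ) :
    IsPlog (fun p => β p + γ p) := by
  obtain ⟨A, N, hA0, hA⟩ := hβ.exists_bound
  obtain ⟨B, N', hB0, hB⟩ := hγ.exists_bound
  refine ⟨fun p => add_nonneg (hβ.1 p) (hγ.1 p), A + B, max N N', fun p => ?_⟩
  have h1 := p.one_le_ell
  calc β p + γ p ≤ A * p.ell ^ N + B * p.ell ^ N' := add_le_add (hA p) (hB p)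
    _ ≤ A * p.ell ^ max N N' + B * p.ell ^ max N N' := by
      have e1 := pow_le_pow_right₀ h1 (le_max_left N N')
      have e2 := pow_le_pow_right₀ h1 (le_max_right N N')
      gcongr
    _ = (A + B) * p.ell ^ max N N' := by ring

theorem IsPlog.mul {β γ : Par → ℝ} (hβ : IsPlog β) (hγ : IsPlog γ) :
    IsPlog (fun p => β p * γ p) := by
  obtain ⟨A, N, hA0, hA⟩ := hβ.exists_bound
  obtain ⟨B, N', hB0, hB⟩ := hγ.exists_bound
  refine ⟨fun p => mul_nonneg (hβ.1 p) (hγ.1 p), A * B, N + N', fun p => ?_⟩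
  have h1 := p.ell_pos
  calc β p * γ p ≤ (A * p.ell ^ N) * (B * p.ell ^ N') :=
        mul_le_mul (hA p) (hB p) (hγ.1 p) (by positivity)
    _ = A * B * p.ell ^ (N + N') := by ring

theorem IsPlog.sum {α : Type} (s : Finset α) {β : α → Par → ℝ} (h : ∀ a ∈ s, IsPlog (β a)) :
    IsPlog (fun p => ∑ a ∈ s, β a p) := by
  classical
  induction s using Finset.induction_on with
  | empty => simpa using IsPlog.const le_rfl
  | insert a s ha ih =>
    simp only [Finset.sum_insert ha]
    exact (h a (Finset.mem_insert_self a s)).add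
      (ih fun b hb => h b (Finset.mem_insert_of_mem hb))

end Plog

/-! ### Weighted bounds for trees and loops -/

section Bounds

variable {n₁ n₂ l₁ l₂ l₁' l₂' : ℕ} {S : Par → Set ℝ} {C : ℝ} {w : Par → ℝ → ℝ} {z : ℕ}

/-- The derivatives of order `z` are bounded by the weight `w`, up to powers of logarithms. -/
def Bdd (S : Par → Set ℝ) (C : ℝ) (w : Par → ℝ → ℝ) (f : Par → ℝ → Config n₁ n₂ → ℝ) (z : ℕ) :
    Prop :=
  ∃ β, IsPlog β ∧ ∀ p, ∀ Λ ∈ S p, ∀ k ∈ p.ball C Λ n₁ n₂,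
    ‖iteratedFDeriv ℝ z (f p Λ) k‖ ≤ w p Λ * β p

theorem Bdd.mono {f : Par → ℝ → Config n₁ n₂ → ℝ} (h : Bdd S C w f z) {S' : Par → Set ℝ}
    {w' : Par → ℝ → ℝ} {c : ℝ} (hc : 0 ≤ c) (hS : ∀ p, S' p ⊆ S p)
    (hw : ∀ p, ∀ Λ ∈ S' p, w p Λ ≤ c * w' p Λ) : Bdd S' C w' f z := by
  obtain ⟨β, hβ, hb⟩ := h
  refine ⟨fun p => c * β p, (IsPlog.const hc).mul hβ, fun p Λ hΛ k hk => ?_⟩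
  refine (hb p Λ (hS p hΛ) k hk).trans ?_
  have h1 := mul_le_mul_of_nonneg_right (hw p Λ hΛ) (hβ.1 p)
  linarith

theorem Bdd.union {f : Par → ℝ → Config n₁ n₂ → ℝ} {S' S'' : Par → Set ℝ}
    (hw : ∀ p, ∀ Λ ∈ S'' p, 0 ≤ w p Λ) (h : Bdd S C w f z)
    (h' : Bdd S' C w f z) (hS : ∀ p, S'' p ⊆ S p ∪ S' p) : Bdd S'' C w f z := by
  obtain ⟨β, hβ, hb⟩ := h
  obtain ⟨γ, hγ, hc⟩ := h'
  refine ⟨fun p => β p + γ p, hβ.add hγ, fun p Λ hΛ k hk => ?_⟩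
  have h1 := mul_nonneg (hw p Λ hΛ) (hβ.1 p)
  have h2 := mul_nonneg (hw p Λ hΛ) (hγ.1 p)
  rcases hS p hΛ with h | h
  · linarith [hb p Λ h k hk]
  · linarith [hc p Λ h k hk]

theorem Bdd.of_eq_zero {f : Par → ℝ → Config n₁ n₂ → ℝ} (h : ∀ p, ∀ Λ ∈ S p, ∀ k, f p Λ k = 0) :
    Bdd S C w f z := by
  refine ⟨fun _ => 0, IsPlog.const le_rfl, fun p Λ hΛ k _ => ?_⟩
  have : f p Λ = fun _ => 0 := funext fun k => h p Λ hΛ k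
  rw [this, mul_zero]
  cases z with
  | zero => simp
  | succ z => simp

theorem Bdd.add {f g : Par → ℝ → Config n₁ n₂ → ℝ} (hf' : ∀ p Λ, ContDiff ℝ ∞ (f p Λ))
    (hg' : ∀ p Λ, ContDiff ℝ ∞ (g p Λ)) (hf : Bdd S C w f z) (hg : Bdd S C w g z) :
    Bdd S C w (fun p Λ k => f p Λ k + g p Λ k) z := by
  obtain ⟨β, hβ, hb⟩ := hf
  obtain ⟨γ, hγ, hc⟩ := hg
  refine ⟨fun p => β p + γ p, hβ.add hγ, fun p Λ hΛ k hk => ?_⟩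
  have : (fun k => f p Λ k + g p Λ k) = f p Λ + g p Λ := rfl
  dsimp only
  rw [this, iteratedFDeriv_add_apply ((hf' p Λ).contDiffAt.of_le (by exact_mod_cast le_top))
    ((hg' p Λ).contDiffAt.of_le (by exact_mod_cast le_top)), mul_add]
  exact (norm_add_le _ _).trans (add_le_add (hb p Λ hΛ k hk) (hc p Λ hΛ k hk))

theorem Bdd.const_mul {f : Par → ℝ → Config n₁ n₂ → ℝ} (hf' : ∀ p Λ, ContDiff ℝ ∞ (f p Λ))
    (hf : Bdd S C w f z) (c : ℝ) : Bdd S C w (fun p Λ k => c * f p Λ k) z := by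
  obtain ⟨β, hβ, hb⟩ := hf
  refine ⟨fun p => |c| * β p, (IsPlog.const (abs_nonneg c)).mul hβ, fun p Λ hΛ k hk => ?_⟩
  rw [norm_iteratedFDeriv_const_mul_le (hf' p Λ)]
  calc |c| * ‖iteratedFDeriv ℝ z (f p Λ) k‖ ≤ |c| * (w p Λ * β p) := by
        gcongr; exact hb p Λ hΛ k hk
    _ = w p Λ * (|c| * β p) := by ring

theorem Bdd.sum {α : Type} (s : Finset α) {f : α → Par → ℝ → Config n₁ n₂ → ℝ}
    (hf' : ∀ a ∈ s, ∀ p Λ, ContDiff ℝ ∞ (f a p Λ)) (hf : ∀ a ∈ s, Bdd S C w (f a) z) :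
    Bdd S C w (fun p Λ k => ∑ a ∈ s, f a p Λ k) z := by
  classical
  induction s using Finset.induction_on with
  | empty => exact Bdd.of_eq_zero fun p Λ _ k => by simp
  | insert a s ha ih =>
    simp only [Finset.sum_insert ha]
    exact Bdd.add (hf' a (Finset.mem_insert_self a s))
      (fun p Λ => ContDiff.sum fun b hb => hf' b (Finset.mem_insert_of_mem hb) p Λ)
      (hf a (Finset.mem_insert_self a s))
      (ih (fun b hb => hf' b (Finset.mem_insert_of_mem hb))
        (fun b hb => hf b (Finset.mem_insert_of_mem hb)))

/-- The derivatives of all orders are bounded by the weight `w` and inverse powers of the light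
scale. -/
def ScaledBdd (S : Par → Set ℝ) (C : ℝ) (w : Par → ℝ → ℝ) (f : Par → ℝ → Config n₁ n₂ → ℝ) : Prop :=
  ∀ z, Bdd S C (fun p Λ => w p Λ * (p.u Λ)⁻¹ ^ z) f z

/-- In the Leibniz formula the powers `ρ ^ i` and `ρ ^ (z - i)` recombine, so a common cost `ρ` per
derivative passes to products. -/
theorem norm_iteratedFDeriv_mul_le_scaled {E : Type} [NormedAddCommGroup E] [NormedSpace ℝ E]
    {f g : E → ℝ} (hf : ContDiff ℝ ∞ f) (hg : ContDiff ℝ ∞ g) {x : E} {α β ρ : ℝ} {a b : ℕ → ℝ}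
    (ha : ∀ i, ‖iteratedFDeriv ℝ i f x‖ ≤ α * ρ ^ i * a i)
    (hb : ∀ i, ‖iteratedFDeriv ℝ i g x‖ ≤ β * ρ ^ i * b i) (z : ℕ) :
    ‖iteratedFDeriv ℝ z (fun y => f y * g y) x‖ ≤
      α * β * ρ ^ z * ∑ i ∈ Finset.range (z + 1), (z.choose i : ℝ) * (a i * b (z - i)) := by
  refine (norm_iteratedFDeriv_mul_le hf hg x (n := z) (by exact_mod_cast le_top)).trans ?_
  rw [Finset.mul_sum]
  refine Finset.sum_le_sum fun i hi => ?_
  have hi' : i ≤ z := by simpa [Nat.lt_succ_iff] using hi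
  calc (z.choose i : ℝ) * ‖iteratedFDeriv ℝ i f x‖ * ‖iteratedFDeriv ℝ (z - i) g x‖
      ≤ (z.choose i : ℝ) * (α * ρ ^ i * a i) * (β * ρ ^ (z - i) * b (z - i)) := by
        refine mul_le_mul (mul_le_mul_of_nonneg_left (ha i) (Nat.cast_nonneg _)) (hb _)
          (norm_nonneg _) (mul_nonneg (Nat.cast_nonneg _) ((norm_nonneg _).trans (ha i)))
    _ = α * β * (ρ ^ i * ρ ^ (z - i)) * ((z.choose i : ℝ) * (a i * b (z - i))) := by ring
    _ = _ := by rw [← pow_add, Nat.add_sub_cancel' hi']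

/-- Bounds on a propagator. -/
structure IsBddLine (S : Par → Set ℝ) (d : Par → ℝ → Mom → ℝ) : Prop where
  line : ∀ p, IsLine (d p)
  bound : ∀ z, ∃ c, 0 ≤ c ∧ ∀ p, ∀ Λ ∈ S p, ∀ q,
    ‖iteratedFDeriv ℝ z (d p Λ) q‖ ≤ c * ((p.u Λ)⁻¹) ^ (3 + z)

/-- If the line momentum exceeds `2Λ` the tree vanishes in a neighbourhood. Otherwise `2 ≤ C` puts
the line inside the balls, so both vertices are evaluated where they are bounded; `u⁻³` is the size
of the line. -/
theorem ScaledBdd.tree {d : Par → ℝ → Mom → ℝ} (hd : IsBddLine S d) (hS : ∀ p, ∀ Λ ∈ S p, 0 ≤ Λ)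
    (hC : 2 ≤ C) {φ : Config n₁ n₂ →L[ℝ] Mom}
    {A : Config n₁ n₂ →L[ℝ] Config l₁ l₂} {B : Config n₁ n₂ →L[ℝ] Config l₁' l₂'}
    (hs : IsSplitting φ A B) {f : Par → ℝ → Config l₁ l₂ → ℝ} {g : Par → ℝ → Config l₁' l₂' → ℝ}
    (hf' : ∀ p Λ, ContDiff ℝ ∞ (f p Λ)) (hg' : ∀ p Λ, ContDiff ℝ ∞ (g p Λ)) {w' : Par → ℝ → ℝ}
    (hw : ∀ p, ∀ Λ ∈ S p, 0 ≤ w p Λ) (hw' : ∀ p, ∀ Λ ∈ S p, 0 ≤ w' p Λ)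
    (hf : ScaledBdd S C w f) (hg : ScaledBdd S C w' g) :
    ScaledBdd S C (fun p Λ => (p.u Λ)⁻¹ ^ 3 * w p Λ * w' p Λ)
      (fun p Λ k => d p Λ (φ k) * f p Λ (A k) * g p Λ (B k)) := by
  choose c hc0 hc using hd.bound
  choose β hβ hb using hf
  choose γ hγ hg using hg
  set b₁ : Par → ℕ → ℝ := fun p z => ∑ i ∈ Finset.range (z + 1),
    (z.choose i : ℝ) * ((c i * ‖φ‖ ^ i) * (β (z - i) p * ‖A‖ ^ (z - i))) with hb₁
  set b₂ : Par → ℕ → ℝ := fun p z => ∑ i ∈ Finset.range (z + 1),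
    (z.choose i : ℝ) * (b₁ p i * (γ (z - i) p * ‖B‖ ^ (z - i))) with hb₂
  have hp₁ : ∀ z, IsPlog (fun p => b₁ p z) := fun z => IsPlog.sum _ fun i _ =>
    (IsPlog.const (Nat.cast_nonneg _)).mul ((IsPlog.const (mul_nonneg (hc0 i) (by positivity))).mul
      ((hβ _).mul (IsPlog.const (by positivity))))
  have hp₂ : ∀ z, IsPlog (fun p => b₂ p z) := fun z => IsPlog.sum _ fun i _ =>
    (IsPlog.const (Nat.cast_nonneg _)).mul ((hp₁ i).mul
      ((hγ _).mul (IsPlog.const (by positivity))))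
  intro z
  refine ⟨fun p => b₂ p z, hp₂ z, fun p Λ hΛ k hk => ?_⟩
  have hΛ0 := hS p Λ hΛ
  have hu := p.u_pos hΛ0
  have hdc : ContDiff ℝ ∞ (d p Λ) := contDiff_left_param (hd.line p).smooth Λ
  by_cases hφ : ‖φ k‖ ≤ 2 * Λ
  · have hm := p.m_pos
    have hM := p.M_pos
    obtain ⟨hA, hB⟩ := hs.mem _ _ k hk (hφ.trans (by nlinarith)) (hφ.trans (by nlinarith))
    have h1 : ∀ i, ‖iteratedFDeriv ℝ i (fun k => d p Λ (φ k)) k‖ ≤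
        (p.u Λ)⁻¹ ^ 3 * (p.u Λ)⁻¹ ^ i * (c i * ‖φ‖ ^ i) := fun i => by
      refine (norm_iteratedFDeriv_comp_clm_le φ hdc i k).trans ?_
      calc _ ≤ c i * ((p.u Λ)⁻¹) ^ (3 + i) * ‖φ‖ ^ i := by gcongr; exact hc i p Λ hΛ _
        _ = _ := by ring
    have h2 : ∀ i, ‖iteratedFDeriv ℝ i (fun k => f p Λ (A k)) k‖ ≤
        w p Λ * (p.u Λ)⁻¹ ^ i * (β i p * ‖A‖ ^ i) := fun i => by
      refine (norm_iteratedFDeriv_comp_clm_le A (hf' p Λ) i k).trans ?_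
      calc _ ≤ (w p Λ * (p.u Λ)⁻¹ ^ i * β i p) * ‖A‖ ^ i := by gcongr; exact hb i p Λ hΛ _ hA
        _ = _ := by ring
    have h3 : ∀ i, ‖iteratedFDeriv ℝ i (fun k => g p Λ (B k)) k‖ ≤
        w' p Λ * (p.u Λ)⁻¹ ^ i * (γ i p * ‖B‖ ^ i) := fun i => by
      refine (norm_iteratedFDeriv_comp_clm_le B (hg' p Λ) i k).trans ?_
      calc _ ≤ (w' p Λ * (p.u Λ)⁻¹ ^ i * γ i p) * ‖B‖ ^ i := by gcongr; exact hg i p Λ hΛ _ hB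
        _ = _ := by ring
    have c1 : ContDiff ℝ ∞ (fun k => d p Λ (φ k)) := hdc.comp φ.contDiff
    have c2 : ContDiff ℝ ∞ (fun k => f p Λ (A k)) := (hf' p Λ).comp A.contDiff
    have c3 : ContDiff ℝ ∞ (fun k => g p Λ (B k)) := (hg' p Λ).comp B.contDiff
    have h4 := norm_iteratedFDeriv_mul_le_scaled c1 c2 h1 h2
    exact norm_iteratedFDeriv_mul_le_scaled (c1.mul c2) c3 h4 h3 z
  · have h0 : (fun k => d p Λ (φ k) * f p Λ (A k) * g p Λ (B k)) =ᶠ[𝓝 k] fun _ => 0 := by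
      have : ∀ᶠ k' in 𝓝 k, 2 * Λ < ‖φ k'‖ :=
        continuousAt_const.eventually_lt φ.continuous.norm.continuousAt (not_le.1 hφ)
      filter_upwards [this] with k' hk'
      rw [(hd.line p).support Λ _ (by rwa [abs_of_nonneg hΛ0])]
      ring
    rw [(h0.iteratedFDeriv ℝ z).eq_of_nhds]
    have h5 : ‖iteratedFDeriv ℝ z (fun _ : Config n₁ n₂ => (0 : ℝ)) k‖ = 0 := by
      cases z with
      | zero => simp
      | succ z => simp
    rw [h5]
    have := hw p Λ hΛ
    have := hw' p Λ hΛ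
    have := (hp₂ z).1 p
    positivity

theorem exists_volume_closedBall_le :
    ∃ c, 0 ≤ c ∧ ∀ u Λ : ℝ, 0 ≤ Λ → Λ ≤ u →
      (volume : Measure Mom).real (Metric.closedBall 0 (2 * |Λ|)) ≤ c * u ^ 4 := by
  refine ⟨(volume : Measure Mom).real (Metric.closedBall 0 2), measureReal_nonneg,
    fun u Λ hΛ hu => ?_⟩
  have hu0 : 0 ≤ u := hΛ.trans hu
  have h := Measure.addHaar_closedBall_mul (volume : Measure Mom) (0 : Mom) hu0
    (s := 2) (by norm_num)
  rw [finrank_euclideanSpace_fin] at h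
  have h2 : (volume : Measure Mom).real (Metric.closedBall 0 (u * 2)) =
      (volume : Measure Mom).real (Metric.closedBall 0 2) * u ^ 4 := by
    rw [measureReal_def, h, ENNReal.toReal_mul, ENNReal.toReal_ofReal (by positivity), mul_comm,
      measureReal_def]
  rw [← h2]
  refine measureReal_mono (Metric.closedBall_subset_closedBall ?_) ?_
  · rw [abs_of_nonneg hΛ]; linarith
  · exact (isCompact_closedBall _ _).measure_ne_top

/-- The line gives `u⁻³` and the ball of radius `2Λ ≤ 2u` in four dimensions a volume of order `u⁴`:
together one power of `u`. -/
theorem ScaledBdd.loop {d : Par → ℝ → Mom → ℝ} (hd : IsBddLine S d) (hS : ∀ p, ∀ Λ ∈ S p, 0 ≤ Λ)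
    (hC : 2 ≤ C) {T : Config n₁ n₂ × Mom →L[ℝ] Config l₁ l₂} (hT : IsInsertion T)
    {f : Par → ℝ → Config l₁ l₂ → ℝ} (hf' : ∀ p Λ, ContDiff ℝ ∞ (f p Λ))
    (hf : ScaledBdd S C w f) :
    ScaledBdd S C (fun p Λ => p.u Λ * w p Λ)
      (fun p Λ k => ∫ q, d p Λ q * f p Λ (T (k, q))) := by
  obtain ⟨c, hc0, hc⟩ := hd.bound 0
  obtain ⟨v, hv0, hv⟩ := exists_volume_closedBall_le
  set T₁ : Config n₁ n₂ →L[ℝ] Config l₁ l₂ := T.comp (ContinuousLinearMap.inl ℝ _ _) with hT₁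
  have hTeq : ∀ k q, T (k, q) = T₁ k + T (0, q) := fun k q => by
    simp [hT₁, ← map_add]
  intro z
  obtain ⟨β, hβ, hb⟩ := hf z
  refine ⟨fun p => c * v * ‖T₁‖ ^ z * β p, (IsPlog.const (by positivity)).mul hβ,
    fun p Λ hΛ k hk => ?_⟩
  have hΛ0 := hS p Λ hΛ
  have hu := p.u_pos hΛ0
  have hdc : ContDiff ℝ ∞ (d p Λ) := contDiff_left_param (hd.line p).smooth Λ
  have h1 : (fun k => ∫ q, d p Λ q * f p Λ (T (k, q))) =
      fun k => ∫ q in Metric.closedBall (0 : Mom) (2 * |Λ|), d p Λ q * f p Λ (T (k, q)) :=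
    funext fun k => (hd.line p).integral_eq le_rfl _
  dsimp only
  rw [h1]
  have hg : ContDiff ℝ ∞ (fun x : Config n₁ n₂ × Mom => d p Λ x.2 * f p Λ (T (x.1, x.2))) :=
    (hdc.comp contDiff_snd).mul ((hf' p Λ).comp T.contDiff)
  refine (norm_iteratedFDeriv_setIntegral_param_le (isCompact_closedBall _ _) hg z k
    (B := c * (p.u Λ)⁻¹ ^ 3 * (w p Λ * (p.u Λ)⁻¹ ^ z * β p * ‖T₁‖ ^ z)) fun q hq => ?_).trans ?_
  · rw [mem_closedBall_zero_iff, abs_of_nonneg hΛ0] at hq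
    have hm := p.m_pos
    have hM := p.M_pos
    have hTk : T (k, q) ∈ p.ball C Λ l₁ l₂ :=
      hT.mem _ _ k hk q (hq.trans (by nlinarith)) (hq.trans (by nlinarith))
    have hshift : ContDiff ℝ ∞ (fun y => f p Λ (y + T (0, q))) :=
      (hf' p Λ).comp (contDiff_id.add contDiff_const)
    have h2 : (fun y => d p Λ q * f p Λ (T (y, q))) =
        fun y => d p Λ q * (fun y => f p Λ (y + T (0, q))) (T₁ y) := by
      ext y; simp only [← hTeq]
    rw [h2, norm_iteratedFDeriv_const_mul_le
      (f := fun y => (fun y => f p Λ (y + T (0, q))) (T₁ y)) (hshift.comp T₁.contDiff)]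
    have h3 := norm_iteratedFDeriv_comp_clm_le T₁ hshift z k
    rw [iteratedFDeriv_comp_add_right, ← hTeq] at h3
    have h4 := hc p Λ hΛ q
    rw [norm_iteratedFDeriv_zero, Real.norm_eq_abs] at h4
    refine mul_le_mul h4 (h3.trans ?_) (norm_nonneg _) (by positivity)
    gcongr
    exact hb p Λ hΛ _ hTk
  -- Non-negativity of the vertex bound is read off at the zero configuration, which lies in the
  -- ball.
  · have hB : 0 ≤ c * (p.u Λ)⁻¹ ^ 3 * (w p Λ * (p.u Λ)⁻¹ ^ z * β p * ‖T₁‖ ^ z) := by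
      have := (norm_nonneg _).trans (hb p Λ hΛ (0 : Config l₁ l₂) ?_)
      · positivity
      · have hm := p.m_pos
        have hM := p.M_pos
        have h0 : ∀ j, allLegs l₁ l₂ (0 : Config l₁ l₂) j = 0 := fun j => by
          unfold allLegs; split_ifs <;> simp
        refine ⟨fun j _ => ?_, fun j _ => ?_⟩
        · rw [lightLegs, h0, norm_zero]; positivity
        · rw [heavyLegs, h0, norm_zero]; positivity
    have hvol := hv (p.u Λ) Λ hΛ0 (by unfold Par.u; linarith [p.m_pos])
    refine (mul_le_mul_of_nonneg_left hvol hB).trans (le_of_eq ?_)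
    field_simp

end Bounds


/-! ### The weights and the two kinds of lines -/

section Weights

variable {n₁ n₂ l₁ l₂ l₁' l₂' : ℕ} {C : ℝ}

/-- All scales below the ultraviolet cutoff. -/
def Par.scales (p : Par) : Set ℝ := Icc 0 p.L0

/-- The scales at which the heavy line does not vanish. -/
def Par.heavyScales (p : Par) : Set ℝ := Icc p.M p.L0

theorem Par.nonneg_of_mem_scales (p : Par) : ∀ Λ ∈ p.scales, 0 ≤ Λ := fun _ h => h.1

theorem Par.nonneg_of_mem_heavyScales (p : Par) : ∀ Λ ∈ p.heavyScales, 0 ≤ Λ := fun _ h =>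
  p.M_pos.le.trans h.1

/-- The naive weight, of degree `θ` in the infrared scale of the vertex. -/
noncomputable def baseWeight (θ n₂ : ℕ) (e : ℤ) (p : Par) (Λ : ℝ) : ℝ := p.X n₂ Λ ^ θ * p.u Λ ^ e

/-- The weight for vertex functions of dimension `4 - D`. -/
noncomputable def weight (θ n₂ D : ℕ) (p : Par) (Λ : ℝ) : ℝ :=
  if D ≤ 4 then p.X n₂ Λ ^ (4 + θ - D) else baseWeight θ n₂ (4 - D) p Λ

theorem baseWeight_pos (θ n₂ : ℕ) (e : ℤ) (p : Par) {Λ : ℝ} (hΛ : 0 ≤ Λ) :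
    0 < baseWeight θ n₂ e p Λ :=
  mul_pos (pow_pos (p.X_pos n₂ hΛ) _) (zpow_pos (p.u_pos hΛ) _)

theorem weight_pos (θ n₂ D : ℕ) (p : Par) {Λ : ℝ} (hΛ : 0 ≤ Λ) : 0 < weight θ n₂ D p Λ := by
  unfold weight
  split_ifs
  · exact pow_pos (p.X_pos n₂ hΛ) _
  · exact baseWeight_pos _ _ _ p hΛ

theorem baseWeight_mul_inv_pow (θ n₂ : ℕ) (e : ℤ) (z : ℕ) (p : Par) {Λ : ℝ} (hΛ : 0 ≤ Λ) :
    baseWeight θ n₂ e p Λ * (p.u Λ)⁻¹ ^ z = baseWeight θ n₂ (e - z) p Λ := by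
  have hu := (p.u_pos hΛ).ne'
  rw [baseWeight, baseWeight, mul_assoc, inv_pow, zpow_sub₀ hu, zpow_natCast, div_eq_mul_inv]

theorem u_mul_baseWeight (θ n₂ : ℕ) (e : ℤ) (p : Par) {Λ : ℝ} (hΛ : 0 ≤ Λ) :
    p.u Λ * baseWeight θ n₂ e p Λ = baseWeight θ n₂ (e + 1) p Λ := by
  have hu := (p.u_pos hΛ).ne'
  rw [baseWeight, baseWeight, zpow_add_one₀ hu]
  ring

theorem baseWeight_mono_legs (θ : ℕ) {a b : ℕ} (h : a ≤ b) (e : ℤ) (p : Par) {Λ : ℝ} (hΛ : 0 ≤ Λ) :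
    baseWeight θ a e p Λ ≤ baseWeight θ b e p Λ := by
  have h1 := p.X_mono_legs h Λ
  have h2 := (p.X_pos a hΛ).le
  have h3 := zpow_nonneg (p.u_pos hΛ).le e
  unfold baseWeight
  gcongr

theorem baseWeight_mul (θ θ' a b : ℕ) (e e' : ℤ) {c : ℕ} (ha : a ≤ c) (hb : b ≤ c) (p : Par) {Λ : ℝ}
    (hΛ : 0 ≤ Λ) : baseWeight θ a e p Λ * baseWeight θ' b e' p Λ ≤
      baseWeight (θ + θ') c (e + e') p Λ := by
  refine (mul_le_mul (baseWeight_mono_legs θ ha e p hΛ) (baseWeight_mono_legs θ' hb e' p hΛ)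
    (baseWeight_pos _ _ _ p hΛ).le (baseWeight_pos _ _ _ p hΛ).le).trans_eq ?_
  have hu := (p.u_pos hΛ).ne'
  unfold baseWeight
  rw [zpow_add₀ hu, pow_add]
  ring

/-- Without heavy legs `X = u`, and at `D = 4` both forms are `X ^ θ`. What is left out is the heavy
two-point function with fewer than two derivatives. -/
theorem weight_eq_baseWeight {D : ℕ} (θ : ℕ) (h : n₂ = 0 ∨ 4 ≤ D) (p : Par) {Λ : ℝ} (hΛ : 0 ≤ Λ) :
    weight θ n₂ D p Λ = baseWeight θ n₂ (4 - D) p Λ := by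
  unfold weight
  split_ifs with h4
  · have hu := (p.u_pos hΛ).ne'
    rcases h with rfl | h
    · have : p.X 0 Λ = p.u Λ := rfl
      rw [baseWeight, this, ← zpow_natCast, ← zpow_natCast, ← zpow_add₀ hu]
      congr 1
      omega
    · obtain rfl : D = 4 := by omega
      simp [baseWeight]
  · rfl

/-- Each `X` is replaced by `2u`, and its exponent is at most `4 + θ` in both branches. -/
theorem weight_le_of_M_le (θ D : ℕ) (p : Par) {Λ : ℝ} (hΛ : p.M ≤ Λ) :
    weight θ n₂ D p Λ ≤ 2 ^ (4 + θ) * baseWeight θ 0 (4 - D) p Λ := by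
  have h0 : 0 ≤ Λ := p.M_pos.le.trans hΛ
  have hX := p.X_le_of_M_le n₂ hΛ
  have hX0 := (p.X_pos n₂ h0).le
  have hu := p.u_pos h0
  have e0 : p.X 0 Λ = p.u Λ := rfl
  unfold weight
  split_ifs with h4
  · have h1 : baseWeight θ 0 (4 - D) p Λ = p.u Λ ^ (4 + θ - D) := by
      rw [baseWeight, e0, ← zpow_natCast, ← zpow_natCast, ← zpow_add₀ hu.ne']
      congr 1
      omega
    rw [h1]
    calc p.X n₂ Λ ^ (4 + θ - D) ≤ (2 * p.u Λ) ^ (4 + θ - D) := by gcongr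
      _ = 2 ^ (4 + θ - D) * p.u Λ ^ (4 + θ - D) := mul_pow _ _ _
      _ ≤ 2 ^ (4 + θ) * p.u Λ ^ (4 + θ - D) := by
        gcongr
        · norm_num
        · omega
  · unfold baseWeight
    rw [e0]
    have h3 := zpow_nonneg hu.le (4 - D : ℤ)
    calc p.X n₂ Λ ^ θ * p.u Λ ^ (4 - D : ℤ) ≤ (2 * p.u Λ) ^ θ * p.u Λ ^ (4 - D : ℤ) := by gcongr
      _ = 2 ^ θ * (p.u Λ ^ θ * p.u Λ ^ (4 - D : ℤ)) := by rw [mul_pow]; ring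
      _ ≤ 2 ^ (4 + θ) * (p.u Λ ^ θ * p.u Λ ^ (4 - D : ℤ)) := by
        gcongr
        · norm_num
        · omega

/-- The bounds on a vertex function and on all its derivatives. -/
def HasWeight (C : ℝ) (θ : ℕ) (f : Par → ℝ → Config n₁ n₂ → ℝ) : Prop :=
  ∀ z, Bdd Par.scales C (weight θ n₂ (2 * (n₁ + n₂) + z)) f z

/-- Among nonempty vertices the hypothesis excludes only the heavy two-point function. That one has
no light leg, so this form suffices for every end of a light line. -/
theorem HasWeight.scaled {θ : ℕ} {f : Par → ℝ → Config n₁ n₂ → ℝ} (h : HasWeight C θ f)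
    (hn : n₂ = 0 ∨ 2 ≤ n₁ + n₂) :
    ScaledBdd Par.scales C (baseWeight θ n₂ (4 - 2 * (n₁ + n₂ : ℕ))) f := fun z => by
  refine (h z).mono zero_le_one (fun p => subset_rfl) fun p Λ hΛ => ?_
  rw [one_mul, baseWeight_mul_inv_pow _ _ _ _ _ hΛ.1, weight_eq_baseWeight θ (by omega) p hΛ.1]
  push_cast
  rw [sub_sub]

/-- For `M ≤ Λ` every weight is comparable to the light one, the heavy two-point function included;
heavy lines need no other scales. -/
theorem HasWeight.scaled_heavy {θ : ℕ} {f : Par → ℝ → Config n₁ n₂ → ℝ} (h : HasWeight C θ f) :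
    ScaledBdd Par.heavyScales C (baseWeight θ 0 (4 - 2 * (n₁ + n₂ : ℕ))) f := fun z => by
  refine (h z).mono (c := 2 ^ (4 + θ)) (by positivity)
    (fun p => Icc_subset_Icc_left p.M_pos.le) fun p Λ hΛ => ?_
  rw [baseWeight_mul_inv_pow _ _ _ _ _ (p.nonneg_of_mem_heavyScales Λ hΛ)]
  refine (weight_le_of_M_le θ _ p hΛ.1).trans_eq ?_
  push_cast
  rw [sub_sub]

theorem ScaledBdd.mono {S : Par → Set ℝ} {w w' : Par → ℝ → ℝ} {f : Par → ℝ → Config n₁ n₂ → ℝ}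
    (h : ScaledBdd S C w f) (hS : ∀ p, ∀ Λ ∈ S p, 0 ≤ Λ) (hw : ∀ p, ∀ Λ ∈ S p, w p Λ ≤ w' p Λ) :
    ScaledBdd S C w' f := fun z => by
  refine (h z).mono zero_le_one (fun p => subset_rfl) fun p Λ hΛ => ?_
  rw [one_mul]
  have := p.u_pos (hS p Λ hΛ)
  have := hw p Λ hΛ
  gcongr

theorem ScaledBdd.extend {w : Par → ℝ → ℝ} {f : Par → ℝ → Config n₁ n₂ → ℝ}
    (h : ScaledBdd Par.heavyScales C w f) (hw : ∀ p Λ, 0 ≤ Λ → 0 ≤ w p Λ)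
    (hf : ∀ p Λ k, 0 ≤ Λ → Λ < p.M → f p Λ k = 0) : ScaledBdd Par.scales C w f := fun z => by
  refine Bdd.union (fun p Λ hΛ => ?_) (h z)
    (Bdd.of_eq_zero (S := fun p => Ico 0 p.M) fun p Λ hΛ k => hf p Λ k hΛ.1 hΛ.2) fun p Λ hΛ => ?_
  · have := p.u_pos hΛ.1
    have := hw p Λ hΛ.1
    positivity
  · rcases lt_or_ge Λ p.M with h | h
    · exact Or.inr ⟨hΛ.1, h⟩
    · exact Or.inl ⟨h, hΛ.2⟩

theorem ScaledBdd.add {S : Par → Set ℝ} {w : Par → ℝ → ℝ} {f g : Par → ℝ → Config n₁ n₂ → ℝ}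
    (hf' : ∀ p Λ, ContDiff ℝ ∞ (f p Λ)) (hg' : ∀ p Λ, ContDiff ℝ ∞ (g p Λ))
    (hf : ScaledBdd S C w f) (hg : ScaledBdd S C w g) :
    ScaledBdd S C w (fun p Λ k => f p Λ k + g p Λ k) := fun z => (hf z).add hf' hg' (hg z)

theorem ScaledBdd.const_mul {S : Par → Set ℝ} {w : Par → ℝ → ℝ} {f : Par → ℝ → Config n₁ n₂ → ℝ}
    (hf' : ∀ p Λ, ContDiff ℝ ∞ (f p Λ)) (hf : ScaledBdd S C w f) (c : ℝ) :
    ScaledBdd S C w (fun p Λ k => c * f p Λ k) := fun z => (hf z).const_mul hf' c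

variable {K : ℝ → ℝ}

theorem isBddLine_light (hK : IsCutoffProfile K) :
    IsBddLine Par.scales (fun p => dpropLight K p.m) where
  line p := isLine_dpropLight hK p.m_pos
  bound z := by
    obtain ⟨c, hc0, hc⟩ := exists_dpropLight_bound hK z
    exact ⟨c, hc0, fun p Λ hΛ q => hc p.m Λ p.m_pos hΛ.1 q⟩

theorem isBddLine_heavy (hK : IsCutoffProfile K) :
    IsBddLine Par.heavyScales (fun p => dpropHeavy K p.M) where
  line p := isLine_dpropHeavy hK p.M_pos
  bound z := by
    obtain ⟨c, hc0, hc⟩ := exists_dpropHeavy_bound hK z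
    refine ⟨c, hc0, fun p Λ hΛ q => (hc p.M Λ p.M_pos (p.nonneg_of_mem_heavyScales Λ hΛ) q).trans ?_⟩
    have h1 := p.u_pos (p.nonneg_of_mem_heavyScales Λ hΛ)
    have h2 : p.u Λ ≤ Λ + p.M := by unfold Par.u; linarith [p.m_lt]
    have h3 : 0 ≤ (Λ + p.M)⁻¹ := inv_nonneg.2 (h1.le.trans h2)
    gcongr

end Weights

/-! ### Power counting for single terms -/

section RHSBounds

variable {n₁ n₂ l₁ l₂ l₁' l₂' : ℕ} {C : ℝ} {K : ℝ → ℝ}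

/-- The exponent is `1 + 4 - 2(|n| + 1)`. The vertex has at least two pairs of legs, so its weight
has the naive form. -/
theorem scaledBdd_loopLight (hK : IsCutoffProfile K) (hC : 2 ≤ C) (hn : 1 ≤ n₁ + n₂) {θ : ℕ}
    {f : Par → ℝ → Config (n₁ + 1) n₂ → ℝ} (hf' : ∀ p Λ, ContDiff ℝ ∞ (f p Λ))
    (hf : HasWeight C θ f) :
    ScaledBdd Par.scales C (baseWeight θ n₂ (3 - 2 * (n₁ + n₂ : ℕ)))
      (fun p Λ k => loopLight K p.m Λ n₁ n₂ (f p Λ) k) := by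
  obtain ⟨T, hT, he⟩ := exists_insertLight hn
  have h := ScaledBdd.loop (isBddLine_light hK) Par.nonneg_of_mem_scales hC hT hf'
    (hf.scaled (by omega))
  simp_rw [loopLight, ← he]
  refine h.mono Par.nonneg_of_mem_scales fun p Λ hΛ => ?_
  rw [u_mul_baseWeight _ _ _ _ hΛ.1]
  exact le_of_eq (by congr 1; push_cast; ring)

theorem scaledBdd_loopHeavy (hK : IsCutoffProfile K) (hC : 2 ≤ C) (hn : 1 ≤ n₁ + n₂) {θ : ℕ}
    {f : Par → ℝ → Config n₁ (n₂ + 1) → ℝ} (hf' : ∀ p Λ, ContDiff ℝ ∞ (f p Λ))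
    (hf : HasWeight C θ f) :
    ScaledBdd Par.scales C (baseWeight θ n₂ (3 - 2 * (n₁ + n₂ : ℕ)))
      (fun p Λ k => loopHeavy K p.M Λ n₁ n₂ (f p Λ) k) := by
  obtain ⟨T, hT, he⟩ := exists_insertHeavy hn
  have h := ScaledBdd.loop (isBddLine_heavy hK) Par.nonneg_of_mem_heavyScales hC hT hf'
    hf.scaled_heavy
  simp_rw [loopHeavy, ← he]
  refine (h.mono Par.nonneg_of_mem_heavyScales (w' := baseWeight θ n₂ (3 - 2 * (n₁ + n₂ : ℕ)))
    fun p Λ hΛ => ?_).extend (fun p Λ hΛ => (baseWeight_pos _ _ _ p hΛ).le) fun p Λ k h0 h1 => ?_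
  · have h0 := p.nonneg_of_mem_heavyScales Λ hΛ
    rw [u_mul_baseWeight _ _ _ _ h0]
    refine (baseWeight_mono_legs θ (Nat.zero_le n₂) _ p h0).trans_eq ?_
    congr 1; push_cast; ring
  · simp [dpropHeavy_eq_zero hK h0 h1]

/-- Power counting for trees: `-3 + (4 - 2N) + (4 - 2N') = 3 - 2n`, because a line uses up one pair
of legs. -/
theorem inv_pow_three_mul_baseWeight_le {θ θ' N N' a b c : ℕ} (ha : a ≤ c) (hb : b ≤ c) {n : ℕ}
    (hN : N + N' = n + 1) (p : Par) {Λ : ℝ} (hΛ : 0 ≤ Λ) :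
    (p.u Λ)⁻¹ ^ 3 * baseWeight θ a (4 - 2 * N) p Λ * baseWeight θ' b (4 - 2 * N') p Λ ≤
      baseWeight (θ + θ') c (3 - 2 * n) p Λ := by
  have h1 := baseWeight_mul θ θ' a b (4 - 2 * N) (4 - 2 * N') ha hb p hΛ
  have hu := p.u_pos hΛ
  calc _ = (baseWeight θ a (4 - 2 * N) p Λ * baseWeight θ' b (4 - 2 * N') p Λ) * (p.u Λ)⁻¹ ^ 3 := by
        ring
    _ ≤ baseWeight (θ + θ') c (4 - 2 * N + (4 - 2 * N')) p Λ * (p.u Λ)⁻¹ ^ 3 := by gcongr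
    _ = baseWeight (θ + θ') c (3 - 2 * n) p Λ := by
      rw [baseWeight_mul_inv_pow _ _ _ _ _ hΛ]
      congr 1
      push_cast
      omega

theorem scaledBdd_symmTreeLight (hK : IsCutoffProfile K) (hC : 2 ≤ C) (hn : 1 ≤ n₁ + n₂)
    (h₁ : l₁ + l₁' = n₁ + 1) (h₂ : l₂ + l₂' = n₂) (hl : 0 < l₁) (hl' : 0 < l₁') {θ θ' : ℕ}
    {f : Par → ℝ → Config l₁ l₂ → ℝ} {g : Par → ℝ → Config l₁' l₂' → ℝ}
    (hf' : ∀ p Λ, ContDiff ℝ ∞ (f p Λ)) (hg' : ∀ p Λ, ContDiff ℝ ∞ (g p Λ))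
    (hf : HasWeight C θ f) (hg : HasWeight C θ' g) :
    (∀ p Λ, ContDiff ℝ ∞ (symmTreeLight K p.m Λ n₁ n₂ l₁ l₂ l₁' l₂' (f p Λ) (g p Λ))) ∧
    ScaledBdd Par.scales C (baseWeight (θ + θ') n₂ (3 - 2 * (n₁ + n₂ : ℕ)))
      (fun p Λ k => symmTreeLight K p.m Λ n₁ n₂ l₁ l₂ l₁' l₂' (f p Λ) (g p Λ) k) := by
  obtain ⟨ι, _, c, φ, A, B, hs, he⟩ := exists_symmTreeLight hn h₁ h₂ hl hl'
  have hsm : ∀ i p Λ, ContDiff ℝ ∞ (fun k => dpropLight K p.m Λ (φ i k) * f p Λ (A i k) *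
      g p Λ (B i k)) := fun i p Λ =>
    (((contDiff_left_param (isLine_dpropLight hK p.m_pos).smooth Λ).comp (φ i).contDiff).mul
      ((hf' p Λ).comp (A i).contDiff)).mul ((hg' p Λ).comp (B i).contDiff)
  have he' : ∀ p Λ, symmTreeLight K p.m Λ n₁ n₂ l₁ l₂ l₁' l₂' (f p Λ) (g p Λ) =
      fun k => c * ∑ i, dpropLight K p.m Λ (φ i k) * f p Λ (A i k) * g p Λ (B i k) :=
    fun p Λ => funext fun k => he K p.m Λ _ _ k
  simp_rw [he']
  have hsum : ∀ p Λ, ContDiff ℝ ∞ (fun k => ∑ i, dpropLight K p.m Λ (φ i k) * f p Λ (A i k) *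
      g p Λ (B i k)) := fun p Λ => ContDiff.sum fun i _ => hsm i p Λ
  refine ⟨fun p Λ => contDiff_const.mul (hsum p Λ), ScaledBdd.const_mul hsum (fun z =>
    Bdd.sum _ (fun i _ => hsm i) fun i _ => ?_) c⟩
  exact (ScaledBdd.tree (isBddLine_light hK) Par.nonneg_of_mem_scales hC (hs i) hf' hg'
    (fun p Λ hΛ => (baseWeight_pos _ _ _ p hΛ.1).le)
    (fun p Λ hΛ => (baseWeight_pos _ _ _ p hΛ.1).le) (hf.scaled (by omega))
    (hg.scaled (by omega))).mono Par.nonneg_of_mem_scales (fun p Λ hΛ =>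
      inv_pow_three_mul_baseWeight_le (by omega) (by omega) (by omega) p hΛ.1) z

theorem scaledBdd_symmTreeHeavy (hK : IsCutoffProfile K) (hC : 2 ≤ C) (hn : 1 ≤ n₁ + n₂)
    (h₁ : l₁ + l₁' = n₁) (h₂ : l₂ + l₂' = n₂ + 1) (hl : 0 < l₂) (hl' : 0 < l₂') {θ θ' : ℕ}
    {f : Par → ℝ → Config l₁ l₂ → ℝ} {g : Par → ℝ → Config l₁' l₂' → ℝ}
    (hf' : ∀ p Λ, ContDiff ℝ ∞ (f p Λ)) (hg' : ∀ p Λ, ContDiff ℝ ∞ (g p Λ))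
    (hf : HasWeight C θ f) (hg : HasWeight C θ' g) :
    (∀ p Λ, ContDiff ℝ ∞ (symmTreeHeavy K p.M Λ n₁ n₂ l₁ l₂ l₁' l₂' (f p Λ) (g p Λ))) ∧
    ScaledBdd Par.scales C (baseWeight (θ + θ') n₂ (3 - 2 * (n₁ + n₂ : ℕ)))
      (fun p Λ k => symmTreeHeavy K p.M Λ n₁ n₂ l₁ l₂ l₁' l₂' (f p Λ) (g p Λ) k) := by
  obtain ⟨ι, _, c, φ, A, B, hs, he⟩ := exists_symmTreeHeavy hn h₁ h₂ hl hl'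
  have hsm : ∀ i p Λ, ContDiff ℝ ∞ (fun k => dpropHeavy K p.M Λ (φ i k) * f p Λ (A i k) *
      g p Λ (B i k)) := fun i p Λ =>
    (((contDiff_left_param (isLine_dpropHeavy hK p.M_pos).smooth Λ).comp (φ i).contDiff).mul
      ((hf' p Λ).comp (A i).contDiff)).mul ((hg' p Λ).comp (B i).contDiff)
  have he' : ∀ p Λ, symmTreeHeavy K p.M Λ n₁ n₂ l₁ l₂ l₁' l₂' (f p Λ) (g p Λ) =
      fun k => c * ∑ i, dpropHeavy K p.M Λ (φ i k) * f p Λ (A i k) * g p Λ (B i k) :=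
    fun p Λ => funext fun k => he K p.M Λ _ _ k
  simp_rw [he']
  have hsum : ∀ p Λ, ContDiff ℝ ∞ (fun k => ∑ i, dpropHeavy K p.M Λ (φ i k) * f p Λ (A i k) *
      g p Λ (B i k)) := fun p Λ => ContDiff.sum fun i _ => hsm i p Λ
  refine ⟨fun p Λ => contDiff_const.mul (hsum p Λ), ScaledBdd.const_mul hsum (fun z =>
    Bdd.sum _ (fun i _ => hsm i) fun i _ => ?_) c⟩
  refine ((ScaledBdd.tree (isBddLine_heavy hK) Par.nonneg_of_mem_heavyScales hC (hs i) hf' hg'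
    (fun p Λ hΛ => (baseWeight_pos _ _ _ p (p.nonneg_of_mem_heavyScales Λ hΛ)).le)
    (fun p Λ hΛ => (baseWeight_pos _ _ _ p (p.nonneg_of_mem_heavyScales Λ hΛ)).le)
    hf.scaled_heavy hg.scaled_heavy).mono Par.nonneg_of_mem_heavyScales (fun p Λ hΛ =>
      inv_pow_three_mul_baseWeight_le (Nat.zero_le n₂) (Nat.zero_le n₂) (n := n₁ + n₂) (by omega) p
        (p.nonneg_of_mem_heavyScales Λ hΛ))).extend (fun p Λ hΛ => (baseWeight_pos _ _ _ p hΛ).le)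
      (fun p Λ k h0 h1 => ?_) z
  simp [dpropHeavy_eq_zero hK h0 h1]

end RHSBounds


/-! ### Power counting for the whole right-hand side -/

section FamilyBounds

variable {n₁ n₂ : ℕ} {C : ℝ} {K : ℝ → ℝ} {θ θ' : ℕ} {L D : Par → VertexFamily}

theorem HasWeight.of_eq_zero {f : Par → ℝ → Config n₁ n₂ → ℝ} (h : ∀ p Λ k, f p Λ k = 0) :
    HasWeight C θ f := fun _ => Bdd.of_eq_zero fun p Λ _ k => h p Λ k

/-- All vertex functions are smooth in the momenta. -/
def IsMomSmooth (L : Par → VertexFamily) : Prop :=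
  ∀ r n₁ n₂, 1 ≤ n₁ + n₂ → ∀ p Λ, ContDiff ℝ ∞ (L p r n₁ n₂ Λ)

theorem Bdd.smooth_sum {α : Type} (s : Finset α) {f : α → Par → ℝ → Config n₁ n₂ → ℝ}
    {w : Par → ℝ → ℝ} {S : Par → Set ℝ}
    (h : ∀ a ∈ s, (∀ p Λ, ContDiff ℝ ∞ (f a p Λ)) ∧ ScaledBdd S C w (f a)) :
    (∀ p Λ, ContDiff ℝ ∞ (fun k => ∑ a ∈ s, f a p Λ k)) ∧
      ScaledBdd S C w (fun p Λ k => ∑ a ∈ s, f a p Λ k) :=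
  ⟨fun p Λ => ContDiff.sum fun a ha => (h a ha).1 p Λ,
    fun z => Bdd.sum s (fun a ha => (h a ha).1) fun a ha => (h a ha).2 z⟩

theorem scaledBdd_smooth_zero {w : Par → ℝ → ℝ} {S : Par → Set ℝ}
    {f : Par → ℝ → Config n₁ n₂ → ℝ} (h : ∀ p Λ k, f p Λ k = 0) :
    (∀ p Λ, ContDiff ℝ ∞ (f p Λ)) ∧ ScaledBdd S C w f := by
  refine ⟨fun p Λ => ?_, fun z => Bdd.of_eq_zero fun p Λ _ k => h p Λ k⟩
  rw [show f p Λ = fun _ => 0 from funext (h p Λ)]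
  exact contDiff_const

/-- The exponents `θ` add in a product. Two families are needed for the linearized flow, where one
factor has `θ = 0` and the differentiated one `θ = 2`. -/
theorem scaledBdd_treesLight (hK : IsCutoffProfile K) (hC : 2 ≤ C) (hn : 1 ≤ n₁ + n₂)
    (hL : IsMomSmooth L) (hD : IsMomSmooth D) (hLc : ∀ p Λ, IsConnectedAt (L p) Λ)
    (hDc : ∀ p Λ, IsConnectedAt (D p) Λ) (r : Fin 3 → ℕ)
    (hLw : ∀ s l₁ l₂, 1 ≤ l₁ + l₂ → ∑ i, s i < ∑ i, r i →
      HasWeight C θ (fun p Λ k => L p s l₁ l₂ Λ k))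
    (hDw : ∀ s l₁ l₂, 1 ≤ l₁ + l₂ → ∑ i, s i < ∑ i, r i →
      HasWeight C θ' (fun p Λ k => D p s l₁ l₂ Λ k)) :
    (∀ p Λ, ContDiff ℝ ∞ (treesLight K p.m (L p) (D p) r n₁ n₂ Λ)) ∧
    ScaledBdd Par.scales C (baseWeight (θ + θ') n₂ (3 - 2 * (n₁ + n₂ : ℕ)))
      (fun p Λ k => treesLight K p.m (L p) (D p) r n₁ n₂ Λ k) := by
  unfold treesLight
  refine Bdd.smooth_sum _ fun s hs => Bdd.smooth_sum _ fun l hl => Bdd.smooth_sum _ fun h hh => ?_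
  rw [Finset.mem_Iic] at hs
  rw [Finset.HasAntidiagonal.mem_antidiagonal] at hl hh
  rcases Nat.eq_zero_or_pos l.1 with h0 | hl1
  · exact scaledBdd_smooth_zero fun p Λ k => by simp [h0]
  rcases Nat.eq_zero_or_pos l.2 with h0 | hl2
  · exact scaledBdd_smooth_zero fun p Λ k => by simp [h0]
  by_cases hs0 : s = 0
  · refine scaledBdd_smooth_zero fun p Λ k => ?_
    subst hs0
    rw [symmTreeLight_zero_left ((hLc p Λ).zero _ _ (by omega)), mul_zero]
  by_cases hsr : s = r
  · refine scaledBdd_smooth_zero fun p Λ k => ?_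
    subst hsr
    rw [tsub_self, symmTreeLight_zero_right _ ((hDc p Λ).zero _ _ (by omega)), mul_zero]
  have h5 := scaledBdd_symmTreeLight hK hC hn hl hh hl1 hl2
    (hL s l.1 h.1 (by omega)) (hD (r - s) l.2 h.2 (by omega))
    (hLw s l.1 h.1 (by omega) (sum_lt_of_le_of_ne hs hsr))
    (hDw (r - s) l.2 h.2 (by omega) (sum_sub_lt hs hs0))
  exact ⟨fun p Λ => contDiff_const.mul (h5.1 p Λ), ScaledBdd.const_mul h5.1 h5.2 _⟩

theorem scaledBdd_treesHeavy (hK : IsCutoffProfile K) (hC : 2 ≤ C) (hn : 1 ≤ n₁ + n₂)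
    (hL : IsMomSmooth L) (hD : IsMomSmooth D) (hLc : ∀ p Λ, IsConnectedAt (L p) Λ)
    (hDc : ∀ p Λ, IsConnectedAt (D p) Λ) (r : Fin 3 → ℕ)
    (hLw : ∀ s l₁ l₂, 1 ≤ l₁ + l₂ → ∑ i, s i < ∑ i, r i →
      HasWeight C θ (fun p Λ k => L p s l₁ l₂ Λ k))
    (hDw : ∀ s l₁ l₂, 1 ≤ l₁ + l₂ → ∑ i, s i < ∑ i, r i →
      HasWeight C θ' (fun p Λ k => D p s l₁ l₂ Λ k)) :
    (∀ p Λ, ContDiff ℝ ∞ (treesHeavy K p.M (L p) (D p) r n₁ n₂ Λ)) ∧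
    ScaledBdd Par.scales C (baseWeight (θ + θ') n₂ (3 - 2 * (n₁ + n₂ : ℕ)))
      (fun p Λ k => treesHeavy K p.M (L p) (D p) r n₁ n₂ Λ k) := by
  unfold treesHeavy
  refine Bdd.smooth_sum _ fun s hs => Bdd.smooth_sum _ fun l hl => Bdd.smooth_sum _ fun h hh => ?_
  rw [Finset.mem_Iic] at hs
  rw [Finset.HasAntidiagonal.mem_antidiagonal] at hl hh
  rcases Nat.eq_zero_or_pos h.1 with h0 | hl1
  · exact scaledBdd_smooth_zero fun p Λ k => by simp [h0]
  rcases Nat.eq_zero_or_pos h.2 with h0 | hl2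
  · exact scaledBdd_smooth_zero fun p Λ k => by simp [h0]
  by_cases hs0 : s = 0
  · refine scaledBdd_smooth_zero fun p Λ k => ?_
    subst hs0
    rw [symmTreeHeavy_zero_left ((hLc p Λ).zero _ _ (by omega)), mul_zero]
  by_cases hsr : s = r
  · refine scaledBdd_smooth_zero fun p Λ k => ?_
    subst hsr
    rw [tsub_self, symmTreeHeavy_zero_right _ ((hDc p Λ).zero _ _ (by omega)), mul_zero]
  have h5 := scaledBdd_symmTreeHeavy hK hC hn hl hh hl1 hl2
    (hL s l.1 h.1 (by omega)) (hD (r - s) l.2 h.2 (by omega))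
    (hLw s l.1 h.1 (by omega) (sum_lt_of_le_of_ne hs hsr))
    (hDw (r - s) l.2 h.2 (by omega) (sum_sub_lt hs hs0))
  exact ⟨fun p Λ => contDiff_const.mul (h5.1 p Λ), ScaledBdd.const_mul h5.1 h5.2 _⟩

/-- The loops and trees on the right-hand side of the flow equation, or of its linearization. -/
theorem scaledBdd_loops_trees (hK : IsCutoffProfile K) (hC : 2 ≤ C) (hn : 1 ≤ n₁ + n₂)
    (hD : IsMomSmooth D) (r : Fin 3 → ℕ)
    (hD' : ∀ p Λ, ContDiff ℝ ∞ (loopLight K p.m Λ n₁ n₂ (D p r (n₁ + 1) n₂ Λ)) ∧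
      ContDiff ℝ ∞ (loopHeavy K p.M Λ n₁ n₂ (D p r n₁ (n₂ + 1) Λ)))
    (hDw : ∀ l₁ l₂, l₁ + l₂ = n₁ + n₂ + 1 → HasWeight C θ (fun p Λ k => D p r l₁ l₂ Λ k))
    {tl th : Par → ℝ → Config n₁ n₂ → ℝ}
    (htl : (∀ p Λ, ContDiff ℝ ∞ (tl p Λ)) ∧
      ScaledBdd Par.scales C (baseWeight θ n₂ (3 - 2 * (n₁ + n₂ : ℕ))) tl)
    (hth : (∀ p Λ, ContDiff ℝ ∞ (th p Λ)) ∧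
      ScaledBdd Par.scales C (baseWeight θ n₂ (3 - 2 * (n₁ + n₂ : ℕ))) th) :
    ScaledBdd Par.scales C (baseWeight θ n₂ (3 - 2 * (n₁ + n₂ : ℕ))) (fun p Λ k =>
      loopCoeff n₁ * loopLight K p.m Λ n₁ n₂ (D p r (n₁ + 1) n₂ Λ) k + 2 * tl p Λ k +
      loopCoeff n₂ * loopHeavy K p.M Λ n₁ n₂ (D p r n₁ (n₂ + 1) Λ) k + 2 * th p Λ k) := by
  have a1 := (scaledBdd_loopLight hK hC hn (hD r (n₁ + 1) n₂ (by omega))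
    (hDw (n₁ + 1) n₂ (by omega))).const_mul (fun p Λ => (hD' p Λ).1) (loopCoeff n₁)
  have a2 := (scaledBdd_loopHeavy hK hC hn (hD r n₁ (n₂ + 1) (by omega))
    (hDw n₁ (n₂ + 1) (by omega))).const_mul (fun p Λ => (hD' p Λ).2) (loopCoeff n₂)
  have a3 := htl.2.const_mul htl.1 2
  have a4 := hth.2.const_mul hth.1 2
  have s1 : ∀ p Λ, ContDiff ℝ ∞ (fun k =>
      loopCoeff n₁ * loopLight K p.m Λ n₁ n₂ (D p r (n₁ + 1) n₂ Λ) k) := fun p Λ =>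
    contDiff_const.mul (hD' p Λ).1
  have s2 : ∀ p Λ, ContDiff ℝ ∞ (fun k =>
      loopCoeff n₂ * loopHeavy K p.M Λ n₁ n₂ (D p r n₁ (n₂ + 1) Λ) k) := fun p Λ =>
    contDiff_const.mul (hD' p Λ).2
  have s3 : ∀ p Λ, ContDiff ℝ ∞ (fun k => 2 * tl p Λ k) := fun p Λ => contDiff_const.mul (htl.1 p Λ)
  have s4 : ∀ p Λ, ContDiff ℝ ∞ (fun k => 2 * th p Λ k) := fun p Λ => contDiff_const.mul (hth.1 p Λ)
  exact ((a1.add s1 s3 a3).add (fun p Λ => (s1 p Λ).add (s3 p Λ)) s2 a2).add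
    (fun p Λ => ((s1 p Λ).add (s3 p Λ)).add (s2 p Λ)) s4 a4

theorem contDiff_loops {f : ℝ → ℝ → Config (n₁ + 1) n₂ → ℝ} {g : ℝ → ℝ → Config n₁ (n₂ + 1) → ℝ}
    (hK : IsCutoffProfile K) {m M : ℝ} (hm : 0 < m) (hM : 0 < M) (hn : 1 ≤ n₁ + n₂)
    (hf : IsSmooth f) (hg : IsSmooth g) (Λ₀ Λ : ℝ) :
    ContDiff ℝ ∞ (loopLight K m Λ n₁ n₂ (f Λ₀ Λ)) ∧
      ContDiff ℝ ∞ (loopHeavy K M Λ n₁ n₂ (g Λ₀ Λ)) :=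
  ⟨(IsSmooth.loopLight hK hm hn hf).mom Λ₀ Λ, (IsSmooth.loopHeavy hK hM hn hg).mom Λ₀ Λ⟩

end FamilyBounds

/-! ### Homogeneity of the linearized flow -/

section Linearity

variable {n₁ n₂ l₁ l₂ l₁' l₂' : ℕ} {K : ℝ → ℝ} {m M Λ : ℝ}

theorem loopLight_const_mul (c : ℝ) (f : Config (n₁ + 1) n₂ → ℝ) (k : Config n₁ n₂) :
    loopLight K m Λ n₁ n₂ (fun k => c * f k) k = c * loopLight K m Λ n₁ n₂ f k := by
  unfold loopLight
  rw [← integral_const_mul]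
  congr 1
  ext q
  ring

theorem loopHeavy_const_mul (c : ℝ) (f : Config n₁ (n₂ + 1) → ℝ) (k : Config n₁ n₂) :
    loopHeavy K M Λ n₁ n₂ (fun k => c * f k) k = c * loopHeavy K M Λ n₁ n₂ f k := by
  unfold loopHeavy
  rw [← integral_const_mul]
  congr 1
  ext q
  ring

theorem symm_const_mul (a b : ℕ) (c : ℝ) (F : (ℕ → Mom) → (ℕ → Mom) → ℝ) (p p' : ℕ → Mom) :
    symm a b (fun p p' => c * F p p') p p' = c * symm a b F p p' := by
  unfold symm
  simp_rw [← Finset.mul_sum]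
  ring

theorem symmTreeLight_const_mul (c : ℝ) (f : Config l₁ l₂ → ℝ) (g : Config l₁' l₂' → ℝ)
    (k : Config n₁ n₂) :
    symmTreeLight K m Λ n₁ n₂ l₁ l₂ l₁' l₂' (fun k => c * f k) g k =
      c * symmTreeLight K m Λ n₁ n₂ l₁ l₂ l₁' l₂' f g k ∧
    symmTreeLight K m Λ n₁ n₂ l₁ l₂ l₁' l₂' f (fun k => c * g k) k =
      c * symmTreeLight K m Λ n₁ n₂ l₁ l₂ l₁' l₂' f g k := by
  unfold symmTreeLight
  rw [← symm_const_mul]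
  constructor <;> congr 1 <;> ext p p' <;> simp only [treeLight] <;> ring

theorem symmTreeHeavy_const_mul (c : ℝ) (f : Config l₁ l₂ → ℝ) (g : Config l₁' l₂' → ℝ)
    (k : Config n₁ n₂) :
    symmTreeHeavy K m Λ n₁ n₂ l₁ l₂ l₁' l₂' (fun k => c * f k) g k =
      c * symmTreeHeavy K m Λ n₁ n₂ l₁ l₂ l₁' l₂' f g k ∧
    symmTreeHeavy K m Λ n₁ n₂ l₁ l₂ l₁' l₂' f (fun k => c * g k) k =
      c * symmTreeHeavy K m Λ n₁ n₂ l₁ l₂ l₁' l₂' f g k := by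
  unfold symmTreeHeavy
  rw [← symm_const_mul]
  constructor <;> congr 1 <;> ext p p' <;> simp only [treeHeavy] <;> ring

/-- Since `Λ₀` is constant along the flow in `Λ`, this lets the factor `Λ₀³` be included in the
function that is estimated. -/
theorem linRHS_const_mul (c : ℝ) (L D : VertexFamily) (r : Fin 3 → ℕ) (k : Config n₁ n₂) :
    linRHS K m M L (fun r n₁ n₂ Λ k => c * D r n₁ n₂ Λ k) r n₁ n₂ Λ k =
      c * linRHS K m M L D r n₁ n₂ Λ k := by
  unfold linRHS treesLight treesHeavy
  simp only [loopLight_const_mul, loopHeavy_const_mul, (symmTreeLight_const_mul _ _ _ _).1,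
    (symmTreeLight_const_mul _ _ _ _).2, (symmTreeHeavy_const_mul _ _ _ _).1,
    (symmTreeHeavy_const_mul _ _ _ _).2, mul_left_comm _ c, ← Finset.mul_sum, ← mul_add]

end Linearity


/-! ### Integration costs a logarithm -/

section Integration

/-- Here `u b ≤ 2Λ₀` and `m ≤ u a`; the summand `1` in `ell` absorbs `log 2`. -/
theorem Par.log_le_ell (p : Par) {a b : ℝ} (ha : 0 ≤ a) (hab : a ≤ b) (hb : b ≤ p.L0) :
    Real.log (p.u b) - Real.log (p.u a) ≤ p.ell := by
  have hm := p.m_pos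
  have h1 : Real.log (p.u b) ≤ Real.log (2 * p.L0) := Real.log_le_log (p.u_pos (ha.trans hab)) (by
    unfold Par.u; linarith [p.m_lt, p.lt_L0])
  have h2 : Real.log p.m ≤ Real.log (p.u a) := Real.log_le_log hm (by unfold Par.u; linarith)
  have h3 : Real.log 2 ≤ 1 := by linarith [Real.log_two_lt_d9]
  rw [Real.log_mul two_ne_zero p.L0_pos.ne'] at h1
  rw [Par.ell, Real.log_div p.L0_pos.ne' hm.ne']
  linarith

theorem Par.norm_sub_le (p : Par) {E : Type} [NormedAddCommGroup E] [NormedSpace ℝ E]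
    {φ φ' : ℝ → E} {a b W : ℝ} (ha : 0 ≤ a) (hab : a ≤ b) (hb : b ≤ p.L0)
    (hφ : ∀ s, HasDerivAt φ (φ' s) s) (hφ' : ∀ s ∈ Icc a b, ‖φ' s‖ ≤ W / p.u s) (hW : 0 ≤ W) :
    ‖φ b - φ a‖ ≤ W * p.ell := by
  have hu : ∀ s ∈ Icc a b, 0 < p.u s := fun s hs => p.u_pos (ha.trans hs.1)
  have hB : ∀ s ∈ Icc a b, HasDerivAt (fun s => W * (Real.log (p.u s) - Real.log (p.u a)))
      (W / p.u s) s := fun s hs => by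
    have h1 : HasDerivAt p.u 1 s := (hasDerivAt_id s).add_const p.m
    have h2 := ((h1.log (hu s hs).ne').sub_const (Real.log (p.u a))).const_mul W
    rwa [mul_one_div] at h2
  have h := image_norm_le_of_norm_deriv_right_le_deriv_boundary' (f := fun s => φ s - φ a) (f' := φ')
    (a := a) (b := b) (B := fun s => W * (Real.log (p.u s) - Real.log (p.u a)))
    (B' := fun s => W / p.u s) (fun s _ => ((hφ s).sub_const _).continuousAt.continuousWithinAt)
    (fun s _ => ((hφ s).sub_const _).hasDerivWithinAt) (by simp)
    (fun s hs => (hB s hs).continuousAt.continuousWithinAt)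
    (fun s hs => (hB s (Ico_subset_Icc_self hs)).hasDerivWithinAt)
    (fun s hs => hφ' s (Ico_subset_Icc_self hs)) (right_mem_Icc.2 hab)
  exact h.trans (mul_le_mul_of_nonneg_left (p.log_le_ell ha hab hb) hW)

end Integration

/-! ### Monotonicity of the weights in the scale -/

section WeightComparison

variable {n₂ : ℕ}

theorem weight_mono {θ D : ℕ} (hD : D ≤ 4) (p : Par) {s t : ℝ} (hs : 0 ≤ s) (h : s ≤ t) :
    weight θ n₂ D p s ≤ weight θ n₂ D p t := by
  have := p.X_mono n₂ h
  have := (p.X_pos n₂ hs).le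
  unfold weight
  rw [if_pos hD, if_pos hD]
  gcongr

theorem Par.X_mul_u_le (p : Par) (n₂ : ℕ) {s t : ℝ} (h : s ≤ t) :
    p.X n₂ t * p.u s ≤ p.X n₂ s * p.u t := by
  have := p.m_lt
  unfold X u
  split_ifs <;> nlinarith

/-- The weight equals `(X/u) ^ θ * u ^ (θ + e)`, a product of two non-increasing functions: the
ratio `(Λ + M)/(Λ + m)` falls, and the second exponent is not positive. -/
theorem baseWeight_anti {θ : ℕ} {e : ℤ} (he : (θ : ℤ) + e ≤ 0) (p : Par) {s t : ℝ} (hs : 0 ≤ s)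
    (h : s ≤ t) : baseWeight θ n₂ e p t ≤ baseWeight θ n₂ e p s := by
  have hus := p.u_pos hs
  have hut := p.u_pos (hs.trans h)
  have h0 : ∀ r, 0 < p.u r → baseWeight θ n₂ e p r = (p.X n₂ r / p.u r) ^ θ * p.u r ^ (θ + e) :=
    fun r hr => by
      rw [baseWeight, div_pow, zpow_add₀ hr.ne', zpow_natCast]
      field_simp
  rw [h0 s hus, h0 t hut]
  have h1 : p.X n₂ t / p.u t ≤ p.X n₂ s / p.u s := by
    rw [div_le_div_iff₀ hut hus]
    exact p.X_mul_u_le n₂ h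
  have h2 : p.u t ^ ((θ : ℤ) + e) ≤ p.u s ^ ((θ : ℤ) + e) := by
    obtain ⟨N, hN⟩ := Int.eq_ofNat_of_zero_le (neg_nonneg.2 he)
    obtain hN' : (θ : ℤ) + e = -(N : ℤ) := by omega
    rw [hN', zpow_neg, zpow_neg, zpow_natCast, zpow_natCast]
    have : p.u s ≤ p.u t := by unfold Par.u; linarith
    gcongr
  have h3 := div_pos (p.X_pos n₂ (hs.trans h)) hut
  have h4 := div_pos (p.X_pos n₂ hs) hus
  have h5 := zpow_pos hut ((θ : ℤ) + e)
  gcongr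

/-- For `θ = 2` the total exponent `θ + 4 - D` is still positive at `D = 5`. That dimension cannot
be integrated down from the cutoff and is treated by parity. -/
theorem weight_anti {θ D : ℕ} (hθ : θ ≤ 2) (hD : 6 ≤ D) (p : Par) {s t : ℝ} (hs : 0 ≤ s)
    (h : s ≤ t) : weight θ n₂ D p t ≤ weight θ n₂ D p s := by
  unfold weight
  rw [if_neg (by omega), if_neg (by omega)]
  exact baseWeight_anti (by omega) p hs h

theorem Par.X_le_of_le_M (p : Par) (h2 : n₂ ≠ 0) {s t : ℝ} (hs : 0 ≤ s) (ht : t ≤ p.M) :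
    p.X n₂ t ≤ 2 * p.X n₂ s := by
  unfold X
  rw [if_neg h2, if_neg h2]
  linarith

/-- Below `M` the heavy infrared scale varies by at most a factor two, and powers of `u` occur only
with negative exponents. -/
theorem weight_le_of_le_M (θ D : ℕ) (p : Par) (h2 : n₂ ≠ 0) {s t : ℝ} (hs : 0 ≤ s) (hst : s ≤ t)
    (ht : t ≤ p.M) : weight θ n₂ D p t ≤ 2 ^ (4 + θ) * weight θ n₂ D p s := by
  have h := p.X_le_of_le_M h2 hs ht
  have hs0 := (p.X_pos n₂ hs).le
  have ht0 := (p.X_pos n₂ (hs.trans hst)).le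
  unfold weight
  split_ifs with h4
  · calc p.X n₂ t ^ (4 + θ - D) ≤ (2 * p.X n₂ s) ^ (4 + θ - D) := by gcongr
      _ = 2 ^ (4 + θ - D) * p.X n₂ s ^ (4 + θ - D) := mul_pow _ _ _
      _ ≤ 2 ^ (4 + θ) * p.X n₂ s ^ (4 + θ - D) := by
        gcongr
        · norm_num
        · omega
  · obtain ⟨N, hN⟩ : ∃ N : ℕ, (4 - D : ℤ) = -(N : ℤ) := ⟨D - 4, by omega⟩
    have h1 : p.u t ^ (4 - D : ℤ) ≤ p.u s ^ (4 - D : ℤ) := by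
      have : p.u s ≤ p.u t := by unfold Par.u; linarith
      have := p.u_pos hs
      rw [hN, zpow_neg, zpow_neg, zpow_natCast, zpow_natCast]
      gcongr
    have h3 := zpow_pos (p.u_pos (hs.trans hst)) (4 - D : ℤ)
    have h5 := zpow_pos (p.u_pos hs) (4 - D : ℤ)
    unfold baseWeight
    calc p.X n₂ t ^ θ * p.u t ^ (4 - D : ℤ) ≤ (2 * p.X n₂ s) ^ θ * p.u s ^ (4 - D : ℤ) := by gcongr
      _ = 2 ^ θ * (p.X n₂ s ^ θ * p.u s ^ (4 - D : ℤ)) := by rw [mul_pow]; ring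
      _ ≤ 2 ^ (4 + θ) * (p.X n₂ s ^ θ * p.u s ^ (4 - D : ℤ)) := by
        gcongr
        · norm_num
        · omega

/-- The scales at which the infrared scales of the light and of the heavy field are comparable. -/
def Par.commonScales (p : Par) (n₂ : ℕ) : Set ℝ := {Λ | Λ ∈ p.scales ∧ (n₂ = 0 ∨ p.M ≤ Λ)}

theorem Par.X_le_of_mem (p : Par) {Λ : ℝ} (h : Λ ∈ p.commonScales n₂) : p.X n₂ Λ ≤ 2 * p.u Λ := by
  rcases h.2 with rfl | h2
  · have : p.X 0 Λ = p.u Λ := rfl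
    linarith [p.u_pos h.1.1]
  · exact p.X_le_of_M_le n₂ h2

/-- One more derivative costs up to `1/u`, and a displacement within a ball gains at most a multiple
of `X`; these balance only where `X` and `u` are comparable. -/
theorem weight_succ_mul_X_le (θ D : ℕ) (p : Par) {Λ : ℝ} (h : Λ ∈ p.commonScales n₂) :
    weight θ n₂ (D + 1) p Λ * p.X n₂ Λ ≤ 2 * weight θ n₂ D p Λ := by
  have h0 := h.1.1
  have hX := p.X_le_of_mem h
  have hX0 := p.X_pos n₂ h0
  have hw := weight_pos θ n₂ D p h0
  by_cases hD : D + 1 ≤ 4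
  · have : weight θ n₂ (D + 1) p Λ * p.X n₂ Λ = weight θ n₂ D p Λ := by
      unfold weight
      rw [if_pos hD, if_pos (by omega), ← pow_succ]
      congr 1
      omega
    linarith
  · rw [weight_eq_baseWeight θ (by omega) p h0, weight_eq_baseWeight θ (by omega) p h0]
    have hb := baseWeight_pos θ n₂ (4 - (D + 1 : ℕ) : ℤ) p h0
    calc _ ≤ baseWeight θ n₂ (4 - (D + 1 : ℕ) : ℤ) p Λ * (2 * p.u Λ) := by gcongr
      _ = 2 * (p.u Λ * baseWeight θ n₂ (4 - (D + 1 : ℕ) : ℤ) p Λ) := by ring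
      _ = _ := by
        rw [u_mul_baseWeight _ _ _ p h0, show (4 - D : ℤ) = 4 - (D + 1 : ℕ) + 1 by push_cast; ring]

theorem baseWeight_le_weight (θ D : ℕ) (p : Par) {Λ : ℝ} (h0 : 0 ≤ Λ) :
    baseWeight θ n₂ (4 - D) p Λ ≤ weight θ n₂ D p Λ := by
  unfold weight
  split_ifs with h4
  · have h1 := p.u_le_X n₂ Λ
    have hu := (p.u_pos h0).le
    have h2 := (p.X_pos n₂ h0).le
    obtain ⟨N, hN⟩ := Nat.exists_eq_add_of_le h4
    rw [show 4 + θ - D = θ + N by omega, pow_add, baseWeight, show (4 - D : ℤ) = (N : ℤ) by omega,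
      zpow_natCast]
    gcongr
  · exact le_rfl

end WeightComparison

/-! ### Balls of momenta and the mean value inequality -/

section Balls

variable {n₁ n₂ : ℕ} {C : ℝ}

theorem exists_legs_clm (n₁ n₂ j : ℕ) :
    ∃ T : Config n₁ n₂ →L[ℝ] Mom, ∀ k, allLegs n₁ n₂ k j = T k := by
  obtain ⟨T, hT, -⟩ := exists_clm_leg (isLegs_allLegs n₁ n₂ j)
  exact ⟨T, fun k => (hT k).symm⟩

theorem convex_legBall (a b : ℝ) (n₁ n₂ : ℕ) : Convex ℝ (legBall a b n₁ n₂) := by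
  choose T hT using exists_legs_clm n₁ n₂
  have h : ∀ (j : ℕ) (c : ℝ), Convex ℝ {k : Config n₁ n₂ | ‖T j k‖ ≤ c} := fun j c => by
    have e : {k : Config n₁ n₂ | ‖T j k‖ ≤ c} = (T j).toLinearMap ⁻¹' Metric.closedBall 0 c := by
      ext k
      simp
    rw [e]
    exact (convex_closedBall (0 : Mom) c).linear_preimage (T j).toLinearMap
  have h2 : legBall a b n₁ n₂ = (⋂ j, ⋂ (_ : j < 2 * n₁), {k | ‖T j k‖ ≤ a}) ∩
      ⋂ j, ⋂ (_ : j < 2 * n₂), {k | ‖T (2 * n₁ + j) k‖ ≤ b} := by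
    ext k
    simp only [legBall, lightLegs, heavyLegs, hT, mem_inter_iff, mem_iInter, mem_ofPred_eq]
  rw [h2]
  exact (convex_iInter₂ fun j _ => h _ _).inter (convex_iInter₂ fun j _ => h _ _)

/-- A configuration admitted at one scale remains admitted at larger ones, so the flow can be
integrated at fixed momenta. -/
theorem Par.ball_mono (p : Par) (hC : 0 ≤ C) {s t : ℝ} (h : s ≤ t) :
    p.ball C s n₁ n₂ ⊆ p.ball C t n₁ n₂ := fun k hk =>
  ⟨fun j hj => (hk.1 j hj).trans (by gcongr), fun j hj => (hk.2 j hj).trans (by gcongr)⟩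

theorem Par.zero_mem_ball (p : Par) (hC : 0 ≤ C) {Λ : ℝ} (h : 0 ≤ Λ) :
    (0 : Config n₁ n₂) ∈ p.ball C Λ n₁ n₂ := by
  have h0 : ∀ j, allLegs n₁ n₂ (0 : Config n₁ n₂) j = 0 := fun j => by
    unfold allLegs; split_ifs <;> simp
  have hm := p.m_pos
  have hM := p.M_pos
  refine ⟨fun j _ => ?_, fun j _ => ?_⟩
  · rw [lightLegs, h0, norm_zero]; positivity
  · rw [heavyLegs, h0, norm_zero]; positivity

theorem Par.norm_le_of_mem_ball (p : Par) (hC : 0 ≤ C) {Λ : ℝ} (h : 0 ≤ Λ) {k : Config n₁ n₂}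
    (hk : k ∈ p.ball C Λ n₁ n₂) : ‖k‖ ≤ C * p.X n₂ Λ := by
  refine (pi_norm_le_iff_of_nonneg (mul_nonneg hC (p.X_pos n₂ h).le)).2 fun i => ?_
  have hi : allLegs n₁ n₂ k i = k i := by simp [allLegs]
  rw [← hi]
  by_cases h1 : (i : ℕ) < 2 * n₁
  · exact (hk.1 i h1).trans (mul_le_mul_of_nonneg_left (p.u_le_X n₂ Λ) hC)
  · have h2 := hk.2 (i - 2 * n₁) (by omega)
    rw [heavyLegs, Nat.add_sub_cancel' (not_lt.1 h1)] at h2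
    have : p.X n₂ Λ = Λ + p.M := if_neg (by omega)
    rwa [this]

/-- The constant `3` comes from the dependent leg of the heavy four-point function, a sum of three
vectors of length `M`. -/
theorem Par.renPoint_mem_ball (p : Par) (hC : 3 ≤ C) :
    renPoint p.pbar n₁ n₂ ∈ p.ball C 0 n₁ n₂ := by
  have hm := p.m_pos
  have hM := p.M_pos
  have hp := p.norm_pbar
  have hCM : 3 * p.M ≤ C * (0 + p.M) := by nlinarith
  have h3 : ∀ a b c : Fin 5, ‖-p.pbar a + -p.pbar b + -p.pbar c‖ ≤ 3 * p.M := fun a b c => by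
    have := norm_add₃_le (a := -p.pbar a) (b := -p.pbar b) (c := -p.pbar c)
    simp only [norm_neg, hp] at this
    linarith
  unfold renPoint
  split
  · refine ⟨fun j hj => by omega, fun j hj => ?_⟩
    interval_cases j <;> simp [heavyLegs, allLegs, hp] <;> linarith
  · refine ⟨fun j hj => by omega, fun j hj => ?_⟩
    interval_cases j <;> simp [heavyLegs, allLegs, Fin.sum_univ_succ, hp] <;>
      linarith [h3 3 2 1]
  · refine ⟨fun j hj => ?_, fun j hj => ?_⟩
    · have : 0 ≤ C * p.m := by positivity
      interval_cases j <;> simpa [lightLegs, allLegs]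
    · interval_cases j <;> simp [heavyLegs, allLegs, Fin.sum_univ_succ, hp] <;> linarith
  · exact p.zero_mem_ball (by linarith) le_rfl

theorem norm_iteratedFDeriv_sub_le {f : Config n₁ n₂ → ℝ} (hf : ContDiff ℝ ∞ f) {z : ℕ} (p : Par)
    (hC : 0 ≤ C) {Λ B : ℝ} (h : 0 ≤ Λ) (hB : ∀ k ∈ p.ball C Λ n₁ n₂, ‖iteratedFDeriv ℝ (z + 1) f k‖ ≤ B)
    {k k' : Config n₁ n₂} (hk : k ∈ p.ball C Λ n₁ n₂) (hk' : k' ∈ p.ball C Λ n₁ n₂) :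
    ‖iteratedFDeriv ℝ z f k' - iteratedFDeriv ℝ z f k‖ ≤ B * (2 * C * p.X n₂ Λ) := by
  have h1 := (convex_legBall _ _ n₁ n₂).norm_image_sub_le_of_norm_fderiv_le (𝕜 := ℝ)
    (f := iteratedFDeriv ℝ z f) (C := B)
    (fun x _ => (hf.differentiable_iteratedFDeriv (by exact_mod_cast ENat.natCast_lt_top z)) x)
    (fun x hx => by rw [norm_fderiv_iteratedFDeriv]; exact hB x hx) hk hk'
  have hB0 : 0 ≤ B := (norm_nonneg _).trans (hB k hk)
  refine h1.trans (mul_le_mul_of_nonneg_left ?_ hB0)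
  have := norm_sub_le k' k
  linarith [p.norm_le_of_mem_ball hC h hk, p.norm_le_of_mem_ball hC h hk']

/-- Under `p ↦ -p`, which fixes `0`, a derivative of odd order changes sign. -/
theorem IsInvariant.iteratedFDeriv_odd {f : Config n₁ n₂ → ℝ} (hf : ContDiff ℝ ∞ f)
    (hi : IsInvariant f) {z : ℕ} (hz : Odd z) : iteratedFDeriv ℝ z f 0 = 0 := by
  ext v
  have h1 := hi.iteratedFDeriv_apply hf (LinearIsometryEquiv.neg ℝ) z 0 v
  have h2 : (fun i => LinearIsometryEquiv.neg ℝ ((0 : Config n₁ n₂) i)) = 0 := by ext; simp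
  have h3 : (fun a i => LinearIsometryEquiv.neg ℝ (v a i)) = fun a => (-1 : ℝ) • v a := by
    ext; simp
  rw [h2, h3, ContinuousMultilinearMap.map_smul_univ] at h1
  simp only [Finset.prod_const, Finset.card_univ, Fintype.card_fin, hz.neg_one_pow] at h1
  simp only [zero_apply]
  simp only [smul_eq_mul] at h1
  linarith

end Balls


/-! ### From bounds on the flow to bounds on its solution -/

section FlowPair

variable {n₁ n₂ : ℕ} {C : ℝ} {θ : ℕ} {f g : Par → ℝ → Config n₁ n₂ → ℝ}

/-- A smooth solution `f` of a flow equation with right-hand side `g`. -/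
structure IsFlowPair (f g : Par → ℝ → Config n₁ n₂ → ℝ) : Prop where
  smooth : ∀ p, ContDiff ℝ ∞ (fun x : ℝ × Config n₁ n₂ => f p x.1 x.2)
  flow : ∀ p Λ k, HasDerivAt (fun s => f p s k) (g p Λ k) Λ
  invariant : ∀ p Λ, IsInvariant (f p Λ)

theorem IsFlowPair.contDiff (h : IsFlowPair f g) (p : Par) (Λ : ℝ) : ContDiff ℝ ∞ (f p Λ) :=
  contDiff_left_param (h.smooth p) Λ

theorem IsFlowPair.hasDerivAt (h : IsFlowPair f g) (p : Par) (z : ℕ) (k : Config n₁ n₂) (Λ : ℝ) :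
    HasDerivAt (fun s => iteratedFDeriv ℝ z (f p s) k) (iteratedFDeriv ℝ z (g p Λ) k) Λ := by
  have h1 := hasDerivAt_iteratedFDeriv_param (h.smooth p) z k Λ
  have h2 : (fun k => deriv (fun s => f p s k) Λ) = g p Λ := funext fun k => (h.flow p Λ k).deriv
  rwa [h2] at h1

/-- The right-hand side of a flow equation is smaller than the weight by an inverse power of the
light scale. -/
def FlowBdd (C : ℝ) (θ : ℕ) (g : Par → ℝ → Config n₁ n₂ → ℝ) (z : ℕ) : Prop :=
  ∃ β, IsPlog β ∧ ∀ p, ∀ Λ ∈ Par.scales p, ∀ k ∈ p.ball C Λ n₁ n₂,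
    ‖iteratedFDeriv ℝ z (g p Λ) k‖ ≤ weight θ n₂ (2 * (n₁ + n₂) + z) p Λ * β p / p.u Λ

theorem ScaledBdd.flowBdd (h : ScaledBdd Par.scales C (baseWeight θ n₂ (3 - 2 * (n₁ + n₂ : ℕ))) g)
    (z : ℕ) : FlowBdd C θ g z := by
  obtain ⟨β, hβ, hb⟩ := h z
  refine ⟨β, hβ, fun p Λ hΛ k hk => (hb p Λ hΛ k hk).trans ?_⟩
  have hu := p.u_pos hΛ.1
  dsimp only
  rw [le_div_iff₀ hu, baseWeight_mul_inv_pow _ _ _ _ _ hΛ.1, mul_comm, ← mul_assoc,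
    u_mul_baseWeight _ _ _ _ hΛ.1]
  refine mul_le_mul_of_nonneg_right ?_ (hβ.1 p)
  have := baseWeight_le_weight (n₂ := n₂) θ (2 * (n₁ + n₂) + z) p hΛ.1
  rwa [show (4 - (2 * (n₁ + n₂) + z : ℕ) : ℤ) = 3 - 2 * (n₁ + n₂ : ℕ) - z + 1 by
    push_cast; ring] at this

/-- Integrate down from `Λ₀`. The weight is non-increasing, so its value at the lower end dominates
both the boundary term and the integrand. -/
theorem IsFlowPair.bdd_of_top (h : IsFlowPair f g) (hC : 0 ≤ C) (hθ : θ ≤ 2) {z : ℕ}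
    (hD : 6 ≤ 2 * (n₁ + n₂) + z) (hg : FlowBdd C θ g z)
    (htop : Bdd (fun p => {p.L0}) C (weight θ n₂ (2 * (n₁ + n₂) + z)) f z) :
    Bdd Par.scales C (weight θ n₂ (2 * (n₁ + n₂) + z)) f z := by
  obtain ⟨β, hβ, hb⟩ := hg
  obtain ⟨γ, hγ, hc⟩ := htop
  refine ⟨fun p => γ p + β p * p.ell, hγ.add (hβ.mul isPlog_ell), fun p Λ hΛ k hk => ?_⟩
  have hw := (weight_pos θ n₂ (2 * (n₁ + n₂) + z) p hΛ.1).le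
  have h1 := p.norm_sub_le (W := weight θ n₂ (2 * (n₁ + n₂) + z) p Λ * β p) hΛ.1 hΛ.2 le_rfl
    (h.hasDerivAt p z k) (fun s hs => by
      have hs0 := hΛ.1.trans hs.1
      refine (hb p s ⟨hs0, hs.2⟩ k (p.ball_mono hC hs.1 hk)).trans ?_
      have := p.u_pos hs0
      have := weight_anti (n₂ := n₂) hθ hD p hΛ.1 hs.1
      have := hβ.1 p
      gcongr) (mul_nonneg hw (hβ.1 p))
  have h2 := hc p p.L0 rfl k (p.ball_mono hC hΛ.2 hk)
  have h3 := weight_anti (n₂ := n₂) hθ hD p hΛ.1 hΛ.2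
  have h4 := mul_le_mul_of_nonneg_right h3 (hγ.1 p)
  rw [norm_sub_rev] at h1
  have h5 := norm_sub_norm_le (iteratedFDeriv ℝ z (f p Λ) k) (iteratedFDeriv ℝ z (f p p.L0) k)
  linarith

/-- What is missing is a vertex with heavy legs at a scale below `M`. It is reached by integrating
down from `M`, across which the weight grows by no more than a constant factor. -/
theorem IsFlowPair.bdd_of_common (h : IsFlowPair f g) (hC : 0 ≤ C) {z : ℕ} (hg : FlowBdd C θ g z)
    (hf : Bdd (fun p => p.commonScales n₂) C (weight θ n₂ (2 * (n₁ + n₂) + z)) f z) :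
    Bdd Par.scales C (weight θ n₂ (2 * (n₁ + n₂) + z)) f z := by
  obtain ⟨β, hβ, hb⟩ := hg
  obtain ⟨γ, hγ, hc⟩ := hf
  refine ⟨fun p => 2 ^ (4 + θ) * (γ p + β p * p.ell), (IsPlog.const (by positivity)).mul
    (hγ.add (hβ.mul isPlog_ell)), fun p Λ hΛ k hk => ?_⟩
  have hw := (weight_pos θ n₂ (2 * (n₁ + n₂) + z) p hΛ.1).le
  have hγp := hγ.1 p
  have hβp := hβ.1 p
  have hl := p.ell_pos
  by_cases hgood : n₂ = 0 ∨ p.M ≤ Λ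
  · refine (hc p Λ ⟨hΛ, hgood⟩ k hk).trans (mul_le_mul_of_nonneg_left ?_ hw)
    have : (1 : ℝ) ≤ 2 ^ (4 + θ) := one_le_pow₀ (by norm_num)
    have : 0 ≤ β p * p.ell := by positivity
    nlinarith
  · push Not at hgood
    obtain ⟨hn2, hM⟩ := hgood
    have hW : ∀ s ∈ Icc Λ p.M, weight θ n₂ (2 * (n₁ + n₂) + z) p s ≤
        2 ^ (4 + θ) * weight θ n₂ (2 * (n₁ + n₂) + z) p Λ := fun s hs =>
      weight_le_of_le_M θ _ p hn2 hΛ.1 hs.1 hs.2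
    have h1 := p.norm_sub_le (W := 2 ^ (4 + θ) * weight θ n₂ (2 * (n₁ + n₂) + z) p Λ * β p)
      hΛ.1 hM.le p.lt_L0.le (h.hasDerivAt p z k) (fun s hs => by
        have hs0 := hΛ.1.trans hs.1
        refine (hb p s ⟨hs0, hs.2.trans p.lt_L0.le⟩ k (p.ball_mono hC hs.1 hk)).trans ?_
        have := p.u_pos hs0
        have := hW s hs
        gcongr) (by positivity)
    have h2 := hc p p.M ⟨⟨p.M_pos.le, p.lt_L0.le⟩, Or.inr le_rfl⟩ k (p.ball_mono hC hM.le hk)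
    have h4 := mul_le_mul_of_nonneg_right (hW p.M (right_mem_Icc.2 hM.le)) hγp
    rw [norm_sub_rev] at h1
    have h5 := norm_sub_norm_le (iteratedFDeriv ℝ z (f p Λ) k) (iteratedFDeriv ℝ z (f p p.M) k)
    linarith

theorem IsFlowPair.norm_sub_le_of_succ (h : IsFlowPair f g) (hC : 0 ≤ C) {z : ℕ}
    (hs : Bdd Par.scales C (weight θ n₂ (2 * (n₁ + n₂) + (z + 1))) f (z + 1)) :
    ∃ β, IsPlog β ∧ ∀ p, ∀ Λ ∈ p.commonScales n₂, ∀ k ∈ p.ball C Λ n₁ n₂, ∀ k' ∈ p.ball C Λ n₁ n₂,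
      ‖iteratedFDeriv ℝ z (f p Λ) k' - iteratedFDeriv ℝ z (f p Λ) k‖ ≤
        weight θ n₂ (2 * (n₁ + n₂) + z) p Λ * β p := by
  obtain ⟨β, hβ, hb⟩ := hs
  refine ⟨fun p => 4 * C * β p, (IsPlog.const (by positivity)).mul hβ,
    fun p Λ hΛ k hk k' hk' => ?_⟩
  refine (norm_iteratedFDeriv_sub_le (h.contDiff p Λ) p hC hΛ.1.1 (hb p Λ hΛ.1) hk hk').trans ?_
  have := weight_succ_mul_X_le θ (2 * (n₁ + n₂) + z) p hΛ
  have h2 : 0 ≤ 2 * C * β p := by have := hβ.1 p; positivity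
  have h3 := mul_le_mul_of_nonneg_right this h2
  rw [← add_assoc]
  linarith

/-- The next derivative spreads a bound from one configuration over the convex ball, so one point
per scale suffices, and only at the scales where `X` and `u` are comparable. -/
theorem IsFlowPair.bdd_of_succ (h : IsFlowPair f g) (hC : 0 ≤ C) {z : ℕ} (hg : FlowBdd C θ g z)
    (hs : Bdd Par.scales C (weight θ n₂ (2 * (n₁ + n₂) + (z + 1))) f (z + 1))
    (hpt : ∃ β, IsPlog β ∧ ∀ p, ∀ Λ ∈ p.commonScales n₂, ∃ k ∈ p.ball C Λ n₁ n₂,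
      ‖iteratedFDeriv ℝ z (f p Λ) k‖ ≤ weight θ n₂ (2 * (n₁ + n₂) + z) p Λ * β p) :
    Bdd Par.scales C (weight θ n₂ (2 * (n₁ + n₂) + z)) f z := by
  refine h.bdd_of_common hC hg ?_
  obtain ⟨β, hβ, hb⟩ := h.norm_sub_le_of_succ hC hs
  obtain ⟨γ, hγ, hc⟩ := hpt
  refine ⟨fun p => β p + γ p, hβ.add hγ, fun p Λ hΛ k hk => ?_⟩
  obtain ⟨k₀, hk₀, h0⟩ := hc p Λ hΛ
  have h1 := hb p Λ hΛ k₀ hk₀ k hk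
  have h2 := norm_sub_norm_le (iteratedFDeriv ℝ z (f p Λ) k) (iteratedFDeriv ℝ z (f p Λ) k₀)
  linarith

theorem IsFlowPair.bdd_of_odd (h : IsFlowPair f g) (hC : 0 ≤ C) {z : ℕ} (hz : Odd z)
    (hg : FlowBdd C θ g z)
    (hs : Bdd Par.scales C (weight θ n₂ (2 * (n₁ + n₂) + (z + 1))) f (z + 1)) :
    Bdd Par.scales C (weight θ n₂ (2 * (n₁ + n₂) + z)) f z := by
  refine h.bdd_of_succ hC hg hs ⟨fun _ => 0, IsPlog.const le_rfl, fun p Λ hΛ =>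
    ⟨0, p.zero_mem_ball hC hΛ.1.1, ?_⟩⟩
  rw [(h.invariant p Λ).iteratedFDeriv_odd (h.contDiff p Λ) hz]
  simp

/-- Integrate up from scale `0` at fixed momenta. For `D ≤ 4` the weight is non-decreasing, so its
value at the upper end dominates. -/
theorem IsFlowPair.point_bound (h : IsFlowPair f g) (hC : 0 ≤ C) {z : ℕ}
    (hD : 2 * (n₁ + n₂) + z ≤ 4) (hg : FlowBdd C θ g z) {k₀ : Par → Config n₁ n₂}
    (hk₀ : ∀ p, k₀ p ∈ p.ball C 0 n₁ n₂) {v : Par → Fin z → Config n₁ n₂}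
    (hv : ∀ p i, ‖v p i‖ ≤ 1) {A : ℝ} (hA : 0 ≤ A)
    (h0 : ∀ p, |iteratedFDeriv ℝ z (f p 0) (k₀ p) (v p)| ≤
      A * weight θ n₂ (2 * (n₁ + n₂) + z) p 0) :
    ∃ β, IsPlog β ∧ ∀ p, ∀ Λ ∈ p.scales, |iteratedFDeriv ℝ z (f p Λ) (k₀ p) (v p)| ≤
      weight θ n₂ (2 * (n₁ + n₂) + z) p Λ * β p := by
  obtain ⟨β, hβ, hb⟩ := hg
  refine ⟨fun p => A + β p * p.ell, (IsPlog.const hA).add (hβ.mul isPlog_ell), fun p Λ hΛ => ?_⟩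
  have hw := (weight_pos θ n₂ (2 * (n₁ + n₂) + z) p hΛ.1).le
  have hop : ∀ T : ContinuousMultilinearMap ℝ (fun _ : Fin z => Config n₁ n₂) ℝ,
      |T (v p)| ≤ ‖T‖ := fun T => by
    refine (T.le_opNorm (v p)).trans (mul_le_of_le_one_right (norm_nonneg _) ?_)
    exact Finset.prod_le_one (fun i _ => norm_nonneg _) fun i _ => hv p i
  have h1 := p.norm_sub_le (W := weight θ n₂ (2 * (n₁ + n₂) + z) p Λ * β p) le_rfl hΛ.1 hΛ.2
    (h.hasDerivAt p z (k₀ p)) (fun s hs => by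
      refine (hb p s ⟨hs.1, hs.2.trans hΛ.2⟩ _ (p.ball_mono hC hs.1 (hk₀ p))).trans ?_
      have := p.u_pos hs.1
      have := weight_mono (n₂ := n₂) (θ := θ) hD p hs.1 hs.2
      have := hβ.1 p
      gcongr) (mul_nonneg hw (hβ.1 p))
  have h2 := (hop _).trans h1
  rw [sub_apply] at h2
  have h3 := mul_le_mul_of_nonneg_left (weight_mono (n₂ := n₂) (θ := θ) hD p le_rfl hΛ.1) hA
  have h4 := abs_sub_abs_le_abs_sub (iteratedFDeriv ℝ z (f p Λ) (k₀ p) (v p))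
    (iteratedFDeriv ℝ z (f p 0) (k₀ p) (v p))
  linarith [h0 p]

theorem IsFlowPair.bdd_zero (h : IsFlowPair f g) (hC : 3 ≤ C) (hn2 : n₁ + n₂ ≤ 2)
    (hg : FlowBdd C θ g 0)
    (hs : Bdd Par.scales C (weight θ n₂ (2 * (n₁ + n₂) + (0 + 1))) f (0 + 1)) {A : ℝ} (hA : 0 ≤ A)
    (h0 : ∀ p, |f p 0 (renPoint p.pbar n₁ n₂)| ≤ A * weight θ n₂ (2 * (n₁ + n₂)) p 0) :
    Bdd Par.scales C (weight θ n₂ (2 * (n₁ + n₂) + 0)) f 0 := by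
  have hC0 : 0 ≤ C := by linarith
  refine h.bdd_of_succ hC0 hg hs ?_
  obtain ⟨β, hβ, hb⟩ := h.point_bound hC0 (by omega) hg (k₀ := fun p => renPoint p.pbar n₁ n₂)
    (fun p => p.renPoint_mem_ball hC) (v := fun _ => Fin.elim0) (fun _ i => i.elim0) hA
    (fun p => by simpa only [iteratedFDeriv_zero_apply, add_zero] using h0 p)
  refine ⟨β, hβ, fun p Λ hΛ => ⟨_, p.ball_mono hC0 hΛ.1.1 (p.renPoint_mem_ball hC), ?_⟩⟩
  have := hb p Λ hΛ.1
  rwa [norm_iteratedFDeriv_zero, Real.norm_eq_abs]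

/-- At zero momentum the rank-one part disappears and the second derivative is a multiple of the
inner product, whose size is visible on any unit vector. -/
theorem IsInvariant.norm_secondDeriv_le {F : Config n₁ n₂ → ℝ} (hn : n₁ + n₂ = 1)
    (hF : ContDiff ℝ ∞ F) (hi : IsInvariant F) {t : Mom} (ht : ‖t‖ = 1) :
    ‖iteratedFDeriv ℝ 2 F 0‖ ≤ |iteratedFDeriv ℝ 2 F 0 (fun _ => diag n₁ n₂ t)| := by
  obtain ⟨c, hc⟩ := hi.exists_secondDeriv_eq hF (p := 0) ht (inner_zero_left _)
  have hd : diag n₁ n₂ 0 = 0 := rfl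
  rw [hd] at hc
  refine ContinuousMultilinearMap.opNorm_le_bound (abs_nonneg _) fun v => ?_
  have hpos : 0 < 2 * n₁ + 2 * n₂ - 1 := by omega
  set i₀ : Fin (2 * n₁ + 2 * n₂ - 1) := ⟨0, hpos⟩
  have hv : v = fun a => diag n₁ n₂ (v a i₀) := by
    ext1 a
    funext i
    have : i = i₀ := Fin.ext (by have := i.2; simp only [i₀]; omega)
    rw [this]
    rfl
  have h1 := hc fun a => v a i₀
  rw [← hv] at h1
  simp only [inner_zero_left, mul_zero, add_zero] at h1
  rw [h1, Fin.prod_univ_two, norm_mul, Real.norm_eq_abs]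
  gcongr
  refine (norm_inner_le_norm _ _).trans ?_
  gcongr <;> exact norm_le_pi_norm _ _

/-- The condition controls a single matrix element at the renormalization point. It is carried up in
the scale there, then moved to zero momentum by the third derivative; at zero momentum it controls
the whole form. -/
theorem IsFlowPair.bdd_two (h : IsFlowPair f g) (hC : 3 ≤ C) (hn : n₁ + n₂ = 1)
    (hg : FlowBdd C θ g 2)
    (hs : Bdd Par.scales C (weight θ n₂ (2 * (n₁ + n₂) + (2 + 1))) f (2 + 1))
    (h0 : ∀ p, iteratedFDeriv ℝ 2 (f p 0) (renPoint p.pbar n₁ n₂)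
      (fun _ => diag n₁ n₂ (perp (p.pbar 0))) = 0) :
    Bdd Par.scales C (weight θ n₂ (2 * (n₁ + n₂) + 2)) f 2 := by
  have hC0 : 0 ≤ C := by linarith
  refine h.bdd_of_succ hC0 hg hs ?_
  have hdiag : ∀ q : Mom, ‖q‖ = 1 → ‖diag n₁ n₂ q‖ ≤ 1 := fun q hq =>
    (pi_norm_le_iff_of_nonneg zero_le_one).2 fun _ => hq.le
  obtain ⟨β, hβ, hb⟩ := h.point_bound hC0 (by omega) hg (k₀ := fun p => renPoint p.pbar n₁ n₂)
    (fun p => p.renPoint_mem_ball hC) (v := fun p _ => diag n₁ n₂ (perp (p.pbar 0)))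
    (fun p _ => hdiag _ (norm_perp _)) le_rfl
    (fun p => by rw [h0, abs_zero, zero_mul])
  obtain ⟨γ, hγ, hc⟩ := h.norm_sub_le_of_succ hC0 hs
  refine ⟨fun p => β p + γ p, hβ.add hγ, fun p Λ hΛ => ⟨0, p.zero_mem_ball hC0 hΛ.1.1, ?_⟩⟩
  refine ((h.invariant p Λ).norm_secondDeriv_le hn (h.contDiff p Λ)
    (norm_perp (p.pbar 0))).trans ?_
  have h1 := hb p Λ hΛ.1
  have h2 := hc p Λ hΛ _ (p.ball_mono hC0 hΛ.1.1 (p.renPoint_mem_ball hC)) 0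
    (p.zero_mem_ball hC0 hΛ.1.1)
  set T := iteratedFDeriv ℝ 2 (f p Λ) 0 with hT
  set T' := iteratedFDeriv ℝ 2 (f p Λ) (renPoint p.pbar n₁ n₂) with hT'
  have h3 := (T - T').le_opNorm (fun _ => diag n₁ n₂ (perp (p.pbar 0)))
  have h4 : ∏ _i : Fin 2, ‖diag n₁ n₂ (perp (p.pbar 0))‖ ≤ 1 :=
    Finset.prod_le_one (fun i _ => norm_nonneg _) fun i _ => hdiag _ (norm_perp _)
  have h5 := mul_le_of_le_one_right (norm_nonneg (T - T')) h4
  rw [sub_apply, Real.norm_eq_abs] at h3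
  have h6 := abs_sub_abs_le_abs_sub (T fun _ => diag n₁ n₂ (perp (p.pbar 0)))
    (T' fun _ => diag n₁ n₂ (perp (p.pbar 0)))
  linarith

/-- Bounds on the solution of a flow equation follow from bounds on its right-hand side, from
bounds on the irrelevant terms at the cutoff scale, and from renormalization conditions. -/
theorem IsFlowPair.hasWeight (h : IsFlowPair f g) (hC : 3 ≤ C) (hθ : θ ≤ 2) (hn : 1 ≤ n₁ + n₂)
    (hg : ScaledBdd Par.scales C (baseWeight θ n₂ (3 - 2 * (n₁ + n₂ : ℕ))) g)
    (htop : ∀ z, 6 ≤ 2 * (n₁ + n₂) + z →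
      Bdd (fun p => {p.L0}) C (weight θ n₂ (2 * (n₁ + n₂) + z)) f z)
    {A : ℝ} (hA : 0 ≤ A)
    (hval : n₁ + n₂ ≤ 2 → ∀ p, |f p 0 (renPoint p.pbar n₁ n₂)| ≤
      A * weight θ n₂ (2 * (n₁ + n₂)) p 0)
    (hfield : n₁ + n₂ = 1 → ∀ p, iteratedFDeriv ℝ 2 (f p 0) (renPoint p.pbar n₁ n₂)
      (fun _ => diag n₁ n₂ (perp (p.pbar 0))) = 0) : HasWeight C θ f := by
  have hC0 : 0 ≤ C := by linarith
  have hgz := hg.flowBdd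
  have hirr : ∀ z, 6 ≤ 2 * (n₁ + n₂) + z →
      Bdd Par.scales C (weight θ n₂ (2 * (n₁ + n₂) + z)) f z := fun z hz =>
    h.bdd_of_top hC0 hθ hz (hgz z) (htop z hz)
  intro z
  by_cases hz : 6 ≤ 2 * (n₁ + n₂) + z
  · exact hirr z hz
  -- Descend in `z`. Odd derivatives follow from parity, starting at `D = 5`; even ones from the
  -- renormalization conditions.
  · obtain h2 | h1 : n₁ + n₂ = 2 ∨ n₁ + n₂ = 1 := by omega
    · have b1 := h.bdd_of_odd hC0 (z := 1) (by decide) (hgz 1) (hirr _ (by omega))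
      have b0 := h.bdd_zero hC (by omega) (hgz 0) b1 hA (hval (by omega))
      obtain rfl | rfl : z = 0 ∨ z = 1 := by omega
      · exact b0
      · exact b1
    · have b3 := h.bdd_of_odd hC0 (z := 3) (by decide) (hgz 3) (hirr _ (by omega))
      have b2 := h.bdd_two hC h1 (hgz 2) b3 (hfield h1)
      have b1 := h.bdd_of_odd hC0 (z := 1) (by decide) (hgz 1) b2
      have b0 := h.bdd_zero hC (by omega) (hgz 0) b1 hA (hval (by omega))
      obtain rfl | rfl | rfl | rfl : z = 0 ∨ z = 1 ∨ z = 2 ∨ z = 3 := by omega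
      · exact b0
      · exact b1
      · exact b2
      · exact b3

end FlowPair


/-! ### The derivative with respect to the ultraviolet cutoff -/

section CutoffDerivative

variable {n₁ n₂ : ℕ} {K : ℝ → ℝ} {m M : ℝ} {pbar : Fin 5 → Mom} {F : ℝ → VertexFamily}

theorem IsRenormalizedFlow.dot_connected (hF : IsRenormalizedFlow K m M pbar F) (Λ₀ Λ : ℝ) :
    IsConnectedAt (dotFamily F Λ₀) Λ where
  zero n₁ n₂ hn k := by
    have : (fun s => F s 0 n₁ n₂ Λ k) = fun _ => 0 :=
      funext fun s => (hF.connected s Λ).zero n₁ n₂ hn k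
    rw [dotFamily, dot, this, deriv_const]
  connected r n₁ n₂ hn k := by
    have : (fun s => F s r n₁ n₂ Λ k) = fun _ => 0 :=
      funext fun s => (hF.connected s Λ).connected r n₁ n₂ hn k
    rw [dotFamily, dot, this, deriv_const]

theorem IsRenormalizedFlow.dot_invariant (hF : IsRenormalizedFlow K m M pbar F) (Λ₀ Λ : ℝ)
    (r : Fin 3 → ℕ) (hn : 1 ≤ n₁ + n₂) : IsInvariant (dotFamily F Λ₀ r n₁ n₂ Λ) := fun R k => by
  have : (fun s => F s r n₁ n₂ Λ fun i => R (k i)) = fun s => F s r n₁ n₂ Λ k :=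
    funext fun s => hF.invariant s Λ r n₁ n₂ hn R k
  rw [dotFamily, dotFamily, dot, dot, this]

/-- The derivatives in the two scales commute, and differentiating the right-hand side in `Λ₀`
linearizes it. -/
theorem IsRenormalizedFlow.dot_flow (hF : IsRenormalizedFlow K m M pbar F) (hK : IsCutoffProfile K)
    (hm : 0 < m) (hM : 0 < M) (r : Fin 3 → ℕ) (hn : 1 ≤ n₁ + n₂) (Λ₀ Λ : ℝ) (k : Config n₁ n₂) :
    HasDerivAt (fun s => dotFamily F Λ₀ r n₁ n₂ s k)
      (linRHS K m M (F Λ₀) (dotFamily F Λ₀) r n₁ n₂ Λ k) Λ := by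
  have hs : ContDiff ℝ ∞ (fun x : ℝ × ℝ => F x.2 r n₁ n₂ x.1 k) :=
    (hF.smooth r n₁ n₂ hn).comp contDiff_snd contDiff_fst contDiff_const
  have h := (hasDerivAt_fderiv_param (h := fun t s => F s r n₁ n₂ t k) hs Λ₀ Λ).clm_apply
    (hasDerivAt_const Λ (1 : ℝ))
  have e1 : (fun s => deriv (fun t => F s r n₁ n₂ t k) Λ) =
      fun s => flowRHS K m M (F s) r n₁ n₂ Λ k := funext fun s => (hF.flow r n₁ n₂ hn s Λ k).deriv
  rw [e1] at h
  simp only [fderiv_apply_one_eq_deriv, map_zero, add_zero] at h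
  rwa [(hasDerivAt_flowRHS hK hm hM hF.smooth r hn Λ₀ Λ k).deriv] at h

theorem IsRenormalizedFlow.dot_ren_value (hF : IsRenormalizedFlow K m M pbar F) (r : Fin 3 → ℕ)
    (hn : 1 ≤ n₁ + n₂) (hn2 : n₁ + n₂ ≤ 2) (Λ₀ : ℝ) :
    dotFamily F Λ₀ r n₁ n₂ 0 (renPoint pbar n₁ n₂) = 0 := by
  have : (fun s => F s r n₁ n₂ 0 (renPoint pbar n₁ n₂)) = fun _ => renValue r n₁ n₂ :=
    funext fun s => hF.ren_value r n₁ n₂ hn hn2 s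
  rw [dotFamily, dot, this, deriv_const]

theorem IsSmoothFamily.hasDerivAt_iteratedFDeriv (hF : IsSmoothFamily F) (r : Fin 3 → ℕ)
    (hn : 1 ≤ n₁ + n₂) (z : ℕ) (Λ₀ Λ : ℝ) (k : Config n₁ n₂) :
    HasDerivAt (fun s => iteratedFDeriv ℝ z (F s r n₁ n₂ Λ) k)
      (iteratedFDeriv ℝ z (PhiPsi.dotFamily F Λ₀ r n₁ n₂ Λ) k) Λ₀ :=
  hasDerivAt_iteratedFDeriv_param (h := fun s => F s r n₁ n₂ Λ) ((hF r n₁ n₂ hn).fst_param Λ) z k Λ₀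

theorem IsRenormalizedFlow.dot_ren_field (hF : IsRenormalizedFlow K m M pbar F) (r : Fin 3 → ℕ)
    (hn : n₁ + n₂ = 1) (Λ₀ : ℝ) :
    iteratedFDeriv ℝ 2 (dotFamily F Λ₀ r n₁ n₂ 0) (renPoint pbar n₁ n₂)
      (fun _ => diag n₁ n₂ (perp (pbar 0))) = 0 := by
  have h := (ContinuousMultilinearMap.apply ℝ (fun _ : Fin 2 => Config n₁ n₂) ℝ
    (fun _ => diag n₁ n₂ (perp (pbar 0)))).hasFDerivAt.comp_hasDerivAt Λ₀
    (hF.smooth.hasDerivAt_iteratedFDeriv r hn.ge 2 Λ₀ 0 (renPoint pbar n₁ n₂))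
  refine h.unique ((hasDerivAt_const Λ₀ (0 : ℝ)).congr_of_eventuallyEq
    (Eventually.of_forall fun s => ?_))
  exact hF.ren_field r n₁ n₂ hn s

/-- Along the diagonal `Λ = Λ₀` the function is local for every cutoff, so its total derivative is
local as well. This derivative is the sum of the two partial ones, and the one in `Λ` is given by
the flow. -/
theorem IsRenormalizedFlow.dot_bare (hF : IsRenormalizedFlow K m M pbar F) (r : Fin 3 → ℕ)
    (hn : 1 ≤ n₁ + n₂) (Λ₀ : ℝ) : ∃ a b : ℝ, (2 < n₁ + n₂ → a = 0) ∧ (1 < n₁ + n₂ → b = 0) ∧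
      ∀ k, dotFamily F Λ₀ r n₁ n₂ Λ₀ k = a + b * quad n₁ n₂ k -
        flowRHS K m M (F Λ₀) r n₁ n₂ Λ₀ k := by
  obtain ⟨a, b, ha, hb, ha0, hb0, hab⟩ := hF.bare r n₁ n₂ hn
  refine ⟨deriv a Λ₀, deriv b Λ₀, fun h => by simp [ha0 h], fun h => by simp [hb0 h], fun k => ?_⟩
  have hs : ContDiff ℝ ∞ (fun x : ℝ × ℝ => F x.1 r n₁ n₂ x.2 k) :=
    (hF.smooth r n₁ n₂ hn).comp contDiff_fst contDiff_snd contDiff_const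
  obtain ⟨T, hT⟩ := (hs.differentiable (by simp)) (Λ₀, Λ₀)
  have h1 : HasDerivAt (fun s => F s r n₁ n₂ Λ₀ k) (T (1, 0)) Λ₀ :=
    HasFDerivAt.comp_hasDerivAt (f := fun s : ℝ => (s, Λ₀)) Λ₀ hT
      ((hasDerivAt_id Λ₀).prodMk (hasDerivAt_const Λ₀ Λ₀))
  have h2 : HasDerivAt (fun s => F Λ₀ r n₁ n₂ s k) (T (0, 1)) Λ₀ :=
    HasFDerivAt.comp_hasDerivAt (f := fun s : ℝ => (Λ₀, s)) Λ₀ hT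
      ((hasDerivAt_const Λ₀ Λ₀).prodMk (hasDerivAt_id Λ₀))
  have h3 : HasDerivAt (fun s => F s r n₁ n₂ s k) (T (1, 1)) Λ₀ :=
    HasFDerivAt.comp_hasDerivAt (f := fun s : ℝ => (s, s)) Λ₀ hT
      ((hasDerivAt_id Λ₀).prodMk (hasDerivAt_id Λ₀))
  have h4 : HasDerivAt (fun s => F s r n₁ n₂ s k) (deriv a Λ₀ + deriv b Λ₀ * quad n₁ n₂ k) Λ₀ := by
    simp_rw [hab]
    exact ((ha.differentiable (by simp)) Λ₀).hasDerivAt.add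
      (((hb.differentiable (by simp)) Λ₀).hasDerivAt.mul_const _)
  have h5 : T (1, 1) = T (1, 0) + T (0, 1) := by rw [← map_add]; simp
  have e1 := h1.unique ((hF.smooth r n₁ n₂ hn).hasDerivAt_dot Λ₀ Λ₀ k)
  have e2 := h2.unique (hF.flow r n₁ n₂ hn Λ₀ Λ₀ k)
  have e3 := h3.unique h4
  have e4 : dotFamily F Λ₀ r n₁ n₂ Λ₀ k = T (1, 0) := e1.symm
  linarith

/-- The constant terms have `D ≤ 4`, and the second derivative of the kinetic term has `D = 4`;
nothing of a local action survives beyond. -/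
theorem iteratedFDeriv_bare_eq_zero (hn : 1 ≤ n₁ + n₂) {a b : ℝ} (ha : 2 < n₁ + n₂ → a = 0)
    (hb : 1 < n₁ + n₂ → b = 0) {z : ℕ} (hz : 5 ≤ 2 * (n₁ + n₂) + z) (k : Config n₁ n₂) :
    iteratedFDeriv ℝ z (fun k => a + b * quad n₁ n₂ k) k = 0 := by
  have hq := contDiff_quad hn
  have hz' : (z : WithTop ℕ∞) ≤ ∞ := by exact_mod_cast le_top
  have e : (fun k => a + b * quad n₁ n₂ k) = (fun _ => a) + b • quad n₁ n₂ := rfl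
  rw [e, iteratedFDeriv_add_apply contDiff_const.contDiffAt
    ((show ContDiff ℝ ∞ (b • quad n₁ n₂) from hq.const_smul b).contDiffAt.of_le hz'),
    iteratedFDeriv_const_smul_apply (hq.contDiffAt.of_le hz')]
  have h1 : b • iteratedFDeriv ℝ z (quad n₁ n₂) k = 0 := by
    by_cases h : 1 < n₁ + n₂
    · rw [hb h, zero_smul]
    · rw [iteratedFDeriv_quad_eq_zero hn (by omega), smul_zero]
  rw [h1, add_zero]
  by_cases h : 2 < n₁ + n₂
  · rw [ha h]
    exact congrFun (iteratedFDeriv_fun_zero) k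
  · rw [iteratedFDeriv_const_of_ne (by omega)]
    rfl

end CutoffDerivative

/-! ### The two inductions on rank -/

section Induction

variable {n₁ n₂ : ℕ} {C : ℝ} {K : ℝ → ℝ} {F : Par → ℝ → VertexFamily}

/-- The vertex functions at the ultraviolet cutoff of `p`. -/
def atCutoff (F : Par → ℝ → VertexFamily) (p : Par) : VertexFamily := F p p.L0

/-- The derivatives of the vertex functions with respect to the ultraviolet cutoff, multiplied by
its cube. -/
noncomputable def scaledDot (F : Par → ℝ → VertexFamily) (p : Par) : VertexFamily :=
  fun r n₁ n₂ Λ k => p.L0 ^ 3 * dotFamily (F p) p.L0 r n₁ n₂ Λ k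

theorem isMomSmooth_atCutoff (hF : ∀ p, IsRenormalizedFlow K p.m p.M p.pbar (F p)) :
    IsMomSmooth (atCutoff F) := fun r n₁ n₂ hn p Λ => ((hF p).smooth r n₁ n₂ hn).mom p.L0 Λ

theorem isSmooth_scaledDot (hF : ∀ p, IsRenormalizedFlow K p.m p.M p.pbar (F p)) (p : Par)
    (r : Fin 3 → ℕ) (hn : 1 ≤ n₁ + n₂) :
    IsSmooth (fun s Λ k => p.L0 ^ 3 * dotFamily (F p) s r n₁ n₂ Λ k) :=
  ((hF p).smooth.dotFamily r n₁ n₂ hn).const_mul _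

theorem isMomSmooth_scaledDot (hF : ∀ p, IsRenormalizedFlow K p.m p.M p.pbar (F p)) :
    IsMomSmooth (scaledDot F) := fun r _ _ hn p Λ => (isSmooth_scaledDot hF p r hn).mom p.L0 Λ

theorem isConnectedAt_scaledDot (hF : ∀ p, IsRenormalizedFlow K p.m p.M p.pbar (F p)) (p : Par)
    (Λ : ℝ) : IsConnectedAt (scaledDot F p) Λ where
  zero n₁ n₂ hn k := by rw [scaledDot, ((hF p).dot_connected _ _).zero n₁ n₂ hn k, mul_zero]
  connected r n₁ n₂ hn k := by
    rw [scaledDot, ((hF p).dot_connected _ _).connected r n₁ n₂ hn k, mul_zero]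

theorem scaledBdd_flowRHS (hF : ∀ p, IsRenormalizedFlow K p.m p.M p.pbar (F p))
    (hK : IsCutoffProfile K) (hC : 2 ≤ C) (r : Fin 3 → ℕ) (hn : 1 ≤ n₁ + n₂)
    (h : ∀ s l₁ l₂, 1 ≤ l₁ + l₂ → ∑ i, s i < ∑ i, r i →
      HasWeight C 0 (fun p Λ k => atCutoff F p s l₁ l₂ Λ k))
    (h' : ∀ l₁ l₂, l₁ + l₂ = n₁ + n₂ + 1 →
      HasWeight C 0 (fun p Λ k => atCutoff F p r l₁ l₂ Λ k)) :
    ScaledBdd Par.scales C (baseWeight 0 n₂ (3 - 2 * (n₁ + n₂ : ℕ)))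
      (fun p Λ k => flowRHS K p.m p.M (atCutoff F p) r n₁ n₂ Λ k) := by
  simp_rw [flowRHS_eq_trees]
  have hs := isMomSmooth_atCutoff hF
  have hc : ∀ p Λ, IsConnectedAt (atCutoff F p) Λ := fun p Λ => (hF p).connected p.L0 Λ
  exact scaledBdd_loops_trees hK hC hn hs r
    (fun p Λ => contDiff_loops hK p.m_pos p.M_pos hn ((hF p).smooth r (n₁ + 1) n₂ (by omega))
      ((hF p).smooth r n₁ (n₂ + 1) (by omega)) p.L0 Λ) h'
    (scaledBdd_treesLight hK hC hn hs hs hc hc r h h)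
    (scaledBdd_treesHeavy hK hC hn hs hs hc hc r h h)

theorem scaledBdd_linRHS (hF : ∀ p, IsRenormalizedFlow K p.m p.M p.pbar (F p))
    (hK : IsCutoffProfile K) (hC : 2 ≤ C) (r : Fin 3 → ℕ) (hn : 1 ≤ n₁ + n₂)
    (hU : ∀ s l₁ l₂, 1 ≤ l₁ + l₂ → HasWeight C 0 (fun p Λ k => atCutoff F p s l₁ l₂ Λ k))
    (h : ∀ s l₁ l₂, 1 ≤ l₁ + l₂ → ∑ i, s i < ∑ i, r i →
      HasWeight C 2 (fun p Λ k => scaledDot F p s l₁ l₂ Λ k))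
    (h' : ∀ l₁ l₂, l₁ + l₂ = n₁ + n₂ + 1 →
      HasWeight C 2 (fun p Λ k => scaledDot F p r l₁ l₂ Λ k)) :
    ScaledBdd Par.scales C (baseWeight 2 n₂ (3 - 2 * (n₁ + n₂ : ℕ)))
      (fun p Λ k => linRHS K p.m p.M (atCutoff F p) (scaledDot F p) r n₁ n₂ Λ k) := by
  unfold linRHS
  have hs := isMomSmooth_atCutoff hF
  have hd := isMomSmooth_scaledDot hF
  have hc : ∀ p Λ, IsConnectedAt (atCutoff F p) Λ := fun p Λ => (hF p).connected p.L0 Λ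
  have hdc := isConnectedAt_scaledDot hF
  have hU' : ∀ s l₁ l₂, 1 ≤ l₁ + l₂ → ∑ i, s i < ∑ i, r i →
      HasWeight C 0 (fun p Λ k => atCutoff F p s l₁ l₂ Λ k) := fun s l₁ l₂ hl _ => hU s l₁ l₂ hl
  have a1 := scaledBdd_treesLight hK hC hn hd hs hdc hc r h hU'
  have a2 := scaledBdd_treesLight hK hC hn hs hd hc hdc r hU' h
  have b1 := scaledBdd_treesHeavy hK hC hn hd hs hdc hc r h hU'
  have b2 := scaledBdd_treesHeavy hK hC hn hs hd hc hdc r hU' h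
  rw [add_zero] at a1 b1
  rw [zero_add] at a2 b2
  exact scaledBdd_loops_trees hK hC hn hd r
    (fun p Λ => contDiff_loops hK p.m_pos p.M_pos hn
      (isSmooth_scaledDot hF p r (n₁ := n₁ + 1) (n₂ := n₂) (by omega))
      (isSmooth_scaledDot hF p r (n₁ := n₁) (n₂ := n₂ + 1) (by omega)) p.L0 Λ) h'
    ⟨fun p Λ => (a1.1 p Λ).add (a2.1 p Λ), a1.2.add a1.1 a2.1 a2.2⟩
    ⟨fun p Λ => (b1.1 p Λ).add (b2.1 p Λ), b1.2.add b1.1 b2.1 b2.2⟩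

theorem abs_renValue_le (r : Fin 3 → ℕ) (hn : 1 ≤ n₁ + n₂) (p : Par) :
    |renValue r n₁ n₂| ≤ 1 * weight 0 n₂ (2 * (n₁ + n₂)) p 0 := by
  have hw := (weight_pos 0 n₂ (2 * (n₁ + n₂)) p le_rfl).le
  by_cases h2 : n₁ + n₂ = 2
  · have : weight 0 n₂ (2 * (n₁ + n₂)) p 0 = 1 := by simp [weight, h2]
    rw [this]
    unfold renValue
    split <;> (try split_ifs) <;> norm_num
  · have : renValue r n₁ n₂ = 0 := by
      unfold renValue
      split <;> first | omega | rfl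
    rw [this, abs_zero, one_mul]
    exact hw

/-- A loop vertex with more legs than connectedness permits need not have smaller rank, because of
the truncated subtraction; it is supplied by `hzero` instead. -/
theorem rank_induction {P : (Fin 3 → ℕ) → ℕ → ℕ → Prop}
    (hzero : ∀ r n₁ n₂, 1 ≤ n₁ + n₂ → (r = 0 ∨ (∑ i, r i) + 1 < n₁ + n₂) → P r n₁ n₂)
    (hstep : ∀ r n₁ n₂, 1 ≤ n₁ + n₂ →
      (∀ s l₁ l₂, 1 ≤ l₁ + l₂ → ∑ i, s i < ∑ i, r i → P s l₁ l₂) →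
      (∀ l₁ l₂, l₁ + l₂ = n₁ + n₂ + 1 → P r l₁ l₂) → P r n₁ n₂) :
    ∀ r n₁ n₂, 1 ≤ n₁ + n₂ → P r n₁ n₂ := by
  suffices h : ∀ N r n₁ n₂, 1 ≤ n₁ + n₂ → rank r n₁ n₂ < N → P r n₁ n₂ from
    fun r n₁ n₂ hn => h _ r n₁ n₂ hn (Nat.lt_succ_self _)
  intro N
  induction N with
  | zero => intro r n₁ n₂ _ h; omega
  | succ N ih =>
    intro r n₁ n₂ hn hN
    refine hstep r n₁ n₂ hn (fun s l₁ l₂ hl hs => ih s l₁ l₂ hl ?_) fun l₁ l₂ hl => ?_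
    · have := rank_lt_of_sum_lt hs n₁ n₂ l₁ l₂
      omega
    · by_cases h : n₁ + n₂ ≤ ∑ i, r i
      · refine ih r l₁ l₂ (by omega) ?_
        have := rank_lt_of_legs h (n₁' := l₁) (n₂' := l₂) (by omega)
        omega
      · exact hzero r l₁ l₂ (by omega) (Or.inr (by omega))

theorem IsConnectedAt.eq_zero {L : VertexFamily} {Λ : ℝ} (h : IsConnectedAt L Λ) {r : Fin 3 → ℕ}
    (hn : 1 ≤ n₁ + n₂) (h0 : r = 0 ∨ (∑ i, r i) + 1 < n₁ + n₂) (k : Config n₁ n₂) :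
    L r n₁ n₂ Λ k = 0 := by
  rcases h0 with rfl | h0
  · exact h.zero _ _ hn k
  · exact h.connected _ _ _ h0 k

/-- The irrelevant derivatives vanish at the cutoff scale by locality, and the renormalized values
are bounded by the weight at scale `0`, which is `1` for four legs. -/
theorem hasWeight_atCutoff (hF : ∀ p, IsRenormalizedFlow K p.m p.M p.pbar (F p))
    (hK : IsCutoffProfile K) (hC : 3 ≤ C) :
    ∀ r n₁ n₂, 1 ≤ n₁ + n₂ → HasWeight C 0 (fun p Λ k => atCutoff F p r n₁ n₂ Λ k) := by
  refine rank_induction (fun r n₁ n₂ hn h0 => HasWeight.of_eq_zero fun p Λ k =>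
    ((hF p).connected p.L0 Λ).eq_zero hn h0 k) fun r n₁ n₂ hn h h' => ?_
  have hg := scaledBdd_flowRHS hF hK (by linarith) r hn h h'
  refine IsFlowPair.hasWeight ⟨fun p => ((hF p).smooth r n₁ n₂ hn).snd_param p.L0,
    fun p Λ k => (hF p).flow r n₁ n₂ hn p.L0 Λ k,
    fun p Λ => (hF p).invariant p.L0 Λ r n₁ n₂ hn⟩ hC (by norm_num) hn hg (fun z hz => ?_)
    zero_le_one (fun hn2 p => ?_) fun h1 p => (hF p).ren_field r n₁ n₂ h1 p.L0
  · refine ⟨fun _ => 0, IsPlog.const le_rfl, fun p Λ hΛ k _ => ?_⟩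
    obtain rfl : Λ = p.L0 := hΛ
    obtain ⟨a, b, -, -, ha, hb, hab⟩ := (hF p).bare r n₁ n₂ hn
    have e : (fun k => atCutoff F p r n₁ n₂ p.L0 k) = fun k => a p.L0 + b p.L0 * quad n₁ n₂ k :=
      funext fun k => hab p.L0 k
    dsimp only
    rw [e, iteratedFDeriv_bare_eq_zero hn (fun h => by simp [ha h]) (fun h => by simp [hb h])
      (by omega)]
    simp
  · have := (hF p).ren_value r n₁ n₂ hn hn2 p.L0
    rw [atCutoff, this]
    exact abs_renValue_le r hn p

/-- The renormalized values do not depend on the cutoff, so the conditions become homogeneous. At `Λ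
= Λ₀` the irrelevant derivatives equal minus those of the right-hand side of the flow, already
bounded with an extra `1/u`. There `Λ₀³ ≤ X² u`, which pays for that `1/u` and leaves `X²`: hence `θ
= 2`. -/
theorem hasWeight_scaledDot (hF : ∀ p, IsRenormalizedFlow K p.m p.M p.pbar (F p))
    (hK : IsCutoffProfile K) (hC : 3 ≤ C) :
    ∀ r n₁ n₂, 1 ≤ n₁ + n₂ → HasWeight C 2 (fun p Λ k => scaledDot F p r n₁ n₂ Λ k) := by
  have hU := hasWeight_atCutoff hF hK hC
  refine rank_induction (fun r n₁ n₂ hn h0 => HasWeight.of_eq_zero fun p Λ k =>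
    (isConnectedAt_scaledDot hF p Λ).eq_zero hn h0 k) fun r n₁ n₂ hn h h' => ?_
  have hg := scaledBdd_linRHS hF hK (by linarith) r hn hU h h'
  have hG := scaledBdd_flowRHS hF hK (by linarith) r hn (fun s l₁ l₂ hl _ => hU s l₁ l₂ hl)
    (fun l₁ l₂ hl => hU r l₁ l₂ (by omega))
  refine IsFlowPair.hasWeight ⟨fun p => (isSmooth_scaledDot hF p r hn).snd_param p.L0,
    fun p Λ k => ?_, fun p Λ => ((hF p).dot_invariant p.L0 Λ r hn).const_mul _⟩ hC le_rfl hn hg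
    (fun z hz => ?_) le_rfl (fun hn2 p => ?_) fun h1 p => ?_
  · have h1 := ((hF p).dot_flow hK p.m_pos p.M_pos r hn p.L0 Λ k).const_mul (p.L0 ^ 3)
    rw [← linRHS_const_mul] at h1
    exact h1
  · obtain ⟨β, hβ, hb⟩ := hG.flowBdd z
    refine ⟨β, hβ, fun p Λ hΛ k hk => ?_⟩
    obtain rfl : Λ = p.L0 := hΛ
    obtain ⟨a, b, ha, hb', hab⟩ := (hF p).dot_bare r hn p.L0
    have hL := p.L0_pos
    have hu := p.u_pos hL.le
    have hz' : (z : WithTop ℕ∞) ≤ ∞ := by exact_mod_cast le_top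
    have sA : ContDiff ℝ ∞ (fun k => a + b * quad n₁ n₂ k) :=
      contDiff_const.add (contDiff_const.mul (contDiff_quad hn))
    have sG : ContDiff ℝ ∞ (flowRHS K p.m p.M (atCutoff F p) r n₁ n₂ p.L0) :=
      ((hF p).smooth.flowRHS hK p.m_pos p.M_pos r hn).mom p.L0 p.L0
    have e : (fun k => dotFamily (F p) p.L0 r n₁ n₂ p.L0 k) =
        (fun k => a + b * quad n₁ n₂ k) - flowRHS K p.m p.M (atCutoff F p) r n₁ n₂ p.L0 :=
      funext hab
    have h1 := norm_iteratedFDeriv_const_mul_le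
      (((hF p).smooth.dotFamily r n₁ n₂ hn).mom p.L0 p.L0) (p.L0 ^ 3) z k
    have h2 := hb p p.L0 ⟨hL.le, le_rfl⟩ k hk
    have h3 : ‖iteratedFDeriv ℝ z (fun k => dotFamily (F p) p.L0 r n₁ n₂ p.L0 k) k‖ ≤
        weight 0 n₂ (2 * (n₁ + n₂) + z) p p.L0 * β p / p.u p.L0 := by
      rw [e, iteratedFDeriv_sub_apply (sA.contDiffAt.of_le hz') (sG.contDiffAt.of_le hz'),
        iteratedFDeriv_bare_eq_zero hn ha hb' (by omega), zero_sub, norm_neg]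
      exact h2
    have hu1 : p.L0 ≤ p.u p.L0 := by unfold Par.u; linarith [p.m_pos]
    have hX1 := hu1.trans (p.u_le_X n₂ p.L0)
    have hw : p.L0 ^ 3 * (weight 0 n₂ (2 * (n₁ + n₂) + z) p p.L0 * β p / p.u p.L0) ≤
        weight 2 n₂ (2 * (n₁ + n₂) + z) p p.L0 * β p := by
      rw [weight_eq_baseWeight 0 (by omega) p hL.le, weight_eq_baseWeight 2 (by omega) p hL.le]
      unfold baseWeight
      have hβp := hβ.1 p
      have hzp := zpow_pos hu (4 - (2 * (n₁ + n₂) + z : ℕ) : ℤ)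
      rw [pow_zero, one_mul, ← mul_div_assoc, div_le_iff₀ hu]
      have : p.L0 ^ 3 ≤ p.X n₂ p.L0 ^ 2 * p.u p.L0 := by
        calc p.L0 ^ 3 = p.L0 ^ 2 * p.L0 := by ring
          _ ≤ _ := by gcongr
      calc p.L0 ^ 3 * (p.u p.L0 ^ (4 - (2 * (n₁ + n₂) + z : ℕ) : ℤ) * β p)
          ≤ (p.X n₂ p.L0 ^ 2 * p.u p.L0) *
            (p.u p.L0 ^ (4 - (2 * (n₁ + n₂) + z : ℕ) : ℤ) * β p) := by gcongr
        _ = _ := by ring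
    have h4 : p.L0 ^ 3 * ‖iteratedFDeriv ℝ z (fun k => dotFamily (F p) p.L0 r n₁ n₂ p.L0 k) k‖ ≤
        p.L0 ^ 3 * (weight 0 n₂ (2 * (n₁ + n₂) + z) p p.L0 * β p / p.u p.L0) := by gcongr
    refine h1.trans_le ?_
    rw [abs_of_pos (by positivity)]
    exact h4.trans hw
  · rw [scaledDot, (hF p).dot_ren_value r hn hn2, mul_zero, abs_zero, zero_mul]
  · have h2 := (hF p).dot_ren_field r h1 p.L0
    have h2' : (2 : ℕ) ≤ (∞ : WithTop ℕ∞) := ENat.LEInfty.out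
    have e : (fun k => scaledDot F p r n₁ n₂ 0 k) =
        p.L0 ^ 3 • dotFamily (F p) p.L0 r n₁ n₂ 0 := rfl
    rw [e, iteratedFDeriv_const_smul_apply
      ((((hF p).smooth.dotFamily r n₁ n₂ hn).mom p.L0 0).contDiffAt.of_le h2'), smul_apply, h2,
      smul_zero]

end Induction


/-! ### Final bounds and removal of the cutoff -/

section Main

variable {n₁ n₂ : ℕ} {K : ℝ → ℝ}

theorem exists_dot_bound (hK : IsCutoffProfile K) {C : ℝ} (hC : 3 ≤ C) (r : Fin 3 → ℕ)
    (hn : 1 ≤ n₁ + n₂) (z : ℕ) : ∃ (A : ℝ) (N : ℕ), 0 ≤ A ∧ ∀ p : Par, ∀ Λ ∈ p.scales,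
      ∀ k ∈ p.ball C Λ n₁ n₂,
        ‖iteratedFDeriv ℝ z (dotFamily (vertex K p.m p.M p.pbar) p.L0 r n₁ n₂ Λ) k‖ ≤
          (p.L0 ^ 3)⁻¹ * weight 2 n₂ (2 * (n₁ + n₂) + z) p Λ * (A * p.ell ^ N) := by
  have hF : ∀ p : Par, IsRenormalizedFlow K p.m p.M p.pbar (vertex K p.m p.M p.pbar) := fun p =>
    isRenormalizedFlow_vertex hK p.m_pos p.M_pos
  obtain ⟨β, hβ, hb⟩ := hasWeight_scaledDot hF hK hC r n₁ n₂ hn z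
  obtain ⟨A, N, hA, hN⟩ := hβ.exists_bound
  refine ⟨A, N, hA, fun p Λ hΛ k hk => ?_⟩
  have hL := p.L0_pos
  have h1 := norm_iteratedFDeriv_const_mul_le
    (((hF p).smooth.dotFamily r n₁ n₂ hn).mom p.L0 Λ) (p.L0 ^ 3) z k
  have h2 := h1.symm.trans_le (hb p Λ hΛ k hk)
  rw [abs_of_pos (by positivity)] at h2
  have hw := (weight_pos 2 n₂ (2 * (n₁ + n₂) + z) p hΛ.1).le
  rw [mul_assoc, le_inv_mul_iff₀ (by positivity)]
  exact h2.trans (mul_le_mul_of_nonneg_left (hN p) hw)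

/-- The number of legs in the constant accounts for the dependent leg, a sum of the others. A
dependent light leg occurs only without heavy legs, so its bound involves the light scale alone. -/
theorem Par.mem_ball_of_independent (p : Par) {C c Λ : ℝ} (hΛ : 0 ≤ Λ) (hc : 0 ≤ c)
    (hC : c * (2 * n₁ + 2 * n₂ : ℕ) ≤ C) (hn : 1 ≤ n₁ + n₂) {k : Config n₁ n₂}
    (h : ∀ j : Fin (2 * n₁ + 2 * n₂ - 1), ((j : ℕ) < 2 * n₁ → ‖k j‖ ≤ c * (Λ + p.m)) ∧
      (2 * n₁ ≤ (j : ℕ) → ‖k j‖ ≤ c * (Λ + p.M))) : k ∈ p.ball C Λ n₁ n₂ := by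
  have hm := p.m_pos
  have hmM := p.m_lt
  have hcC : c ≤ C := by
    refine le_trans ?_ hC
    have : (1 : ℝ) ≤ (2 * n₁ + 2 * n₂ : ℕ) := by exact_mod_cast (by omega)
    nlinarith
  have hsum : ∀ B : ℝ, 0 ≤ B → (∀ j, ‖k j‖ ≤ c * B) → ‖-∑ i, k i‖ ≤ C * B := fun B hB hk => by
    rw [norm_neg]
    refine (norm_sum_le_of_le _ fun i _ => hk i).trans ?_
    rw [Finset.sum_const, Finset.card_univ, Fintype.card_fin, nsmul_eq_mul]
    have h1 : ((2 * n₁ + 2 * n₂ - 1 : ℕ) : ℝ) ≤ (2 * n₁ + 2 * n₂ : ℕ) := by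
      exact_mod_cast Nat.sub_le _ _
    calc _ ≤ ((2 * n₁ + 2 * n₂ : ℕ) : ℝ) * (c * B) := by gcongr
      _ = c * (2 * n₁ + 2 * n₂ : ℕ) * B := by ring
      _ ≤ C * B := by gcongr
  refine ⟨fun j hj => ?_, fun j hj => ?_⟩
  · rw [lightLegs, allLegs]
    split_ifs with h1 h2
    · exact ((h ⟨j, h1⟩).1 hj).trans (by gcongr)
    · exact hsum _ (by positivity) fun i => (h i).1 (by have := i.2; omega)
    · omega
  · rw [heavyLegs, allLegs]
    split_ifs with h1 h2
    · exact ((h ⟨2 * n₁ + j, h1⟩).2 (Nat.le_add_right _ _)).trans (by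
        have := p.M_pos
        gcongr)
    · have := p.M_pos
      refine hsum _ (by positivity) fun i => ?_
      rcases lt_or_ge (i : ℕ) (2 * n₁) with h3 | h3
      · exact ((h i).1 h3).trans (by gcongr)
      · exact (h i).2 h3
    · omega

theorem norm_single_le_one (d : Fin (2 * n₁ + 2 * n₂ - 1) × Fin 4) :
    ‖(Pi.single d.1 (EuclideanSpace.single d.2 (1 : ℝ)) : Config n₁ n₂)‖ ≤ 1 := by
  refine (pi_norm_le_iff_of_nonneg zero_le_one).2 fun i => ?_
  rcases eq_or_ne i d.1 with rfl | h
  · simp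
  · simp [Pi.single_eq_of_ne h]

theorem abs_apply_single_le {z : ℕ} (d : Fin z → Fin (2 * n₁ + 2 * n₂ - 1) × Fin 4)
    (T : ContinuousMultilinearMap ℝ (fun _ : Fin z => Config n₁ n₂) ℝ) :
    |T fun i => Pi.single (d i).1 (EuclideanSpace.single (d i).2 (1 : ℝ))| ≤ ‖T‖ :=
  (T.le_opNorm _).trans (mul_le_of_le_one_right (norm_nonneg _)
    (Finset.prod_le_one (fun _ _ => norm_nonneg _) fun _ _ => norm_single_le_one _))

variable {m M : ℝ} {pbar : Fin 5 → Mom} {L : ℝ → VertexFamily}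

/-- Uniqueness replaces a family chosen separately for each cutoff, with no regularity in `Λ₀`
assumed, by one that is smooth in `Λ₀`. -/
theorem eq_vertex (hK : IsCutoffProfile K) (hm : 0 < m) (hM : m < M)
    (hL : ∀ Λ₀, M < Λ₀ → IsVertexFamily K m M pbar Λ₀ (L Λ₀)) (r : Fin 3 → ℕ) (hn : 1 ≤ n₁ + n₂)
    {Λ s : ℝ} (hs : M < s) (hΛ : 0 ≤ Λ) (hΛs : Λ ≤ s) :
    L s r n₁ n₂ Λ = vertex K m M pbar s r n₁ n₂ Λ :=
  funext fun k => IsVertexFamily.unique ((hm.trans hM).trans hs).le (hL s hs)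
    ((isRenormalizedFlow_vertex hK hm (hm.trans hM)).isVertexFamily s) r hn Λ ⟨hΛ, hΛs⟩ k

/-- Near `Λ₀` within `Ici Λ` the cutoffs satisfy both `M < s` and `Λ ≤ s`, where the given family
agrees with `vertex`. At `Λ₀ = Λ` this is a derivative from the right. -/
theorem hasDerivWithinAt_momDeriv (hK : IsCutoffProfile K) (hm : 0 < m) (hM : m < M)
    (hL : ∀ Λ₀, M < Λ₀ → IsVertexFamily K m M pbar Λ₀ (L Λ₀)) (r : Fin 3 → ℕ) (hn : 1 ≤ n₁ + n₂)
    {Λ Λ₀ : ℝ} (hs : M < Λ₀) (hΛ : 0 ≤ Λ) (hΛs : Λ ≤ Λ₀) {z : ℕ}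
    (d : Fin z → Fin (2 * n₁ + 2 * n₂ - 1) × Fin 4) (k : Config n₁ n₂) :
    HasDerivWithinAt (fun s => momDeriv z d (L s r n₁ n₂ Λ) k)
      (momDeriv z d (dotFamily (vertex K m M pbar) Λ₀ r n₁ n₂ Λ) k) (Ici Λ) Λ₀ := by
  have h := (ContinuousMultilinearMap.apply ℝ (fun _ : Fin z => Config n₁ n₂) ℝ
    (fun i => Pi.single (d i).1 (EuclideanSpace.single (d i).2 (1 : ℝ)))).hasFDerivAt.comp_hasDerivAt
    Λ₀ ((isSmoothFamily_vertex (pbar := pbar) hK hm (hm.trans hM)).hasDerivAt_iteratedFDeriv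
      r hn z Λ₀ Λ k)
  refine HasDerivWithinAt.congr_of_eventuallyEq h.hasDerivWithinAt ?_ ?_
  · filter_upwards [self_mem_nhdsWithin, mem_nhdsWithin_of_mem_nhds (Ioi_mem_nhds hs)] with s h1 h2
    rw [eq_vertex hK hm hM hL r hn h2 hΛ h1]
    rfl
  · rw [eq_vertex hK hm hM hL r hn hs hΛ hΛs]
    rfl

theorem weight_two_light (p : Par) (hn₂ : n₂ = 0) (z : ℕ) {Λ : ℝ} (hΛ : 0 ≤ Λ) :
    (p.L0 ^ 3)⁻¹ * weight 2 n₂ (2 * (n₁ + n₂) + z) p Λ =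
      ((Λ + p.m) / p.L0) ^ 3 * (Λ + p.m) ^ ((3 : ℤ) - 2 * n₁ - z) := by
  subst hn₂
  have hu : (0 : ℝ) < Λ + p.m := p.u_pos hΛ
  have hX : p.X 0 Λ = Λ + p.m := rfl
  rw [weight_eq_baseWeight 2 (Or.inl rfl) p hΛ, baseWeight, hX, Par.u,
    show (4 - (2 * (n₁ + 0) + z : ℕ) : ℤ) = 3 - 2 * n₁ - z + 1 by push_cast; ring,
    zpow_add_one₀ hu.ne', div_pow, div_eq_mul_inv]
  ring

theorem weight_two_irrelevant (p : Par) (hn₂ : n₂ ≠ 0) {z : ℕ} (hD : 4 < 2 * (n₁ + n₂) + z) {Λ : ℝ}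
    (hΛ : 0 ≤ Λ) : (p.L0 ^ 3)⁻¹ * weight 2 n₂ (2 * (n₁ + n₂) + z) p Λ =
      ((Λ + p.M) / p.L0) ^ 2 * ((Λ + p.m) / p.L0) *
        (Λ + p.m) ^ ((3 : ℤ) - 2 * (n₁ + n₂) - z) := by
  have hu : (0 : ℝ) < Λ + p.m := p.u_pos hΛ
  have hX : p.X n₂ Λ = Λ + p.M := if_neg hn₂
  rw [weight_eq_baseWeight 2 (Or.inr hD.le) p hΛ, baseWeight, hX, Par.u,
    show (4 - (2 * (n₁ + n₂) + z : ℕ) : ℤ) = 3 - 2 * (n₁ + n₂) - z + 1 by push_cast; ring,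
    zpow_add_one₀ hu.ne', div_pow, div_eq_mul_inv, div_eq_mul_inv]
  ring

theorem weight_two_relevant (p : Par) (hn₂ : n₂ ≠ 0) {z : ℕ} (hD : 2 * (n₁ + n₂) + z ≤ 4) {Λ : ℝ}
    (hΛ : 0 ≤ Λ) : (p.L0 ^ 3)⁻¹ * weight 2 n₂ (2 * (n₁ + n₂) + z) p Λ =
      ((Λ + p.M) / p.L0) ^ 3 * (Λ + p.M) ^ ((3 : ℤ) - 2 * (n₁ + n₂) - z) := by
  have hX : p.X n₂ Λ = Λ + p.M := if_neg hn₂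
  have hX0 : 0 < Λ + p.M := hX ▸ p.X_pos n₂ hΛ
  have h1 : (Λ + p.M) ^ (4 + 2 - (2 * (n₁ + n₂) + z)) =
      (Λ + p.M) ^ 3 * (Λ + p.M) ^ ((3 : ℤ) - 2 * (n₁ + n₂) - z) := by
    rw [← zpow_natCast, ← zpow_natCast, ← zpow_add₀ hX0.ne']
    congr 1
    omega
  rw [weight, if_pos hD, hX, h1, div_pow, div_eq_mul_inv]
  ring

theorem exists_polynomial_bound (hK : IsCutoffProfile K) {κ : ℝ} (hκ : 0 < κ) (r : Fin 3 → ℕ)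
    (n₁ n₂ z : ℕ) (hn : 1 ≤ n₁ + n₂) : ∃ Plog : Polynomial ℝ, ∀ p : Par, ∀ Λ ∈ p.scales,
      ∀ k ∈ region n₁ n₂ (2 * Λ) (κ * p.m) p.M,
        ‖iteratedFDeriv ℝ z (dotFamily (vertex K p.m p.M p.pbar) p.L0 r n₁ n₂ Λ) k‖ ≤
          (p.L0 ^ 3)⁻¹ * weight 2 n₂ (2 * (n₁ + n₂) + z) p Λ *
            Plog.eval (Real.log (p.L0 / p.m)) := by
  -- The radii `max (2Λ) (κm)` and `max (2Λ) M` lie below `2 + κ` times `Λ + m` and `Λ + M`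
  -- respectively.
  obtain ⟨A, N, -, hb⟩ := exists_dot_bound hK
    (C := max 3 ((2 + κ) * (2 * n₁ + 2 * n₂ : ℕ))) (le_max_left _ _) r hn z
  refine ⟨Polynomial.C A * (1 + Polynomial.X) ^ N, fun p Λ hΛ k hk => ?_⟩
  have hm := p.m_pos
  have hM := p.M_pos
  have h0 := hΛ.1
  have h1 := hb p Λ hΛ k (p.mem_ball_of_independent h0 (c := 2 + κ) (by positivity)
    (le_max_right _ _) hn fun j => ⟨fun hj => ((hk j).1 hj).trans (max_le ?_ ?_),
      fun hj => ((hk j).2 hj).trans (max_le ?_ ?_)⟩)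
  · simpa [Par.ell] using h1
  · nlinarith
  · nlinarith
  · nlinarith
  · nlinarith

/-- The bounds on the derivatives of the vertex functions with respect to the ultraviolet cutoff. -/
theorem cutoff_derivative_bounds (hK : IsCutoffProfile K) (κ : ℝ) (hκ : 0 < κ) (r : Fin 3 → ℕ)
    (n₁ n₂ z : ℕ) (hn : 1 ≤ n₁ + n₂) : ∃ Plog : Polynomial ℝ,
      ∀ (m M : ℝ) (pbar : Fin 5 → Mom), 0 < m → m < M → (∀ i, ‖pbar i‖ = M) →
      ∀ L : ℝ → VertexFamily, (∀ Λ₀, M < Λ₀ → IsVertexFamily K m M pbar Λ₀ (L Λ₀)) →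
      ∀ Λ₀ Λ : ℝ, M < Λ₀ → 0 ≤ Λ → Λ ≤ Λ₀ →
      ∀ d : Fin z → Fin (2 * n₁ + 2 * n₂ - 1) × Fin 4,
      ∀ k ∈ region n₁ n₂ (2 * Λ) (κ * m) M,
        DifferentiableWithinAt ℝ (fun s => momDeriv z d (L s r n₁ n₂ Λ) k) (Ici Λ) Λ₀ ∧
        (n₂ = 0 →
          |derivWithin (fun s => momDeriv z d (L s r n₁ n₂ Λ) k) (Ici Λ) Λ₀| ≤
            ((Λ + m) / Λ₀) ^ 3 * (Λ + m) ^ ((3 : ℤ) - 2 * n₁ - z) *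
              Plog.eval (Real.log (Λ₀ / m))) ∧
        (n₂ ≠ 0 → 4 < 2 * (n₁ + n₂) + z →
          |derivWithin (fun s => momDeriv z d (L s r n₁ n₂ Λ) k) (Ici Λ) Λ₀| ≤
            ((Λ + M) / Λ₀) ^ 2 * ((Λ + m) / Λ₀) *
              (Λ + m) ^ ((3 : ℤ) - 2 * (n₁ + n₂) - z) * Plog.eval (Real.log (Λ₀ / m))) ∧
        (n₂ ≠ 0 → 2 * (n₁ + n₂) + z ≤ 4 →
          |derivWithin (fun s => momDeriv z d (L s r n₁ n₂ Λ) k) (Ici Λ) Λ₀| ≤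
            ((Λ + M) / Λ₀) ^ 3 * (Λ + M) ^ ((3 : ℤ) - 2 * (n₁ + n₂) - z) *
              Plog.eval (Real.log (Λ₀ / m))) := by
  obtain ⟨Plog, hP⟩ := exists_polynomial_bound hK hκ r n₁ n₂ z hn
  refine ⟨Plog, fun m M pbar hm hM hpbar L hL Λ₀ Λ hΛ₀ hΛ hΛs d k hk => ?_⟩
  have hd := hasDerivWithinAt_momDeriv hK hm hM hL r hn hΛ₀ hΛ hΛs d k
  have hb := (abs_apply_single_le d _).trans (hP ⟨m, M, Λ₀, pbar, hm, hM, hΛ₀, hpbar⟩ Λ ⟨hΛ, hΛs⟩ k hk)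
  rw [hd.derivWithin (uniqueDiffOn_Ici Λ Λ₀ hΛs)]
  refine ⟨hd.differentiableWithinAt, fun h => hb.trans_eq ?_, fun h hD => hb.trans_eq ?_,
    fun h hD => hb.trans_eq ?_⟩
  · rw [weight_two_light _ h z hΛ]
  · rw [weight_two_irrelevant _ h hD hΛ]
  · rw [weight_two_relevant _ h hD hΛ]

/-- This is `yᴺ ≤ N! eʸ` at `y = 1 + log x`. Losing a full power of the cutoff is harmless, as two
of the three remain. -/
theorem pow_one_add_log_le {x : ℝ} (hx : 1 ≤ x) (N : ℕ) :
    (1 + Real.log x) ^ N ≤ N.factorial * Real.exp 1 * x := by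
  have h0 : 0 ≤ 1 + Real.log x := by linarith [Real.log_nonneg hx]
  have h := Real.pow_div_factorial_le_exp (1 + Real.log x) h0 N
  rw [div_le_iff₀ (by positivity), Real.exp_add, Real.exp_log (by linarith)] at h
  linarith

/-- On bounded sets of momenta, the derivatives of the vertex functions with respect to the
ultraviolet cutoff decrease with its square. -/
theorem exists_dot_bound_sq (hK : IsCutoffProfile K) (hm : 0 < m) (hM : m < M)
    (hpbar : ∀ i, ‖pbar i‖ = M) (r : Fin 3 → ℕ) (hn : 1 ≤ n₁ + n₂) {Λ : ℝ} (hΛ : 0 ≤ Λ) (z : ℕ)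
    (R : ℝ) : ∃ B, 0 ≤ B ∧ ∀ s, M < s → Λ ≤ s → ∀ k ∈ Metric.closedBall (0 : Config n₁ n₂) R,
      ‖iteratedFDeriv ℝ z (dotFamily (vertex K m M pbar) s r n₁ n₂ Λ) k‖ ≤ B / s ^ 2 := by
  -- Uniformity in the masses is not needed here: `R ≤ (|R| / m) (Λ + m)` puts any bounded set into
  -- a ball.
  obtain ⟨A, N, hA, hb⟩ := exists_dot_bound hK
    (C := max 3 (|R| / m * (2 * n₁ + 2 * n₂ : ℕ))) (le_max_left _ _) r hn z
  have hM0 := hm.trans hM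
  -- The weight does not involve the cutoff, so any admissible value can stand in for it.
  set q : Par := ⟨m, M, M + 1, pbar, hm, hM, by linarith, hpbar⟩ with hq
  have hw := (weight_pos 2 n₂ (2 * (n₁ + n₂) + z) q hΛ).le
  refine ⟨weight 2 n₂ (2 * (n₁ + n₂) + z) q Λ * (A * (N.factorial * Real.exp 1 / m)),
    by positivity, fun s hs hΛs k hk => ?_⟩
  have hs0 := hM0.trans hs
  set p : Par := ⟨m, M, s, pbar, hm, hM, hs, hpbar⟩ with hp
  rw [mem_closedBall_zero_iff] at hk
  have hkR : ‖k‖ ≤ |R| := hk.trans (le_abs_self R)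
  have hR : ∀ c, m ≤ c → |R| ≤ |R| / m * (Λ + c) := fun c hc => by
    rw [div_mul_eq_mul_div, le_div_iff₀ hm]
    have := abs_nonneg R
    gcongr
    linarith
  have h1 := hb p Λ ⟨hΛ, hΛs⟩ k (p.mem_ball_of_independent hΛ (c := |R| / m) (by positivity)
    (le_max_right _ _) hn fun j => ⟨fun _ => ((norm_le_pi_norm k j).trans hkR).trans (hR _ le_rfl),
      fun _ => ((norm_le_pi_norm k j).trans hkR).trans (hR _ hM.le)⟩)
  have hwq : weight 2 n₂ (2 * (n₁ + n₂) + z) p Λ = weight 2 n₂ (2 * (n₁ + n₂) + z) q Λ := rfl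
  have h2 : p.ell ^ N ≤ N.factorial * Real.exp 1 * (s / m) :=
    pow_one_add_log_le ((one_le_div hm).2 (hM.trans hs).le) N
  refine h1.trans ?_
  rw [hwq]
  calc (s ^ 3)⁻¹ * weight 2 n₂ (2 * (n₁ + n₂) + z) q Λ * (A * p.ell ^ N)
      ≤ (s ^ 3)⁻¹ * weight 2 n₂ (2 * (n₁ + n₂) + z) q Λ *
        (A * (N.factorial * Real.exp 1 * (s / m))) := by gcongr
    _ = _ := by field_simp

/-- The integral of `B / x²` from `s` to `t` is `B (s⁻¹ - t⁻¹)`. -/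
theorem norm_vertex_sub_le (hK : IsCutoffProfile K) (hm : 0 < m) (hM : 0 < M)
    (r : Fin 3 → ℕ) (hn : 1 ≤ n₁ + n₂) {Λ : ℝ} {z : ℕ} {k : Config n₁ n₂} {B s t : ℝ} (hB : 0 ≤ B)
    (hs : 0 < s) (hst : s ≤ t) (hb : ∀ x ∈ Icc s t,
      ‖iteratedFDeriv ℝ z (dotFamily (vertex K m M pbar) x r n₁ n₂ Λ) k‖ ≤ B / x ^ 2) :
    ‖iteratedFDeriv ℝ z (vertex K m M pbar t r n₁ n₂ Λ) k -
      iteratedFDeriv ℝ z (vertex K m M pbar s r n₁ n₂ Λ) k‖ ≤ B / s := by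
  have hd := fun x => (isSmoothFamily_vertex (pbar := pbar) hK hm hM).hasDerivAt_iteratedFDeriv
    r hn z x Λ k
  have hBd : ∀ x ∈ Icc s t, HasDerivAt (fun x => B * (s⁻¹ - x⁻¹)) (B / x ^ 2) x := fun x hx => by
    have h := ((hasDerivAt_inv (hs.trans_le hx.1).ne').const_sub s⁻¹).const_mul B
    rwa [neg_neg, ← div_eq_mul_inv] at h
  have h := image_norm_le_of_norm_deriv_right_le_deriv_boundary' (a := s) (b := t)
    (fun x _ => ((hd x).sub_const
      (iteratedFDeriv ℝ z (vertex K m M pbar s r n₁ n₂ Λ) k)).continuousAt.continuousWithinAt)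
    (fun x _ => ((hd x).sub_const _).hasDerivWithinAt) (by simp)
    (fun x hx => (hBd x hx).continuousAt.continuousWithinAt)
    (fun x hx => (hBd x (Ico_subset_Icc_self hx)).hasDerivWithinAt)
    (fun x hx => hb x (Ico_subset_Icc_self hx)) (right_mem_Icc.2 hst)
  refine h.trans ?_
  rw [div_eq_mul_inv]
  have := inv_pos.2 (hs.trans_le hst)
  gcongr
  linarith

/-- Convergence of the vertex functions when the ultraviolet cutoff is removed. -/
theorem exists_limit (hK : IsCutoffProfile K) (hm : 0 < m) (hM : m < M)
    (hpbar : ∀ i, ‖pbar i‖ = M) (hL : ∀ Λ₀, M < Λ₀ → IsVertexFamily K m M pbar Λ₀ (L Λ₀))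
    (r : Fin 3 → ℕ) (hn : 1 ≤ n₁ + n₂) {Λ : ℝ} (hΛ : 0 ≤ Λ) :
    ∃ G : Config n₁ n₂ → ℝ, ContDiff ℝ ∞ G ∧
      ∀ (z : ℕ) (d : Fin z → Fin (2 * n₁ + 2 * n₂ - 1) × Fin 4) (R : ℝ),
        TendstoUniformlyOn (fun Λ₀ k => momDeriv z d (L Λ₀ r n₁ n₂ Λ) k)
          (fun k => momDeriv z d G k) atTop (Metric.closedBall 0 R) := by
  have hM0 := hm.trans hM
  obtain ⟨G, hG, hlim⟩ := exists_contDiff_limit (fun s => vertex K m M pbar s r n₁ n₂ Λ)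
    (fun s => (isSmoothFamily_vertex hK hm hM0 r n₁ n₂ hn).mom s Λ) fun z R => by
    obtain ⟨B, hB, hb⟩ := exists_dot_bound_sq (pbar := pbar) hK hm hM hpbar r hn hΛ z R
    have key : ∀ s t, M < s → Λ ≤ s → s ≤ t → ∀ k ∈ Metric.closedBall (0 : Config n₁ n₂) R,
        ‖iteratedFDeriv ℝ z (vertex K m M pbar t r n₁ n₂ Λ) k -
          iteratedFDeriv ℝ z (vertex K m M pbar s r n₁ n₂ Λ) k‖ ≤ B / s := fun s t hs hΛs hst k hk =>
      norm_vertex_sub_le hK hm hM0 r hn hB (hM0.trans hs) hst fun x hx =>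
        hb x (hs.trans_le hx.1) (hΛs.trans hx.1) k hk
    rw [Metric.uniformCauchySeqOn_iff]
    intro ε hε
    -- The added ones make `M < s` and `B / s < ε` strict.
    refine ⟨max (max (M + 1) Λ) ((B + 1) / ε), fun s hs t ht k hk => ?_⟩
    have hlt : ∀ s, max (max (M + 1) Λ) ((B + 1) / ε) ≤ s → M < s ∧ Λ ≤ s ∧ B / s < ε := fun s hs => by
      have h1 : M + 1 ≤ s := ((le_max_left _ _).trans (le_max_left _ _)).trans hs
      have h2 : (B + 1) / ε ≤ s := (le_max_right _ _).trans hs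
      rw [div_le_iff₀ hε] at h2
      refine ⟨by linarith, ((le_max_right _ _).trans (le_max_left _ _)).trans hs, ?_⟩
      rw [div_lt_iff₀ (by linarith)]
      linarith
    obtain ⟨s1, s2, s3⟩ := hlt s hs
    obtain ⟨t1, t2, t3⟩ := hlt t ht
    rw [dist_eq_norm]
    rcases le_total s t with h | h
    · rw [norm_sub_rev]
      exact (key s t s1 s2 h k hk).trans_lt s3
    · exact (key t s t1 t2 h k hk).trans_lt t3
  refine ⟨G, hG, fun z d R => ?_⟩
  rw [Metric.tendstoUniformlyOn_iff]
  intro ε hε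
  filter_upwards [Metric.tendstoUniformlyOn_iff.1 (hlim z R) ε hε, eventually_gt_atTop M,
    eventually_ge_atTop Λ] with s h1 hs hΛs k hk
  have h2 := h1 k hk
  rw [eq_vertex hK hm hM hL r hn hs hΛ hΛs]
  rw [dist_eq_norm] at h2 ⊢
  exact (abs_apply_single_le d (iteratedFDeriv ℝ z G k -
    iteratedFDeriv ℝ z (vertex K m M pbar s r n₁ n₂ Λ) k)).trans_lt h2

end Main

end PhiPsi

theorem theorem2 (K : ℝ → ℝ) (hK : IsCutoffProfile K) :
    -- for every ultraviolet cutoff the vertex functions exist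
    (∀ (m M : ℝ) (pbar : Fin 5 → Mom), 0 < m → m < M → (∀ i, ‖pbar i‖ = M) →
      ∀ Λ₀ : ℝ, M < Λ₀ → ∃ L : VertexFamily, IsVertexFamily K m M pbar Λ₀ L) ∧
    -- bounds on the derivatives with respect to the ultraviolet cutoff, with `μ = κ m`
    (∀ κ : ℝ, 0 < κ → ∀ (r : Fin 3 → ℕ) (n₁ n₂ z : ℕ), 1 ≤ n₁ + n₂ →
      ∃ Plog : Polynomial ℝ,
        ∀ (m M : ℝ) (pbar : Fin 5 → Mom), 0 < m → m < M → (∀ i, ‖pbar i‖ = M) →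
        ∀ L : ℝ → VertexFamily, (∀ Λ₀, M < Λ₀ → IsVertexFamily K m M pbar Λ₀ (L Λ₀)) →
        ∀ Λ₀ Λ : ℝ, M < Λ₀ → 0 ≤ Λ → Λ ≤ Λ₀ →
        ∀ d : Fin z → Fin (2 * n₁ + 2 * n₂ - 1) × Fin 4,
        ∀ k ∈ region n₁ n₂ (2 * Λ) (κ * m) M,
          DifferentiableWithinAt ℝ (fun s => momDeriv z d (L s r n₁ n₂ Λ) k) (Ici Λ) Λ₀ ∧
          (n₂ = 0 →
            |derivWithin (fun s => momDeriv z d (L s r n₁ n₂ Λ) k) (Ici Λ) Λ₀| ≤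
              ((Λ + m) / Λ₀) ^ 3 * (Λ + m) ^ ((3 : ℤ) - 2 * n₁ - z) *
                Plog.eval (Real.log (Λ₀ / m))) ∧
          (n₂ ≠ 0 → 4 < 2 * (n₁ + n₂) + z →
            |derivWithin (fun s => momDeriv z d (L s r n₁ n₂ Λ) k) (Ici Λ) Λ₀| ≤
              ((Λ + M) / Λ₀) ^ 2 * ((Λ + m) / Λ₀) *
                (Λ + m) ^ ((3 : ℤ) - 2 * (n₁ + n₂) - z) * Plog.eval (Real.log (Λ₀ / m))) ∧
          (n₂ ≠ 0 → 2 * (n₁ + n₂) + z ≤ 4 →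
            |derivWithin (fun s => momDeriv z d (L s r n₁ n₂ Λ) k) (Ici Λ) Λ₀| ≤
              ((Λ + M) / Λ₀) ^ 3 * (Λ + M) ^ ((3 : ℤ) - 2 * (n₁ + n₂) - z) *
                Plog.eval (Real.log (Λ₀ / m)))) ∧
    -- convergence when the ultraviolet cutoff is removed (at `Λ = 0`: Green functions)
    (∀ (m M : ℝ) (pbar : Fin 5 → Mom), 0 < m → m < M → (∀ i, ‖pbar i‖ = M) →
      ∀ L : ℝ → VertexFamily, (∀ Λ₀, M < Λ₀ → IsVertexFamily K m M pbar Λ₀ (L Λ₀)) →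
      ∀ (r : Fin 3 → ℕ) (n₁ n₂ : ℕ), 1 ≤ n₁ + n₂ → ∀ Λ : ℝ, 0 ≤ Λ →
        ∃ G : Config n₁ n₂ → ℝ, ContDiff ℝ ∞ G ∧
          ∀ (z : ℕ) (d : Fin z → Fin (2 * n₁ + 2 * n₂ - 1) × Fin 4) (R : ℝ),
            TendstoUniformlyOn (fun Λ₀ k => momDeriv z d (L Λ₀ r n₁ n₂ Λ) k)
              (fun k => momDeriv z d G k) atTop (Metric.closedBall 0 R)) := by
  refine ⟨fun m M pbar hm hM _ Λ₀ _ => ⟨vertex K m M pbar Λ₀,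
    (isRenormalizedFlow_vertex hK hm (hm.trans hM)).isVertexFamily Λ₀⟩,
    fun κ hκ r n₁ n₂ z hn => cutoff_derivative_bounds hK κ hκ r n₁ n₂ z hn,
    fun m M pbar hm hM hpbar L hL r n₁ n₂ hn Λ hΛ => exists_limit hK hm hM hpbar hL r hn hΛ⟩
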